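/- Conventions. $M$ is a smooth 4-manifold without boundary. An even-contact structure is a smooth hyperplane field $\mathcal E$ with $[\mathcal E,\mathcal E]=TM$; an Engel structure is a smooth plane field $\mathcal D$ such that $\mathcal E=[\mathcal D,\mathcal D]$ is even-contact. The kernel $\mathcal W\subset\mathcal E$ is the line field $\mathcal W(q)=\ker\big(\mathcal E(q)\times\mathcal E(q)\to T_qM/\mathcal E(q),\ (X,Y)\mapsto[X,Y](q)\big)$; one has $\mathcal W\subset\mathcal D$. If $\mathcal W$ and $\mathcal D$ are oriented and $(W,X)$ is a frame of $\mathcal D$ compatible with the orientations, with $W$ spanning $\mathcal W$, the Engel framing is $\{W,X,[W,X],[X,[W,X]]\}$; up to homotopy it depends only on the orientations. Engel torsion. Let $N\subset M$ be a closed embedded hypersurface transverse to $\mathcal D$. Choose a vector field $T$ near $N$, tangent to $\mathcal D$ and transverse to $N$, whose flow gives a tubular neighbourhood $\mathcal U(N)\cong N\times(-\varepsilon,\varepsilon)$ with $\partial_t=T$, and a frame $X,Y,Z$ of $TN$ with $X\in\mathcal D$, $Y\in\mathcal E$, extended to $\mathcal U(N)$ invariantly under the flow of $T$. Then $\mathcal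 D=\langle T,\,(H_p(t))_1X+(H_p(t))_2Y+(H_p(t))_3Z\rangle$ for a smooth family of curves $H_p:(-\varepsilon,\varepsilon)\to\mathbb S^2$, $p\in N$, which we normalise by $H_p(0)=(1,0,0)$ and $\dot H_p(0)\in\mathbb R_{>0}\,(0,1,0)$. It is required that each segment $\{p\}\times(-\varepsilon,\varepsilon)$ is either everywhere tangent or nowhere tangent to $\mathcal W$ (so $H_p$ lies in a great circle, or is everywhere strictly convex, or everywhere strictly concave), and that each point of $N$ has a neighbourhood in which all curves $H_p$ have geodesic curvature $\ge0$ or all have geodesic curvature $\le0$. Let $\eta_p$ be the $C^2$-curve obtained by concatenating $H_p|_{(-\varepsilon,0]}$, the circle through $(1,0,0)$ with tangent direction $(0,1,0)$ and the geodesic curvature of $H_p$ at $t=0$, traversed once, and $H_p|_{[0,\varepsilon)}$. A plane field $\mathcal L(\mathcal D)$ is obtained from $\mathcal D$ by introducing Engel torsion along $N$ if, for some such choices and some $0<a<\varepsilon$, it coincides with $\mathcal D$ outside $N\times[-a,a]$ and equals $\langle T,\,(\lambda_p(t))_1X+(\lambda_p(t))_2Y+(\lambda_p(t))_3Z\rangle$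 in $\mathcal U(N)$, where $(\lambda_p)_{p\in N}$ is a smooth family of immersed curves $(-\varepsilon,\varepsilon)\to\mathbb S^2$ which is a $C^2$-small smoothing, up to reparametrisation, of $(\eta_p)_{p\in N}$ with $\lambda_p(t)=H_p(t)$ for $|t|\ge a$, and whose geodesic curvature has everywhere the same sign ($+$, $0$ or $-$) as that of $H_p$. Here a $\delta$-small smoothing is one whose position, unit tangent vector and geodesic curvature differ by less than $\delta$ from those of $\eta_p\circ\tau_p$, for reparametrisations $\tau_p$ depending continuously on $p$. Proposition. Let $M$ be a Hausdorff, second countable smooth 4-manifold, $\mathcal D$ an Engel structure on $M$ with $\mathcal D$ and its kernel $\mathcal W$ oriented, and $N\subset M$ a closed embedded hypersurface transverse to $\mathcal D$. Then there is $\delta>0$ such that the following holds for all plane fields $\mathcal L(\mathcal D)$ obtained from $\mathcal D$ by introducing Engel torsion along $N$ with a $\delta$-small smoothing, and all $\mathcal L(\mathcal L(\mathcal D))$ obtained from $\mathcal L(\mathcal D)$ in the same way along the same $N$ (with possibly different auxiliary choices): $\mathcal L(\mathcal D)$ and $\mathcal L(\mathcal L(\mathcal D))$ are Engel structures, $N$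 is transverse to $\mathcal L(\mathcal D)$, $\mathcal L(\mathcal D)$ and $\mathcal L(\mathcal L(\mathcal D))$ and their kernels have orientations which agree at each step outside the modified region $N\times[-a,a]$ with those of the previous structure, and for these orientations the Engel framing of $\mathcal L(\mathcal L(\mathcal D))$ is homotopic, through framings of $TM$, to the Engel framing of $\mathcal D$. -/

import Mathlib

open Set Filter Topology
open scoped Manifold ContDiff

/-! ### Distributions, Lie brackets and Engel structures -/

section Distributions

variable {n : ℕ} {M : Type*} [TopologicalSpace M] [ChartedSpace (EuclideanSpace ℝ (Fin n)) M]
  [IsManifold (𝓡 n) ∞ M]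

/-- A field of linear subspaces of the tangent spaces of an `n`-manifold `M`. -/
abbrev TangentDist (n : ℕ) (M : Type*) [TopologicalSpace M]
    [ChartedSpace (EuclideanSpace ℝ (Fin n)) M] : Type _ :=
  (q : M) → Submodule ℝ (TangentSpace (𝓡 n) q)

/-- The vector field `V` is smooth at `q`. -/
def SmoothVecAt (V : (q : M) → TangentSpace (𝓡 n) q) (q : M) : Prop :=
  ContMDiffAt (𝓡 n) (𝓡 n).tangent ∞ (fun y => (⟨y, V y⟩ : TangentBundle (𝓡 n) M)) q

/-- `D` is a smooth distribution of rank `k`: locally it has a smooth frame of `k` vector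
fields. -/
def IsSmoothDistribution (k : ℕ) (D : TangentDist n M) : Prop :=
  ∀ q : M, ∃ V : Fin k → (y : M) → TangentSpace (𝓡 n) y, ∀ᶠ y in 𝓝 q,
    (∀ i, SmoothVecAt (V i) y) ∧ LinearIndependent ℝ (fun i => V i y) ∧
      Submodule.span ℝ (range fun i => V i y) = D y

/-- `V` restricts to a smooth section of `D` on a neighbourhood of `q`. -/
def IsLocalSection (D : TangentDist n M) (q : M) (V : (y : M) → TangentSpace (𝓡 n) y) : Prop :=
  ∀ᶠ y in 𝓝 q, SmoothVecAt V y ∧ V y ∈ D y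

/-- The derived distribution `[D, D]`: at `q` it is spanned by `D q` and by the values at `q` of
the brackets of local sections of `D`. -/
noncomputable def derivedDist (D : TangentDist n M) : TangentDist n M := fun q =>
  D q ⊔ Submodule.span ℝ {v | ∃ V V' : (y : M) → TangentSpace (𝓡 n) y,
    IsLocalSection D q V ∧ IsLocalSection D q V' ∧
      v = VectorField.mlieBracket (𝓡 n) V V' q}

/-- `v ∈ T_qM` lies in the kernel line `W(q)` of `E`, the kernel of the form
`E(q) × E(q) → T_qM / E(q)` induced by the Lie bracket. -/
def InKernel (E : TangentDist n M) (q : M) (v : TangentSpace (𝓡 n) q) : Prop :=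
  v ∈ E q ∧ ∀ V V' : (y : M) → TangentSpace (𝓡 n) y,
    IsLocalSection E q V → IsLocalSection E q V' → V q = v →
      VectorField.mlieBracket (𝓡 n) V V' q ∈ E q

end Distributions

section Engel

variable {M : Type*} [TopologicalSpace M] [ChartedSpace (EuclideanSpace ℝ (Fin 4)) M]
  [IsManifold (𝓡 4) ∞ M]

/-- `E` is an even-contact structure: a smooth hyperplane field with `[E, E] = TM`. -/
def IsEvenContact (E : TangentDist 4 M) : Prop :=
  IsSmoothDistribution 3 E ∧ ∀ q, derivedDist E q = ⊤

/-- `D` is an Engel structure: a smooth plane field such that `[D, D]` is even-contact. -/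
def IsEngel (D : TangentDist 4 M) : Prop :=
  IsSmoothDistribution 2 D ∧ IsEvenContact (derivedDist D)

/-- `(W, X)` is a global smooth frame of `D` with `W` spanning the kernel line field of
`[D, D]`. Such a pair amounts to a choice of orientations of the kernel line field and of `D`. -/
structure IsEngelPair (D : TangentDist 4 M) (W X : (q : M) → TangentSpace (𝓡 4) q) : Prop where
  smooth_W : ∀ q, SmoothVecAt W q
  smooth_X : ∀ q, SmoothVecAt X q
  kernel_W : ∀ q, InKernel (derivedDist D) q (W q)
  indep : ∀ q, LinearIndependent ℝ ![W q, X q]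
  span : ∀ q, Submodule.span ℝ {W q, X q} = D q

/-- The Engel framing `{W, X, [W, X], [X, [W, X]]}`. -/
noncomputable def engelFraming (W X : (q : M) → TangentSpace (𝓡 4) q) (q : M) :
    Fin 4 → TangentSpace (𝓡 4) q :=
  ![W q, X q, VectorField.mlieBracket (𝓡 4) W X q,
    VectorField.mlieBracket (𝓡 4) X (VectorField.mlieBracket (𝓡 4) W X) q]

/-- `F₀` and `F₁` are homotopic through (continuous) framings of `TM`. -/
def FramingHomotopic (F₀ F₁ : (q : M) → Fin 4 → TangentSpace (𝓡 4) q) : Prop :=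
  ∃ F : unitInterval → (q : M) → Fin 4 → TangentSpace (𝓡 4) q,
    (∀ i, Continuous fun a : unitInterval × M =>
      (⟨a.2, F a.1 a.2 i⟩ : TangentBundle (𝓡 4) M)) ∧
    (∀ s q, LinearIndependent ℝ (F s q)) ∧ F 0 = F₀ ∧ F 1 = F₁

/-- The pairs `(W, X)` and `(W', X')` define the same orientations, of the line spanned by the
first vector and of the plane spanned by both, at every point of `S`. -/
def SameOrientationOn (S : Set M) (W X W' X' : (q : M) → TangentSpace (𝓡 4) q) : Prop :=
  ∀ q ∈ S, ∃ a b c : ℝ, 0 < a ∧ 0 < c ∧ W' q = a • W q ∧ X' q = b • W q + c • X q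

end Engel

/-! ### Curves on the two-sphere -/

/-- Euclidean three-space. -/
abbrev E3 : Type := EuclideanSpace ℝ (Fin 3)

/-- The unit tangent vector of the curve `γ` at time `t`. -/
noncomputable def unitTangent (γ : ℝ → E3) (t : ℝ) : E3 := ‖deriv γ t‖⁻¹ • deriv γ t

/-- The geodesic curvature `det(γ, γ', γ'') / |γ'|³` of the immersed curve `γ` in the unit
sphere. -/
noncomputable def geodCurv (γ : ℝ → E3) (t : ℝ) : ℝ :=
  Matrix.det !![γ t 0, γ t 1, γ t 2;
    deriv γ t 0, deriv γ t 1, deriv γ t 2;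
    deriv (deriv γ) t 0, deriv (deriv γ) t 1, deriv (deriv γ) t 2] / ‖deriv γ t‖ ^ 3

/-- The circle in the unit sphere that starts at `(1, 0, 0)` in the direction `(0, 1, 0)` and has
constant geodesic curvature `κ`; it is traversed once as `θ` runs over `[0, 2π]`. -/
noncomputable def circ (κ : ℝ) (θ : ℝ) : E3 :=
  (1 + κ ^ 2)⁻¹ •
    !₂[κ ^ 2 + Real.cos θ, Real.sqrt (1 + κ ^ 2) * Real.sin θ, κ * (1 - Real.cos θ)]

/-- The concatenation `η` of `γ|_{s ≤ 0}`, the full circle tangent to `γ` at `γ 0` with the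
curvature of `γ` there, and `γ|_{s ≥ 0}` (shifted by `2π`). Rather than the curve itself we record
the value at `s` of an attribute `f` of parametrised curves: its position, its unit tangent
vector, or its geodesic curvature. -/
noncomputable def withCircle {β : Type*} (f : (ℝ → E3) → ℝ → β) (γ : ℝ → E3) (s : ℝ) : β :=
  if s ≤ 0 then f γ s
  else if s ≤ 2 * Real.pi then f (circ (geodCurv γ 0)) s
  else f γ (s - 2 * Real.pi)

/-! ### Transverse hypersurfaces and Engel torsion -/

section Torsion

variable {N : Type*} [TopologicalSpace N] [ChartedSpace (EuclideanSpace ℝ (Fin 3)) N]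
  [IsManifold (𝓡 3) ∞ N]
variable {M : Type*} [TopologicalSpace M] [ChartedSpace (EuclideanSpace ℝ (Fin 4)) M]
  [IsManifold (𝓡 4) ∞ M]

/-- The map `ι : N → M` is transverse to `D`: `T_pN + D = TM` along `N`. -/
def IsTransverse (ι : N → M) (D : TangentDist 4 M) : Prop :=
  ∀ p : N, (LinearMap.range (mfderiv (𝓡 3) (𝓡 4) ι p).toLinearMap :
    Submodule ℝ (TangentSpace (𝓡 4) (ι p))) ⊔ D (ι p) = ⊤

/-- The differential of `Φ : N × ℝ → M` at `(p, t)`, applied to the vector `(v, r)`. -/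
noncomputable def tubeDeriv (Φ : N × ℝ → M) (p : N) (t : ℝ) (v : TangentSpace (𝓡 3) p) (r : ℝ) :
    TangentSpace (𝓡 4) (Φ (p, t)) :=
  mfderiv ((𝓡 3).prod 𝓘(ℝ, ℝ)) (𝓡 4) Φ (p, t) (v, r)

/-- The vector `T = ∂_t` of the tube at `Φ (p, t)`. -/
noncomputable def tubeT (Φ : N × ℝ → M) (p : N) (t : ℝ) : TangentSpace (𝓡 4) (Φ (p, t)) :=
  tubeDeriv Φ p t 0 1

/-- The vector `u₁ X + u₂ Y + u₃ Z` at `Φ (p, t)`, where `(X, Y, Z)` is the frame `e` of `TN`,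
extended to the tube invariantly under the flow of `T`. -/
noncomputable def tubeVec (Φ : N × ℝ → M) (e : Fin 3 → (p : N) → TangentSpace (𝓡 3) p)
    (p : N) (t : ℝ) (u : E3) : TangentSpace (𝓡 4) (Φ (p, t)) :=
  tubeDeriv Φ p t (∑ i, u i • e i p) 0

/-- The data from which Engel torsion is introduced along the hypersurface `ι : N → M`: a tubular
neighbourhood `N × (-ε, ε)` given by the flow `Φ` of a vector field `T` which is tangent to the
Engel structure `D` and transverse to `N`; a frame `(X, Y, Z)` of `TN`; and the resulting
description `D = ⟨T, H⟩` of `D` by a family of curves `H_p : (-ε, ε) → S²`. -/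
structure AdaptedTube (ι : N → M) (D : TangentDist 4 M) where
  /-- half of the length of the fibres of the tube -/
  ε : ℝ
  ε_pos : 0 < ε
  /-- the parametrisation of the tube -/
  Φ : N × ℝ → M
  Φ_smooth : ContMDiffOn ((𝓡 3).prod 𝓘(ℝ, ℝ)) (𝓡 4) ∞ Φ (univ ×ˢ Ioo (-ε) ε)
  Φ_zero : ∀ p, Φ (p, 0) = ι p
  Φ_inj : InjOn Φ (univ ×ˢ Ioo (-ε) ε)
  Φ_bij : ∀ p, ∀ t ∈ Ioo (-ε) ε,
    Function.Bijective (mfderiv ((𝓡 3).prod 𝓘(ℝ, ℝ)) (𝓡 4) Φ (p, t))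
  /-- the frame `(X, Y, Z)` of `TN` -/
  e : Fin 3 → (p : N) → TangentSpace (𝓡 3) p
  e_smooth : ∀ i p, SmoothVecAt (e i) p
  e_indep : ∀ p, LinearIndependent ℝ (fun i => e i p)
  /-- the family of curves `H_p` -/
  H : N → ℝ → E3
  H_smooth : ContMDiffOn ((𝓡 3).prod 𝓘(ℝ, ℝ)) 𝓘(ℝ, E3) ∞ (fun a : N × ℝ => H a.1 a.2)
    (univ ×ˢ Ioo (-ε) ε)
  H_norm : ∀ p, ∀ t ∈ Ioo (-ε) ε, ‖H p t‖ = 1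
  /-- `D = ⟨T, H⟩`; in particular `D` is tangent to `T` -/
  D_eq : ∀ p, ∀ t ∈ Ioo (-ε) ε,
    D (Φ (p, t)) = Submodule.span ℝ {tubeT Φ p t, tubeVec Φ e p t (H p t)}
  /-- along `N`, the vector field `X` spans `D ∩ TN` -/
  H_zero : ∀ p, H p 0 = !₂[1, 0, 0]
  /-- along `N`, the vector fields `X, Y` span `[D, D] ∩ TN`, and `H_p` moves towards `Y` -/
  H_deriv_zero : ∀ p, ∃ c : ℝ, 0 < c ∧ deriv (H p) 0 = c • !₂[0, 1, 0]
  /-- each orbit of `T` in the tube is either contained in a leaf of the kernel foliation, or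
  nowhere tangent to the kernel foliation -/
  kernel_dichotomy : ∀ p,
    (∀ t ∈ Ioo (-ε) ε, InKernel (derivedDist D) (Φ (p, t)) (tubeT Φ p t)) ∨
    (∀ t ∈ Ioo (-ε) ε, ¬ InKernel (derivedDist D) (Φ (p, t)) (tubeT Φ p t))
  /-- the set of `p` with `H_p` convex and the set of `p` with `H_p` concave have no common limit
  points -/
  convexity : ∀ p, ∃ σ : ℝ, (σ = 1 ∨ σ = -1) ∧
    ∀ᶠ p' in 𝓝 p, ∀ t ∈ Ioo (-ε) ε, 0 ≤ σ * geodCurv (H p') t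

/-- `D'` is the result of introducing Engel torsion to `D` along `ι : N → M` by means of the tube
`A`: the curves `H_p` are replaced by curves `lam_p`, which are smoothings of the concatenations
`η_p` of `H_p|_{t ≤ 0}`, a full circle osculating `H_p` at `t = 0`, and `H_p|_{t ≥ 0}`. Up to the
reparametrisations `τ_p`, the curves `lam_p` are `δ`-close to `η_p` in the `C²`-sense (position,
unit tangent vector, geodesic curvature), and they have the same convexity as `H_p`. -/
structure EngelTorsion (δ : ℝ) {ι : N → M} {D : TangentDist 4 M} (A : AdaptedTube ι D)
    (D' : TangentDist 4 M) where
  /-- the modification takes place in `N × [-a, a]` -/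
  a : ℝ
  a_pos : 0 < a
  a_lt : a < A.ε
  /-- the family of curves `lam_p` -/
  lam : N → ℝ → E3
  lam_smooth : ContMDiffOn ((𝓡 3).prod 𝓘(ℝ, ℝ)) 𝓘(ℝ, E3) ∞ (fun b : N × ℝ => lam b.1 b.2)
    (univ ×ˢ Ioo (-A.ε) A.ε)
  lam_norm : ∀ p, ∀ t ∈ Ioo (-A.ε) A.ε, ‖lam p t‖ = 1
  lam_immersed : ∀ p, ∀ t ∈ Ioo (-A.ε) A.ε, deriv (lam p) t ≠ 0
  lam_eq : ∀ p, ∀ t ∈ Ioo (-A.ε) A.ε, a ≤ |t| → lam p t = A.H p t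
  /-- `lam_p` is convex, concave, or contained in a great circle whenever `H_p` is so -/
  lam_convexity : ∀ p, ∀ t ∈ Ioo (-A.ε) A.ε,
    SignType.sign (geodCurv (lam p) t) = SignType.sign (geodCurv (A.H p) t)
  /-- the change of parameter on the curve `η_p` -/
  τ : N → ℝ → ℝ
  τ_continuous : ContinuousOn (fun b : N × ℝ => τ b.1 b.2) (univ ×ˢ Ioo (-A.ε) A.ε)
  τ_mono : ∀ p, StrictMonoOn (τ p) (Ioo (-A.ε) A.ε)
  τ_left : ∀ p, ∀ t ∈ Ioc (-A.ε) (-a), τ p t = t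
  τ_right : ∀ p, ∀ t ∈ Ico a A.ε, τ p t = t + 2 * Real.pi
  close_position : ∀ p, ∀ t ∈ Ioo (-A.ε) A.ε,
    ‖lam p t - withCircle (fun γ s => γ s) (A.H p) (τ p t)‖ < δ
  close_tangent : ∀ p, ∀ t ∈ Ioo (-A.ε) A.ε,
    ‖unitTangent (lam p) t - withCircle unitTangent (A.H p) (τ p t)‖ < δ
  close_curvature : ∀ p, ∀ t ∈ Ioo (-A.ε) A.ε,
    |geodCurv (lam p) t - withCircle geodCurv (A.H p) (τ p t)| < δ
  /-- `D' = ⟨T, lam⟩` in the tube -/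
  D'_eq : ∀ p, ∀ t ∈ Ioo (-A.ε) A.ε,
    D' (A.Φ (p, t)) = Submodule.span ℝ {tubeT A.Φ p t, tubeVec A.Φ A.e p t (lam p t)}
  /-- `D'` coincides with `D` away from the modification -/
  D'_off : ∀ q, q ∉ A.Φ '' (univ ×ˢ Icc (-a) a) → D' q = D q

/-- The complement of the region in which `D` is modified. -/
def EngelTorsion.outside {δ : ℝ} {ι : N → M} {D D' : TangentDist 4 M} {A : AdaptedTube ι D}
    (L : EngelTorsion δ A D') : Set M := (A.Φ '' (univ ×ˢ Icc (-L.a) L.a))ᶜ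

end Torsion

/-!
In the tube, `D` is spanned by `T = ∂_t` and by the moving vector `H_p(t)`, expanded in a frame of
`TN` that does not depend on `t`. Hence `[D, D]` is spanned by `∂_t`, `H` and `Ḣ`, and the bracket
on `[D, D]` is governed by two determinants: `kerB = det (H, Ḣ, Ḧ)`, a nonzero multiple of the
geodesic curvature, and `kerA`, which involves the bracket of `H` with `Ḣ` in the direction of `N`.
The kernel is spanned by `kerA ∂_t - kerB H`, and `[D, D]` is even-contact wherever one of the two
does not vanish (`IsImmersedFieldModel.inKernel_iff`,
`IsImmersedFieldModel.derivedDist_derivedDist`).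

*The modified structure is Engel.* The modification preserves the sign of the geodesic curvature,
hence that of `kerB`. On a fibre tangent to the kernel both families of curves stay in one great
circle, and, since the geodesic curvature of nearby curves does not change sign, its spatial
derivative vanishes there. This turns into a linear differential equation which forces `kerA` to
have the same sign along the whole fibre (`exists_det3_spaceBracket_eq`), and so the same sign for
both families (`EngelTorsion.kernel_compat`). The two kernel lines are thus on the same side, a
convex condition, and a partition of unity provides an oriented frame of the new structure that
extends the given one from the outside (`EngelTorsion.exists_pair`). The orientations are unique
because every fibre leaves the modified region (`EngelTorsion.sameOrientation`).

*One modification rotates the framing once.* With respect to the moving frame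
`∂_t, γ, γ̇ / |γ̇|, γ × γ̇ / |γ̇|` of the plane field described by a family of curves `γ`, the Engel
framing is block triangular (`Tube.Describes.engelFraming_block`), and the triangular matrices of
the two structures are homotopic (`matHomotopic_of_block`). This reduces the comparison to the two
moving frames. A smoothing that is `1 / 10`-small has a moving frame homotopic to that of the
concatenation of `H_p` with a circle, which in turn, after the circle is deformed to a great circle,
is that of `H_p` with its two middle vectors rotated once in the plane they span. Because there is
the additional direction `∂_t`, the axis can be turned until this is a rotation of the first two
vectors, in either sense (`matHomotopic_rot12_rot01`); that both senses are possible reflects that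
the generator of the fundamental group of the rotation group has order two. The outcome is
`EngelTorsion.framingHomotopic_rotFraming`: up to homotopy, the new Engel framing arises from the
old one by rotating the first two vectors once along the fibres of the tube, in a sense that may be
chosen freely over each component of `N`.

*Two modifications cancel.* The second tube may differ from the first one, and induce another
coorientation of `N`. The senses are chosen so that the two full rotations across `N` are
opposite to each other (`Tube.exists_oppositeSign`). Then the sum of the two angles is a continuous
real-valued function on `M` (`EngelTorsion.continuous_phaseMap_add`), and multiplying it by
`1 - s` undoes the rotation (`framingHomotopic_rotFraming_cos_sin`).
-/

set_option linter.unusedSectionVars false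

/-! ### Distributions in a vector space -/

/-- If a vector field `V` tangent to a distribution of constant rank vanishes at `x`, then its
derivative at `x` takes values in the distribution: these are limits of difference quotients, which
are tangent to the distribution, and a distribution of constant rank is closed. -/
theorem fderiv_mem_span_of_eventually_mem {E : Type*} [NormedAddCommGroup E] [NormedSpace ℝ E]
    [CompleteSpace E] {k : ℕ} {F : Fin k → E → E} {V : E → E} {x : E} (hF : ∀ i, ContinuousAt (F i) x)
    (hind : LinearIndependent ℝ fun i => F i x) (hV : DifferentiableAt ℝ V x) (h0 : V x = 0)
    (hmem : ∀ᶠ y in 𝓝 x, V y ∈ Submodule.span ℝ (range fun i => F i y)) (w : E) :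
    fderiv ℝ V x w ∈ Submodule.span ℝ (range fun i => F i x) := by
  by_contra hcon
  have h1 : LinearIndependent ℝ (Fin.cons (fderiv ℝ V x w) (fun i => F i x) : Fin (k + 1) → E) :=
    linearIndependent_finCons.2 ⟨hind, hcon⟩
  have h2 := h1.eventually
  have hline : HasDerivAt (fun h : ℝ => V (x + h • w)) (fderiv ℝ V x w) 0 := by
    have h3 : HasDerivAt (fun h : ℝ => x + h • w) w 0 := by
      simpa using ((hasDerivAt_id (0 : ℝ)).smul_const w).const_add x
    have h4 : HasFDerivAt V (fderiv ℝ V x) (x + (0 : ℝ) • w) := by simpa using hV.hasFDerivAt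
    exact h4.comp_hasDerivAt (0 : ℝ) h3
  have hcurve : Tendsto (fun h : ℝ => x + h • w) (𝓝[≠] 0) (𝓝 x) := by
    have : ContinuousAt (fun h : ℝ => x + h • w) 0 := by fun_prop
    have h5 := this.tendsto
    simp only [zero_smul, add_zero] at h5
    exact h5.mono_left nhdsWithin_le_nhds
  have hslope := hline.tendsto_slope
  have ht : Tendsto (fun h : ℝ => (Fin.cons (slope (fun h : ℝ => V (x + h • w)) 0 h)
      (fun i => F i (x + h • w)) : Fin (k + 1) → E)) (𝓝[≠] 0)
      (𝓝 (Fin.cons (fderiv ℝ V x w) (fun i => F i x))) := by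
    rw [tendsto_pi_nhds]
    intro i
    refine Fin.cases ?_ (fun j => ?_) i
    · simpa using hslope
    · simpa [Function.comp_def] using (hF j).tendsto.comp hcurve
  have h6 := (ht.eventually h2).and (hcurve.eventually hmem)
  obtain ⟨h, h7, h8⟩ := h6.exists
  refine (linearIndependent_finCons.1 h7).2 ?_
  simp only [slope, zero_smul, add_zero, h0, vsub_eq_sub, sub_zero]
  exact Submodule.smul_mem _ _ h8

/-! ### Local parametrisations and pulled back vector fields -/

section LocalParam

variable {n : ℕ} {M : Type*} [TopologicalSpace M] [ChartedSpace (EuclideanSpace ℝ (Fin n)) M]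
  [IsManifold (𝓡 n) ∞ M]
variable {E : Type*} [NormedAddCommGroup E] [NormedSpace ℝ E] [CompleteSpace E]

/-- `Ψ : E → M` is smooth with bijective differential at every point near `x`. -/
def IsLocalParam (n : ℕ) {M : Type*} [TopologicalSpace M]
    [ChartedSpace (EuclideanSpace ℝ (Fin n)) M] {E : Type*} [NormedAddCommGroup E]
    [NormedSpace ℝ E] (Ψ : E → M) (x : E) : Prop :=
  ∀ᶠ y in 𝓝 x, ContMDiffAt 𝓘(ℝ, E) (𝓡 n) ∞ Ψ y ∧
    Function.Bijective (mfderiv 𝓘(ℝ, E) (𝓡 n) Ψ y)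

/-- The differential of a local parametrisation, as a map between the model vector spaces. -/
noncomputable def dparam (n : ℕ) {M : Type*} [TopologicalSpace M]
    [ChartedSpace (EuclideanSpace ℝ (Fin n)) M] {E : Type*} [NormedAddCommGroup E]
    [NormedSpace ℝ E] (Ψ : E → M) (y : E) : E →L[ℝ] TangentSpace (𝓡 n) (Ψ y) :=
  mfderiv 𝓘(ℝ, E) (𝓡 n) Ψ y

theorem SmoothVecAt.mdifferentiableAt {V : (q : M) → TangentSpace (𝓡 n) q} {q : M}
    (h : SmoothVecAt V q) :
    MDifferentiableAt (𝓡 n) (𝓡 n).tangent (fun y => (⟨y, V y⟩ : TangentBundle (𝓡 n) M)) q :=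
  ContMDiffAt.mdifferentiableAt h (by simp)

theorem SmoothVecAt.add {V W : (q : M) → TangentSpace (𝓡 n) q} {q : M}
    (h : SmoothVecAt V q) (h' : SmoothVecAt W q) : SmoothVecAt (V + W) q :=
  ContMDiffAt.add_section h h'

theorem SmoothVecAt.sub {V W : (q : M) → TangentSpace (𝓡 n) q} {q : M}
    (h : SmoothVecAt V q) (h' : SmoothVecAt W q) : SmoothVecAt (V - W) q :=
  ContMDiffAt.sub_section h h'

theorem SmoothVecAt.const_smul {V : (q : M) → TangentSpace (𝓡 n) q} {q : M}
    (c : ℝ) (h : SmoothVecAt V q) : SmoothVecAt (c • V) q :=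
  ContMDiffAt.const_smul_section h

theorem SmoothVecAt.mlieBracket {V W : (q : M) → TangentSpace (𝓡 n) q} {q : M}
    (h : SmoothVecAt V q) (h' : SmoothVecAt W q) :
    SmoothVecAt (VectorField.mlieBracket (𝓡 n) V W) q := by
  have : IsManifold (𝓡 n) (minSmoothness ℝ 2) M := by
    simp only [minSmoothness_of_isRCLikeNormedField]
    exact IsManifold.of_le (n := ∞) (WithTop.coe_le_coe.2 le_top)
  have : IsManifold (𝓡 n) (((⊤ : ℕ∞) : ℕ∞ω) + 1) M := by simpa using ‹IsManifold (𝓡 n) ∞ M›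
  exact ContMDiffAt.mlieBracket_vectorField (m := ⊤) (n := ⊤) h h' (by simp)

theorem IsLocalParam.self {Ψ : E → M} {x : E} (h : IsLocalParam n Ψ x) :
    ContMDiffAt 𝓘(ℝ, E) (𝓡 n) ∞ Ψ x ∧ Function.Bijective (mfderiv 𝓘(ℝ, E) (𝓡 n) Ψ x) :=
  Filter.Eventually.self_of_nhds (p := fun y => ContMDiffAt 𝓘(ℝ, E) (𝓡 n) ∞ Ψ y ∧
    Function.Bijective (mfderiv 𝓘(ℝ, E) (𝓡 n) Ψ y)) h

theorem IsLocalParam.isInvertible {Ψ : E → M} {x : E} (h : IsLocalParam n Ψ x) :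
    (mfderiv 𝓘(ℝ, E) (𝓡 n) Ψ x).IsInvertible := by
  have hb := h.self.2
  let e : E ≃L[ℝ] EuclideanSpace ℝ (Fin n) :=
    ContinuousLinearEquiv.ofBijective (E := E) (F := EuclideanSpace ℝ (Fin n))
      (mfderiv 𝓘(ℝ, E) (𝓡 n) Ψ x) (LinearMap.ker_eq_bot.2 hb.1) (LinearMap.range_eq_top.2 hb.2)
  exact ⟨e, by ext v; rfl⟩

theorem dparam_injective {Ψ : E → M} {x : E} (h : IsLocalParam n Ψ x) :
    Function.Injective (dparam n Ψ x) := h.self.2.1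

/-- The field `V` on `M` is represented by the field `ξ` in the parametrisation `Ψ` near `x`. -/
def IsRep (Ψ : E → M) (x : E) (V : (q : M) → TangentSpace (𝓡 n) q) (ξ : E → E) : Prop :=
  ∀ᶠ y in 𝓝 x, V (Ψ y) = dparam n Ψ y (ξ y)

theorem inverse_apply_eq_of_isInvertible {F G : Type*} [NormedAddCommGroup F] [NormedSpace ℝ F]
    [NormedAddCommGroup G] [NormedSpace ℝ G] {L : F →L[ℝ] G} (hL : L.IsInvertible) (v : F) :
    L.inverse (L v) = v := by
  obtain ⟨e, rfl⟩ := hL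
  simp

theorem IsRep.mpullback_eventuallyEq {Ψ : E → M} {x : E} (h : IsLocalParam n Ψ x)
    {V : (q : M) → TangentSpace (𝓡 n) q} {ξ : E → E} (hV : IsRep Ψ x V ξ) :
    VectorField.mpullback 𝓘(ℝ, E) (𝓡 n) Ψ V =ᶠ[𝓝 x] ξ := by
  filter_upwards [hV, Filter.Eventually.eventually_nhds h] with y hy hp
  rw [VectorField.mpullback_apply, hy]
  exact inverse_apply_eq_of_isInvertible (F := E) (G := EuclideanSpace ℝ (Fin n))
    (IsLocalParam.isInvertible hp) (ξ y)

theorem isRep_mpullback {Ψ : E → M} {x : E} (h : IsLocalParam n Ψ x)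
    (V : (q : M) → TangentSpace (𝓡 n) q) :
    IsRep Ψ x V (VectorField.mpullback 𝓘(ℝ, E) (𝓡 n) Ψ V) := by
  filter_upwards [Filter.Eventually.eventually_nhds h] with y hp
  obtain ⟨v, hv⟩ := hp.self_of_nhds.2.2 (V (Ψ y))
  rw [VectorField.mpullback_apply, ← hv]
  have := inverse_apply_eq_of_isInvertible (F := E) (G := EuclideanSpace ℝ (Fin n))
    (IsLocalParam.isInvertible hp) v
  exact (congrArg _ this).symm

theorem SmoothVecAt.contDiffAt_mpullback {Ψ : E → M} {x : E} (h : IsLocalParam n Ψ x)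
    {V : (q : M) → TangentSpace (𝓡 n) q} (hV : SmoothVecAt V (Ψ x)) :
    ContDiffAt ℝ ∞ (VectorField.mpullback 𝓘(ℝ, E) (𝓡 n) Ψ V : E → E) x := by
  have := ContMDiffAt.mpullback_vectorField_preimage (n := ∞) (m := ∞) hV h.self.1
    h.isInvertible (by simp)
  exact contMDiffAt_vectorSpace_iff_contDiffAt.1 this

theorem IsRep.contDiffAt {Ψ : E → M} {x : E} (h : IsLocalParam n Ψ x)
    {V : (q : M) → TangentSpace (𝓡 n) q} {ξ : E → E} (hV : IsRep Ψ x V ξ)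
    (hs : SmoothVecAt V (Ψ x)) : ContDiffAt ℝ ∞ ξ x :=
  (SmoothVecAt.contDiffAt_mpullback h hs).congr_of_eventuallyEq
    (hV.mpullback_eventuallyEq h).symm

theorem mlieBracket_vectorSpace (V W : (y : E) → TangentSpace 𝓘(ℝ, E) y) (x : E) :
    VectorField.mlieBracket 𝓘(ℝ, E) V W x = VectorField.lieBracket ℝ V W x := by
  rw [← VectorField.mlieBracketWithin_univ, VectorField.mlieBracketWithin_eq_lieBracketWithin]
  exact congrFun (VectorField.lieBracketWithin_univ (𝕜 := ℝ) (V := V) (W := W)) x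

/-- The Lie bracket of two vector fields, computed in a parametrisation. -/
theorem IsRep.mlieBracket_eq {Ψ : E → M} {x : E} (h : IsLocalParam n Ψ x)
    {V W : (q : M) → TangentSpace (𝓡 n) q} {ξ ζ : E → E} (hV : IsRep Ψ x V ξ)
    (hW : IsRep Ψ x W ζ) (hsV : SmoothVecAt V (Ψ x)) (hsW : SmoothVecAt W (Ψ x)) :
    VectorField.mlieBracket (𝓡 n) V W (Ψ x) =
      dparam n Ψ x (VectorField.lieBracket ℝ ξ ζ x) := by
  have : IsManifold (𝓡 n) (minSmoothness ℝ 3) M := by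
    simp only [minSmoothness_of_isRCLikeNormedField]
    exact IsManifold.of_le (n := ∞) (WithTop.coe_le_coe.2 le_top)
  have h1 := VectorField.mpullback_mlieBracket hsV.mdifferentiableAt hsW.mdifferentiableAt
    h.self.1 (by simp only [minSmoothness_of_isRCLikeNormedField]; exact WithTop.coe_le_coe.2 le_top)
  rw [VectorField.mpullback_apply] at h1
  rw [(IsRep.mpullback_eventuallyEq h hV).mlieBracket_vectorField_eq
    (IsRep.mpullback_eventuallyEq h hW)] at h1
  have h3 := mlieBracket_vectorSpace ξ ζ x
  obtain ⟨v, hv⟩ := h.self.2.2 (VectorField.mlieBracket (𝓡 n) V W (Ψ x))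
  rw [← hv] at h1 ⊢
  have h2 := inverse_apply_eq_of_isInvertible (F := E) (G := EuclideanSpace ℝ (Fin n))
    h.isInvertible v
  rw [← h3]
  exact congrArg _ (h2.symm.trans h1)


/-- The inverse of the preferred chart is a parametrisation near the base point. -/
theorem isLocalParam_extChartAt_symm (q : M) :
    IsLocalParam n (extChartAt (𝓡 n) q).symm (extChartAt (𝓡 n) q q) := by
  have h1 : (extChartAt (𝓡 n) q).target ∈ 𝓝 (extChartAt (𝓡 n) q q) :=
    extChartAt_target_mem_nhds q
  filter_upwards [eventually_mem_nhds_iff.2 h1] with y hy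
  have hy' := mem_of_mem_nhds hy
  refine ⟨(contMDiffOn_extChartAt_symm q).contMDiffAt hy, ?_⟩
  have h2 := isInvertible_mfderivWithin_extChartAt_symm hy'
  have hr : range (𝓡 n) = univ := by simp
  rw [hr, mfderivWithin_univ] at h2
  obtain ⟨e, he⟩ := h2
  rw [← he]
  exact e.bijective

/-- The vector fields `F i` form a smooth frame of `D` near `q`. -/
def IsFrameNear {k : ℕ} (F : Fin k → (y : M) → TangentSpace (𝓡 n) y) (D : TangentDist n M)
    (q : M) : Prop :=
  ∀ᶠ y in 𝓝 q, (∀ i, SmoothVecAt (F i) y) ∧ LinearIndependent ℝ (fun i => F i y) ∧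
    Submodule.span ℝ (range fun i => F i y) = D y

/-- A vector field vanishing at a point and tangent to a smooth distribution has all its brackets
at that point tangent to the distribution. -/
theorem mlieBracket_mem_of_eq_zero {k : ℕ} {D : TangentDist n M} {q : M}
    {F : Fin k → (y : M) → TangentSpace (𝓡 n) y} (hF : IsFrameNear F D q) {V W : (y : M) → TangentSpace (𝓡 n) y} (hV : IsLocalSection D q V)
    (hW : SmoothVecAt W q) (h0 : V q = 0) : VectorField.mlieBracket (𝓡 n) V W q ∈ D q := by
  let Ψ : EuclideanSpace ℝ (Fin n) → M := (extChartAt (𝓡 n) q).symm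
  let x : EuclideanSpace ℝ (Fin n) := extChartAt (𝓡 n) q q
  have hΨ : IsLocalParam n Ψ x := isLocalParam_extChartAt_symm q
  have hx : Ψ x = q := extChartAt_to_inv q
  have hcont : Tendsto Ψ (𝓝 x) (𝓝 (Ψ x)) := hΨ.self.1.continuousAt
  rw [← hx] at hF hV hW h0 ⊢
  have hFx := Filter.Eventually.self_of_nhds (p := fun y => (∀ i, SmoothVecAt (F i) y) ∧
    LinearIndependent ℝ (fun i => F i y) ∧ Submodule.span ℝ (range fun i => F i y) = D y) hF
  have hVx := Filter.Eventually.self_of_nhds (p := fun y => SmoothVecAt V y ∧ V y ∈ D y) hV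
  let ξ : EuclideanSpace ℝ (Fin n) → EuclideanSpace ℝ (Fin n) := VectorField.mpullback 𝓘(ℝ, _) (𝓡 n) Ψ V
  let ζ : EuclideanSpace ℝ (Fin n) → EuclideanSpace ℝ (Fin n) := VectorField.mpullback 𝓘(ℝ, _) (𝓡 n) Ψ W
  let f : Fin k → EuclideanSpace ℝ (Fin n) → EuclideanSpace ℝ (Fin n) := fun i =>
    VectorField.mpullback 𝓘(ℝ, _) (𝓡 n) Ψ (F i)
  have hξ : IsRep Ψ x V ξ := isRep_mpullback hΨ V
  have hζ : IsRep Ψ x W ζ := isRep_mpullback hΨ W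
  have hf : ∀ i, IsRep Ψ x (F i) (f i) := fun i => isRep_mpullback hΨ (F i)
  rw [hξ.mlieBracket_eq hΨ hζ hVx.1 hW, ← hFx.2.2]
  have hspan : ∀ᶠ y in 𝓝 x, Submodule.span ℝ (range fun i => F i (Ψ y)) =
      (Submodule.span ℝ (range fun i => f i y)).map (dparam n Ψ y).toLinearMap := by
    have := eventually_all.2 hf
    filter_upwards [this] with y hy
    rw [Submodule.map_span, ← range_comp]
    simp only [hy]
    rfl
  have hmem : ∀ᶠ y in 𝓝 x, ξ y ∈ Submodule.span ℝ (range fun i => f i y) := by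
    filter_upwards [hspan, hcont.eventually hF, hcont.eventually hV, hξ,
      Filter.Eventually.eventually_nhds hΨ] with y h1 h2 h3 h4 h5
    have h6 := h3.2
    rw [← h2.2.2, h1, h4] at h6
    obtain ⟨v, hv, hv'⟩ := h6
    rwa [← dparam_injective h5 hv']
  rw [hspan.self_of_nhds]
  refine Submodule.mem_map_of_mem ?_
  have hξ0 : ξ x = 0 := by
    apply dparam_injective hΨ
    have := Filter.Eventually.self_of_nhds (p := fun y => V (Ψ y) = dparam n Ψ y (ξ y)) hξ
    rw [← this, h0]
    rw [map_zero]
  have hind : LinearIndependent ℝ fun i => f i x := by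
    have h1 := hFx.2.1
    have h2 : (fun i => F i (Ψ x)) =
        (dparam n Ψ x).toLinearMap ∘ fun i => f i x := by
      funext i
      exact Filter.Eventually.self_of_nhds (p := fun y => F i (Ψ y) = dparam n Ψ y (f i y)) (hf i)
    rw [h2] at h1
    exact h1.of_comp _
  rw [VectorField.lieBracket, hξ0, map_zero, zero_sub]
  refine Submodule.neg_mem _ ?_
  exact fderiv_mem_span_of_eventually_mem (fun i => ((hf i).contDiffAt hΨ (hFx.1 i)).continuousAt)
    hind ((hξ.contDiffAt hΨ hVx.1).differentiableAt (by simp)) hξ0 hmem _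

end LocalParam

/-! ### Brackets of sections of a distribution -/

section Brackets

variable {n : ℕ} {M : Type*} [TopologicalSpace M] [ChartedSpace (EuclideanSpace ℝ (Fin n)) M]
  [IsManifold (𝓡 n) ∞ M]
variable {D D' : TangentDist n M} {q : M} {V W V' W' : (y : M) → TangentSpace (𝓡 n) y}

theorem IsLocalSection.self (h : IsLocalSection D q V) : SmoothVecAt V q ∧ V q ∈ D q :=
  Filter.Eventually.self_of_nhds (p := fun y => SmoothVecAt V y ∧ V y ∈ D y) h

theorem IsLocalSection.add (h : IsLocalSection D q V) (h' : IsLocalSection D q W) :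
    IsLocalSection D q (V + W) := by
  filter_upwards [h, h'] with y h1 h2
  exact ⟨h1.1.add h2.1, Submodule.add_mem _ h1.2 h2.2⟩

theorem IsLocalSection.sub (h : IsLocalSection D q V) (h' : IsLocalSection D q W) :
    IsLocalSection D q (V - W) := by
  filter_upwards [h, h'] with y h1 h2
  exact ⟨h1.1.sub h2.1, Submodule.sub_mem _ h1.2 h2.2⟩

theorem IsLocalSection.const_smul (c : ℝ) (h : IsLocalSection D q V) :
    IsLocalSection D q (c • V) := by
  filter_upwards [h] with y h1
  exact ⟨h1.1.const_smul c, Submodule.smul_mem _ _ h1.2⟩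

theorem IsLocalSection.congr_dist (h : IsLocalSection D q V) (hD : ∀ᶠ y in 𝓝 q, D' y = D y) :
    IsLocalSection D' q V := by
  filter_upwards [h, hD] with y h1 h2
  exact ⟨h1.1, h2 ▸ h1.2⟩

theorem IsFrameNear.self {k : ℕ} {F : Fin k → (y : M) → TangentSpace (𝓡 n) y}
    (h : IsFrameNear F D q) : (∀ i, SmoothVecAt (F i) q) ∧ LinearIndependent ℝ (fun i => F i q) ∧
      Submodule.span ℝ (range fun i => F i q) = D q :=
  Filter.Eventually.self_of_nhds (p := fun y => (∀ i, SmoothVecAt (F i) y) ∧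
    LinearIndependent ℝ (fun i => F i y) ∧ Submodule.span ℝ (range fun i => F i y) = D y) h

theorem IsFrameNear.isLocalSection {k : ℕ} {F : Fin k → (y : M) → TangentSpace (𝓡 n) y}
    (h : IsFrameNear F D q) (i : Fin k) : IsLocalSection D q (F i) := by
  filter_upwards [h] with y h1
  refine ⟨h1.1 i, ?_⟩
  rw [← h1.2.2]
  exact Submodule.subset_span (mem_range_self i)

theorem IsLocalSection.finsetSum {ι : Type*} (s : Finset ι)
    {F : ι → (y : M) → TangentSpace (𝓡 n) y} (hF : ∀ i ∈ s, IsLocalSection D q (F i)) :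
    IsLocalSection D q (∑ i ∈ s, F i) := by
  classical
  induction s using Finset.induction_on with
  | empty =>
    simp only [Finset.sum_empty]
    exact Eventually.of_forall fun y => ⟨Bundle.contMDiff_zeroSection ℝ _ y, Submodule.zero_mem _⟩
  | insert a s ha ih =>
    rw [Finset.sum_insert ha]
    exact (hF a (by simp)).add (ih fun i hi => hF i (by simp [hi]))

/-- The bracket form of a distribution: the class modulo `D q` of the bracket of two sections of `D`
at `q` is determined by the values of the sections at `q`. -/
theorem mlieBracket_sub_mlieBracket_mem {k : ℕ} {F : Fin k → (y : M) → TangentSpace (𝓡 n) y}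
    (hF : IsFrameNear F D q) (hV : IsLocalSection D q V) (hW : IsLocalSection D q W)
    (hV' : IsLocalSection D q V') (hW' : IsLocalSection D q W') (h1 : V q = V' q)
    (h2 : W q = W' q) :
    VectorField.mlieBracket (𝓡 n) V W q - VectorField.mlieBracket (𝓡 n) V' W' q ∈ D q := by
  have e1 : VectorField.mlieBracket (𝓡 n) V W q =
      VectorField.mlieBracket (𝓡 n) (V - V') W q + VectorField.mlieBracket (𝓡 n) V' W q := by
    rw [← VectorField.mlieBracket_add_left (hV.self.1.sub hV'.self.1).mdifferentiableAt
      hV'.self.1.mdifferentiableAt, sub_add_cancel]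
  have e2 : VectorField.mlieBracket (𝓡 n) V' W q =
      VectorField.mlieBracket (𝓡 n) V' (W - W') q + VectorField.mlieBracket (𝓡 n) V' W' q := by
    rw [← VectorField.mlieBracket_add_right (hW.self.1.sub hW'.self.1).mdifferentiableAt
      hW'.self.1.mdifferentiableAt, sub_add_cancel]
  rw [e1, e2, ← add_assoc, add_sub_cancel_right]
  refine Submodule.add_mem _ ?_ ?_
  · exact mlieBracket_mem_of_eq_zero hF (hV.sub hV') hW.self.1 (sub_eq_zero.2 h1)
  · rw [VectorField.mlieBracket_swap_apply]
    exact Submodule.neg_mem _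
      (mlieBracket_mem_of_eq_zero hF (hW.sub hW') hV'.self.1 (sub_eq_zero.2 h2))

theorem mlieBracket_sum_smul_right {ι : Type*} (s : Finset ι)
    {F : ι → (y : M) → TangentSpace (𝓡 n) y} (c : ι → ℝ)
    (hF : ∀ i ∈ s, SmoothVecAt (F i) q) :
    VectorField.mlieBracket (𝓡 n) V (∑ i ∈ s, c i • F i) q =
      ∑ i ∈ s, c i • VectorField.mlieBracket (𝓡 n) V (F i) q := by
  classical
  have key : SmoothVecAt (∑ i ∈ s, c i • F i) q ∧
      VectorField.mlieBracket (𝓡 n) V (∑ i ∈ s, c i • F i) q =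
      ∑ i ∈ s, c i • VectorField.mlieBracket (𝓡 n) V (F i) q := by
    induction s using Finset.induction_on with
    | empty =>
      simp only [Finset.sum_empty, VectorField.mlieBracket_zero_right, Pi.zero_apply, and_true]
      exact Bundle.contMDiff_zeroSection ℝ _ q
    | insert a s ha ih =>
      have h1 := ih fun i hi => hF i (by simp [hi])
      have h2 := hF a (by simp)
      rw [Finset.sum_insert ha, Finset.sum_insert ha]
      refine ⟨(h2.const_smul _).add h1.1, ?_⟩
      rw [VectorField.mlieBracket_add_right (h2.const_smul _).mdifferentiableAt
        h1.1.mdifferentiableAt, h1.2,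
        VectorField.mlieBracket_const_smul_right h2.mdifferentiableAt]
  exact key.2

/-- Modulo the distribution, the bracket of a section with another one is expressed by the brackets
with the members of a frame. -/
theorem mlieBracket_sub_sum_mem {k : ℕ} {F : Fin k → (y : M) → TangentSpace (𝓡 n) y}
    (hF : IsFrameNear F D q) (hV : IsLocalSection D q V) (hW : IsLocalSection D q W)
    {m : ℕ} {G : Fin m → (y : M) → TangentSpace (𝓡 n) y} (hG : ∀ i, IsLocalSection D q (G i))
    {c : Fin m → ℝ} (hc : W q = ∑ i, c i • G i q) :
    VectorField.mlieBracket (𝓡 n) V W q -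
      ∑ i, c i • VectorField.mlieBracket (𝓡 n) V (G i) q ∈ D q := by
  rw [← mlieBracket_sum_smul_right Finset.univ c (fun i _ => (hG i).self.1)]
  refine mlieBracket_sub_mlieBracket_mem hF hV hW hV
    (IsLocalSection.finsetSum _ fun i _ => (hG i).const_smul _) rfl ?_
  rw [hc, Finset.sum_apply]
  rfl

theorem exists_coeff_of_frame {k : ℕ} {F : Fin k → (y : M) → TangentSpace (𝓡 n) y}
    (hF : IsFrameNear F D q) {v : TangentSpace (𝓡 n) q} (hv : v ∈ D q) :
    ∃ c : Fin k → ℝ, v = ∑ i, c i • F i q := by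
  rw [← hF.self.2.2] at hv
  obtain ⟨c, hc⟩ := (Submodule.mem_span_range_iff_exists_fun ℝ).1 hv
  exact ⟨c, hc.symm⟩

/-- The derived distribution is spanned by the distribution and by the brackets of the members of
any frame. -/
theorem derivedDist_eq_of_frame {k : ℕ} {F : Fin k → (y : M) → TangentSpace (𝓡 n) y}
    (hF : IsFrameNear F D q) {S : Submodule ℝ (TangentSpace (𝓡 n) q)} (hS : D q ≤ S)
    (hFS : ∀ i j, VectorField.mlieBracket (𝓡 n) (F i) (F j) q ∈ S)
    (hSF : S ≤ D q ⊔ Submodule.span ℝ {v | ∃ i j, v = VectorField.mlieBracket (𝓡 n) (F i) (F j) q}) :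
    derivedDist D q = S := by
  apply le_antisymm
  · refine sup_le hS (Submodule.span_le.2 ?_)
    rintro v ⟨V, V', hV, hV', rfl⟩
    obtain ⟨c, hc⟩ := exists_coeff_of_frame hF hV.self.2
    obtain ⟨c', hc'⟩ := exists_coeff_of_frame hF hV'.self.2
    have h1 := mlieBracket_sub_sum_mem hF hV hV' hF.isLocalSection hc'
    have h2 : ∀ i, VectorField.mlieBracket (𝓡 n) V (F i) q ∈ S := by
      intro i
      have h3 := mlieBracket_sub_sum_mem hF (hF.isLocalSection i) hV hF.isLocalSection hc
      rw [VectorField.mlieBracket_swap_apply]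
      refine Submodule.neg_mem _ ?_
      rw [← sub_add_cancel (VectorField.mlieBracket (𝓡 n) (F i) V q)
        (∑ j, c j • VectorField.mlieBracket (𝓡 n) (F i) (F j) q)]
      exact Submodule.add_mem _ (hS h3)
        (Submodule.sum_mem _ fun j _ => Submodule.smul_mem _ _ (hFS i j))
    rw [← sub_add_cancel (VectorField.mlieBracket (𝓡 n) V V' q)
        (∑ i, c' i • VectorField.mlieBracket (𝓡 n) V (F i) q)]
    exact Submodule.add_mem _ (hS h1)
        (Submodule.sum_mem _ fun j _ => Submodule.smul_mem _ _ (h2 j))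
  · refine hSF.trans (sup_le_sup_left (Submodule.span_mono ?_) _)
    rintro v ⟨i, j, rfl⟩
    exact ⟨F i, F j, hF.isLocalSection i, hF.isLocalSection j, rfl⟩

theorem mlieBracket_mem_derivedDist (hV : IsLocalSection D q V) (hW : IsLocalSection D q W) :
    VectorField.mlieBracket (𝓡 n) V W q ∈ derivedDist D q :=
  Submodule.mem_sup_right (Submodule.subset_span ⟨V, W, hV, hW, rfl⟩)

theorem le_derivedDist : D q ≤ derivedDist D q := le_sup_left

/-- Membership in the kernel of a distribution can be tested on any extension of the vector and on
any frame. -/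
theorem inKernel_iff_of_frame {k : ℕ} {F : Fin k → (y : M) → TangentSpace (𝓡 n) y}
    (hF : IsFrameNear F D q) (hV : IsLocalSection D q V) :
    InKernel D q (V q) ↔ ∀ i, VectorField.mlieBracket (𝓡 n) V (F i) q ∈ D q := by
  constructor
  · intro h i
    exact h.2 V (F i) hV (hF.isLocalSection i) rfl
  · refine fun h => ⟨hV.self.2, fun U U' hU hU' hUV => ?_⟩
    have h1 := mlieBracket_sub_mlieBracket_mem hF hU hU' hV hU' hUV rfl
    obtain ⟨c, hc⟩ := exists_coeff_of_frame hF hU'.self.2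
    have h2 := mlieBracket_sub_sum_mem hF hV hU' hF.isLocalSection hc
    have h3 := Submodule.add_mem _ (Submodule.add_mem _ h1 h2)
      (Submodule.sum_mem _ fun j (_ : j ∈ Finset.univ) => Submodule.smul_mem _ (c j) (h j))
    simpa using h3

theorem derivedDist_congr (h : ∀ᶠ y in 𝓝 q, D y = D' y) : derivedDist D q = derivedDist D' q := by
  have h' : ∀ᶠ y in 𝓝 q, D' y = D y := h.mono fun _ e => e.symm
  unfold derivedDist
  rw [h.self_of_nhds]
  congr 2
  ext v
  constructor
  · rintro ⟨V, V', hV, hV', rfl⟩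
    exact ⟨V, V', hV.congr_dist h', hV'.congr_dist h', rfl⟩
  · rintro ⟨V, V', hV, hV', rfl⟩
    exact ⟨V, V', hV.congr_dist h, hV'.congr_dist h, rfl⟩

theorem eventually_derivedDist_congr (h : ∀ᶠ y in 𝓝 q, D y = D' y) :
    ∀ᶠ y in 𝓝 q, derivedDist D y = derivedDist D' y :=
  h.eventually_nhds.mono fun _ => derivedDist_congr

theorem InKernel.congr (h : ∀ᶠ y in 𝓝 q, D' y = D y) {v : TangentSpace (𝓡 n) q}
    (hv : InKernel D q v) : InKernel D' q v := by
  have h' : ∀ᶠ y in 𝓝 q, D y = D' y := h.mono fun _ e => e.symm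
  refine ⟨h.self_of_nhds ▸ hv.1, fun V V' hV hV' e => ?_⟩
  rw [h.self_of_nhds]
  exact hv.2 V V' (hV.congr_dist h') (hV'.congr_dist h') e

theorem IsFrameNear.finrank_eq {k : ℕ} {F : Fin k → (y : M) → TangentSpace (𝓡 n) y}
    (hF : IsFrameNear F D q) : Module.finrank ℝ (D q) = k := by
  have h := hF.self
  rw [← h.2.2, finrank_span_eq_card h.2.1, Fintype.card_fin]

end Brackets

/-! ### Engel framings -/

theorem LinearIndependent.sum_smul_of_det_ne_zero {V : Type*} [AddCommGroup V] [Module ℝ V]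
    {m : ℕ} {f : Fin m → V} (hf : LinearIndependent ℝ f) {A : Matrix (Fin m) (Fin m) ℝ}
    (hA : A.det ≠ 0) : LinearIndependent ℝ fun i => ∑ j, A j i • f j := by
  rw [Fintype.linearIndependent_iff]
  intro g hg
  have h1 : ∑ j, (A.mulVec g) j • f j = 0 := by
    rw [← hg]
    simp only [Matrix.mulVec, dotProduct, Finset.sum_smul, Finset.smul_sum, smul_smul]
    rw [Finset.sum_comm]
    simp only [mul_comm]
  have h2 := Fintype.linearIndependent_iff.1 hf _ h1
  have h3 : A.mulVec g = 0 := funext h2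
  have h4 := Matrix.eq_zero_of_mulVec_eq_zero hA h3
  exact fun i => congrFun h4 i

theorem mem_span_range_two {V : Type*} [AddCommGroup V] [Module ℝ V] {f : Fin 2 → V} {v : V} :
    v ∈ Submodule.span ℝ (range f) ↔ ∃ a b : ℝ, v = a • f 0 + b • f 1 := by
  rw [Submodule.mem_span_range_iff_exists_fun]
  constructor
  · rintro ⟨c, rfl⟩
    exact ⟨c 0, c 1, by simp [Fin.sum_univ_two]⟩
  · rintro ⟨a, b, rfl⟩
    exact ⟨![a, b], by simp [Fin.sum_univ_two]⟩

theorem mem_span_range_three {V : Type*} [AddCommGroup V] [Module ℝ V] {f : Fin 3 → V} {v : V} :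
    v ∈ Submodule.span ℝ (range f) ↔ ∃ a b c : ℝ, v = a • f 0 + b • f 1 + c • f 2 := by
  rw [Submodule.mem_span_range_iff_exists_fun]
  constructor
  · rintro ⟨c, rfl⟩
    exact ⟨c 0, c 1, c 2, by simp [Fin.sum_univ_three]⟩
  · rintro ⟨a, b, c, rfl⟩
    exact ⟨![a, b, c], by simp [Fin.sum_univ_three]⟩

section EngelPair

variable {M : Type*} [TopologicalSpace M] [ChartedSpace (EuclideanSpace ℝ (Fin 4)) M]
  [IsManifold (𝓡 4) ∞ M]
variable {D : TangentDist 4 M} {W X W' X' : (q : M) → TangentSpace (𝓡 4) q} {q : M}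

theorem IsEngelPair.isFrameNear (h : IsEngelPair D W X) (q : M) : IsFrameNear ![W, X] D q := by
  refine Eventually.of_forall fun y => ⟨fun i => ?_, ?_, ?_⟩
  · fin_cases i
    · exact h.smooth_W y
    · exact h.smooth_X y
  · have h1 := h.indep y
    convert h1 using 1
    funext i
    fin_cases i <;> rfl
  · rw [← h.span y]
    congr 1
    ext v
    simp [Fin.exists_fin_two, eq_comm]

theorem IsEngelPair.mem_W (h : IsEngelPair D W X) (q : M) : W q ∈ D q := by
  rw [← h.span q]
  exact Submodule.subset_span (by simp)

theorem IsEngelPair.mem_X (h : IsEngelPair D W X) (q : M) : X q ∈ D q := by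
  rw [← h.span q]
  exact Submodule.subset_span (by simp)

theorem IsEngelPair.isLocalSection_W (h : IsEngelPair D W X) (q : M) : IsLocalSection D q W :=
  Eventually.of_forall fun y => ⟨h.smooth_W y, h.mem_W y⟩

theorem IsEngelPair.isLocalSection_X (h : IsEngelPair D W X) (q : M) : IsLocalSection D q X :=
  Eventually.of_forall fun y => ⟨h.smooth_X y, h.mem_X y⟩

theorem IsEngelPair.mem_iff (h : IsEngelPair D W X) {v : TangentSpace (𝓡 4) q} :
    v ∈ D q ↔ ∃ a b : ℝ, v = a • W q + b • X q := by
  rw [← h.span q, Submodule.mem_span_pair]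
  simp only [eq_comm]

theorem span_range_vecThree {V : Type*} [AddCommGroup V] [Module ℝ V] (a b c : V) :
    Submodule.span ℝ (range ![a, b, c]) = Submodule.span ℝ {a, b} ⊔ Submodule.span ℝ {c} := by
  rw [← Submodule.span_union]
  congr 1
  ext v
  simp only [mem_range, Fin.exists_fin_succ, Matrix.cons_val_zero, Matrix.cons_val_succ,
    IsEmpty.exists_iff, or_false, mem_union, mem_insert_iff, mem_singleton_iff, or_assoc]
  simp only [eq_comm]

theorem derivedDist_eq_of_frame_two {V₁ V₂ : (q : M) → TangentSpace (𝓡 4) q}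
    (h : IsFrameNear ![V₁, V₂] D q) :
    derivedDist D q = Submodule.span ℝ
      (range ![V₁ q, V₂ q, VectorField.mlieBracket (𝓡 4) V₁ V₂ q]) := by
  have hD : D q = Submodule.span ℝ {V₁ q, V₂ q} := by
    rw [← h.self.2.2]
    congr 1
    ext v
    simp [Fin.exists_fin_two, eq_comm]
  rw [span_range_vecThree, ← hD]
  refine derivedDist_eq_of_frame h le_sup_left ?_ ?_
  · have key : VectorField.mlieBracket (𝓡 4) V₁ V₂ q ∈
        D q ⊔ Submodule.span ℝ {VectorField.mlieBracket (𝓡 4) V₁ V₂ q} :=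
      Submodule.mem_sup_right (Submodule.subset_span rfl)
    intro i j
    fin_cases i <;> fin_cases j
    · simp
    · exact key
    · have := Submodule.neg_mem _ key
      rw [← VectorField.mlieBracket_swap_apply] at this
      exact this
    · simp
  · refine sup_le_sup_left (Submodule.span_mono ?_) _
    rintro v rfl
    exact ⟨0, 1, rfl⟩

theorem IsEngelPair.derivedDist_eq (h : IsEngelPair D W X) (q : M) :
    derivedDist D q = Submodule.span ℝ
      (range ![W q, X q, VectorField.mlieBracket (𝓡 4) W X q]) :=
  derivedDist_eq_of_frame_two (h.isFrameNear q)

theorem IsSmoothDistribution.finrank_eq {k : ℕ} (h : IsSmoothDistribution k D) (q : M) :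
    Module.finrank ℝ (D q) = k := by
  obtain ⟨F, hF⟩ := h q
  exact IsFrameNear.finrank_eq (F := F) hF

theorem IsEngelPair.isFrameNear_derivedDist (h : IsEngelPair D W X) (hD : IsEngel D) (q : M) :
    IsFrameNear ![W, X, VectorField.mlieBracket (𝓡 4) W X] (derivedDist D) q := by
  refine Eventually.of_forall fun y => ⟨fun i => ?_, ?_, ?_⟩
  · fin_cases i
    · exact h.smooth_W y
    · exact h.smooth_X y
    · exact (h.smooth_W y).mlieBracket (h.smooth_X y)
  · have h1 := hD.2.1.finrank_eq y
    rw [h.derivedDist_eq y] at h1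
    have h2 := (linearIndependent_iff_card_eq_finrank_span
      (b := ![W y, X y, VectorField.mlieBracket (𝓡 4) W X y])).2 (by
        simp only [Set.finrank]
        rw [h1, Fintype.card_fin])
    convert h2 using 1
    funext i
    fin_cases i <;> rfl
  · rw [h.derivedDist_eq y]
    congr 2
    funext i
    fin_cases i <;> rfl

theorem IsEngelPair.mem_derivedDist_iff (h : IsEngelPair D W X) {v : TangentSpace (𝓡 4) q} :
    v ∈ derivedDist D q ↔
      ∃ a b c : ℝ, v = a • W q + b • X q + c • VectorField.mlieBracket (𝓡 4) W X q := by
  rw [h.derivedDist_eq q, mem_span_range_three]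
  rfl

/-- The Engel framing is a framing: its last member is transverse to `[D, D]`, because it is the
only bracket of a frame `W, X, [W, X]` of `[D, D]` that does not lie in `[D, D]`. -/
theorem IsEngelPair.mlieBracket_notMem (h : IsEngelPair D W X) (hD : IsEngel D) (q : M) :
    VectorField.mlieBracket (𝓡 4) X (VectorField.mlieBracket (𝓡 4) W X) q ∉ derivedDist D q := by
  intro hcon
  have hF := h.isFrameNear_derivedDist hD q
  have h1 : ∀ i j, VectorField.mlieBracket (𝓡 4)
      ((![W, X, VectorField.mlieBracket (𝓡 4) W X] : Fin 3 → (q : M) → TangentSpace (𝓡 4) q) i)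
      ((![W, X, VectorField.mlieBracket (𝓡 4) W X] : Fin 3 → (q : M) → TangentSpace (𝓡 4) q) j) q
      ∈ derivedDist D q := by
    have hW : ∀ j, VectorField.mlieBracket (𝓡 4) W
      ((![W, X, VectorField.mlieBracket (𝓡 4) W X] : Fin 3 → (q : M) → TangentSpace (𝓡 4) q) j) q
      ∈ derivedDist D q := fun j => (h.kernel_W q).2 W _ (hF.isLocalSection 0)
        (hF.isLocalSection j) rfl
    intro i j
    fin_cases i
    · exact hW j
    · fin_cases j
      · have := hW 1
        rw [VectorField.mlieBracket_swap_apply]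
        exact Submodule.neg_mem _ this
      · simp
      · exact hcon
    · fin_cases j
      · have := hW 2
        rw [VectorField.mlieBracket_swap_apply]
        exact Submodule.neg_mem _ this
      · rw [VectorField.mlieBracket_swap_apply]
        exact Submodule.neg_mem _ hcon
      · simp
  have h2 := derivedDist_eq_of_frame hF (S := derivedDist D q) le_rfl h1 le_sup_left
  have h3 := hD.2.2 q
  have h4 := hD.2.1.finrank_eq q
  rw [← h2, h3] at h4
  have h5 : Module.finrank ℝ (TangentSpace (𝓡 4) q) = 4 := by
    have : Module.finrank ℝ (EuclideanSpace ℝ (Fin 4)) = 4 := by simp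
    exact this
  rw [finrank_top, h5] at h4
  omega

theorem IsEngelPair.linearIndependent_engelFraming (h : IsEngelPair D W X) (hD : IsEngel D)
    (q : M) : LinearIndependent ℝ (engelFraming W X q) := by
  have h1 := (h.isFrameNear_derivedDist hD q).self.2
  have h2 : (Fin.snoc (fun i => (![W, X, VectorField.mlieBracket (𝓡 4) W X] :
      Fin 3 → (q : M) → TangentSpace (𝓡 4) q) i q) (engelFraming W X q 3) :
      Fin 4 → TangentSpace (𝓡 4) q) = engelFraming W X q := by
    funext i
    fin_cases i <;> rfl
  rw [← h2, linearIndependent_finSnoc]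
  refine ⟨h1.1, ?_⟩
  rw [h1.2]
  exact h.mlieBracket_notMem hD q

/-- The kernel of `[D, D]` is a line field. -/
theorem IsEngelPair.exists_eq_smul_of_inKernel (h : IsEngelPair D W X) (hD : IsEngel D)
    {v : TangentSpace (𝓡 4) q} (hv : InKernel (derivedDist D) q v) : ∃ a : ℝ, v = a • W q := by
  obtain ⟨a, b, c, hc⟩ := h.mem_derivedDist_iff.1 hv.1
  set Z := VectorField.mlieBracket (𝓡 4) W X with hZ
  have hF := h.isFrameNear_derivedDist hD q
  have hsW : IsLocalSection (derivedDist D) q W := hF.isLocalSection 0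
  have hsX : IsLocalSection (derivedDist D) q X := hF.isLocalSection 1
  have hsZ : IsLocalSection (derivedDist D) q Z := hF.isLocalSection 2
  have hsU : IsLocalSection (derivedDist D) q (a • W + b • X + c • Z) :=
    ((hsW.const_smul a).add (hsX.const_smul b)).add (hsZ.const_smul c)
  have hUq : (a • W + b • X + c • Z) q = v := hc.symm
  have hY := h.mlieBracket_notMem hD q
  have key : ∀ G : (q : M) → TangentSpace (𝓡 4) q, IsLocalSection (derivedDist D) q G →
      a • VectorField.mlieBracket (𝓡 4) W G q + b • VectorField.mlieBracket (𝓡 4) X G q +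
        c • VectorField.mlieBracket (𝓡 4) Z G q ∈ derivedDist D q := by
    intro G hG
    have h1 := hv.2 _ G hsU hG hUq
    rwa [VectorField.mlieBracket_add_left
      ((hsW.const_smul a).add (hsX.const_smul b)).self.1.mdifferentiableAt
      (hsZ.const_smul c).self.1.mdifferentiableAt,
      VectorField.mlieBracket_add_left (hsW.const_smul a).self.1.mdifferentiableAt
      (hsX.const_smul b).self.1.mdifferentiableAt,
      VectorField.mlieBracket_const_smul_left hsW.self.1.mdifferentiableAt,
      VectorField.mlieBracket_const_smul_left hsX.self.1.mdifferentiableAt,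
      VectorField.mlieBracket_const_smul_left hsZ.self.1.mdifferentiableAt] at h1
  have hWk : ∀ G : (q : M) → TangentSpace (𝓡 4) q, IsLocalSection (derivedDist D) q G →
      VectorField.mlieBracket (𝓡 4) W G q ∈ derivedDist D q := fun G hG =>
    (h.kernel_W q).2 W G hsW hG rfl
  have hb : b = 0 := by
    by_contra hb
    have h1 := key Z hsZ
    simp only [VectorField.mlieBracket_self, Pi.zero_apply, smul_zero, add_zero] at h1
    have h2 := (Submodule.add_mem_iff_right _ (Submodule.smul_mem _ a (hWk Z hsZ))).1 h1
    exact hY ((Submodule.smul_mem_iff _ hb).1 h2)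
  have hc0 : c = 0 := by
    by_contra hc0
    have h1 := key X hsX
    simp only [VectorField.mlieBracket_self, Pi.zero_apply, smul_zero, add_zero] at h1
    have h2 := (Submodule.add_mem_iff_right _ (Submodule.smul_mem _ a (hWk X hsX))).1 h1
    have h3 := (Submodule.smul_mem_iff _ hc0).1 h2
    rw [VectorField.mlieBracket_swap_apply] at h3
    exact hY ((Submodule.neg_mem_iff _).1 h3)
  exact ⟨a, by rw [hc, hb, hc0]; simp⟩

/-- The Engel framings of two pairs defining the same orientations at a point differ by a triangular
matrix with positive diagonal there. -/
theorem engelFraming_eq_sum_of_sameOrientation (hD : IsEngel D) (h : IsEngelPair D W X)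
    (h' : IsEngelPair D W' X') (hq : SameOrientationOn {q} W X W' X') :
    ∃ P : Matrix (Fin 4) (Fin 4) ℝ, P.BlockTriangular id ∧ (∀ i, 0 < P i i) ∧
      ∀ i, engelFraming W' X' q i = ∑ j, P j i • engelFraming W X q j := by
  obtain ⟨a, b, c, ha, hc, hW, hX⟩ := hq q rfl
  set Z := VectorField.mlieBracket (𝓡 4) W X with hZ
  set Z' := VectorField.mlieBracket (𝓡 4) W' X' with hZ'
  set Y := VectorField.mlieBracket (𝓡 4) X Z with hY
  set Y' := VectorField.mlieBracket (𝓡 4) X' Z' with hY'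
  have hF := h.isFrameNear q
  have hE := h.isFrameNear_derivedDist hD q
  have hE' := h'.isFrameNear_derivedDist hD q
  have hsW := h.isLocalSection_W q
  have hsX := h.isLocalSection_X q
  have hsW' := h'.isLocalSection_W q
  have hsX' := h'.isLocalSection_X q
  have eW : IsLocalSection (derivedDist D) q W := hE.isLocalSection 0
  have eX : IsLocalSection (derivedDist D) q X := hE.isLocalSection 1
  have eZ : IsLocalSection (derivedDist D) q Z := hE.isLocalSection 2
  have eX' : IsLocalSection (derivedDist D) q X' := hE'.isLocalSection 1
  have eZ' : IsLocalSection (derivedDist D) q Z' := hE'.isLocalSection 2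
  have z1 : Z' q - (a * c) • Z q ∈ D q := by
    have h1 := mlieBracket_sub_mlieBracket_mem hF hsW' hsX' (hsW.const_smul a)
      ((hsW.const_smul b).add (hsX.const_smul c)) hW hX
    rwa [VectorField.mlieBracket_add_right (hsW.const_smul b).self.1.mdifferentiableAt
      (hsX.const_smul c).self.1.mdifferentiableAt,
      VectorField.mlieBracket_const_smul_right hsW.self.1.mdifferentiableAt,
      VectorField.mlieBracket_const_smul_right hsX.self.1.mdifferentiableAt,
      VectorField.mlieBracket_const_smul_left hsW.self.1.mdifferentiableAt,
      VectorField.mlieBracket_const_smul_left hsW.self.1.mdifferentiableAt,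
      VectorField.mlieBracket_self, Pi.zero_apply, smul_zero, smul_zero, zero_add, smul_smul,
      mul_comm c a] at h1
  obtain ⟨d1, d2, hd⟩ := h.mem_iff.1 z1
  have hZ'q : Z' q = (d1 • W + d2 • X + (a * c) • Z) q := by
    rw [sub_eq_iff_eq_add] at hd
    exact hd
  have hWk : ∀ G : (q : M) → TangentSpace (𝓡 4) q, IsLocalSection (derivedDist D) q G →
      VectorField.mlieBracket (𝓡 4) W G q ∈ derivedDist D q := fun G hG =>
    (h.kernel_W q).2 W G eW hG rfl
  have y1 : Y' q - (a * c * c) • Y q ∈ derivedDist D q := by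
    have e1 : IsLocalSection (derivedDist D) q (b • W + c • X) :=
      (eW.const_smul b).add (eX.const_smul c)
    have e2 : IsLocalSection (derivedDist D) q (d1 • W + d2 • X + (a * c) • Z) :=
      ((eW.const_smul d1).add (eX.const_smul d2)).add (eZ.const_smul _)
    have h1 := mlieBracket_sub_mlieBracket_mem hE eX' eZ' e1 e2 hX hZ'q
    have h2 : VectorField.mlieBracket (𝓡 4) (b • W + c • X) (d1 • W + d2 • X + (a * c) • Z) q
        - (a * c * c) • Y q ∈ derivedDist D q := by
      rw [VectorField.mlieBracket_add_left (eW.const_smul b).self.1.mdifferentiableAt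
        (eX.const_smul c).self.1.mdifferentiableAt,
        VectorField.mlieBracket_const_smul_left eW.self.1.mdifferentiableAt,
        VectorField.mlieBracket_const_smul_left eX.self.1.mdifferentiableAt,
        VectorField.mlieBracket_add_right (V := X)
          ((eW.const_smul d1).add (eX.const_smul d2)).self.1.mdifferentiableAt
          (eZ.const_smul _).self.1.mdifferentiableAt,
        VectorField.mlieBracket_add_right (V := X) (eW.const_smul d1).self.1.mdifferentiableAt
          (eX.const_smul d2).self.1.mdifferentiableAt,
        VectorField.mlieBracket_const_smul_right (V := X) eW.self.1.mdifferentiableAt,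
        VectorField.mlieBracket_const_smul_right (V := X) eX.self.1.mdifferentiableAt,
        VectorField.mlieBracket_const_smul_right (V := X) eZ.self.1.mdifferentiableAt,
        VectorField.mlieBracket_self, VectorField.mlieBracket_swap_apply (V := X) (W := W)]
      have h3 := Submodule.sub_mem _ (Submodule.smul_mem _ b (hWk _ e2))
        (Submodule.smul_mem _ (c * d1) (hWk X eX))
      convert h3 using 1
      simp only [Pi.zero_apply, smul_zero, add_zero, smul_add, smul_neg, smul_smul,
        mul_comm c (a * c), ← hY]
      abel
    have h4 := Submodule.add_mem _ h1 h2
    simpa using h4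
  obtain ⟨f1, f2, f3, hf⟩ := h.mem_derivedDist_iff.1 y1
  refine ⟨!![a, b, d1, f1; 0, c, d2, f2; 0, 0, a * c, f3; 0, 0, 0, a * c * c], ?_, ?_, ?_⟩
  · intro i j hij
    fin_cases i <;> fin_cases j <;> first | rfl | (exfalso; revert hij; decide)
  · have h1 := mul_pos ha hc
    have h2 := mul_pos h1 hc
    intro i
    fin_cases i <;> simpa
  · intro i
    fin_cases i
    · simpa [Fin.sum_univ_four, engelFraming] using hW
    · simpa [Fin.sum_univ_four, engelFraming] using hX
    · simpa [Fin.sum_univ_four, engelFraming] using hZ'q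
    · rw [sub_eq_iff_eq_add] at hf
      simpa [Fin.sum_univ_four, engelFraming] using hf

/-- A framing and its product with a triangular matrix with positive diagonal are joined by a
segment of framings. -/
theorem LinearIndependent.segment_of_blockTriangular {V : Type*} [AddCommGroup V] [Module ℝ V]
    {m : ℕ} {f g : Fin m → V} (hf : LinearIndependent ℝ f) {P : Matrix (Fin m) (Fin m) ℝ}
    (hP : P.BlockTriangular id) (hpos : ∀ i, 0 < P i i) (hg : ∀ i, g i = ∑ j, P j i • f j)
    {s : ℝ} (hs0 : 0 ≤ s) (hs1 : s ≤ 1) :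
    LinearIndependent ℝ fun i => (1 - s) • f i + s • g i := by
  have h1 := hf.sum_smul_of_det_ne_zero (A := (1 - s) • (1 : Matrix (Fin m) (Fin m) ℝ) + s • P) (by
    rw [Matrix.det_of_isUpperTriangular]
    · refine Finset.prod_ne_zero_iff.2 fun i _ => ne_of_gt ?_
      simp only [Matrix.add_apply, Matrix.smul_apply, Matrix.one_apply_eq, smul_eq_mul, mul_one]
      rcases eq_or_lt_of_le hs0 with h | h
      · rw [← h]; norm_num
      · have := mul_pos h (hpos i); linarith
    · intro i j hij
      have h2 : i ≠ j := fun e => by simp [e] at hij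
      simp [Matrix.one_apply_ne h2, hP hij])
  convert h1 using 1
  funext i
  simp only [hg, Matrix.add_apply, Matrix.smul_apply, smul_eq_mul, add_smul,
    Finset.sum_add_distrib, Finset.smul_sum, smul_smul]
  congr 1
  simp [Matrix.one_apply]

end EngelPair

/-! ### Vector fields given in a parametrisation -/

section PushForward

variable {n : ℕ} {M : Type*} [TopologicalSpace M] [ChartedSpace (EuclideanSpace ℝ (Fin n)) M]
  [IsManifold (𝓡 n) ∞ M]
variable {E : Type*} [NormedAddCommGroup E] [NormedSpace ℝ E] [CompleteSpace E]

/-- The inverse function theorem on manifolds: a local parametrisation has a smooth local inverse. -/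
theorem IsLocalParam.exists_inverse {Ψ : E → M} {x : E} (h : IsLocalParam n Ψ x) :
    ∃ G : M → E, (∀ᶠ y in 𝓝 x, G (Ψ y) = y) ∧ (∀ᶠ q in 𝓝 (Ψ x), Ψ (G q) = q) ∧
      (∀ᶠ q in 𝓝 (Ψ x), ContMDiffAt (𝓡 n) 𝓘(ℝ, E) ∞ G q) ∧ ContinuousAt G (Ψ x) := by
  set q₀ := Ψ x with hq₀
  set φ := extChartAt (𝓡 n) q₀ with hφ
  let f : E → EuclideanSpace ℝ (Fin n) := fun y => φ (Ψ y)
  have hΨc : ContinuousAt Ψ x := h.self.1.continuousAt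
  have hsrc : ∀ᶠ y in 𝓝 x, Ψ y ∈ φ.source := hΨc.eventually (extChartAt_source_mem_nhds q₀)
  -- near `x`, the map `f` is smooth with invertible derivative
  have hf : ∀ᶠ y in 𝓝 x, Ψ y ∈ φ.source ∧ ContDiffAt ℝ ∞ f y ∧
      ∃ e : E ≃L[ℝ] EuclideanSpace ℝ (Fin n), HasFDerivAt f (e : E →L[ℝ] EuclideanSpace ℝ (Fin n)) y := by
    filter_upwards [Filter.Eventually.eventually_nhds h, hsrc] with y hy hys
    have hy' : IsLocalParam n Ψ y := hy
    have hys' : Ψ y ∈ (chartAt (EuclideanSpace ℝ (Fin n)) q₀).source := by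
      rwa [hφ, extChartAt_source] at hys
    have h1 : ContMDiffAt 𝓘(ℝ, E) 𝓘(ℝ, EuclideanSpace ℝ (Fin n)) ∞ f y :=
      (contMDiffAt_extChartAt' hys').comp y hy'.self.1
    refine ⟨hys, h1.contDiffAt, ?_⟩
    obtain ⟨e₁, he₁⟩ := hy'.isInvertible
    obtain ⟨e₂, he₂⟩ := isInvertible_mfderiv_extChartAt (I := 𝓡 n) hys
    have h2 : HasMFDerivAt 𝓘(ℝ, E) 𝓘(ℝ, EuclideanSpace ℝ (Fin n)) f y
        ((mfderiv (𝓡 n) 𝓘(ℝ, EuclideanSpace ℝ (Fin n)) φ (Ψ y)).comp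
          (mfderiv 𝓘(ℝ, E) (𝓡 n) Ψ y)) :=
      HasMFDerivAt.comp y
        ((contMDiffAt_extChartAt' (n := ∞) hys').mdifferentiableAt (by simp)).hasMFDerivAt
        (hy'.self.1.mdifferentiableAt (by simp)).hasMFDerivAt
    rw [← he₁, ← he₂] at h2
    exact ⟨e₁.trans e₂, h2.hasFDerivAt⟩
  obtain ⟨-, hfx, e, he⟩ := hf.self_of_nhds
  let Θ := hfx.toOpenPartialHomeomorph f he (by simp)
  have hΘ : ∀ y, Θ y = f y := fun y => rfl
  have hxΘ : x ∈ Θ.source := hfx.mem_toOpenPartialHomeomorph_source he (by simp)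
  have hfxt : f x ∈ Θ.target := Θ.map_source hxΘ
  have hsymmx : Θ.symm (f x) = x := Θ.left_inv hxΘ
  have hφc : ContinuousAt φ q₀ := continuousAt_extChartAt q₀
  have hGc : ContinuousAt (fun q => Θ.symm (φ q)) q₀ :=
    ContinuousAt.comp (g := Θ.symm) (Θ.continuousAt_symm hfxt) hφc
  have hGq : Θ.symm (φ q₀) = x := hsymmx
  refine ⟨fun q => Θ.symm (φ q), ?_, ?_, ?_, hGc⟩
  · filter_upwards [Θ.open_source.mem_nhds hxΘ] with y hy
    exact Θ.left_inv hy
  · have h1 : ∀ᶠ q in 𝓝 q₀, φ q ∈ Θ.target := hφc.eventually (Θ.open_target.mem_nhds hfxt)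
    have h2 : ∀ᶠ q in 𝓝 q₀, Ψ (Θ.symm (φ q)) ∈ φ.source := by
      have := hGc.tendsto
      rw [hGq] at this
      exact this.eventually hsrc
    filter_upwards [h1, h2, extChartAt_source_mem_nhds (I := 𝓡 n) q₀] with q h1 h2 h3
    have h4 : f (Θ.symm (φ q)) = φ q := Θ.right_inv h1
    exact φ.injOn h2 h3 h4
  · have h1 : ∀ᶠ q in 𝓝 q₀, φ q ∈ Θ.target := hφc.eventually (Θ.open_target.mem_nhds hfxt)
    have h2 := hGc.tendsto
    rw [hGq] at h2
    filter_upwards [h1, h2.eventually hf, extChartAt_source_mem_nhds (I := 𝓡 n) q₀] with q h1 h2 h3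
    obtain ⟨-, h4, e', he'⟩ := h2
    have h5 : ContDiffAt ℝ ∞ Θ.symm (φ q) := Θ.contDiffAt_symm h1 he' h4
    have h3' : q ∈ (chartAt (EuclideanSpace ℝ (Fin n)) q₀).source := by
      rwa [extChartAt_source] at h3
    exact ContMDiffAt.comp q h5.contMDiffAt (contMDiffAt_extChartAt' h3')

theorem IsLocalParam.map_nhds {Ψ : E → M} {x : E} (h : IsLocalParam n Ψ x) :
    map Ψ (𝓝 x) = 𝓝 (Ψ x) := by
  apply le_antisymm h.self.1.continuousAt
  obtain ⟨G, h1, h2, -, h4⟩ := h.exists_inverse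
  have h5 : Tendsto G (𝓝 (Ψ x)) (𝓝 x) := by
    have := h4.tendsto
    rwa [h1.self_of_nhds] at this
  intro s hs
  filter_upwards [h5 hs, h2] with q hq hq'
  rw [← hq']
  exact hq

/-- Every smooth vector field in a parametrisation comes from one on the manifold. -/
theorem IsLocalParam.exists_isRep {Ψ : E → M} {x : E} (h : IsLocalParam n Ψ x) {ξ : E → E}
    (hξ : ∀ᶠ y in 𝓝 x, ContDiffAt ℝ ∞ ξ y) :
    ∃ V : (q : M) → TangentSpace (𝓡 n) q, IsRep Ψ x V ξ ∧ ∀ᶠ q in 𝓝 (Ψ x), SmoothVecAt V q := by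
  obtain ⟨G, h1, h2, h3, h4⟩ := h.exists_inverse
  have hΨc : ContinuousAt Ψ x := h.self.1.continuousAt
  have h5 : Tendsto G (𝓝 (Ψ x)) (𝓝 x) := by
    have := h4.tendsto
    rwa [h1.self_of_nhds] at this
  -- the differentials of `Ψ` and `G` are inverse to each other
  have hinv : ∀ᶠ y in 𝓝 x, ∃ e : E ≃L[ℝ] EuclideanSpace ℝ (Fin n),
      mfderiv 𝓘(ℝ, E) (𝓡 n) Ψ y = (e : E →L[ℝ] EuclideanSpace ℝ (Fin n)) ∧
      mfderiv (𝓡 n) 𝓘(ℝ, E) G (Ψ y) = (e.symm : EuclideanSpace ℝ (Fin n) →L[ℝ] E) := by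
    filter_upwards [Filter.Eventually.eventually_nhds h, h1.eventually_nhds,
      hΨc.eventually h3] with y hy hGy hGs
    have hy' : IsLocalParam n Ψ y := hy
    obtain ⟨e, he⟩ := hy'.isInvertible
    refine ⟨e, he.symm, ?_⟩
    have h6 : HasMFDerivAt 𝓘(ℝ, E) 𝓘(ℝ, E) (fun y => G (Ψ y)) y
        ((mfderiv (𝓡 n) 𝓘(ℝ, E) G (Ψ y)).comp (mfderiv 𝓘(ℝ, E) (𝓡 n) Ψ y)) :=
      HasMFDerivAt.comp y (hGs.mdifferentiableAt (by simp)).hasMFDerivAt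
        (hy'.self.1.mdifferentiableAt (by simp)).hasMFDerivAt
    have h7 : HasMFDerivAt 𝓘(ℝ, E) 𝓘(ℝ, E) (fun y => G (Ψ y)) y (ContinuousLinearMap.id ℝ E) :=
      (hasMFDerivAt_id y).congr_of_eventuallyEq hGy
    have h8 := hasMFDerivAt_unique h6 h7
    rw [← he] at h8
    refine ContinuousLinearMap.ext fun w => ?_
    obtain ⟨v, rfl⟩ := e.surjective w
    have h9 := congrArg (fun L : E →L[ℝ] E => L v) h8
    exact h9.trans (e.symm_apply_apply v).symm
  refine ⟨VectorField.mpullback (𝓡 n) 𝓘(ℝ, E) G ξ, ?_, ?_⟩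
  · filter_upwards [hinv, h1] with y ⟨e, he, he'⟩ hG
    change (mfderiv (𝓡 n) 𝓘(ℝ, E) G (Ψ y) : EuclideanSpace ℝ (Fin n) →L[ℝ] E).inverse
      (ξ (G (Ψ y))) = _
    rw [hG]
    refine (congrArg (fun L : EuclideanSpace ℝ (Fin n) →L[ℝ] E => L.inverse (ξ y)) he').trans ?_
    have h6 : (e.symm : EuclideanSpace ℝ (Fin n) →L[ℝ] E).inverse =
        (e : E →L[ℝ] EuclideanSpace ℝ (Fin n)) := by
      rw [ContinuousLinearMap.inverse_equiv, e.symm_symm]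
    exact (congrArg (fun L : E →L[ℝ] EuclideanSpace ℝ (Fin n) => L (ξ y)) h6).trans
      (congrArg (fun L : E →L[ℝ] EuclideanSpace ℝ (Fin n) => L (ξ y)) he.symm)
  · have h6 := h5.eventually (hinv.and hξ)
    filter_upwards [h2, h3, h6] with q hq hGq h7
    obtain ⟨⟨e, he, he'⟩, hξ'⟩ := h7
    rw [hq] at he'
    exact ContMDiffAt.mpullback_vectorField_preimage (n := ∞) (m := ∞)
      (contMDiffAt_vectorSpace_iff_contDiffAt.2 hξ') hGq ⟨e.symm, he'.symm⟩ (by simp)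

end PushForward

/-! ### Determinants in three-space -/

/-- The determinant of three vectors of `ℝ³`. -/
def det3 (a b c : E3) : ℝ :=
  a 0 * (b 1 * c 2 - b 2 * c 1) - a 1 * (b 0 * c 2 - b 2 * c 0) + a 2 * (b 0 * c 1 - b 1 * c 0)

theorem E3.ext {a b : E3} (h0 : a 0 = b 0) (h1 : a 1 = b 1) (h2 : a 2 = b 2) : a = b := by
  ext i
  fin_cases i
  · exact h0
  · exact h1
  · exact h2

theorem det3_eq_matrix_det (a b c : E3) :
    det3 a b c = Matrix.det !![a 0, a 1, a 2; b 0, b 1, b 2; c 0, c 1, c 2] := by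
  rw [Matrix.det_fin_three]
  simp [det3]
  ring

theorem det3_add_right (a b c c' : E3) : det3 a b (c + c') = det3 a b c + det3 a b c' := by
  simp only [det3, PiLp.add_apply]; ring

theorem det3_sub_right (a b c c' : E3) : det3 a b (c - c') = det3 a b c - det3 a b c' := by
  simp only [det3, PiLp.sub_apply]; ring

theorem det3_smul_right (a b c : E3) (r : ℝ) : det3 a b (r • c) = r * det3 a b c := by
  simp only [det3, PiLp.smul_apply, smul_eq_mul]; ring

theorem det3_self_right (a b : E3) : det3 a b b = 0 := by simp only [det3]; ring

theorem det3_self_left (a b : E3) : det3 a b a = 0 := by simp only [det3]; ring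

theorem exists_det3_ne_zero {a b : E3} (h : LinearIndependent ℝ ![a, b]) :
    ∃ c, det3 a b c ≠ 0 := by
  by_contra! hcon
  have h0 := hcon !₂[1, 0, 0]
  have h1 := hcon !₂[0, 1, 0]
  have h2 := hcon !₂[0, 0, 1]
  simp [det3] at h0 h1 h2
  rw [LinearIndependent.pair_iff] at h
  have hb : b ≠ 0 := by
    rintro rfl
    have := h 0 1 (by simp)
    simp at this
  have key : ∀ i, b i = 0 := by
    intro i
    have h3 : b i • a + (-a i) • b = 0 := by
      apply E3.ext <;> fin_cases i <;> simp <;> linarith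
    exact (h _ _ h3).1
  exact hb (E3.ext (key 0) (key 1) (key 2))

theorem exists_eq_of_det3_eq_zero {a b c : E3} (h : LinearIndependent ℝ ![a, b])
    (h0 : det3 a b c = 0) : ∃ s t : ℝ, c = s • a + t • b := by
  by_contra! hcon
  -- otherwise the three vectors would be independent, so that their determinant would not vanish
  have h1 : LinearIndependent ℝ ![c, a, b] := by
    have : ![c, a, b] = Fin.cons c ![a, b] := rfl
    rw [this, linearIndependent_finCons]
    refine ⟨h, fun hc => ?_⟩
    obtain ⟨s, t, hst⟩ := mem_span_range_two.1 hc
    exact hcon s t hst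
  have h2 : (!![c 0, c 1, c 2; a 0, a 1, a 2; b 0, b 1, b 2] : Matrix (Fin 3) (Fin 3) ℝ).det ≠ 0 := by
    have h3 : LinearIndependent ℝ
        (!![c 0, c 1, c 2; a 0, a 1, a 2; b 0, b 1, b 2] : Matrix (Fin 3) (Fin 3) ℝ).row := by
      have h4 := h1.map' (EuclideanSpace.equiv (Fin 3) ℝ).toLinearMap (LinearEquiv.ker _)
      have h5 : (!![c 0, c 1, c 2; a 0, a 1, a 2; b 0, b 1, b 2] : Matrix (Fin 3) (Fin 3) ℝ).row =
          (EuclideanSpace.equiv (Fin 3) ℝ).toLinearMap ∘ ![c, a, b] := by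
        funext i j
        fin_cases i <;> fin_cases j <;> rfl
      rw [h5]
      exact h4
    exact ((Matrix.isUnit_iff_isUnit_det _).1 (Matrix.linearIndependent_rows_iff_isUnit.1 h3)).ne_zero
  apply h2
  rw [Matrix.det_fin_three]
  simp only [det3] at h0
  simp
  linarith

/-! ### A plane field spanned by a direction and a moving vector -/

section FieldModel

variable {M : Type*} [TopologicalSpace M] [ChartedSpace (EuclideanSpace ℝ (Fin 4)) M]
  [IsManifold (𝓡 4) ∞ M]

/-- The partial derivative of `f` in the direction of the last coordinate. -/
noncomputable def dt {F : Type*} [NormedAddCommGroup F] [NormedSpace ℝ F] (f : E3 × ℝ → F)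
    (y : E3 × ℝ) : F := fderiv ℝ f y (0, 1)

/-- The spatial part of the bracket of the vector fields `(v, 0)` and `(∂_t v, 0)`. -/
noncomputable def spaceBracket (v : E3 × ℝ → E3) (y : E3 × ℝ) : E3 :=
  fderiv ℝ (dt v) y (v y, 0) - fderiv ℝ v y (dt v y, 0)

/-- The plane field `D` is spanned, in the parametrisation `Ψ` and over the open set `Ω`, by `∂_t`
and by the time dependent field `v` of vectors of `ℝ³`. -/
structure IsFieldModel (Ω : Set (E3 × ℝ)) (Ψ : E3 × ℝ → M) (v : E3 × ℝ → E3)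
    (D : TangentDist 4 M) : Prop where
  isOpen : IsOpen Ω
  param : ∀ y ∈ Ω, ContMDiffAt 𝓘(ℝ, E3 × ℝ) (𝓡 4) ∞ Ψ y ∧
    Function.Bijective (mfderiv 𝓘(ℝ, E3 × ℝ) (𝓡 4) Ψ y)
  smooth : ∀ y ∈ Ω, ContDiffAt ℝ ∞ v y
  ne_zero : ∀ y ∈ Ω, v y ≠ 0
  dist_eq : ∀ y ∈ Ω, D (Ψ y) = Submodule.span ℝ
    {dparam 4 Ψ y ((0 : E3), (1 : ℝ)), dparam 4 Ψ y (v y, (0 : ℝ))}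

variable {Ω : Set (E3 × ℝ)} {Ψ : E3 × ℝ → M} {v : E3 × ℝ → E3} {D : TangentDist 4 M}
  {y : E3 × ℝ}

theorem contDiffAt_fderiv_apply {F : Type*} [NormedAddCommGroup F] [NormedSpace ℝ F]
    {f : E3 × ℝ → F} (h : ContDiffAt ℝ ∞ f y) (w : E3 × ℝ) :
    ContDiffAt ℝ ∞ (fun z => fderiv ℝ f z w) y :=
  (h.fderiv_right (m := ∞) (by simp)).clm_apply contDiffAt_const

theorem contDiffAt_dt {F : Type*} [NormedAddCommGroup F] [NormedSpace ℝ F]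
    {f : E3 × ℝ → F} (h : ContDiffAt ℝ ∞ f y) : ContDiffAt ℝ ∞ (dt f) y :=
  contDiffAt_fderiv_apply h _

theorem contDiffAt_spaceBracket (h : ContDiffAt ℝ ∞ v y) :
    ContDiffAt ℝ ∞ (spaceBracket v) y := by
  refine ContDiffAt.sub ?_ ?_
  · exact ((contDiffAt_dt h).fderiv_right (m := ∞) (by simp)).clm_apply
      (h.prodMk contDiffAt_const)
  · exact (h.fderiv_right (m := ∞) (by simp)).clm_apply
      ((contDiffAt_dt h).prodMk contDiffAt_const)

theorem contDiffAt_det3 {a b c : E3 × ℝ → E3} (ha : ContDiffAt ℝ ∞ a y)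
    (hb : ContDiffAt ℝ ∞ b y) (hc : ContDiffAt ℝ ∞ c y) :
    ContDiffAt ℝ ∞ (fun z => det3 (a z) (b z) (c z)) y := by
  have h1 : ∀ i, ContDiffAt ℝ ∞ (fun z => a z i) y := fun i => (contDiffAt_piLp 2).1 ha i
  have h2 : ∀ i, ContDiffAt ℝ ∞ (fun z => b z i) y := fun i => (contDiffAt_piLp 2).1 hb i
  have h3 : ∀ i, ContDiffAt ℝ ∞ (fun z => c z i) y := fun i => (contDiffAt_piLp 2).1 hc i
  unfold det3
  exact (((h1 0).mul (((h2 1).mul (h3 2)).sub ((h2 2).mul (h3 1)))).sub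
    ((h1 1).mul (((h2 0).mul (h3 2)).sub ((h2 2).mul (h3 0))))).add
    ((h1 2).mul (((h2 0).mul (h3 1)).sub ((h2 1).mul (h3 0))))

theorem IsFieldModel.mem_nhds (h : IsFieldModel Ω Ψ v D) (hy : y ∈ Ω) : Ω ∈ 𝓝 y :=
  h.isOpen.mem_nhds hy

theorem IsFieldModel.isLocalParam (h : IsFieldModel Ω Ψ v D) (hy : y ∈ Ω) :
    IsLocalParam 4 Ψ y := by
  filter_upwards [h.mem_nhds hy] with z hz using h.param z hz

theorem lieBracket_timeField {u : E3 × ℝ → E3} (hu : DifferentiableAt ℝ u y) :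
    VectorField.lieBracket ℝ (fun _ => ((0 : E3), (1 : ℝ))) (fun z => (u z, (0 : ℝ))) y =
      (dt u y, 0) := by
  have h1 : HasFDerivAt (fun z => (u z, (0 : ℝ)))
      ((fderiv ℝ u y).prod (0 : E3 × ℝ →L[ℝ] ℝ)) y :=
    hu.hasFDerivAt.prodMk (hasFDerivAt_const _ _)
  rw [VectorField.lieBracket, h1.fderiv, fderiv_fun_const]
  simp [dt]

theorem lieBracket_spaceFields {u : E3 × ℝ → E3} (hv : DifferentiableAt ℝ v y)
    (hu : DifferentiableAt ℝ u y) :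
    VectorField.lieBracket ℝ (fun z => (v z, (0 : ℝ))) (fun z => (u z, (0 : ℝ))) y =
      (fderiv ℝ u y (v y, 0) - fderiv ℝ v y (u y, 0), 0) := by
  have h1 : HasFDerivAt (fun z => (u z, (0 : ℝ)))
      ((fderiv ℝ u y).prod (0 : E3 × ℝ →L[ℝ] ℝ)) y :=
    hu.hasFDerivAt.prodMk (hasFDerivAt_const _ _)
  have h2 : HasFDerivAt (fun z => (v z, (0 : ℝ)))
      ((fderiv ℝ v y).prod (0 : E3 × ℝ →L[ℝ] ℝ)) y :=
    hv.hasFDerivAt.prodMk (hasFDerivAt_const _ _)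
  rw [VectorField.lieBracket, h1.fderiv, h2.fderiv]
  simp

/-- A field of the form `(u, r)` in the parametrisation comes from a smooth field on `M`. -/
theorem IsFieldModel.exists_field (h : IsFieldModel Ω Ψ v D) (hy : y ∈ Ω) {u : E3 × ℝ → E3}
    {r : E3 × ℝ → ℝ} (hu : ∀ z ∈ Ω, ContDiffAt ℝ ∞ u z) (hr : ∀ z ∈ Ω, ContDiffAt ℝ ∞ r z) :
    ∃ V : (q : M) → TangentSpace (𝓡 4) q, IsRep Ψ y V (fun z => (u z, r z)) ∧
      ∀ᶠ q in 𝓝 (Ψ y), SmoothVecAt V q :=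
  (h.isLocalParam hy).exists_isRep (by
    filter_upwards [h.mem_nhds hy] with z hz using (hu z hz).prodMk (hr z hz))

theorem IsFieldModel.eventually_image (h : IsFieldModel Ω Ψ v D) (hy : y ∈ Ω) {P : M → Prop}
    (hP : ∀ᶠ z in 𝓝 y, P (Ψ z)) : ∀ᶠ q in 𝓝 (Ψ y), P q := by
  rw [← (h.isLocalParam hy).map_nhds]
  exact hP

theorem IsFieldModel.isFrameNear (h : IsFieldModel Ω Ψ v D) (hy : y ∈ Ω)
    {T V : (q : M) → TangentSpace (𝓡 4) q}
    (hT : IsRep Ψ y T (fun _ => ((0 : E3), (1 : ℝ)))) (hV : IsRep Ψ y V (fun z => (v z, (0 : ℝ))))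
    (hTs : ∀ᶠ q in 𝓝 (Ψ y), SmoothVecAt T q) (hVs : ∀ᶠ q in 𝓝 (Ψ y), SmoothVecAt V q) :
    IsFrameNear ![T, V] D (Ψ y) := by
  have key : ∀ᶠ q in 𝓝 (Ψ y), LinearIndependent ℝ ![T q, V q] ∧
      Submodule.span ℝ {T q, V q} = D q := by
    apply h.eventually_image hy
    filter_upwards [hT, hV, h.mem_nhds hy] with z h1 h2 h3
    rw [h1, h2]
    refine ⟨?_, (h.dist_eq z h3).symm⟩
    have h4 : LinearIndependent ℝ ![((0 : E3), (1 : ℝ)), (v z, (0 : ℝ))] := by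
      rw [LinearIndependent.pair_iff]
      intro s t hst
      have h5 := congrArg Prod.fst hst
      have h6 := congrArg Prod.snd hst
      simp at h5 h6
      exact ⟨h6, h5.resolve_right (h.ne_zero z h3)⟩
    have h5 := h4.map' (dparam 4 Ψ z).toLinearMap
      (LinearMap.ker_eq_bot.2 (dparam_injective (h.isLocalParam h3)))
    have h6 : ![dparam 4 Ψ z ((0 : E3), (1 : ℝ)), dparam 4 Ψ z (v z, (0 : ℝ))] =
        (dparam 4 Ψ z).toLinearMap ∘ ![((0 : E3), (1 : ℝ)), (v z, (0 : ℝ))] := by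
      funext i
      fin_cases i <;> rfl
    rw [h6]
    exact h5
  filter_upwards [key, hTs, hVs] with q h1 h2 h3
  refine ⟨fun i => ?_, ?_, ?_⟩
  · fin_cases i
    · exact h2
    · exact h3
  · convert h1.1 using 1
    funext i
    fin_cases i <;> rfl
  · rw [← h1.2]
    congr 1
    ext w
    simp [Fin.exists_fin_two, eq_comm]

/-- Vector fields on `M` near `Ψ y` which represent `∂_t`, `v` and `∂_t v`, together with the values
of their brackets. -/
theorem IsFieldModel.exists_frame (h : IsFieldModel Ω Ψ v D) (hy : y ∈ Ω) :
    ∃ T V V' : (q : M) → TangentSpace (𝓡 4) q,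
      (∀ᶠ z in 𝓝 y, T (Ψ z) = dparam 4 Ψ z ((0 : E3), (1 : ℝ)) ∧
        V (Ψ z) = dparam 4 Ψ z (v z, (0 : ℝ)) ∧ V' (Ψ z) = dparam 4 Ψ z (dt v z, (0 : ℝ))) ∧
      (∀ᶠ q in 𝓝 (Ψ y), SmoothVecAt T q ∧ SmoothVecAt V q ∧ SmoothVecAt V' q) ∧
      (∀ᶠ z in 𝓝 y, IsFrameNear ![T, V] D (Ψ z)) ∧
      (∀ᶠ z in 𝓝 y, VectorField.mlieBracket (𝓡 4) T V (Ψ z) =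
        dparam 4 Ψ z (dt v z, (0 : ℝ))) ∧
      VectorField.mlieBracket (𝓡 4) T V' (Ψ y) = dparam 4 Ψ y (dt (dt v) y, (0 : ℝ)) ∧
      VectorField.mlieBracket (𝓡 4) V V' (Ψ y) = dparam 4 Ψ y (spaceBracket v y, (0 : ℝ)) := by
  have hsv' : ∀ z ∈ Ω, ContDiffAt ℝ ∞ (dt v) z := fun z hz => contDiffAt_dt (h.smooth z hz)
  obtain ⟨T, hT, hTs⟩ := h.exists_field hy (u := fun _ => 0) (r := fun _ => 1)
    (fun _ _ => contDiffAt_const) (fun _ _ => contDiffAt_const)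
  obtain ⟨V, hV, hVs⟩ := h.exists_field hy (u := v) (r := fun _ => 0)
    h.smooth (fun _ _ => contDiffAt_const)
  obtain ⟨V', hV', hV's⟩ := h.exists_field hy (u := dt v) (r := fun _ => 0)
    hsv' (fun _ _ => contDiffAt_const)
  have hΨc : Tendsto Ψ (𝓝 y) (𝓝 (Ψ y)) := (h.param y hy).1.continuousAt
  refine ⟨T, V, V', ?_, ?_, ?_, ?_, ?_, ?_⟩
  · filter_upwards [hT, hV, hV'] with z h1 h2 h3 using ⟨h1, h2, h3⟩
  · filter_upwards [hTs, hVs, hV's] with z h1 h2 h3 using ⟨h1, h2, h3⟩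
  · filter_upwards [Filter.Eventually.eventually_nhds hT, Filter.Eventually.eventually_nhds hV,
      hΨc.eventually hTs.eventually_nhds, hΨc.eventually hVs.eventually_nhds,
      h.mem_nhds hy] with z h1 h2 h3 h4 h5
    exact h.isFrameNear h5 h1 h2 h3 h4
  · filter_upwards [Filter.Eventually.eventually_nhds hT, Filter.Eventually.eventually_nhds hV,
      hΨc.eventually hTs, hΨc.eventually hVs, h.mem_nhds hy] with z h1 h2 h3 h4 h5
    rw [IsRep.mlieBracket_eq (h.isLocalParam h5) h1 h2 h3 h4,
      lieBracket_timeField ((h.smooth z h5).differentiableAt (by simp))]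
  · rw [IsRep.mlieBracket_eq (h.isLocalParam hy) hT hV' hTs.self_of_nhds hV's.self_of_nhds,
      lieBracket_timeField ((hsv' y hy).differentiableAt (by simp))]
  · rw [IsRep.mlieBracket_eq (h.isLocalParam hy) hV hV' hVs.self_of_nhds hV's.self_of_nhds,
      lieBracket_spaceFields ((h.smooth y hy).differentiableAt (by simp))
        ((hsv' y hy).differentiableAt (by simp))]
    rfl

theorem IsFieldModel.derivedDist_eq (h : IsFieldModel Ω Ψ v D) (hy : y ∈ Ω) :
    derivedDist D (Ψ y) = Submodule.span ℝ (range ![dparam 4 Ψ y ((0 : E3), (1 : ℝ)),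
      dparam 4 Ψ y (v y, (0 : ℝ)), dparam 4 Ψ y (dt v y, (0 : ℝ))]) := by
  obtain ⟨T, V, V', h1, -, h3, h4, -⟩ := h.exists_frame hy
  rw [derivedDist_eq_of_frame_two h3.self_of_nhds, h4.self_of_nhds, h1.self_of_nhds.1,
    h1.self_of_nhds.2.1]

theorem IsFieldModel.isFrameNear_exists (h : IsFieldModel Ω Ψ v D) (hy : y ∈ Ω) :
    ∃ F : Fin 2 → (q : M) → TangentSpace (𝓡 4) q, IsFrameNear F D (Ψ y) := by
  obtain ⟨T, V, V', -, -, h3, -⟩ := h.exists_frame hy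
  exact ⟨_, h3.self_of_nhds⟩

theorem IsFieldModel.mem_derivedDist_iff (h : IsFieldModel Ω Ψ v D) (hy : y ∈ Ω) {u : E3} {r : ℝ} :
    dparam 4 Ψ y (u, r) ∈ derivedDist D (Ψ y) ↔ ∃ b c : ℝ, u = b • v y + c • dt v y := by
  rw [h.derivedDist_eq hy, mem_span_range_three]
  constructor
  · rintro ⟨a, b, c, hab⟩
    refine ⟨b, c, ?_⟩
    simp only [Matrix.cons_val_zero, Matrix.cons_val_one, Matrix.cons_val] at hab
    rw [← map_smul, ← map_smul, ← map_smul, ← map_add, ← map_add] at hab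
    have := congrArg Prod.fst (dparam_injective (h.isLocalParam hy) hab)
    simpa using this
  · rintro ⟨b, c, rfl⟩
    refine ⟨r, b, c, ?_⟩
    simp only [Matrix.cons_val_zero, Matrix.cons_val_one, Matrix.cons_val]
    rw [← map_smul, ← map_smul, ← map_smul, ← map_add, ← map_add]
    simp

/-- If `[D, D]` has rank three, the moving vector and its derivative are independent. -/
theorem IsFieldModel.linearIndependent_of_finrank (h : IsFieldModel Ω Ψ v D) (hy : y ∈ Ω)
    (hr : Module.finrank ℝ (derivedDist D (Ψ y)) = 3) : LinearIndependent ℝ ![v y, dt v y] := by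
  rw [h.derivedDist_eq hy] at hr
  have h1 := (linearIndependent_iff_card_eq_finrank_span (b := ![dparam 4 Ψ y ((0 : E3), (1 : ℝ)),
      dparam 4 Ψ y (v y, (0 : ℝ)), dparam 4 Ψ y (dt v y, (0 : ℝ))])).2 (by
    simp only [Set.finrank]
    rw [hr, Fintype.card_fin])
  rw [LinearIndependent.pair_iff]
  intro s t hst
  have h2 := Fintype.linearIndependent_iff.1 h1 ![0, s, t] (by
    simp only [Fin.sum_univ_three, Matrix.cons_val_zero, Matrix.cons_val_one, Matrix.cons_val,
      zero_smul, zero_add]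
    rw [← map_smul, ← map_smul, ← map_add]
    simp only [Prod.smul_mk, Prod.mk_add_mk, hst, smul_zero, add_zero]
    exact map_zero _)
  exact ⟨h2 1, h2 2⟩

/-- The field model is immersed: the moving vector and its derivative are independent. -/
structure IsImmersedFieldModel (Ω : Set (E3 × ℝ)) (Ψ : E3 × ℝ → M) (v : E3 × ℝ → E3)
    (D : TangentDist 4 M) : Prop extends IsFieldModel Ω Ψ v D where
  immersed : ∀ y ∈ Ω, LinearIndependent ℝ ![v y, dt v y]

theorem IsImmersedFieldModel.mem_derivedDist_iff_det3 (h : IsImmersedFieldModel Ω Ψ v D)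
    (hy : y ∈ Ω) {u : E3} {r : ℝ} :
    dparam 4 Ψ y (u, r) ∈ derivedDist D (Ψ y) ↔ det3 (v y) (dt v y) u = 0 := by
  rw [h.mem_derivedDist_iff hy]
  constructor
  · rintro ⟨b, c, rfl⟩
    rw [det3_add_right, det3_smul_right, det3_smul_right, det3_self_left, det3_self_right]
    simp
  · exact fun h0 => exists_eq_of_det3_eq_zero (h.immersed y hy) h0

/-- `[D, D]` is spanned by the direction `∂_t`, the moving vector and its derivative. -/
theorem IsImmersedFieldModel.isFrameNear_derivedDist (h : IsImmersedFieldModel Ω Ψ v D)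
    (hy : y ∈ Ω) {T V V' : (q : M) → TangentSpace (𝓡 4) q}
    (h1 : ∀ᶠ z in 𝓝 y, T (Ψ z) = dparam 4 Ψ z ((0 : E3), (1 : ℝ)) ∧
        V (Ψ z) = dparam 4 Ψ z (v z, (0 : ℝ)) ∧ V' (Ψ z) = dparam 4 Ψ z (dt v z, (0 : ℝ)))
    (h2 : ∀ᶠ q in 𝓝 (Ψ y), SmoothVecAt T q ∧ SmoothVecAt V q ∧ SmoothVecAt V' q) :
    IsFrameNear ![T, V, V'] (derivedDist D) (Ψ y) := by
  have key : ∀ᶠ q in 𝓝 (Ψ y), LinearIndependent ℝ ![T q, V q, V' q] ∧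
      Submodule.span ℝ (range ![T q, V q, V' q]) = derivedDist D q := by
    apply h.eventually_image hy
    filter_upwards [h1, h.mem_nhds hy] with z h3 h4
    rw [h3.1, h3.2.1, h3.2.2]
    refine ⟨?_, (h.derivedDist_eq h4).symm⟩
    have h5 : LinearIndependent ℝ ![((0 : E3), (1 : ℝ)), (v z, (0 : ℝ)), (dt v z, (0 : ℝ))] := by
      rw [Fintype.linearIndependent_iff]
      intro g hg
      rw [Fin.sum_univ_three] at hg
      have h5 := congrArg Prod.fst hg
      have h6 := congrArg Prod.snd hg
      simp at h5 h6
      have h7 := LinearIndependent.pair_iff.1 (h.immersed z h4) _ _ h5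
      intro i
      fin_cases i
      · exact h6
      · exact h7.1
      · exact h7.2
    have h6 := h5.map' (dparam 4 Ψ z).toLinearMap
      (LinearMap.ker_eq_bot.2 (dparam_injective (h.isLocalParam h4)))
    have h7 : ![dparam 4 Ψ z ((0 : E3), (1 : ℝ)), dparam 4 Ψ z (v z, (0 : ℝ)),
        dparam 4 Ψ z (dt v z, (0 : ℝ))] = (dparam 4 Ψ z).toLinearMap ∘
        ![((0 : E3), (1 : ℝ)), (v z, (0 : ℝ)), (dt v z, (0 : ℝ))] := by
      funext i
      fin_cases i <;> rfl
    rw [h7]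
    exact h6
  filter_upwards [key, h2] with q h3 h4
  refine ⟨fun i => ?_, ?_, ?_⟩
  · fin_cases i
    · exact h4.1
    · exact h4.2.1
    · exact h4.2.2
  · convert h3.1 using 1
    funext i
    fin_cases i <;> rfl
  · rw [← h3.2]
    congr 2
    funext i
    fin_cases i <;> rfl

theorem dparam_surjective (h : IsLocalParam 4 Ψ y) (w : TangentSpace (𝓡 4) (Ψ y)) :
    ∃ u r, w = dparam 4 Ψ y (u, r) := by
  obtain ⟨⟨u, r⟩, hw⟩ := h.self.2.2 w
  exact ⟨u, r, hw.symm⟩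

/-- The criterion for `[D, D]` to be even-contact, in terms of the second derivative of the moving
vector and of its spatial bracket. -/
theorem IsImmersedFieldModel.derivedDist_derivedDist (h : IsImmersedFieldModel Ω Ψ v D)
    (hy : y ∈ Ω) (hAB : det3 (v y) (dt v y) (dt (dt v) y) ≠ 0 ∨
      det3 (v y) (dt v y) (spaceBracket v y) ≠ 0) : derivedDist (derivedDist D) (Ψ y) = ⊤ := by
  obtain ⟨T, V, V', h1, h2, h3, h4, h5, h6⟩ := h.exists_frame hy
  have hF := h.isFrameNear_derivedDist hy h1 h2
  have key : ∃ u : E3, det3 (v y) (dt v y) u ≠ 0 ∧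
      dparam 4 Ψ y (u, (0 : ℝ)) ∈ derivedDist (derivedDist D) (Ψ y) := by
    rcases hAB with hB | hA
    · refine ⟨_, hB, ?_⟩
      rw [← h5]
      exact mlieBracket_mem_derivedDist (hF.isLocalSection 0) (hF.isLocalSection 2)
    · refine ⟨_, hA, ?_⟩
      rw [← h6]
      exact mlieBracket_mem_derivedDist (hF.isLocalSection 1) (hF.isLocalSection 2)
  obtain ⟨u, hu, hmem⟩ := key
  rw [eq_top_iff]
  intro w _
  obtain ⟨a, r, rfl⟩ := dparam_surjective (h.isLocalParam hy) w
  -- subtract a multiple of the bracket that is transverse to `[D, D]`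
  have h7 : det3 (v y) (dt v y) (a - (det3 (v y) (dt v y) a / det3 (v y) (dt v y) u) • u) = 0 := by
    rw [det3_sub_right, det3_smul_right]
    field_simp
    ring
  have h8 := (h.mem_derivedDist_iff_det3 hy (r := r)).2 h7
  have h9 := Submodule.add_mem _ (le_derivedDist h8)
    (Submodule.smul_mem _ (det3 (v y) (dt v y) a / det3 (v y) (dt v y) u) hmem)
  rw [← map_smul, ← map_add] at h9
  simpa using h9

/-- The kernel line of `[D, D]` lies in `D` and is cut out there by one linear equation, whose
coefficients are the two determinants that also decide whether `[D, D]` is even-contact. -/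
theorem IsImmersedFieldModel.inKernel_iff (h : IsImmersedFieldModel Ω Ψ v D) (hy : y ∈ Ω)
    (a b : ℝ) : InKernel (derivedDist D) (Ψ y) (dparam 4 Ψ y (b • v y, a)) ↔
      b * det3 (v y) (dt v y) (spaceBracket v y) +
        a * det3 (v y) (dt v y) (dt (dt v) y) = 0 := by
  obtain ⟨T, V, V', h1, h2, h3, h4, h5, h6⟩ := h.exists_frame hy
  have hF := h.isFrameNear_derivedDist hy h1 h2
  have sT : IsLocalSection (derivedDist D) (Ψ y) T := hF.isLocalSection 0
  have sV : IsLocalSection (derivedDist D) (Ψ y) V := hF.isLocalSection 1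
  have sV' : IsLocalSection (derivedDist D) (Ψ y) V' := hF.isLocalSection 2
  have sU : IsLocalSection (derivedDist D) (Ψ y) (a • T + b • V) :=
    (sT.const_smul a).add (sV.const_smul b)
  have hU : (a • T + b • V) (Ψ y) = dparam 4 Ψ y (b • v y, a) := by
    have e1 : (a • T + b • V) (Ψ y) = a • T (Ψ y) + b • V (Ψ y) := rfl
    rw [e1, h1.self_of_nhds.1, h1.self_of_nhds.2.1, ← map_smul, ← map_smul, ← map_add]
    simp
  have hbr : ∀ G : (q : M) → TangentSpace (𝓡 4) q,
      VectorField.mlieBracket (𝓡 4) (a • T + b • V) G (Ψ y) =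
      a • VectorField.mlieBracket (𝓡 4) T G (Ψ y) +
        b • VectorField.mlieBracket (𝓡 4) V G (Ψ y) := by
    intro G
    rw [VectorField.mlieBracket_add_left (sT.const_smul a).self.1.mdifferentiableAt
      (sV.const_smul b).self.1.mdifferentiableAt,
      VectorField.mlieBracket_const_smul_left sT.self.1.mdifferentiableAt,
      VectorField.mlieBracket_const_smul_left sV.self.1.mdifferentiableAt]
  have hTV : VectorField.mlieBracket (𝓡 4) T V (Ψ y) ∈ derivedDist D (Ψ y) := by
    rw [h4.self_of_nhds, h.mem_derivedDist_iff_det3 hy, det3_self_right]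
  have hlast : VectorField.mlieBracket (𝓡 4) (a • T + b • V) V' (Ψ y) ∈ derivedDist D (Ψ y) ↔
      b * det3 (v y) (dt v y) (spaceBracket v y) +
        a * det3 (v y) (dt v y) (dt (dt v) y) = 0 := by
    rw [hbr, h5, h6, ← map_smul, ← map_smul, ← map_add, Prod.smul_mk, Prod.smul_mk,
      Prod.mk_add_mk, h.mem_derivedDist_iff_det3 hy, det3_add_right, det3_smul_right,
      det3_smul_right, add_comm]
  rw [← hU, inKernel_iff_of_frame hF sU]
  constructor
  · exact fun h7 => hlast.1 (h7 2)
  · intro h7 i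
    fin_cases i
    · have : VectorField.mlieBracket (𝓡 4) (a • T + b • V) T (Ψ y) ∈ derivedDist D (Ψ y) := by
        rw [hbr, VectorField.mlieBracket_self, Pi.zero_apply, smul_zero, zero_add,
          VectorField.mlieBracket_swap_apply]
        exact Submodule.smul_mem _ _ (Submodule.neg_mem _ hTV)
      exact this
    · have : VectorField.mlieBracket (𝓡 4) (a • T + b • V) V (Ψ y) ∈ derivedDist D (Ψ y) := by
        rw [hbr, VectorField.mlieBracket_self, Pi.zero_apply, smul_zero, add_zero]
        exact Submodule.smul_mem _ _ hTV
      exact this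
    · exact hlast.2 h7

end FieldModel

/-! ### Orbits tangent to the kernel -/

section Flat

variable {y : E3 × ℝ}

theorem fderiv_fderiv_apply_comm {F : Type*} [NormedAddCommGroup F] [NormedSpace ℝ F]
    {f : E3 × ℝ → F} (h : ContDiffAt ℝ ∞ f y) (a b : E3 × ℝ) :
    fderiv ℝ (fun z => fderiv ℝ f z a) y b = fderiv ℝ (fun z => fderiv ℝ f z b) y a := by
  have h1 : IsSymmSndFDerivAt ℝ f y := h.isSymmSndFDerivAt (by
    simp only [minSmoothness_of_isRCLikeNormedField]
    exact WithTop.coe_le_coe.2 le_top)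
  have h2 : DifferentiableAt ℝ (fderiv ℝ f) y :=
    (h.fderiv_right (m := ∞) (by simp)).differentiableAt (by simp)
  rw [fderiv_clm_apply h2 (differentiableAt_const _), fderiv_clm_apply h2 (differentiableAt_const _)]
  simpa using h1 b a

theorem hasDerivAt_line {F : Type*} [NormedAddCommGroup F] [NormedSpace ℝ F]
    {f : E3 × ℝ → F} {x : E3} {t : ℝ} (h : DifferentiableAt ℝ f (x, t)) :
    HasDerivAt (fun s => f (x, s)) (dt f (x, t)) t := by
  have h1 : HasDerivAt (fun s : ℝ => (x, s)) ((0 : E3), (1 : ℝ)) t :=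
    (hasDerivAt_const t x).prodMk (hasDerivAt_id t)
  exact h.hasFDerivAt.comp_hasDerivAt t h1

theorem hasDerivAt_fderiv_line {f : E3 × ℝ → ℝ} {x : E3} {t : ℝ}
    (h : ContDiffAt ℝ ∞ f (x, t)) (a : E3) :
    HasDerivAt (fun s => fderiv ℝ f (x, s) (a, 0)) (fderiv ℝ (dt f) (x, t) (a, 0)) t := by
  have h1 := hasDerivAt_line ((contDiffAt_fderiv_apply h (a, 0)).differentiableAt (by simp))
  rw [dt, fderiv_fderiv_apply_comm h] at h1
  exact h1

/-- The vector field with components `c i` in the frame `e i`. -/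
noncomputable def frameField (e : Fin 3 → E3 → E3) (c : Fin 3 → E3 × ℝ → ℝ) (z : E3 × ℝ) : E3 :=
  ∑ i, c i z • e i z.1

variable {Ω : Set (E3 × ℝ)} {c : Fin 3 → E3 × ℝ → ℝ} {e : Fin 3 → E3 → E3}

theorem contDiffAt_frameField (hc : ∀ i, ContDiffAt ℝ ∞ (c i) y)
    (he : ∀ i, ContDiffAt ℝ ∞ (e i) y.1) : ContDiffAt ℝ ∞ (frameField e c) y :=
  ContDiffAt.sum fun i _ => (hc i).smul ((he i).comp y contDiffAt_fst)

theorem fderiv_frameField (hc : ∀ i, ContDiffAt ℝ ∞ (c i) y)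
    (he : ∀ i, ContDiffAt ℝ ∞ (e i) y.1) (a : E3) (b : ℝ) :
    fderiv ℝ (frameField e c) y (a, b) =
      ∑ i, (fderiv ℝ (c i) y (a, b) • e i y.1 + c i y • fderiv ℝ (e i) y.1 a) := by
  have h1 : ∀ i, HasFDerivAt (fun z : E3 × ℝ => e i z.1)
      ((fderiv ℝ (e i) y.1).comp (ContinuousLinearMap.fst ℝ E3 ℝ)) y := fun i =>
    HasFDerivAt.comp y ((he i).differentiableAt (by simp)).hasFDerivAt hasFDerivAt_fst
  have h2 : HasFDerivAt (frameField e c) _ y := HasFDerivAt.fun_sum (u := Finset.univ) fun i _ =>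
    ((hc i).differentiableAt (by simp)).hasFDerivAt.smul (h1 i)
  rw [h2.fderiv]
  simp only [sum_apply, add_apply,
    smul_apply, ContinuousLinearMap.smulRight_apply,
    ContinuousLinearMap.comp_apply, ContinuousLinearMap.coe_fst']
  refine Finset.sum_congr rfl fun i _ => ?_
  rw [add_comm]

theorem dt_frameField (hc : ∀ i, ContDiffAt ℝ ∞ (c i) y)
    (he : ∀ i, ContDiffAt ℝ ∞ (e i) y.1) :
    dt (frameField e c) y = frameField e (fun i => dt (c i)) y := by
  rw [dt, fderiv_frameField hc he]
  simp [frameField, dt]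

theorem eventually_dt_frameField (hΩ : IsOpen Ω) (hc : ∀ i, ∀ z ∈ Ω, ContDiffAt ℝ ∞ (c i) z)
    (he : ∀ i, ∀ z ∈ Ω, ContDiffAt ℝ ∞ (e i) z.1) (hy : y ∈ Ω) :
    dt (frameField e c) =ᶠ[𝓝 y] frameField e (fun i => dt (c i)) := by
  filter_upwards [hΩ.mem_nhds hy] with z hz
  exact dt_frameField (fun i => hc i z hz) (fun i => he i z hz)

/-- The determinant of three vectors given by their components in a frame. -/
theorem det3_sum_smul (e : Fin 3 → E3) (a b d : Fin 3 → ℝ) :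
    det3 (∑ i, a i • e i) (∑ i, b i • e i) (∑ i, d i • e i) =
      det3 (e 0) (e 1) (e 2) * (a 0 * (b 1 * d 2 - b 2 * d 1) - a 1 * (b 0 * d 2 - b 2 * d 0) +
        a 2 * (b 0 * d 1 - b 1 * d 0)) := by
  simp only [det3, Fin.sum_univ_three, PiLp.add_apply, PiLp.smul_apply, smul_eq_mul]
  ring

theorem det3_dt_frameField (hΩ : IsOpen Ω) (hc : ∀ i, ∀ z ∈ Ω, ContDiffAt ℝ ∞ (c i) z)
    (he : ∀ i, ∀ z ∈ Ω, ContDiffAt ℝ ∞ (e i) z.1) (hy : y ∈ Ω) :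
    det3 (frameField e c y) (dt (frameField e c) y) (dt (dt (frameField e c)) y) =
      det3 (e 0 y.1) (e 1 y.1) (e 2 y.1) *
        (c 0 y * (dt (c 1) y * dt (dt (c 2)) y - dt (c 2) y * dt (dt (c 1)) y) -
         c 1 y * (dt (c 0) y * dt (dt (c 2)) y - dt (c 2) y * dt (dt (c 0)) y) +
         c 2 y * (dt (c 0) y * dt (dt (c 1)) y - dt (c 1) y * dt (dt (c 0)) y)) := by
  have h1 := eventually_dt_frameField hΩ hc he hy
  have h2 : dt (dt (frameField e c)) y = frameField e (fun i => dt (dt (c i))) y := by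
    rw [dt, h1.fderiv_eq]
    exact dt_frameField (fun i => contDiffAt_dt (hc i y hy)) (fun i => he i y hy)
  rw [h2, h1.self_of_nhds]
  exact det3_sum_smul (fun i => e i y.1) _ _ _

/-- Along an orbit on which the moving vector stays in the plane spanned by the first two members of
the frame, and at which its geodesic curvature is extremal to first order, the bracket of
the moving vector with its derivative is transverse to that plane by an amount that is constant
along the orbit, up to the square of the speed `q` of the moving vector. The reason: each
derivative `g` of the third component in a spatial direction solves the linear differential equation
`g'' q - g' q' + g m = 0` of the first two components. -/
theorem exists_det3_spaceBracket_eq (hΩ : IsOpen Ω) (hc : ∀ i, ∀ z ∈ Ω, ContDiffAt ℝ ∞ (c i) z)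
    (he : ∀ i, ∀ z ∈ Ω, ContDiffAt ℝ ∞ (e i) z.1) {x : E3} {l r : ℝ}
    (hI : ∀ t ∈ Ioo l r, (x, t) ∈ Ω) (h3 : ∀ t ∈ Ioo l r, c 2 (x, t) = 0)
    (hq : ∀ t ∈ Ioo l r, c 0 (x, t) * dt (c 1) (x, t) - c 1 (x, t) * dt (c 0) (x, t) ≠ 0)
    (hext : ∀ t ∈ Ioo l r, ∀ a : E3,
      fderiv ℝ (dt (dt (c 2))) (x, t) (a, 0) *
          (c 0 (x, t) * dt (c 1) (x, t) - c 1 (x, t) * dt (c 0) (x, t)) -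
        fderiv ℝ (dt (c 2)) (x, t) (a, 0) *
          (c 0 (x, t) * dt (dt (c 1)) (x, t) - c 1 (x, t) * dt (dt (c 0)) (x, t)) +
        fderiv ℝ (c 2) (x, t) (a, 0) *
          (dt (c 0) (x, t) * dt (dt (c 1)) (x, t) - dt (c 1) (x, t) * dt (dt (c 0)) (x, t)) = 0) :
    ∃ k : ℝ, ∀ t ∈ Ioo l r,
      det3 (frameField e c (x, t)) (dt (frameField e c) (x, t))
        (spaceBracket (frameField e c) (x, t)) =
      k * (c 0 (x, t) * dt (c 1) (x, t) - c 1 (x, t) * dt (c 0) (x, t)) ^ 2 := by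
  set q : ℝ → ℝ := fun t => c 0 (x, t) * dt (c 1) (x, t) - c 1 (x, t) * dt (c 0) (x, t) with hqdef
  let g : Fin 3 → ℝ → ℝ := fun j t => fderiv ℝ (c 2) (x, t) (e j x, 0)
  let g' : Fin 3 → ℝ → ℝ := fun j t => fderiv ℝ (dt (c 2)) (x, t) (e j x, 0)
  let N : ℝ → ℝ := fun t => c 0 (x, t) * g' 0 t - dt (c 0) (x, t) * g 0 t +
    (c 1 (x, t) * g' 1 t - dt (c 1) (x, t) * g 1 t)
  -- the third component and its derivative in time vanish along the orbit
  have h3' : ∀ t ∈ Ioo l r, dt (c 2) (x, t) = 0 := by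
    intro t ht
    have h1 := hasDerivAt_line ((hc 2 _ (hI t ht)).differentiableAt (by simp))
    have h2 : (fun s => c 2 (x, s)) =ᶠ[𝓝 t] fun _ => 0 := by
      filter_upwards [isOpen_Ioo.mem_nhds ht] with s hs using h3 s hs
    exact h1.unique ((hasDerivAt_const t (0 : ℝ)).congr_of_eventuallyEq h2)
  have hN : ∀ t ∈ Ioo l r, HasDerivAt (fun s => N s / q s) 0 t := by
    intro t ht
    have hy := hI t ht
    have c0 := hasDerivAt_line ((hc 0 _ hy).differentiableAt (by simp))
    have c1 := hasDerivAt_line ((hc 1 _ hy).differentiableAt (by simp))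
    have c0' := hasDerivAt_line ((contDiffAt_dt (hc 0 _ hy)).differentiableAt (by simp))
    have c1' := hasDerivAt_line ((contDiffAt_dt (hc 1 _ hy)).differentiableAt (by simp))
    have hg : ∀ j, HasDerivAt (g j) (g' j t) t := fun j => hasDerivAt_fderiv_line (hc 2 _ hy) _
    have hg' : ∀ j, HasDerivAt (g' j) (fderiv ℝ (dt (dt (c 2))) (x, t) (e j x, 0)) t := fun j =>
      hasDerivAt_fderiv_line (contDiffAt_dt (hc 2 _ hy)) _
    have e0 := hext t ht (e 0 x)
    have e1 := hext t ht (e 1 x)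
    have hNd : HasDerivAt N _ t :=
      ((c0.mul (hg' 0)).sub (c0'.mul (hg 0))).add ((c1.mul (hg' 1)).sub (c1'.mul (hg 1)))
    have hqd : HasDerivAt q _ t := (c0.mul c1').sub (c1.mul c0')
    have h4 := hNd.div hqd (hq t ht)
    refine h4.congr_deriv ?_
    rw [div_eq_zero_iff]
    left
    simp only [N, q, g, g'] at *
    linear_combination (c 0 (x, t)) * e0 + (c 1 (x, t)) * e1
  have hconst : ∃ k, ∀ t ∈ Ioo l r, N t = k * q t := by
    rcases (Ioo l r).eq_empty_or_nonempty with h0 | ⟨t₀, ht₀⟩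
    · exact ⟨0, fun t ht => by simp [h0] at ht⟩
    · refine ⟨N t₀ / q t₀, fun t ht => ?_⟩
      have h4 : N t / q t = N t₀ / q t₀ :=
        (convex_Ioo l r).is_const_of_fderivWithin_eq_zero (𝕜 := ℝ) (f := fun s => N s / q s)
          (fun s hs => (hN s hs).differentiableAt.differentiableWithinAt)
          (fun s hs => by
            rw [((hN s hs).hasDerivWithinAt.hasFDerivWithinAt).fderivWithin
              (isOpen_Ioo.uniqueDiffWithinAt hs)]
            ext
            simp) ht ht₀
      rw [← h4, div_mul_cancel₀ _ (hq t ht)]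
  obtain ⟨k, hk⟩ := hconst
  refine ⟨det3 (e 0 x) (e 1 x) (e 2 x) * k + (det3 (e 0 x) (e 1 x) (fderiv ℝ (e 1) x (e 0 x)) -
    det3 (e 0 x) (e 1 x) (fderiv ℝ (e 0) x (e 1 x))), fun t ht => ?_⟩
  have hy := hI t ht
  have hcy : ∀ i, ContDiffAt ℝ ∞ (c i) (x, t) := fun i => hc i _ hy
  have hey : ∀ i, ContDiffAt ℝ ∞ (e i) (x, t).1 := fun i => he i _ hy
  have h1 := eventually_dt_frameField hΩ hc he hy
  have hv : frameField e c (x, t) = c 0 (x, t) • e 0 x + c 1 (x, t) • e 1 x := by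
    simp [frameField, Fin.sum_univ_three, h3 t ht]
  have hv' : dt (frameField e c) (x, t) = dt (c 0) (x, t) • e 0 x + dt (c 1) (x, t) • e 1 x := by
    rw [h1.self_of_nhds]
    simp [frameField, Fin.sum_univ_three, h3' t ht]
  have hlin : ∀ (f : E3 × ℝ → ℝ) (a b : ℝ), fderiv ℝ f (x, t) (a • e 0 x + b • e 1 x, 0) =
      a * fderiv ℝ f (x, t) (e 0 x, 0) + b * fderiv ℝ f (x, t) (e 1 x, 0) := by
    intro f a b
    rw [← smul_eq_mul, ← smul_eq_mul, ← map_smul, ← map_smul, ← map_add]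
    simp
  have hw : spaceBracket (frameField e c) (x, t) =
      ∑ i, (fderiv ℝ (dt (c i)) (x, t) (frameField e c (x, t), 0) • e i x +
          dt (c i) (x, t) • fderiv ℝ (e i) x (frameField e c (x, t))) -
      ∑ i, (fderiv ℝ (c i) (x, t) (dt (frameField e c) (x, t), 0) • e i x +
          c i (x, t) • fderiv ℝ (e i) x (dt (frameField e c) (x, t))) := by
    rw [spaceBracket, h1.fderiv_eq, fderiv_frameField (fun i => contDiffAt_dt (hcy i)) hey,
      fderiv_frameField hcy hey]
  have hα : ∀ w, det3 (frameField e c (x, t)) (dt (frameField e c) (x, t)) w =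
      q t * det3 (e 0 x) (e 1 x) w := by
    intro w
    rw [hv, hv']
    simp only [det3, PiLp.add_apply, PiLp.smul_apply, smul_eq_mul, q]
    ring
  rw [hα, hw, hv, hv']
  have hNk := hk t ht
  simp only [Fin.sum_univ_three, h3 t ht, h3' t ht, hlin, map_add, map_smul, det3_sub_right,
    det3_add_right, det3_smul_right, det3_self_right, det3_self_left, zero_smul, add_zero,
    mul_zero]
  simp only [N, g, g', q] at hNk ⊢
  linear_combination (det3 (e 0 x) (e 1 x) (e 2 x) *
    (c 0 (x, t) * dt (c 1) (x, t) - c 1 (x, t) * dt (c 0) (x, t))) * hNk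

end Flat

/-! ### Tubes and plane fields described by families of curves -/

section Tube

variable {N : Type*} [TopologicalSpace N] [ChartedSpace (EuclideanSpace ℝ (Fin 3)) N]
  [IsManifold (𝓡 3) ∞ N]
variable {M : Type*} [TopologicalSpace M] [ChartedSpace (EuclideanSpace ℝ (Fin 4)) M]
  [IsManifold (𝓡 4) ∞ M]

/-- A parametrised tube `N × (-ε, ε) → M` together with a frame of `TN`. -/
structure Tube (N : Type*) [TopologicalSpace N] [ChartedSpace (EuclideanSpace ℝ (Fin 3)) N]
    [IsManifold (𝓡 3) ∞ N] (M : Type*) [TopologicalSpace M]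
    [ChartedSpace (EuclideanSpace ℝ (Fin 4)) M] [IsManifold (𝓡 4) ∞ M] where
  /-- half of the length of the fibres -/
  ε : ℝ
  ε_pos : 0 < ε
  /-- the parametrisation -/
  Φ : N × ℝ → M
  Φ_smooth : ContMDiffOn ((𝓡 3).prod 𝓘(ℝ, ℝ)) (𝓡 4) ∞ Φ (univ ×ˢ Ioo (-ε) ε)
  Φ_inj : InjOn Φ (univ ×ˢ Ioo (-ε) ε)
  Φ_bij : ∀ p, ∀ t ∈ Ioo (-ε) ε,
    Function.Bijective (mfderiv ((𝓡 3).prod 𝓘(ℝ, ℝ)) (𝓡 4) Φ (p, t))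
  /-- the frame of `TN` -/
  e : Fin 3 → (p : N) → TangentSpace (𝓡 3) p
  e_smooth : ∀ i p, SmoothVecAt (e i) p
  e_indep : ∀ p, LinearIndependent ℝ (fun i => e i p)

/-- The tube underlying an adapted tube. -/
def AdaptedTube.tube {ι : N → M} {D : TangentDist 4 M} (A : AdaptedTube ι D) : Tube N M where
  ε := A.ε
  ε_pos := A.ε_pos
  Φ := A.Φ
  Φ_smooth := A.Φ_smooth
  Φ_inj := A.Φ_inj
  Φ_bij := A.Φ_bij
  e := A.e
  e_smooth := A.e_smooth
  e_indep := A.e_indep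

/-- In the tube, the plane field `D` is spanned by `∂_t` and the moving vector with components
`γ`. -/
structure Tube.Describes (𝒯 : Tube N M) (γ : N → ℝ → E3) (D : TangentDist 4 M) : Prop where
  smooth : ContMDiffOn ((𝓡 3).prod 𝓘(ℝ, ℝ)) 𝓘(ℝ, E3) ∞ (fun a : N × ℝ => γ a.1 a.2)
    (univ ×ˢ Ioo (-𝒯.ε) 𝒯.ε)
  norm_eq : ∀ p, ∀ t ∈ Ioo (-𝒯.ε) 𝒯.ε, ‖γ p t‖ = 1
  dist_eq : ∀ p, ∀ t ∈ Ioo (-𝒯.ε) 𝒯.ε, D (𝒯.Φ (p, t)) =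
    Submodule.span ℝ {tubeT 𝒯.Φ p t, tubeVec 𝒯.Φ 𝒯.e p t (γ p t)}

theorem AdaptedTube.describes {ι : N → M} {D : TangentDist 4 M} (A : AdaptedTube ι D) :
    A.tube.Describes A.H D := ⟨A.H_smooth, A.H_norm, A.D_eq⟩

theorem EngelTorsion.describes {δ : ℝ} {ι : N → M} {D D' : TangentDist 4 M}
    {A : AdaptedTube ι D} (L : EngelTorsion δ A D') : A.tube.Describes L.lam D' :=
  ⟨L.lam_smooth, L.lam_norm, L.D'_eq⟩

variable (𝒯 : Tube N M)

/-- The inverse of a chart of `N`. -/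
noncomputable def chartInv (p₀ : N) : E3 → N := (extChartAt (𝓡 3) p₀).symm

/-- The target of a chart of `N`, times the interval of the tube. -/
def Tube.box (p₀ : N) : Set (E3 × ℝ) := (extChartAt (𝓡 3) p₀).target ×ˢ Ioo (-𝒯.ε) 𝒯.ε

/-- The tube, read in a chart of `N`. -/
noncomputable def Tube.Ψ (p₀ : N) (z : E3 × ℝ) : M := 𝒯.Φ (chartInv p₀ z.1, z.2)

/-- The frame of `TN`, read in a chart of `N`. -/
noncomputable def Tube.frame (p₀ : N) (i : Fin 3) (x : E3) : E3 :=
  VectorField.mpullback 𝓘(ℝ, E3) (𝓡 3) (chartInv p₀) (𝒯.e i) x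

/-- The family of curves, read in a chart of `N`. -/
noncomputable def chartCurve (γ : N → ℝ → E3) (p₀ : N) (z : E3 × ℝ) : E3 :=
  γ (chartInv p₀ z.1) z.2

/-- The moving vector, read in a chart of `N`. -/
noncomputable def Tube.field (γ : N → ℝ → E3) (p₀ : N) : E3 × ℝ → E3 :=
  frameField (𝒯.frame p₀) (fun i z => chartCurve γ p₀ z i)

variable {𝒯} {γ : N → ℝ → E3} {D : TangentDist 4 M}

theorem Tube.isOpen_box (p₀ : N) : IsOpen (𝒯.box p₀) :=
  (isOpen_extChartAt_target p₀).prod isOpen_Ioo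

theorem Tube.zero_mem (𝒯 : Tube N M) : (0 : ℝ) ∈ Ioo (-𝒯.ε) 𝒯.ε :=
  ⟨by linarith [𝒯.ε_pos], 𝒯.ε_pos⟩

theorem Tube.dom_mem_nhds {p : N} {t : ℝ} (ht : t ∈ Ioo (-𝒯.ε) 𝒯.ε) :
    (univ ×ˢ Ioo (-𝒯.ε) 𝒯.ε : Set (N × ℝ)) ∈ 𝓝 (p, t) :=
  prod_mem_nhds univ_mem (isOpen_Ioo.mem_nhds ht)

theorem contMDiffAt_chartInv {p₀ : N} {x : E3} (hx : x ∈ (extChartAt (𝓡 3) p₀).target) :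
    ContMDiffAt 𝓘(ℝ, E3) (𝓡 3) ∞ (chartInv p₀) x :=
  (contMDiffOn_extChartAt_symm p₀).contMDiffAt
    ((isOpen_extChartAt_target p₀).mem_nhds hx)

theorem isLocalParam_chartInv {p₀ : N} {x : E3} (hx : x ∈ (extChartAt (𝓡 3) p₀).target) :
    IsLocalParam 3 (chartInv p₀) x := by
  filter_upwards [(isOpen_extChartAt_target p₀).mem_nhds hx] with y hy
  refine ⟨contMDiffAt_chartInv hy, ?_⟩
  have h2 := isInvertible_mfderivWithin_extChartAt_symm (I := 𝓡 3) hy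
  have hr : range (𝓡 3) = univ := by simp
  rw [hr, mfderivWithin_univ] at h2
  obtain ⟨e, he⟩ := h2
  change Function.Bijective (mfderiv 𝓘(ℝ, E3) (𝓡 3) (extChartAt (𝓡 3) p₀).symm y)
  rw [← he]
  exact e.bijective

theorem contMDiffAt_chartInv_prod {p₀ : N} {z : E3 × ℝ} (hz : z ∈ 𝒯.box p₀) :
    ContMDiffAt 𝓘(ℝ, E3 × ℝ) ((𝓡 3).prod 𝓘(ℝ, ℝ)) ∞
      (fun z : E3 × ℝ => (chartInv p₀ z.1, z.2)) z := by
  refine ContMDiffAt.prodMk ?_ contDiffAt_snd.contMDiffAt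
  exact ContMDiffAt.comp z (contMDiffAt_chartInv hz.1) contDiffAt_fst.contMDiffAt

theorem Tube.contMDiffAt_Φ {p : N} {t : ℝ} (ht : t ∈ Ioo (-𝒯.ε) 𝒯.ε) :
    ContMDiffAt ((𝓡 3).prod 𝓘(ℝ, ℝ)) (𝓡 4) ∞ 𝒯.Φ (p, t) :=
  𝒯.Φ_smooth.contMDiffAt (Tube.dom_mem_nhds ht)

theorem Tube.contMDiffAt_Ψ {p₀ : N} {z : E3 × ℝ} (hz : z ∈ 𝒯.box p₀) :
    ContMDiffAt 𝓘(ℝ, E3 × ℝ) (𝓡 4) ∞ (𝒯.Ψ p₀) z :=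
  ContMDiffAt.comp z (Tube.contMDiffAt_Φ hz.2) (contMDiffAt_chartInv_prod hz)

theorem Tube.dparam_Ψ {p₀ : N} {z : E3 × ℝ} (hz : z ∈ 𝒯.box p₀) (u : E3) (r : ℝ) :
    dparam 4 (𝒯.Ψ p₀) z (u, r) =
      tubeDeriv 𝒯.Φ (chartInv p₀ z.1) z.2 (dparam 3 (chartInv p₀) z.1 u) r := by
  have h1 : HasMFDerivAt 𝓘(ℝ, E3 × ℝ) (𝓡 3) (fun z : E3 × ℝ => chartInv p₀ z.1) z
      ((mfderiv 𝓘(ℝ, E3) (𝓡 3) (chartInv p₀) z.1).comp (ContinuousLinearMap.fst ℝ E3 ℝ)) :=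
    HasMFDerivAt.comp z ((contMDiffAt_chartInv hz.1).mdifferentiableAt (by simp)).hasMFDerivAt
      hasFDerivAt_fst.hasMFDerivAt
  have h2 : HasMFDerivAt 𝓘(ℝ, E3 × ℝ) 𝓘(ℝ, ℝ) (fun z : E3 × ℝ => z.2) z
      (ContinuousLinearMap.snd ℝ E3 ℝ) := hasFDerivAt_snd.hasMFDerivAt
  have h3 := h1.prodMk h2
  have h4 := HasMFDerivAt.comp z
    ((Tube.contMDiffAt_Φ (p := chartInv p₀ z.1) hz.2).mdifferentiableAt (by simp)).hasMFDerivAt h3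
  have h5 : mfderiv 𝓘(ℝ, E3 × ℝ) (𝓡 4) (𝒯.Ψ p₀) z = _ := h4.mfderiv
  have h6 : dparam 4 (𝒯.Ψ p₀) z (u, r) = mfderiv 𝓘(ℝ, E3 × ℝ) (𝓡 4) (𝒯.Ψ p₀) z (u, r) := rfl
  rw [h6, h5]
  rfl

theorem Tube.bijective_dparam_Ψ {p₀ : N} {z : E3 × ℝ} (hz : z ∈ 𝒯.box p₀) :
    Function.Bijective (dparam 4 (𝒯.Ψ p₀) z) := by
  have h1 := (isLocalParam_chartInv hz.1).self.2
  have h2 := 𝒯.Φ_bij (chartInv p₀ z.1) z.2 hz.2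
  constructor
  · rintro ⟨u, r⟩ ⟨u', r'⟩ h
    rw [Tube.dparam_Ψ hz, Tube.dparam_Ψ hz] at h
    have h3 := h2.1 h
    have h4 := h1.1 (congrArg Prod.fst h3)
    have h5 : r = r' := congrArg Prod.snd h3
    exact Prod.ext h4 h5
  · intro w
    obtain ⟨⟨v, r⟩, hw⟩ := h2.2 w
    obtain ⟨u, hu⟩ := h1.2 v
    have hu' : dparam 3 (chartInv p₀) z.1 u = v := hu
    refine ⟨((u : E3), r), (Tube.dparam_Ψ hz u r).trans ?_⟩
    rw [hu']
    exact hw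

theorem Tube.dparam_frame {p₀ : N} {x : E3} (hx : x ∈ (extChartAt (𝓡 3) p₀).target) (i : Fin 3) :
    dparam 3 (chartInv p₀) x (𝒯.frame p₀ i x) = 𝒯.e i (chartInv p₀ x) :=
  (Filter.Eventually.self_of_nhds (p := fun y => 𝒯.e i (chartInv p₀ y) =
    dparam 3 (chartInv p₀) y (𝒯.frame p₀ i y))
    (isRep_mpullback (isLocalParam_chartInv hx) (𝒯.e i))).symm

theorem Tube.contDiffAt_frame {p₀ : N} {x : E3} (hx : x ∈ (extChartAt (𝓡 3) p₀).target)
    (i : Fin 3) : ContDiffAt ℝ ∞ (𝒯.frame p₀ i) x :=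
  SmoothVecAt.contDiffAt_mpullback (isLocalParam_chartInv hx) (𝒯.e_smooth i _)

theorem Tube.tubeVec_eq {p₀ : N} {z : E3 × ℝ} (hz : z ∈ 𝒯.box p₀) (u : E3) :
    tubeVec 𝒯.Φ 𝒯.e (chartInv p₀ z.1) z.2 u =
      dparam 4 (𝒯.Ψ p₀) z (∑ i, u i • 𝒯.frame p₀ i z.1, (0 : ℝ)) := by
  rw [Tube.dparam_Ψ hz, map_sum]
  simp only [map_smul, Tube.dparam_frame hz.1]
  rfl

theorem Tube.tubeT_eq {p₀ : N} {z : E3 × ℝ} (hz : z ∈ 𝒯.box p₀) :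
    tubeT 𝒯.Φ (chartInv p₀ z.1) z.2 = dparam 4 (𝒯.Ψ p₀) z ((0 : E3), (1 : ℝ)) := by
  rw [Tube.dparam_Ψ hz, map_zero]
  rfl

theorem Tube.linearIndependent_frame {p₀ : N} {x : E3} (hx : x ∈ (extChartAt (𝓡 3) p₀).target) :
    LinearIndependent ℝ fun i => 𝒯.frame p₀ i x := by
  have h1 := 𝒯.e_indep (chartInv p₀ x)
  have h2 : (fun i => 𝒯.e i (chartInv p₀ x)) =
      (dparam 3 (chartInv p₀) x).toLinearMap ∘ fun i => 𝒯.frame p₀ i x := by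
    funext i
    exact (Tube.dparam_frame hx i).symm
  rw [h2] at h1
  exact h1.of_comp _

theorem Tube.Describes.contDiffAt (h : 𝒯.Describes γ D) {p₀ : N} {z : E3 × ℝ}
    (hz : z ∈ 𝒯.box p₀) : ContDiffAt ℝ ∞ (chartCurve γ p₀) z := by
  have h1 : ContMDiffAt ((𝓡 3).prod 𝓘(ℝ, ℝ)) 𝓘(ℝ, E3) ∞ (fun a : N × ℝ => γ a.1 a.2)
      (chartInv p₀ z.1, z.2) := h.smooth.contMDiffAt (Tube.dom_mem_nhds hz.2)
  exact (ContMDiffAt.comp z h1 (contMDiffAt_chartInv_prod hz)).contDiffAt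

theorem Tube.Describes.isFieldModel (h : 𝒯.Describes γ D) (p₀ : N) :
    IsFieldModel (𝒯.box p₀) (𝒯.Ψ p₀) (𝒯.field γ p₀) D where
  isOpen := Tube.isOpen_box p₀
  param := fun z hz => ⟨Tube.contMDiffAt_Ψ hz, Tube.bijective_dparam_Ψ hz⟩
  smooth := fun z hz => contDiffAt_frameField
    (fun i => (contDiffAt_piLp 2).1 (h.contDiffAt hz) i) (fun i => Tube.contDiffAt_frame hz.1 i)
  ne_zero := fun z hz h0 => by
    have h1 := Fintype.linearIndependent_iff.1 (Tube.linearIndependent_frame hz.1) _ h0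
    have h2 := h.norm_eq (chartInv p₀ z.1) z.2 hz.2
    have h3 : γ (chartInv p₀ z.1) z.2 = 0 := E3.ext (h1 0) (h1 1) (h1 2)
    rw [h3, norm_zero] at h2
    exact zero_ne_one h2
  dist_eq := fun z hz => by
    rw [Tube.Ψ, h.dist_eq _ _ hz.2, Tube.tubeT_eq hz, Tube.tubeVec_eq hz]
    rfl

end Tube

/-! ### Curves with vanishing geodesic curvature -/

theorem geodCurv_eq (γ : ℝ → E3) (t : ℝ) :
    geodCurv γ t = det3 (γ t) (deriv γ t) (deriv (deriv γ) t) / ‖deriv γ t‖ ^ 3 := by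
  rw [geodCurv, det3_eq_matrix_det]

theorem inner_E3 (a b : E3) : inner ℝ a b = a 0 * b 0 + a 1 * b 1 + a 2 * b 2 := by
  simp [PiLp.inner_apply, Fin.sum_univ_three]
  ring

theorem norm_sq_E3 (a : E3) : ‖a‖ ^ 2 = a 0 ^ 2 + a 1 ^ 2 + a 2 ^ 2 := by
  rw [← real_inner_self_eq_norm_sq, inner_E3]; ring

theorem inner_deriv_eq_zero {γ : ℝ → E3} {t l r : ℝ} (ht : t ∈ Ioo l r)
    (hd : DifferentiableAt ℝ γ t) (hn : ∀ s ∈ Ioo l r, ‖γ s‖ = 1) :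
    inner ℝ (γ t) (deriv γ t) = 0 := by
  have h1 := (hd.hasDerivAt.inner ℝ hd.hasDerivAt)
  have h2 : (fun s => inner ℝ (γ s) (γ s)) =ᶠ[𝓝 t] fun _ => (1 : ℝ) := by
    filter_upwards [isOpen_Ioo.mem_nhds ht] with s hs
    rw [real_inner_self_eq_norm_sq, hn s hs, one_pow]
  have h3 := h1.unique ((hasDerivAt_const t (1 : ℝ)).congr_of_eventuallyEq h2)
  rw [real_inner_comm] at h3
  have h4 : inner ℝ (deriv γ t) (γ t) = inner ℝ (γ t) (deriv γ t) := real_inner_comm _ _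
  linarith

theorem linearIndependent_pair_of_inner_eq_zero {a b : E3} (ha : ‖a‖ = 1) (hb : b ≠ 0)
    (hab : inner ℝ a b = 0) : LinearIndependent ℝ ![a, b] := by
  rw [LinearIndependent.pair_iff]
  intro s t hst
  have h1 : inner ℝ a (s • a + t • b) = s := by
    rw [inner_add_right, inner_smul_right, inner_smul_right, hab, real_inner_self_eq_norm_sq, ha]
    ring
  rw [hst, inner_zero_right] at h1
  refine ⟨h1.symm, ?_⟩
  rw [← h1, zero_smul, zero_add] at hst
  exact (smul_eq_zero.1 hst).resolve_right hb

/-- A spherical curve of vanishing geodesic curvature stays in any great circle to which it is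
tangent once: the direction of `γ × γ'` is constant. -/
theorem third_coord_eq_zero_of_det3 {γ γ' γ'' : ℝ → E3} {l r t₀ : ℝ}
    (h1 : ∀ t ∈ Ioo l r, HasDerivAt γ (γ' t) t) (h2 : ∀ t ∈ Ioo l r, HasDerivAt γ' (γ'' t) t)
    (hi : ∀ t ∈ Ioo l r, LinearIndependent ℝ ![γ t, γ' t])
    (hdet : ∀ t ∈ Ioo l r, det3 (γ t) (γ' t) (γ'' t) = 0) (ht₀ : t₀ ∈ Ioo l r)
    (h0 : γ t₀ 2 = 0) (h0' : γ' t₀ 2 = 0) {t : ℝ} (ht : t ∈ Ioo l r) : γ t 2 = 0 := by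
  let n : Fin 3 → ℝ → ℝ := ![fun t => γ t 1 * γ' t 2 - γ t 2 * γ' t 1,
    fun t => γ t 2 * γ' t 0 - γ t 0 * γ' t 2, fun t => γ t 0 * γ' t 1 - γ t 1 * γ' t 0]
  let S : ℝ → ℝ := fun t => n 0 t ^ 2 + n 1 t ^ 2 + n 2 t ^ 2
  have hS : ∀ t ∈ Ioo l r, S t ≠ 0 := by
    intro t ht hS0
    obtain ⟨c, hc⟩ := exists_det3_ne_zero (hi t ht)
    have e0 : n 0 t = 0 := by simp only [S] at hS0; nlinarith [sq_nonneg (n 0 t), sq_nonneg (n 1 t), sq_nonneg (n 2 t)]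
    have e1 : n 1 t = 0 := by simp only [S] at hS0; nlinarith [sq_nonneg (n 0 t), sq_nonneg (n 1 t), sq_nonneg (n 2 t)]
    have e2 : n 2 t = 0 := by simp only [S] at hS0; nlinarith [sq_nonneg (n 0 t), sq_nonneg (n 1 t), sq_nonneg (n 2 t)]
    simp only [n, Matrix.cons_val_zero, Matrix.cons_val_one, Matrix.cons_val] at e0 e1 e2
    apply hc
    simp only [det3]
    linear_combination c 0 * e0 + c 1 * e1 + c 2 * e2
  -- `(γ × γ')' = b (γ × γ')`
  have hn : ∀ t ∈ Ioo l r, ∃ b : ℝ, ∀ i, HasDerivAt (n i) (b * n i t) t := by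
    intro t ht
    obtain ⟨a, b, hab⟩ := exists_eq_of_det3_eq_zero (hi t ht) (hdet t ht)
    refine ⟨b, fun i => ?_⟩
    have c1 : ∀ i, HasDerivAt (fun s => γ s i) (γ' t i) t := fun i =>
      (EuclideanSpace.proj (𝕜 := ℝ) i).hasFDerivAt.comp_hasDerivAt t (h1 t ht)
    have c2 : ∀ i, HasDerivAt (fun s => γ' s i) (a * γ t i + b * γ' t i) t := fun i => by
      have := (EuclideanSpace.proj (𝕜 := ℝ) i).hasFDerivAt.comp_hasDerivAt t (h2 t ht)
      rw [hab] at this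
      refine this.congr_deriv ?_
      simp
    fin_cases i
    · exact (((c1 1).mul (c2 2)).sub ((c1 2).mul (c2 1))).congr_deriv (by simp [n]; ring)
    · exact (((c1 2).mul (c2 0)).sub ((c1 0).mul (c2 2))).congr_deriv (by simp [n]; ring)
    · exact (((c1 0).mul (c2 1)).sub ((c1 1).mul (c2 0))).congr_deriv (by simp [n]; ring)
  have hderiv : ∀ i, ∀ t ∈ Ioo l r, HasDerivAt (fun s => n i s ^ 2 / S s) 0 t := by
    intro i t ht
    obtain ⟨b, hb⟩ := hn t ht
    have hSd : HasDerivAt S _ t := (((hb 0).pow 2).add ((hb 1).pow 2)).add ((hb 2).pow 2)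
    have := ((hb i).pow 2).div hSd (hS t ht)
    refine this.congr_deriv ?_
    rw [div_eq_zero_iff]
    left
    simp only [S, Pi.pow_apply]
    push_cast
    ring
  have hconst : ∀ i, n i t ^ 2 / S t = n i t₀ ^ 2 / S t₀ := fun i =>
    (convex_Ioo l r).is_const_of_fderivWithin_eq_zero (𝕜 := ℝ) (f := fun s => n i s ^ 2 / S s)
      (fun s hs => (hderiv i s hs).differentiableAt.differentiableWithinAt)
      (fun s hs => by
        rw [((hderiv i s hs).hasDerivWithinAt.hasFDerivWithinAt).fderivWithin
          (isOpen_Ioo.uniqueDiffWithinAt hs)]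
        ext
        simp) ht ht₀
  have z : ∀ i, n i t₀ = 0 → n i t = 0 := by
    intro i hi0
    have h3 := hconst i
    rw [hi0] at h3
    simp only [ne_eq, OfNat.ofNat_ne_zero, not_false_eq_true, zero_pow, zero_div,
      div_eq_zero_iff, pow_eq_zero_iff, hS t ht, or_false] at h3
    exact h3
  have z0 := z 0 (by simp [n, h0, h0'])
  have z1 := z 1 (by simp [n, h0, h0'])
  have h4 : n 2 t ≠ 0 := by
    intro h5
    apply hS t ht
    simp [S, z0, z1, h5]
  have h5 : n 0 t * γ t 0 + n 1 t * γ t 1 + n 2 t * γ t 2 = 0 := by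
    simp only [n, Matrix.cons_val_zero, Matrix.cons_val_one, Matrix.cons_val]
    ring
  rw [z0, z1] at h5
  simp only [zero_mul, zero_add] at h5
  exact (mul_eq_zero.1 h5).resolve_left h4

/-! ### The bracket conditions along the fibres of a tube -/

section Tube

variable {N : Type*} [TopologicalSpace N] [ChartedSpace (EuclideanSpace ℝ (Fin 3)) N]
  [IsManifold (𝓡 3) ∞ N]
variable {M : Type*} [TopologicalSpace M] [ChartedSpace (EuclideanSpace ℝ (Fin 4)) M]
  [IsManifold (𝓡 4) ∞ M]
variable {𝒯 : Tube N M} {γ : N → ℝ → E3} {D : TangentDist 4 M}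

theorem mem_box_self (p : N) {t : ℝ} (ht : t ∈ Ioo (-𝒯.ε) 𝒯.ε) :
    ((extChartAt (𝓡 3) p p, t) : E3 × ℝ) ∈ 𝒯.box p :=
  ⟨mem_extChartAt_target p, ht⟩

theorem chartInv_self (p : N) : chartInv p (extChartAt (𝓡 3) p p) = p := extChartAt_to_inv p

theorem Tube.Describes.hasDerivAt (h : 𝒯.Describes γ D) {p₀ : N} {z : E3 × ℝ}
    (hz : z ∈ 𝒯.box p₀) : HasDerivAt (γ (chartInv p₀ z.1)) (dt (chartCurve γ p₀) z) z.2 :=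
  hasDerivAt_line (f := chartCurve γ p₀) (x := z.1) (t := z.2)
    ((h.contDiffAt hz).differentiableAt (by simp))

theorem Tube.Describes.deriv_eq (h : 𝒯.Describes γ D) {p₀ : N} {z : E3 × ℝ}
    (hz : z ∈ 𝒯.box p₀) : deriv (γ (chartInv p₀ z.1)) z.2 = dt (chartCurve γ p₀) z :=
  (h.hasDerivAt hz).deriv

theorem Tube.Describes.hasDerivAt_deriv (h : 𝒯.Describes γ D) {p₀ : N} {z : E3 × ℝ}
    (hz : z ∈ 𝒯.box p₀) :
    HasDerivAt (deriv (γ (chartInv p₀ z.1))) (dt (dt (chartCurve γ p₀)) z) z.2 := by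
  have h1 := hasDerivAt_line (f := dt (chartCurve γ p₀)) (x := z.1) (t := z.2)
    ((contDiffAt_dt (h.contDiffAt hz)).differentiableAt (by simp))
  refine h1.congr_of_eventuallyEq ?_
  filter_upwards [isOpen_Ioo.mem_nhds hz.2] with s hs
  exact h.deriv_eq (z := (z.1, s)) ⟨hz.1, hs⟩

theorem Tube.Describes.deriv_deriv_eq (h : 𝒯.Describes γ D) {p₀ : N} {z : E3 × ℝ}
    (hz : z ∈ 𝒯.box p₀) :
    deriv (deriv (γ (chartInv p₀ z.1))) z.2 = dt (dt (chartCurve γ p₀)) z :=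
  (h.hasDerivAt_deriv hz).deriv

theorem dt_coord {f : E3 × ℝ → E3} {z : E3 × ℝ} (hf : DifferentiableAt ℝ f z) (i : Fin 3) :
    dt (fun z => f z i) z = dt f z i := by
  have h1 : HasFDerivAt (fun z => f z i) _ z :=
    (EuclideanSpace.proj (𝕜 := ℝ) i).hasFDerivAt.comp z hf.hasFDerivAt
  rw [dt, h1.fderiv]
  rfl

theorem Tube.Describes.contDiffAt_coord (h : 𝒯.Describes γ D) {p₀ : N} {z : E3 × ℝ}
    (hz : z ∈ 𝒯.box p₀) (i : Fin 3) : ContDiffAt ℝ ∞ (fun z => chartCurve γ p₀ z i) z :=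
  (contDiffAt_piLp 2).1 (h.contDiffAt hz) i

theorem Tube.Describes.dt_coord (h : 𝒯.Describes γ D) {p₀ : N} {z : E3 × ℝ}
    (hz : z ∈ 𝒯.box p₀) (i : Fin 3) :
    dt (fun z => chartCurve γ p₀ z i) z = deriv (γ (chartInv p₀ z.1)) z.2 i := by
  rw [_root_.dt_coord ((h.contDiffAt hz).differentiableAt (by simp)), h.deriv_eq hz]

theorem Tube.Describes.dt_dt_coord (h : 𝒯.Describes γ D) {p₀ : N} {z : E3 × ℝ}
    (hz : z ∈ 𝒯.box p₀) (i : Fin 3) :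
    dt (dt (fun z => chartCurve γ p₀ z i)) z = deriv (deriv (γ (chartInv p₀ z.1))) z.2 i := by
  have h1 : dt (fun z => chartCurve γ p₀ z i) =ᶠ[𝓝 z] fun z => dt (chartCurve γ p₀) z i := by
    filter_upwards [(Tube.isOpen_box p₀).mem_nhds hz] with w hw
    exact _root_.dt_coord ((h.contDiffAt hw).differentiableAt (by simp)) i
  rw [dt, h1.fderiv_eq]
  change dt (fun z => dt (chartCurve γ p₀) z i) z = _
  rw [_root_.dt_coord ((contDiffAt_dt (h.contDiffAt hz)).differentiableAt (by simp)),
    h.deriv_deriv_eq hz]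

theorem Tube.Describes.dt_field (h : 𝒯.Describes γ D) {p₀ : N} {z : E3 × ℝ}
    (hz : z ∈ 𝒯.box p₀) : dt (𝒯.field γ p₀) z =
      ∑ i, deriv (γ (chartInv p₀ z.1)) z.2 i • 𝒯.frame p₀ i z.1 := by
  rw [Tube.field, dt_frameField (fun i => h.contDiffAt_coord hz i)
    (fun i => Tube.contDiffAt_frame (𝒯 := 𝒯) hz.1 i), frameField]
  refine Finset.sum_congr rfl fun i _ => ?_
  rw [← h.dt_coord hz i]

/-- The coefficient of the kernel field that vanishes when `∂_t` spans the kernel. -/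
noncomputable def Tube.kerB (𝒯 : Tube N M) (γ : N → ℝ → E3) (p₀ : N) (z : E3 × ℝ) : ℝ :=
  det3 (𝒯.field γ p₀ z) (dt (𝒯.field γ p₀) z) (dt (dt (𝒯.field γ p₀)) z)

/-- The coefficient of `∂_t` in the kernel field. -/
noncomputable def Tube.kerA (𝒯 : Tube N M) (γ : N → ℝ → E3) (p₀ : N) (z : E3 × ℝ) : ℝ :=
  det3 (𝒯.field γ p₀ z) (dt (𝒯.field γ p₀) z) (spaceBracket (𝒯.field γ p₀) z)

theorem det3_frame_ne_zero {p₀ : N} {x : E3} (hx : x ∈ (extChartAt (𝓡 3) p₀).target) :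
    det3 (𝒯.frame p₀ 0 x) (𝒯.frame p₀ 1 x) (𝒯.frame p₀ 2 x) ≠ 0 := by
  intro h0
  have h1 := Tube.linearIndependent_frame (𝒯 := 𝒯) hx
  have h2 : LinearIndependent ℝ ![𝒯.frame p₀ 0 x, 𝒯.frame p₀ 1 x] := by
    have := h1.comp ![(0 : Fin 3), 1] (by decide)
    convert this using 1
    funext i
    fin_cases i <;> rfl
  obtain ⟨s, t, hst⟩ := exists_eq_of_det3_eq_zero h2 h0
  have h3 := Fintype.linearIndependent_iff.1 h1 ![s, t, -1] (by
    simp only [Fin.sum_univ_three, hst, Matrix.cons_val_zero, Matrix.cons_val_one,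
      Matrix.cons_val, neg_smul, one_smul, add_neg_cancel]) 2
  simp at h3

theorem Tube.Describes.kerB_eq (h : 𝒯.Describes γ D) {p₀ : N} {z : E3 × ℝ}
    (hz : z ∈ 𝒯.box p₀) : 𝒯.kerB γ p₀ z =
      det3 (𝒯.frame p₀ 0 z.1) (𝒯.frame p₀ 1 z.1) (𝒯.frame p₀ 2 z.1) *
      det3 (γ (chartInv p₀ z.1) z.2) (deriv (γ (chartInv p₀ z.1)) z.2)
        (deriv (deriv (γ (chartInv p₀ z.1))) z.2) := by
  rw [Tube.kerB, Tube.field, det3_dt_frameField (Tube.isOpen_box p₀)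
    (fun i z hz => h.contDiffAt_coord hz i) (fun i z hz => Tube.contDiffAt_frame (𝒯 := 𝒯) hz.1 i) hz]
  have e1 := fun i => h.dt_coord hz i
  have e2 := fun i => h.dt_dt_coord hz i
  rw [e1, e1, e1, e2, e2, e2]
  rfl

theorem det3_eq_geodCurv {γ : ℝ → E3} {t : ℝ} (hd : deriv γ t ≠ 0) :
    det3 (γ t) (deriv γ t) (deriv (deriv γ) t) = geodCurv γ t * ‖deriv γ t‖ ^ 3 := by
  rw [geodCurv_eq, div_mul_cancel₀]
  exact pow_ne_zero 3 (norm_ne_zero_iff.2 hd)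

/-- All curves of the family are immersed. -/
def Tube.Immersed (𝒯 : Tube N M) (γ : N → ℝ → E3) : Prop :=
  ∀ p, ∀ t ∈ Ioo (-𝒯.ε) 𝒯.ε, deriv (γ p) t ≠ 0

theorem Tube.Describes.differentiableAt (h : 𝒯.Describes γ D) {p : N} {t : ℝ}
    (ht : t ∈ Ioo (-𝒯.ε) 𝒯.ε) : DifferentiableAt ℝ (γ p) t := by
  have := (h.hasDerivAt (mem_box_self p ht)).differentiableAt
  rwa [chartInv_self] at this

theorem Tube.Describes.inner_deriv (h : 𝒯.Describes γ D) {p : N} {t : ℝ}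
    (ht : t ∈ Ioo (-𝒯.ε) 𝒯.ε) : inner ℝ (γ p t) (deriv (γ p) t) = 0 :=
  inner_deriv_eq_zero ht (h.differentiableAt ht) (h.norm_eq p)

theorem Tube.Describes.linearIndependent (h : 𝒯.Describes γ D) (hi : 𝒯.Immersed γ) {p : N} {t : ℝ}
    (ht : t ∈ Ioo (-𝒯.ε) 𝒯.ε) : LinearIndependent ℝ ![γ p t, deriv (γ p) t] :=
  linearIndependent_pair_of_inner_eq_zero (h.norm_eq p t ht) (hi p t ht) (h.inner_deriv ht)

theorem Tube.linearIndependent_sum_smul {p₀ : N} {x : E3}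
    (hx : x ∈ (extChartAt (𝓡 3) p₀).target) {a b : E3} :
    LinearIndependent ℝ ![∑ i, a i • 𝒯.frame p₀ i x, ∑ i, b i • 𝒯.frame p₀ i x] ↔
      LinearIndependent ℝ ![a, b] := by
  rw [LinearIndependent.pair_iff, LinearIndependent.pair_iff]
  have key : ∀ s t : ℝ, s • ∑ i, a i • 𝒯.frame p₀ i x + t • ∑ i, b i • 𝒯.frame p₀ i x = 0 ↔
      s • a + t • b = 0 := by
    intro s t
    have e1 : s • ∑ i, a i • 𝒯.frame p₀ i x + t • ∑ i, b i • 𝒯.frame p₀ i x =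
        ∑ i, (s • a + t • b) i • 𝒯.frame p₀ i x := by
      simp only [Finset.smul_sum, smul_smul, ← Finset.sum_add_distrib, ← add_smul, PiLp.add_apply,
        PiLp.smul_apply, smul_eq_mul]
    rw [e1]
    constructor
    · intro h
      have h1 := Fintype.linearIndependent_iff.1 (Tube.linearIndependent_frame (𝒯 := 𝒯) hx) _ h
      exact E3.ext (h1 0) (h1 1) (h1 2)
    · intro h
      simp [h]
  simp only [key]

theorem Tube.Describes.isImmersedFieldModel (h : 𝒯.Describes γ D) (hi : 𝒯.Immersed γ) (p₀ : N) :
    IsImmersedFieldModel (𝒯.box p₀) (𝒯.Ψ p₀) (𝒯.field γ p₀) D where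
  toIsFieldModel := h.isFieldModel p₀
  immersed := fun z hz => by
    rw [h.dt_field hz]
    exact (Tube.linearIndependent_sum_smul hz.1).2 (h.linearIndependent hi hz.2)

theorem Tube.Describes.immersed_of_isEngel (h : 𝒯.Describes γ D) (hD : IsEngel D) :
    𝒯.Immersed γ := by
  intro p t ht h0
  have hz := mem_box_self p ht
  have h1 := (h.isFieldModel p).linearIndependent_of_finrank hz (hD.2.1.finrank_eq _)
  rw [h.dt_field hz] at h1
  have h2 := (Tube.linearIndependent_sum_smul hz.1).1 h1
  simp only [chartInv_self, h0] at h2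
  have h3 := LinearIndependent.pair_iff.1 h2 0 1 (by simp)
  simp at h3

/-- The fibres of the tube are tangent to the kernel exactly where the curves are flat. -/
theorem Tube.Describes.inKernel_tubeT_iff (h : 𝒯.Describes γ D) (hi : 𝒯.Immersed γ) {p : N}
    {t : ℝ} (ht : t ∈ Ioo (-𝒯.ε) 𝒯.ε) :
    InKernel (derivedDist D) (𝒯.Φ (p, t)) (tubeT 𝒯.Φ p t) ↔ geodCurv (γ p) t = 0 := by
  have hz := mem_box_self p ht
  have h1 := (h.isImmersedFieldModel hi p).inKernel_iff hz 1 0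
  have h2 : 𝒯.kerB γ p (extChartAt (𝓡 3) p p, t) = _ := h.kerB_eq hz
  rw [zero_smul, ← Tube.tubeT_eq hz, zero_mul, zero_add, one_mul] at h1
  have h3 := det3_frame_ne_zero (𝒯 := 𝒯) hz.1
  rw [Tube.kerB] at h2
  rw [h2, mul_eq_zero, or_iff_right h3, Tube.Ψ, chartInv_self] at h1
  rw [h1, det3_eq_geodCurv (hi p t ht), mul_eq_zero, or_iff_left]
  exact pow_ne_zero 3 (norm_ne_zero_iff.2 (hi p t ht))

theorem Tube.Describes.kerB_eq_zero_iff (h : 𝒯.Describes γ D) (hi : 𝒯.Immersed γ) {p₀ : N}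
    {z : E3 × ℝ} (hz : z ∈ 𝒯.box p₀) :
    𝒯.kerB γ p₀ z = 0 ↔ geodCurv (γ (chartInv p₀ z.1)) z.2 = 0 := by
  have hd := hi (chartInv p₀ z.1) z.2 hz.2
  rw [h.kerB_eq hz, mul_eq_zero, or_iff_right (det3_frame_ne_zero hz.1),
    det3_eq_geodCurv hd, mul_eq_zero, or_iff_left]
  exact pow_ne_zero 3 (norm_ne_zero_iff.2 hd)

/-- In an Engel structure the two coefficients of the kernel field do not vanish simultaneously:
otherwise the whole plane would lie in the kernel. -/
theorem Tube.Describes.kerA_ne_zero (h : 𝒯.Describes γ D) (hD : IsEngel D)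
    {W X : (q : M) → TangentSpace (𝓡 4) q} (hWX : IsEngelPair D W X) {p₀ : N} {z : E3 × ℝ}
    (hz : z ∈ 𝒯.box p₀) (hB : 𝒯.kerB γ p₀ z = 0) : 𝒯.kerA γ p₀ z ≠ 0 := by
  intro hA
  rw [Tube.kerA] at hA
  rw [Tube.kerB] at hB
  have hm := h.isImmersedFieldModel (h.immersed_of_isEngel hD) p₀
  obtain ⟨a, ha⟩ := hWX.exists_eq_smul_of_inKernel hD
    ((hm.inKernel_iff hz 1 0).2 (by rw [hA, hB]; ring))
  obtain ⟨b, hb⟩ := hWX.exists_eq_smul_of_inKernel hD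
    ((hm.inKernel_iff hz 0 1).2 (by rw [hA, hB]; ring))
  have h1 : dparam 4 (𝒯.Ψ p₀) z (b • ((0 : ℝ) • 𝒯.field γ p₀ z, (1 : ℝ)) -
      a • ((1 : ℝ) • 𝒯.field γ p₀ z, (0 : ℝ))) = 0 := by
    rw [map_sub, map_smul, map_smul, ha, hb, smul_smul, smul_smul, mul_comm, sub_self]
  have h2 := dparam_injective (hm.isLocalParam hz) (h1.trans (map_zero _).symm)
  have h3 := congrArg Prod.snd h2
  simp at h3
  rw [h3, zero_smul] at hb
  have h4 := dparam_injective (hm.isLocalParam hz) (hb.trans (map_zero _).symm)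
  have h5 := hm.ne_zero z hz
  rw [one_smul] at h4
  exact h5 (congrArg Prod.fst h4)

end Tube

/-! ### Fibres tangent to the kernel -/

section FlatFibres

variable {N : Type*} [TopologicalSpace N] [ChartedSpace (EuclideanSpace ℝ (Fin 3)) N]
  [IsManifold (𝓡 3) ∞ N]
variable {M : Type*} [TopologicalSpace M] [ChartedSpace (EuclideanSpace ℝ (Fin 4)) M]
  [IsManifold (𝓡 4) ∞ M]
variable {𝒯 : Tube N M} {γ : N → ℝ → E3} {D : TangentDist 4 M}

/-- Locally in `N`, the curves of the family are all convex or all concave. -/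
def Tube.LocallyConvex (𝒯 : Tube N M) (γ : N → ℝ → E3) : Prop :=
  ∀ p, ∃ σ : ℝ, (σ = 1 ∨ σ = -1) ∧
    ∀ᶠ p' in 𝓝 p, ∀ t ∈ Ioo (-𝒯.ε) 𝒯.ε, 0 ≤ σ * geodCurv (γ p') t

theorem hasDerivAt_space_line {f : E3 × ℝ → ℝ} {x : E3} {t : ℝ}
    (h : DifferentiableAt ℝ f (x, t)) (a : E3) :
    HasDerivAt (fun s : ℝ => f (x + s • a, t)) (fderiv ℝ f (x, t) (a, 0)) 0 := by
  have h1 : HasDerivAt (fun s : ℝ => (x + s • a, t)) (a, (0 : ℝ)) 0 := by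
    have := ((hasDerivAt_id (0 : ℝ)).smul_const a).const_add x
    simp only [id_eq, one_smul] at this
    exact this.prodMk (hasDerivAt_const 0 t)
  have h2 : DifferentiableAt ℝ f (x + (0 : ℝ) • a, t) := by simpa using h
  have h3 : HasDerivAt (fun s : ℝ => f (x + s • a, t)) (fderiv ℝ f (x + (0 : ℝ) • a, t) (a, 0)) 0 :=
    h2.hasFDerivAt.comp_hasDerivAt (0 : ℝ) h1
  refine h3.congr_deriv ?_
  rw [zero_smul, add_zero]

/-- Along a flat curve of a locally convex family, the geodesic curvature is extremal. -/
theorem Tube.Describes.extremal (h : 𝒯.Describes γ D) (hi : 𝒯.Immersed γ)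
    (hc : 𝒯.LocallyConvex γ) {p₀ : N} {x : E3} {t : ℝ} (hz : (x, t) ∈ 𝒯.box p₀)
    (h0 : geodCurv (γ (chartInv p₀ x)) t = 0)
    (h3 : chartCurve γ p₀ (x, t) 2 = 0) (h3' : dt (fun z => chartCurve γ p₀ z 2) (x, t) = 0)
    (h3'' : dt (dt (fun z => chartCurve γ p₀ z 2)) (x, t) = 0) (a : E3) :
    let c : Fin 3 → E3 × ℝ → ℝ := fun i z => chartCurve γ p₀ z i
    fderiv ℝ (dt (dt (c 2))) (x, t) (a, 0) *
          (c 0 (x, t) * dt (c 1) (x, t) - c 1 (x, t) * dt (c 0) (x, t)) -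
        fderiv ℝ (dt (c 2)) (x, t) (a, 0) *
          (c 0 (x, t) * dt (dt (c 1)) (x, t) - c 1 (x, t) * dt (dt (c 0)) (x, t)) +
        fderiv ℝ (c 2) (x, t) (a, 0) *
          (dt (c 0) (x, t) * dt (dt (c 1)) (x, t) - dt (c 1) (x, t) * dt (dt (c 0)) (x, t)) = 0 := by
  intro c
  have hcd : ∀ i, ContDiffAt ℝ ∞ (c i) (x, t) := fun i => h.contDiffAt_coord hz i
  have d0 := fun i => hasDerivAt_space_line ((hcd i).differentiableAt (by simp)) a
  have d1 := fun i => hasDerivAt_space_line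
    ((contDiffAt_dt (hcd i)).differentiableAt (by simp)) a
  have d2 := fun i => hasDerivAt_space_line
    ((contDiffAt_dt (contDiffAt_dt (hcd i))).differentiableAt (by simp)) a
  have hG := (((d0 0).mul (((d1 1).mul (d2 2)).sub ((d1 2).mul (d2 1)))).sub
    ((d0 1).mul (((d1 0).mul (d2 2)).sub ((d1 2).mul (d2 0))))).add
    ((d0 2).mul (((d1 0).mul (d2 1)).sub ((d1 1).mul (d2 0))))
  obtain ⟨σ, hσ, hσc⟩ := hc (chartInv p₀ x)
  have hσ0 : σ ≠ 0 := by rcases hσ with rfl | rfl <;> norm_num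
  have hline : ContinuousAt (fun s : ℝ => x + s • a) 0 := by fun_prop
  have hx0 : x + (0 : ℝ) • a = x := by simp
  have hev1 : ∀ᶠ s : ℝ in 𝓝 0, (x + s • a, t) ∈ 𝒯.box p₀ := by
    have h5 : ContinuousAt (fun s : ℝ => (x + s • a, t)) 0 := hline.prodMk continuousAt_const
    apply h5.eventually_mem
    simp only [hx0]
    exact (Tube.isOpen_box p₀).mem_nhds hz
  have hev2 : ∀ᶠ s : ℝ in 𝓝 0, ∀ t ∈ Ioo (-𝒯.ε) 𝒯.ε,
      0 ≤ σ * geodCurv (γ (chartInv p₀ (x + s • a))) t := by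
    have h5 : ContinuousAt (fun s : ℝ => chartInv p₀ (x + s • a)) 0 := by
      refine ContinuousAt.comp (g := chartInv p₀) ?_ hline
      rw [hx0]
      exact (contMDiffAt_chartInv hz.1).continuousAt
    have h6 := h5.tendsto
    simp only [hx0] at h6
    exact h6.eventually hσc
  have hval : ∀ s : ℝ, (x + s • a, t) ∈ 𝒯.box p₀ →
      c 0 (x + s • a, t) * (dt (c 1) (x + s • a, t) * dt (dt (c 2)) (x + s • a, t) -
        dt (c 2) (x + s • a, t) * dt (dt (c 1)) (x + s • a, t)) -
      c 1 (x + s • a, t) * (dt (c 0) (x + s • a, t) * dt (dt (c 2)) (x + s • a, t) -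
        dt (c 2) (x + s • a, t) * dt (dt (c 0)) (x + s • a, t)) +
      c 2 (x + s • a, t) * (dt (c 0) (x + s • a, t) * dt (dt (c 1)) (x + s • a, t) -
        dt (c 1) (x + s • a, t) * dt (dt (c 0)) (x + s • a, t)) =
      geodCurv (γ (chartInv p₀ (x + s • a))) t *
        ‖deriv (γ (chartInv p₀ (x + s • a))) t‖ ^ 3 := by
    intro s hs
    rw [← det3_eq_geodCurv (hi _ t hs.2)]
    simp only [c, h.dt_coord hs, h.dt_dt_coord hs]
    simp only [det3, chartCurve]
  have hmin : IsLocalMin (fun s : ℝ => σ *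
      (c 0 (x + s • a, t) * (dt (c 1) (x + s • a, t) * dt (dt (c 2)) (x + s • a, t) -
        dt (c 2) (x + s • a, t) * dt (dt (c 1)) (x + s • a, t)) -
      c 1 (x + s • a, t) * (dt (c 0) (x + s • a, t) * dt (dt (c 2)) (x + s • a, t) -
        dt (c 2) (x + s • a, t) * dt (dt (c 0)) (x + s • a, t)) +
      c 2 (x + s • a, t) * (dt (c 0) (x + s • a, t) * dt (dt (c 1)) (x + s • a, t) -
        dt (c 1) (x + s • a, t) * dt (dt (c 0)) (x + s • a, t)))) 0 := by
    filter_upwards [hev1, hev2] with s h5 h6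
    rw [hval s h5, hval 0 (by rw [hx0]; exact hz), hx0, h0, zero_mul, mul_zero, ← mul_assoc]
    exact mul_nonneg (h6 t hz.2) (by positivity)
  have h7 := hmin.hasDerivAt_eq_zero (hG.const_mul σ)
  have h8 := (mul_eq_zero.1 h7).resolve_left hσ0
  simp only [Pi.mul_apply, Pi.sub_apply, hx0] at h8
  have e0 : c 2 (x, t) = 0 := h3
  have e1 : dt (c 2) (x, t) = 0 := h3'
  have e2 : dt (dt (c 2)) (x, t) = 0 := h3''
  rw [e0, e1, e2] at h8
  linear_combination h8

theorem Tube.Describes.hasDerivAt_deriv_self (h : 𝒯.Describes γ D) {p : N} {t : ℝ}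
    (ht : t ∈ Ioo (-𝒯.ε) 𝒯.ε) :
    HasDerivAt (deriv (γ p)) (deriv (deriv (γ p)) t) t := by
  have h1 := h.hasDerivAt_deriv (mem_box_self p ht)
  rw [chartInv_self] at h1
  exact h1.differentiableAt.hasDerivAt

/-- A flat curve tangent to the plane of the first two coordinates stays in it. -/
theorem Tube.Describes.third_eq_zero (h : 𝒯.Describes γ D) (hi : 𝒯.Immersed γ) {p : N}
    (hflat : ∀ t ∈ Ioo (-𝒯.ε) 𝒯.ε, geodCurv (γ p) t = 0) {t₀ : ℝ}
    (ht₀ : t₀ ∈ Ioo (-𝒯.ε) 𝒯.ε) (h0 : γ p t₀ 2 = 0) (h0' : deriv (γ p) t₀ 2 = 0) {t : ℝ}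
    (ht : t ∈ Ioo (-𝒯.ε) 𝒯.ε) : γ p t 2 = 0 :=
  third_coord_eq_zero_of_det3 (fun s hs => (h.differentiableAt hs).hasDerivAt)
    (fun s hs => h.hasDerivAt_deriv_self hs) (fun s hs => h.linearIndependent hi hs)
    (fun s hs => by rw [det3_eq_geodCurv (hi p s hs), hflat s hs, zero_mul]) ht₀ h0 h0' ht

/-- Along a flat fibre the coefficient of `∂_t` in the kernel field is a constant multiple of a
square, so its sign can be read off at either end of the fibre, where the modification has no
effect. -/
theorem Tube.Describes.exists_kerA_eq (h : 𝒯.Describes γ D) (hi : 𝒯.Immersed γ)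
    (hc : 𝒯.LocallyConvex γ) {p₀ : N} {x : E3} (hx : x ∈ (extChartAt (𝓡 3) p₀).target)
    (hflat : ∀ t ∈ Ioo (-𝒯.ε) 𝒯.ε, geodCurv (γ (chartInv p₀ x)) t = 0)
    (h3 : ∀ t ∈ Ioo (-𝒯.ε) 𝒯.ε, γ (chartInv p₀ x) t 2 = 0) :
    ∃ k : ℝ, ∀ t ∈ Ioo (-𝒯.ε) 𝒯.ε, ∃ q : ℝ, q ≠ 0 ∧
      q = γ (chartInv p₀ x) t 0 * deriv (γ (chartInv p₀ x)) t 1 -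
        γ (chartInv p₀ x) t 1 * deriv (γ (chartInv p₀ x)) t 0 ∧
      𝒯.kerA γ p₀ (x, t) = k * q ^ 2 := by
  have hI : ∀ t ∈ Ioo (-𝒯.ε) 𝒯.ε, (x, t) ∈ 𝒯.box p₀ := fun t ht => ⟨hx, ht⟩
  have hzero : ∀ f : E3 × ℝ → ℝ, (∀ t ∈ Ioo (-𝒯.ε) 𝒯.ε, DifferentiableAt ℝ f (x, t)) →
      (∀ t ∈ Ioo (-𝒯.ε) 𝒯.ε, f (x, t) = 0) → ∀ t ∈ Ioo (-𝒯.ε) 𝒯.ε, dt f (x, t) = 0 := by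
    intro f hf h0 t ht
    have h2 : (fun s => f (x, s)) =ᶠ[𝓝 t] fun _ => 0 := by
      filter_upwards [isOpen_Ioo.mem_nhds ht] with s hs using h0 s hs
    exact (hasDerivAt_line (hf t ht)).unique
      ((hasDerivAt_const t (0 : ℝ)).congr_of_eventuallyEq h2)
  have hcd : ∀ i, ∀ z ∈ 𝒯.box p₀, ContDiffAt ℝ ∞ (fun z => chartCurve γ p₀ z i) z :=
    fun i z hz => h.contDiffAt_coord hz i
  have h3' := hzero _ (fun t ht => (hcd 2 _ (hI t ht)).differentiableAt (by simp)) h3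
  have h3'' := hzero _
    (fun t ht => (contDiffAt_dt (hcd 2 _ (hI t ht))).differentiableAt (by simp)) h3'
  have hq : ∀ t ∈ Ioo (-𝒯.ε) 𝒯.ε, chartCurve γ p₀ (x, t) 0 *
      dt (fun z => chartCurve γ p₀ z 1) (x, t) - chartCurve γ p₀ (x, t) 1 *
      dt (fun z => chartCurve γ p₀ z 0) (x, t) ≠ 0 := by
    intro t ht hq0
    obtain ⟨w, hw⟩ := exists_det3_ne_zero (h.linearIndependent hi (p := chartInv p₀ x) ht)
    apply hw
    have e3 := h3 t ht
    have e4 := h3' t ht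
    rw [h.dt_coord (hI t ht)] at e4
    rw [h.dt_coord (hI t ht), h.dt_coord (hI t ht)] at hq0
    simp only [chartCurve] at hq0 e4
    simp only [det3, e3, e4]
    linear_combination w 2 * hq0
  obtain ⟨k, hk⟩ := exists_det3_spaceBracket_eq (e := 𝒯.frame p₀)
    (c := fun i z => chartCurve γ p₀ z i) (Tube.isOpen_box p₀) hcd
    (fun i z hz => Tube.contDiffAt_frame (𝒯 := 𝒯) hz.1 i) hI h3 hq
    (fun t ht a => h.extremal hi hc (hI t ht) (hflat t ht) (h3 t ht) (h3' t ht) (h3'' t ht) a)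
  refine ⟨k, fun t ht => ⟨_, hq t ht, ?_, hk t ht⟩⟩
  rw [h.dt_coord (hI t ht), h.dt_coord (hI t ht)]
  rfl

theorem Tube.kerA_congr {γ' : N → ℝ → E3} {p₀ : N} {z : E3 × ℝ}
    (h : chartCurve γ p₀ =ᶠ[𝓝 z] chartCurve γ' p₀) : 𝒯.kerA γ p₀ z = 𝒯.kerA γ' p₀ z := by
  have h1 : 𝒯.field γ p₀ =ᶠ[𝓝 z] 𝒯.field γ' p₀ := by
    filter_upwards [h] with w hw
    simp only [Tube.field, frameField, hw]
  have h2 : dt (𝒯.field γ p₀) =ᶠ[𝓝 z] dt (𝒯.field γ' p₀) := by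
    filter_upwards [h1.fderiv (𝕜 := ℝ)] with w hw
    simp only [dt, hw]
  simp only [Tube.kerA, spaceBracket, h1.eq_of_nhds, h2.eq_of_nhds, h1.fderiv_eq, h2.fderiv_eq]

/-! ### The kernel line after the modification -/

variable {ι : N → M} {D' : TangentDist 4 M} {δ : ℝ} {A : AdaptedTube ι D}

theorem AdaptedTube.immersed (A : AdaptedTube ι D) (hD : IsEngel D) : A.tube.Immersed A.H :=
  A.describes.immersed_of_isEngel hD

theorem EngelTorsion.immersed (L : EngelTorsion δ A D') : A.tube.Immersed L.lam :=
  L.lam_immersed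

theorem AdaptedTube.locallyConvex (A : AdaptedTube ι D) : A.tube.LocallyConvex A.H :=
  A.convexity

theorem EngelTorsion.geodCurv_eq_zero_iff (L : EngelTorsion δ A D') {p : N} {t : ℝ}
    (ht : t ∈ Ioo (-A.ε) A.ε) : geodCurv (L.lam p) t = 0 ↔ geodCurv (A.H p) t = 0 := by
  rw [← sign_eq_zero_iff, L.lam_convexity p t ht, sign_eq_zero_iff]

theorem mul_nonneg_iff_of_sign_eq {a b : ℝ} (h : SignType.sign a = SignType.sign b) {σ : ℝ}
    (hσ : 0 ≤ σ * b) : 0 ≤ σ * a := by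
  have h1 : SignType.sign (σ * a) = SignType.sign (σ * b) := by rw [sign_mul, sign_mul, h]
  have h2 : 0 ≤ SignType.sign (σ * b) := sign_nonneg_iff.2 hσ
  rw [← h1] at h2
  exact sign_nonneg_iff.1 h2

theorem EngelTorsion.locallyConvex (L : EngelTorsion δ A D') : A.tube.LocallyConvex L.lam := by
  intro p
  obtain ⟨σ, hσ, h⟩ := A.convexity p
  refine ⟨σ, hσ, h.mono fun p' hp' t ht => ?_⟩
  exact mul_nonneg_iff_of_sign_eq (L.lam_convexity p' t ht) (hp' t ht)

theorem AdaptedTube.flat_or (A : AdaptedTube ι D) (hD : IsEngel D) (p : N) :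
    (∀ t ∈ Ioo (-A.ε) A.ε, geodCurv (A.H p) t = 0) ∨
      ∀ t ∈ Ioo (-A.ε) A.ε, geodCurv (A.H p) t ≠ 0 := by
  have h1 : ∀ t ∈ Ioo (-A.ε) A.ε, (InKernel (derivedDist D) (A.Φ (p, t)) (tubeT A.Φ p t) ↔
      geodCurv (A.H p) t = 0) := fun t ht =>
    A.describes.inKernel_tubeT_iff (A.immersed hD) (p := p) ht
  rcases A.kernel_dichotomy p with h2 | h2
  · exact Or.inl fun t ht => (h1 t ht).1 (h2 t ht)
  · exact Or.inr fun t ht h3 => h2 t ht ((h1 t ht).2 h3)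

theorem AdaptedTube.zero_mem (A : AdaptedTube ι D) : (0 : ℝ) ∈ Ioo (-A.ε) A.ε :=
  A.tube.zero_mem

theorem EngelTorsion.chartCurve_eventuallyEq (L : EngelTorsion δ A D') {p₀ : N} {z : E3 × ℝ}
    (hz : z ∈ A.tube.box p₀) (ha : L.a < |z.2|) :
    chartCurve L.lam p₀ =ᶠ[𝓝 z] chartCurve A.H p₀ := by
  have h1 : ∀ᶠ w : E3 × ℝ in 𝓝 z, L.a < |w.2| :=
    (continuous_snd.abs.continuousAt).eventually (lt_mem_nhds ha)
  filter_upwards [h1, (Tube.isOpen_box p₀).mem_nhds hz] with w hw hw'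
  exact L.lam_eq _ _ hw'.2 hw.le

/-- On a fibre tangent to the kernel, the curve and its modification both stay in the plane of the
first two coordinates. -/
theorem EngelTorsion.third_eq_zero (L : EngelTorsion δ A D') (hD : IsEngel D) {p : N}
    (hflat : ∀ t ∈ Ioo (-A.ε) A.ε, geodCurv (A.H p) t = 0) {t : ℝ} (ht : t ∈ Ioo (-A.ε) A.ε) :
    A.H p t 2 = 0 ∧ L.lam p t 2 = 0 := by
  have hH : ∀ t ∈ Ioo (-A.ε) A.ε, A.H p t 2 = 0 := by
    intro t ht
    refine A.describes.third_eq_zero (A.immersed hD) hflat A.zero_mem ?_ ?_ ht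
    · rw [A.H_zero]; simp
    · obtain ⟨c, -, hc⟩ := A.H_deriv_zero p
      rw [hc]; simp
  obtain ⟨t₁, h1, h2⟩ := exists_between L.a_lt
  have ht₁ : t₁ ∈ Ioo (-A.ε) A.ε := ⟨by linarith [L.a_pos], h2⟩
  have hev : L.lam p =ᶠ[𝓝 t₁] A.H p := by
    filter_upwards [isOpen_Ioo.mem_nhds (show t₁ ∈ Ioo L.a A.ε from ⟨h1, h2⟩)] with s hs
    exact L.lam_eq p s ⟨by linarith [L.a_pos, hs.1], hs.2⟩ (hs.1.le.trans (le_abs_self s))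
  have hH' : deriv (A.H p) t₁ 2 = 0 := by
    have h3 : HasDerivAt (fun s => A.H p s 2) (deriv (A.H p) t₁ 2) t₁ :=
      (EuclideanSpace.proj (𝕜 := ℝ) (2 : Fin 3)).hasFDerivAt.comp_hasDerivAt t₁
        (A.describes.differentiableAt ht₁).hasDerivAt
    have h4 : (fun s => A.H p s 2) =ᶠ[𝓝 t₁] fun _ => 0 := by
      filter_upwards [isOpen_Ioo.mem_nhds ht₁] with s hs using hH s hs
    exact h3.unique ((hasDerivAt_const t₁ (0 : ℝ)).congr_of_eventuallyEq h4)
  refine ⟨hH t ht, L.describes.third_eq_zero L.immersed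
    (fun s hs => (L.geodCurv_eq_zero_iff hs).2 (hflat s hs)) ht₁ ?_ ?_ ht⟩
  · rw [hev.eq_of_nhds]; exact hH t₁ ht₁
  · rw [hev.deriv_eq]; exact hH'

/-- The kernel lines of the modified and of the original plane field have compatible coefficients
with respect to `∂_t` and the moving vectors. -/
theorem EngelTorsion.kernel_compat (L : EngelTorsion δ A D') (hD : IsEngel D)
    {W X : (q : M) → TangentSpace (𝓡 4) q} (hWX : IsEngelPair D W X) {p₀ : N} {z : E3 × ℝ}
    (hz : z ∈ A.tube.box p₀) :
    (A.tube.kerB A.H p₀ z = 0 ∧ A.tube.kerB L.lam p₀ z = 0 ∧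
      0 < A.tube.kerA L.lam p₀ z * A.tube.kerA A.H p₀ z) ∨
    0 < A.tube.kerB L.lam p₀ z * A.tube.kerB A.H p₀ z := by
  obtain ⟨x, t⟩ := z
  rcases A.flat_or hD (chartInv p₀ x) with hflat | hne
  · left
    have e1 : ∀ t ∈ Ioo (-A.ε) A.ε, A.tube.kerB A.H p₀ (x, t) = 0 := fun t ht =>
      (A.describes.kerB_eq_zero_iff (A.immersed hD) (z := (x, t)) ⟨hz.1, ht⟩).2 (hflat t ht)
    have hflat' : ∀ t ∈ Ioo (-A.ε) A.ε, geodCurv (L.lam (chartInv p₀ x)) t = 0 :=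
      fun t ht => (L.geodCurv_eq_zero_iff ht).2 (hflat t ht)
    have e2 : A.tube.kerB L.lam p₀ (x, t) = 0 :=
      (L.describes.kerB_eq_zero_iff L.immersed hz).2 (hflat' t hz.2)
    refine ⟨e1 t hz.2, e2, ?_⟩
    obtain ⟨k, hk⟩ := A.describes.exists_kerA_eq (A.immersed hD) A.locallyConvex hz.1 hflat
      (fun t ht => (L.third_eq_zero hD hflat ht).1)
    obtain ⟨k', hk'⟩ := L.describes.exists_kerA_eq L.immersed L.locallyConvex hz.1 hflat'
      (fun t ht => (L.third_eq_zero hD hflat ht).2)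
    obtain ⟨t₁, h1, h2⟩ := exists_between L.a_lt
    have ht₁ : t₁ ∈ Ioo (-A.ε) A.ε := ⟨by linarith [L.a_pos], h2⟩
    have hev := L.chartCurve_eventuallyEq (p₀ := p₀) (z := (x, t₁)) ⟨hz.1, ht₁⟩
      (h1.trans_le (le_abs_self t₁))
    have hev' : L.lam (chartInv p₀ x) =ᶠ[𝓝 t₁] A.H (chartInv p₀ x) :=
      (Continuous.tendsto' (f := fun s : ℝ => (x, s)) (by fun_prop) t₁ (x, t₁) rfl).eventually hev
    obtain ⟨q, hq, hqe, hA⟩ := hk t₁ ht₁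
    obtain ⟨q', hq', hqe', hA'⟩ := hk' t₁ ht₁
    have hqq : q' = q := by rw [hqe, hqe', hev'.deriv_eq, hev'.eq_of_nhds]
    have hkk : k' = k := by
      have h3 : A.tube.kerA L.lam p₀ (x, t₁) = A.tube.kerA A.H p₀ (x, t₁) := Tube.kerA_congr hev
      rw [hA, hA', hqq] at h3
      exact mul_right_cancel₀ (pow_ne_zero 2 hq) h3
    have hk0 : k ≠ 0 := by
      rintro rfl
      refine A.describes.kerA_ne_zero hD hWX (z := (x, t₁)) ⟨hz.1, ht₁⟩ (e1 t₁ ht₁) ?_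
      rw [hA, zero_mul]
    obtain ⟨r, hr, -, hAr⟩ := hk t hz.2
    obtain ⟨r', hr', -, hAr'⟩ := hk' t hz.2
    rw [hAr, hAr', hkk]
    have : 0 < (k * r * r') ^ 2 := by positivity
    nlinarith
  · right
    rw [L.describes.kerB_eq hz, A.describes.kerB_eq hz,
      det3_eq_geodCurv (L.lam_immersed _ t hz.2), det3_eq_geodCurv (A.immersed hD _ t hz.2)]
    have h1 := hne t hz.2
    have h2 : 0 < geodCurv (L.lam (chartInv p₀ x)) t * geodCurv (A.H (chartInv p₀ x)) t := by
      rw [← sign_eq_one_iff, sign_mul, L.lam_convexity _ t hz.2]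
      rcases h1.lt_or_gt with h3 | h3
      · rw [sign_neg h3]; rfl
      · rw [sign_pos h3]; rfl
    have h3 : 0 < ‖deriv (L.lam (chartInv p₀ x)) t‖ := norm_pos_iff.2 (L.lam_immersed _ t hz.2)
    have h4 : 0 < ‖deriv (A.H (chartInv p₀ x)) t‖ := norm_pos_iff.2 (A.immersed hD _ t hz.2)
    have h5 := det3_frame_ne_zero (𝒯 := A.tube) hz.1
    have h6 : 0 < (det3 (A.tube.frame p₀ 0 x) (A.tube.frame p₀ 1 x) (A.tube.frame p₀ 2 x)) ^ 2 *
      (geodCurv (L.lam (chartInv p₀ x)) t * geodCurv (A.H (chartInv p₀ x)) t) *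
      (‖deriv (L.lam (chartInv p₀ x)) t‖ ^ 3 * ‖deriv (A.H (chartInv p₀ x)) t‖ ^ 3) := by
      positivity
    refine h6.trans_eq ?_
    simp only
    ring

/-! ### The modified plane field is an Engel structure -/

theorem EngelTorsion.isOpen_outside [T2Space M] [CompactSpace N] (L : EngelTorsion δ A D') :
    IsOpen L.outside := by
  refine (IsCompact.isClosed ?_).isOpen_compl
  refine (isCompact_univ.prod isCompact_Icc).image_of_continuousOn
    (A.Φ_smooth.continuousOn.mono ?_)
  exact prod_mono subset_rfl fun t ht => ⟨by linarith [ht.1, L.a_lt], by linarith [ht.2, L.a_lt]⟩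

theorem EngelTorsion.eventually_eq [T2Space M] [CompactSpace N] (L : EngelTorsion δ A D') {q : M}
    (hq : q ∈ L.outside) : ∀ᶠ y in 𝓝 q, D' y = D y := by
  filter_upwards [L.isOpen_outside.mem_nhds hq] with y hy
  exact L.D'_off y hy

theorem EngelTorsion.mem_outside_or (L : EngelTorsion δ A D') (q : M) :
    q ∈ L.outside ∨ ∃ p, ∃ t ∈ Icc (-L.a) L.a, t ∈ Ioo (-A.ε) A.ε ∧ q = A.Φ (p, t) := by
  by_cases hq : q ∈ A.Φ '' (univ ×ˢ Icc (-L.a) L.a)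
  · obtain ⟨⟨p, t⟩, ht, rfl⟩ := hq
    exact Or.inr ⟨p, t, ht.2, ⟨by linarith [ht.2.1, L.a_lt], by linarith [ht.2.2, L.a_lt]⟩, rfl⟩
  · exact Or.inl hq

theorem IsImmersedFieldModel.exists_isFrameNear_derivedDist {Ω : Set (E3 × ℝ)} {Ψ : E3 × ℝ → M}
    {v : E3 × ℝ → E3} {y : E3 × ℝ} (h : IsImmersedFieldModel Ω Ψ v D) (hy : y ∈ Ω) :
    ∃ F : Fin 3 → (q : M) → TangentSpace (𝓡 4) q, IsFrameNear F (derivedDist D) (Ψ y) := by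
  obtain ⟨T, V, V', h1, h2, -⟩ := h.exists_frame hy
  exact ⟨_, h.isFrameNear_derivedDist hy h1 h2⟩

/-- Wherever the fibre is not flat, the geodesic curvature of `lam` is nonzero and `[D', D']` is
even-contact; on the flat fibres the coefficient of `∂_t` takes over, by `kernel_compat`. -/
theorem EngelTorsion.isEngel [T2Space M] [CompactSpace N] (L : EngelTorsion δ A D')
    (hD : IsEngel D) {W X : (q : M) → TangentSpace (𝓡 4) q} (hWX : IsEngelPair D W X) :
    IsEngel D' := by
  have key : ∀ p : N, ∀ t ∈ Ioo (-A.ε) A.ε,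
      (∃ F : Fin 2 → (q : M) → TangentSpace (𝓡 4) q, IsFrameNear F D' (A.Φ (p, t))) ∧
      (∃ F : Fin 3 → (q : M) → TangentSpace (𝓡 4) q,
        IsFrameNear F (derivedDist D') (A.Φ (p, t))) ∧
      derivedDist (derivedDist D') (A.Φ (p, t)) = ⊤ := by
    intro p t ht
    have hz : ((extChartAt (𝓡 3) p p, t) : E3 × ℝ) ∈ A.tube.box p := mem_box_self (𝒯 := A.tube) p ht
    have hm := L.describes.isImmersedFieldModel L.immersed p
    have hΨ : A.tube.Ψ p (extChartAt (𝓡 3) p p, t) = A.Φ (p, t) := by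
      rw [Tube.Ψ, chartInv_self]
      rfl
    rw [← hΨ]
    refine ⟨hm.isFrameNear_exists hz, hm.exists_isFrameNear_derivedDist hz,
      hm.derivedDist_derivedDist hz ?_⟩
    rcases L.kernel_compat hD hWX hz with h1 | h1
    · exact Or.inr (left_ne_zero_of_mul h1.2.2.ne')
    · exact Or.inl (left_ne_zero_of_mul h1.ne')
  refine ⟨fun q => ?_, fun q => ?_, fun q => ?_⟩
  · rcases L.mem_outside_or q with hq | ⟨p, t, -, ht, rfl⟩
    · obtain ⟨V, hV⟩ := hD.1 q
      refine ⟨V, ?_⟩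
      filter_upwards [hV, L.eventually_eq hq] with y h1 h2
      rw [h2]
      exact h1
    · exact (key p t ht).1
  · rcases L.mem_outside_or q with hq | ⟨p, t, -, ht, rfl⟩
    · obtain ⟨V, hV⟩ := hD.2.1 q
      refine ⟨V, ?_⟩
      filter_upwards [hV, eventually_derivedDist_congr (L.eventually_eq hq)] with y h1 h2
      rw [h2]
      exact h1
    · exact (key p t ht).2.1
  · rcases L.mem_outside_or q with hq | ⟨p, t, -, ht, rfl⟩
    · rw [derivedDist_congr (eventually_derivedDist_congr (L.eventually_eq hq))]
      exact hD.2.2 q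
    · exact (key p t ht).2.2

theorem isTransverse_of_tube {Φ : N × ℝ → M} (hΦ : ∀ p, ContMDiffAt ((𝓡 3).prod 𝓘(ℝ, ℝ)) (𝓡 4) ∞ Φ (p, 0))
    (hb : ∀ p, Function.Surjective (mfderiv ((𝓡 3).prod 𝓘(ℝ, ℝ)) (𝓡 4) Φ (p, 0)))
    (hT : ∀ p, tubeT Φ p 0 ∈ D (Φ (p, 0))) : IsTransverse (fun p => Φ (p, 0)) D := by
  intro p
  rw [eq_top_iff]
  rintro w -
  obtain ⟨⟨v, r⟩, hw⟩ := hb p w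
  have h1 : HasMFDerivAt (𝓡 3) (𝓡 4) (fun p => Φ (p, 0)) p
      ((mfderiv ((𝓡 3).prod 𝓘(ℝ, ℝ)) (𝓡 4) Φ (p, 0)).comp
        ((ContinuousLinearMap.id ℝ (TangentSpace (𝓡 3) p)).prod
          (0 : TangentSpace (𝓡 3) p →L[ℝ] TangentSpace 𝓘(ℝ, ℝ) (0 : ℝ)))) :=
    HasMFDerivAt.comp p ((hΦ p).mdifferentiableAt (by simp)).hasMFDerivAt
      ((hasMFDerivAt_id p).prodMk (hasMFDerivAt_const (0 : ℝ) p))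
  have h2 : w = mfderiv (𝓡 3) (𝓡 4) (fun p => Φ (p, 0)) p v + r • tubeT Φ p 0 := by
    rw [h1.mfderiv, ← hw]
    have h3 : ((v, r) : TangentSpace ((𝓡 3).prod 𝓘(ℝ, ℝ)) ((p, 0) : N × ℝ)) =
        ((v, (0 : ℝ)) : E3 × ℝ) + r • ((0 : E3), (1 : ℝ)) := by
      refine Prod.ext ?_ ?_
      · exact (add_zero v).symm.trans (congrArg (v + ·) (smul_zero r).symm)
      · change r = 0 + r * 1
        ring
    refine (congrArg (mfderiv ((𝓡 3).prod 𝓘(ℝ, ℝ)) (𝓡 4) Φ (p, 0)) h3).trans ?_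
    refine (map_add (mfderiv ((𝓡 3).prod 𝓘(ℝ, ℝ)) (𝓡 4) Φ (p, 0)) _ _).trans ?_
    exact congrArg₂ (· + ·) rfl
      (map_smul (mfderiv ((𝓡 3).prod 𝓘(ℝ, ℝ)) (𝓡 4) Φ (p, 0)) r _)
  rw [h2]
  exact Submodule.add_mem_sup ⟨v, rfl⟩ (Submodule.smul_mem _ _ (hT p))

theorem EngelTorsion.isTransverse (L : EngelTorsion δ A D') : IsTransverse ι D' := by
  have h1 : (fun p => A.Φ (p, 0)) = ι := funext A.Φ_zero
  rw [← h1]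
  refine isTransverse_of_tube (fun p => Tube.contMDiffAt_Φ (𝒯 := A.tube) A.zero_mem)
    (fun p => (A.Φ_bij p 0 A.zero_mem).2) (fun p => ?_)
  rw [L.D'_eq p 0 A.zero_mem]
  exact Submodule.subset_span (by simp)

end FlatFibres

/-! ### Continuous vector fields along maps -/

section Along

variable {M : Type*} [TopologicalSpace M] [ChartedSpace (EuclideanSpace ℝ (Fin 4)) M]
  [IsManifold (𝓡 4) ∞ M]
variable {Z : Type*} [TopologicalSpace Z] {f : Z → M}

/-- The vector field `v` along `f` is continuous at `z`. -/
def ContAlongAt (f : Z → M) (v : (z : Z) → TangentSpace (𝓡 4) (f z)) (z : Z) : Prop :=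
  ContinuousAt (fun z => (⟨f z, v z⟩ : TangentBundle (𝓡 4) M)) z

/-- The trivialisation of the tangent bundle around a point, as a map into `ℝ⁴`. -/
noncomputable def trivMap (q₀ q : M) : TangentSpace (𝓡 4) q →ₗ[ℝ] EuclideanSpace ℝ (Fin 4) :=
  (trivializationAt (EuclideanSpace ℝ (Fin 4)) (TangentSpace (𝓡 4)) q₀).linearMapAt ℝ q

theorem trivMap_injective {q₀ q : M} (hq : q ∈ (trivializationAt (EuclideanSpace ℝ (Fin 4))
    (TangentSpace (𝓡 4) : M → Type _) q₀).baseSet) : Function.Injective (trivMap q₀ q) := by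
  intro a b hab
  have h1 := Bundle.Trivialization.symmₗ_linearMapAt (R := ℝ) _ hq a
  have h2 := Bundle.Trivialization.symmₗ_linearMapAt (R := ℝ) _ hq b
  rw [← h1, ← h2]
  exact congrArg _ hab

theorem eventually_mem_baseSet {z₀ : Z} (hf : ContinuousAt f z₀) :
    ∀ᶠ z in 𝓝 z₀, f z ∈ (trivializationAt (EuclideanSpace ℝ (Fin 4))
      (TangentSpace (𝓡 4) : M → Type _) (f z₀)).baseSet :=
  hf.eventually_mem ((Bundle.Trivialization.open_baseSet
    (trivializationAt (EuclideanSpace ℝ (Fin 4)) (TangentSpace (𝓡 4) : M → Type _) (f z₀))).mem_nhds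
    (FiberBundle.mem_baseSet_trivializationAt' (f z₀)))

theorem contAlongAt_iff {v : (z : Z) → TangentSpace (𝓡 4) (f z)} {z₀ : Z}
    (hf : ContinuousAt f z₀) :
    ContAlongAt f v z₀ ↔ ContinuousAt (fun z => trivMap (f z₀) (f z) (v z)) z₀ := by
  have h1 : (fun z => trivMap (f z₀) (f z) (v z)) =ᶠ[𝓝 z₀] fun z =>
      (trivializationAt (EuclideanSpace ℝ (Fin 4)) (TangentSpace (𝓡 4)) (f z₀)
        (⟨f z, v z⟩ : TangentBundle (𝓡 4) M)).2 := by
    filter_upwards [eventually_mem_baseSet hf] with z hz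
    exact congrFun (Bundle.Trivialization.coe_linearMapAt_of_mem (R := ℝ) _ hz) (v z)
  rw [continuousAt_congr h1]
  exact (FiberBundle.continuousAt_totalSpace _ _).trans (and_iff_right hf)

theorem ContAlongAt.base {v : (z : Z) → TangentSpace (𝓡 4) (f z)} {z₀ : Z}
    (h : ContAlongAt f v z₀) : ContinuousAt f z₀ :=
  ((FiberBundle.continuousAt_totalSpace _ _).1 h).1

theorem ContAlongAt.sum_smul {m : ℕ} {v : Fin m → (z : Z) → TangentSpace (𝓡 4) (f z)}
    {c : Fin m → Z → ℝ} {z₀ : Z} (hf : ContinuousAt f z₀) (hv : ∀ j, ContAlongAt f (v j) z₀)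
    (hc : ∀ j, ContinuousAt (c j) z₀) : ContAlongAt f (fun z => ∑ j, c j z • v j z) z₀ := by
  rw [contAlongAt_iff hf]
  simp only [map_sum, map_smul]
  exact tendsto_finsetSum _ fun j _ => (hc j).smul ((contAlongAt_iff hf).1 (hv j))

theorem LinearIndependent.matrix_det_ne_zero {v : Fin 4 → EuclideanSpace ℝ (Fin 4)}
    (hv : LinearIndependent ℝ v) : (Matrix.of fun i j => v j i).det ≠ 0 := by
  intro h0
  obtain ⟨c, hc, hc0⟩ := Matrix.exists_mulVec_eq_zero_iff.2 h0
  apply hc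
  funext j
  refine Fintype.linearIndependent_iff.1 hv c ?_ j
  ext i
  have := congrFun hc0 i
  simp only [Matrix.mulVec, dotProduct, Matrix.of_apply, Pi.zero_apply] at this
  simpa [mul_comm] using this

/-- The coefficients of a continuous field with respect to a continuous framing are continuous. -/
theorem ContAlongAt.coeff {v : Fin 4 → (z : Z) → TangentSpace (𝓡 4) (f z)}
    {w : (z : Z) → TangentSpace (𝓡 4) (f z)} {c : Z → Fin 4 → ℝ} {z₀ : Z}
    (hv : ∀ j, ContAlongAt f (v j) z₀) (hw : ContAlongAt f w z₀)
    (hi : LinearIndependent ℝ fun j => v j z₀) (hc : ∀ᶠ z in 𝓝 z₀, w z = ∑ j, c z j • v j z) :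
    ContinuousAt c z₀ := by
  have hf := hw.base
  let B : Z → Matrix (Fin 4) (Fin 4) ℝ := fun z =>
    Matrix.of fun i j => trivMap (f z₀) (f z) (v j z) i
  have hBc : ContinuousAt B z₀ := by
    refine continuousAt_pi.2 fun i => continuousAt_pi.2 fun j => ?_
    exact (EuclideanSpace.proj (𝕜 := ℝ) i).continuous.continuousAt.comp
      ((contAlongAt_iff hf).1 (hv j))
  have hB0 : (B z₀).det ≠ 0 := by
    refine LinearIndependent.matrix_det_ne_zero (v := fun j => trivMap (f z₀) (f z₀) (v j z₀)) ?_
    exact hi.map' _ (LinearMap.ker_eq_bot.2 (trivMap_injective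
      (FiberBundle.mem_baseSet_trivializationAt' _)))
  have hdet : ContinuousAt (fun z => (B z).det) z₀ :=
    (Continuous.matrix_det continuous_id).continuousAt.comp hBc
  have hadj : ContinuousAt (fun z => (B z).adjugate) z₀ :=
    (Continuous.matrix_adjugate continuous_id).continuousAt.comp hBc
  have hb : ContinuousAt (fun z => (fun i => trivMap (f z₀) (f z) (w z) i : Fin 4 → ℝ)) z₀ :=
    continuousAt_pi.2 fun i => (EuclideanSpace.proj (𝕜 := ℝ) i).continuous.continuousAt.comp
      ((contAlongAt_iff hf).1 hw)
  have hev : c =ᶠ[𝓝 z₀] fun z => (B z).det⁻¹ • (B z).adjugate.mulVec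
      (fun i => trivMap (f z₀) (f z) (w z) i) := by
    filter_upwards [hc, hdet.eventually_ne hB0] with z h1 h2
    have h3 : (fun i => trivMap (f z₀) (f z) (w z) i) = (B z).mulVec (c z) := by
      funext i
      rw [h1]
      simp only [map_sum, map_smul, Matrix.mulVec, dotProduct, B, Matrix.of_apply]
      simp [mul_comm]
    rw [h3, Matrix.mulVec_mulVec, Matrix.adjugate_mul, Matrix.smul_mulVec, Matrix.one_mulVec,
      smul_smul, inv_mul_cancel₀ h2, one_smul]
  rw [continuousAt_congr hev]
  refine (hdet.inv₀ hB0).smul ?_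
  refine continuousAt_pi.2 fun i => ?_
  simp only [Matrix.mulVec, dotProduct]
  exact tendsto_finsetSum _ fun j _ =>
    ((continuousAt_pi.1 (continuousAt_pi.1 hadj i)) j).mul (continuousAt_pi.1 hb j)

/-! ### Homotopies of framings -/

/-- A continuous framing of the tangent bundle. -/
structure IsFraming (F : (q : M) → Fin 4 → TangentSpace (𝓡 4) q) : Prop where
  cont : ∀ i, Continuous fun q => (⟨q, F q i⟩ : TangentBundle (𝓡 4) M)
  indep : ∀ q, LinearIndependent ℝ (F q)

variable {F₀ F₁ F₂ : (q : M) → Fin 4 → TangentSpace (𝓡 4) q}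

/-- A framing as a continuous map into the fourth power of the tangent bundle. -/
def framingMap (F : (q : M) → Fin 4 → TangentSpace (𝓡 4) q) (h : IsFraming F) :
    C(M, Fin 4 → TangentBundle (𝓡 4) M) :=
  ⟨fun q i => ⟨q, F q i⟩, continuous_pi h.cont⟩

/-- The property of being the map given by a framing. -/
def IsFramingMap (h : C(M, Fin 4 → TangentBundle (𝓡 4) M)) : Prop :=
  ∃ F : (q : M) → Fin 4 → TangentSpace (𝓡 4) q, (∀ q, LinearIndependent ℝ (F q)) ∧
    ∀ q i, h q i = ⟨q, F q i⟩

theorem FramingHomotopic.isFraming_left (h : FramingHomotopic F₀ F₁) : IsFraming F₀ := by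
  obtain ⟨F, h1, h2, rfl, -⟩ := h
  exact ⟨fun i => (h1 i).comp (Continuous.prodMk_right (0 : unitInterval)), h2 0⟩

theorem FramingHomotopic.isFraming_right (h : FramingHomotopic F₀ F₁) : IsFraming F₁ := by
  obtain ⟨F, h1, h2, -, rfl⟩ := h
  exact ⟨fun i => (h1 i).comp (Continuous.prodMk_right (1 : unitInterval)), h2 1⟩

theorem framingHomotopic_iff (h₀ : IsFraming F₀) (h₁ : IsFraming F₁) :
    FramingHomotopic F₀ F₁ ↔
      ContinuousMap.HomotopicWith (framingMap F₀ h₀) (framingMap F₁ h₁) IsFramingMap := by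
  constructor
  · rintro ⟨F, h1, h2, h3, h4⟩
    refine ⟨⟨⟨⟨fun a i => ⟨a.2, F a.1 a.2 i⟩, continuous_pi h1⟩, fun q => ?_, fun q => ?_⟩,
      fun s => ⟨F s, h2 s, fun q i => rfl⟩⟩⟩
    · simp only [h3]; rfl
    · simp only [h4]; rfl
  · rintro ⟨h⟩
    choose F h1 h2 using fun s => h.prop s
    have h3 : ∀ s q i, h (s, q) i = ⟨q, F s q i⟩ := fun s q i => h2 s q i
    refine ⟨F, fun i => ?_, h1, ?_, ?_⟩
    · have : (fun a : unitInterval × M => (⟨a.2, F a.1 a.2 i⟩ : TangentBundle (𝓡 4) M)) =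
          fun a => h a i := by
        funext a
        exact (h3 a.1 a.2 i).symm
      rw [this]
      exact (continuous_apply i).comp h.continuous
    · funext q i
      have e1 := h3 0 q i
      rw [h.apply_zero] at e1
      exact (Bundle.TotalSpace.mk_injective q e1).symm
    · funext q i
      have e1 := h3 1 q i
      rw [h.apply_one] at e1
      exact (Bundle.TotalSpace.mk_injective q e1).symm

theorem FramingHomotopic.symm (h : FramingHomotopic F₀ F₁) : FramingHomotopic F₁ F₀ :=
  (framingHomotopic_iff h.isFraming_right h.isFraming_left).2
    ((framingHomotopic_iff h.isFraming_left h.isFraming_right).1 h).symm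

theorem FramingHomotopic.trans (h : FramingHomotopic F₀ F₁) (h' : FramingHomotopic F₁ F₂) :
    FramingHomotopic F₀ F₂ :=
  (framingHomotopic_iff h.isFraming_left h'.isFraming_right).2
    (((framingHomotopic_iff h.isFraming_left h.isFraming_right).1 h).trans
      ((framingHomotopic_iff h'.isFraming_left h'.isFraming_right).1 h'))

/-- A framing that is described, over an open set parametrised by `φ`, by a matrix with respect to
a framing `v` of that set may be deformed by deforming the matrix, provided that it stays
fixed off a set `K` whose image is closed. -/
theorem framingHomotopic_of_matrix {φ : Z → M} (hφ : IsOpenEmbedding φ)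
    {v : Fin 4 → (z : Z) → TangentSpace (𝓡 4) (φ z)} (hv : ∀ j z, ContAlongAt φ (v j) z)
    (hi : ∀ z, LinearIndependent ℝ fun j => v j z) {K : Set Z} (hK : IsClosed (φ '' K))
    {B : unitInterval × Z → Matrix (Fin 4) (Fin 4) ℝ} (hB : Continuous B)
    (hdet : ∀ a, (B a).det ≠ 0) (hF₀ : IsFraming F₀)
    (h0 : ∀ z i, F₀ (φ z) i = ∑ j, B (0, z) j i • v j z)
    (h1 : ∀ z i, F₁ (φ z) i = ∑ j, B (1, z) j i • v j z)
    (hBK : ∀ z ∉ K, ∀ s, B (s, z) = B (0, z)) (hoff : ∀ q, q ∉ range φ → F₁ q = F₀ q) :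
    FramingHomotopic F₀ F₁ := by
  classical
  -- values in the tangent spaces are regarded as vectors of `ℝ⁴`, to transport them along `φ z = q`
  let u : Fin 4 → Z → EuclideanSpace ℝ (Fin 4) := v
  let G : unitInterval → (q : M) → Fin 4 → EuclideanSpace ℝ (Fin 4) := fun s q i =>
    if h : ∃ z, φ z = q then ∑ j, B (s, h.choose) j i • u j h.choose else F₀ q i
  have hGφ : ∀ s z i, G s (φ z) i = ∑ j, B (s, z) j i • u j z := by
    intro s z i
    have h : ∃ z', φ z' = φ z := ⟨z, rfl⟩
    refine (dif_pos h).trans ?_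
    rw [hφ.injective h.choose_spec]
  have hGoff : ∀ s q, q ∉ φ '' K → G s q = F₀ q := by
    intro s q hq
    by_cases h : ∃ z, φ z = q
    · obtain ⟨z, rfl⟩ := h
      funext i
      rw [hGφ, hBK z (fun hz => hq ⟨z, hz, rfl⟩) s]
      exact (h0 z i).symm
    · funext i
      exact dif_neg h
  refine ⟨G, fun i => ?_, fun s q => ?_, ?_, ?_⟩
  · rw [continuous_iff_continuousAt]
    rintro ⟨s, q⟩
    by_cases h : ∃ z, φ z = q
    · obtain ⟨z, rfl⟩ := h
      have hO : IsOpenEmbedding (Prod.map id φ : unitInterval × Z → unitInterval × M) :=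
        IsOpenEmbedding.id.prodMap hφ
      have hC : ContinuousAt ((fun a : unitInterval × M =>
          (⟨a.2, G a.1 a.2 i⟩ : TangentBundle (𝓡 4) M)) ∘ Prod.map id φ) (s, z) := by
        have e1 : ((fun a : unitInterval × M =>
            (⟨a.2, G a.1 a.2 i⟩ : TangentBundle (𝓡 4) M)) ∘ Prod.map id φ) =
            fun a : unitInterval × Z => (⟨φ a.2, ∑ j, B a j i • v j a.2⟩ :
              TangentBundle (𝓡 4) M) := by
          funext a
          exact congrArg (Bundle.TotalSpace.mk (φ a.2)) (hGφ a.1 a.2 i)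
        rw [e1]
        refine ContAlongAt.sum_smul (f := fun a : unitInterval × Z => φ a.2)
          (v := fun j a => v j a.2) (c := fun j a => B a j i)
          (hφ.continuous.comp continuous_snd).continuousAt (fun j => ?_) (fun j => ?_)
        · exact ContinuousAt.comp (f := Prod.snd)
            (g := fun z => (⟨φ z, v j z⟩ : TangentBundle (𝓡 4) M)) (x := (s, z)) (hv j z)
            continuousAt_snd
        · exact ((continuous_apply i).comp ((continuous_apply j).comp hB)).continuousAt
      exact hO.continuousAt_iff.1 hC
    · have hq : q ∉ φ '' K := fun ⟨z, _, hz⟩ => h ⟨z, hz⟩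
      have e1 : (fun a : unitInterval × M => (⟨a.2, G a.1 a.2 i⟩ : TangentBundle (𝓡 4) M))
          =ᶠ[𝓝 (s, q)] fun a => ⟨a.2, F₀ a.2 i⟩ := by
        filter_upwards [continuous_snd.continuousAt.eventually (hK.isOpen_compl.mem_nhds hq)]
          with a ha
        exact congrArg (Bundle.TotalSpace.mk a.2) (congrFun (hGoff a.1 a.2 ha) i)
      refine ContinuousAt.congr ?_ e1.symm
      exact ((hF₀.cont i).comp continuous_snd).continuousAt
  · by_cases h : ∃ z, φ z = q
    · obtain ⟨z, rfl⟩ := h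
      have := (hi z).sum_smul_of_det_ne_zero (hdet (s, z))
      have e1 : G s (φ z) = fun i => ∑ j, B (s, z) j i • u j z := funext fun i => hGφ s z i
      exact e1 ▸ this
    · have hq : q ∉ φ '' K := fun ⟨z, _, hz⟩ => h ⟨z, hz⟩
      have := hF₀.indep q
      exact (hGoff s q hq).symm ▸ this
  · funext q i
    by_cases h : ∃ z, φ z = q
    · obtain ⟨z, rfl⟩ := h
      exact (hGφ 0 z i).trans (h0 z i).symm
    · exact congrFun (hGoff 0 q fun ⟨z, _, hz⟩ => h ⟨z, hz⟩) i
  · funext q i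
    by_cases h : ∃ z, φ z = q
    · obtain ⟨z, rfl⟩ := h
      exact (hGφ 1 z i).trans (h1 z i).symm
    · exact (congrFun (hGoff 1 q fun ⟨z, _, hz⟩ => h ⟨z, hz⟩) i).trans
        (congrFun (hoff q fun ⟨z, hz⟩ => h ⟨z, hz⟩) i).symm

/-- Deformation of a framing by a family of matrix valued functions. -/
theorem framingHomotopic_mul {F : (q : M) → Fin 4 → TangentSpace (𝓡 4) q} (hF : IsFraming F)
    {B : unitInterval × M → Matrix (Fin 4) (Fin 4) ℝ} (hB : Continuous B)
    (hdet : ∀ a, (B a).det ≠ 0) :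
    FramingHomotopic (fun q i => ∑ j, B (0, q) j i • F q j)
      (fun q i => ∑ j, B (1, q) j i • F q j) := by
  refine ⟨fun s q i => ∑ j, B (s, q) j i • F q j, fun i => ?_, fun s q => ?_, rfl, rfl⟩
  · rw [continuous_iff_continuousAt]
    intro a
    refine ContAlongAt.sum_smul (f := fun a : unitInterval × M => a.2)
      (v := fun j a => F a.2 j) (c := fun j a => B a j i) continuousAt_snd (fun j => ?_)
      (fun j => ?_)
    · exact ((hF.cont j).comp continuous_snd).continuousAt
    · exact ((continuous_apply i).comp ((continuous_apply j).comp hB)).continuousAt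
  · exact (hF.indep q).sum_smul_of_det_ne_zero (hdet (s, q))

/-- Two framings are homotopic if the straight segments between them consist of framings. -/
theorem framingHomotopic_of_segment (h₀ : IsFraming F₀) (h₁ : IsFraming F₁)
    (h : ∀ q, ∀ s : ℝ, 0 ≤ s → s ≤ 1 →
      LinearIndependent ℝ fun i => (1 - s) • F₀ q i + s • F₁ q i) : FramingHomotopic F₀ F₁ := by
  refine ⟨fun s q i => (1 - (s : ℝ)) • F₀ q i + (s : ℝ) • F₁ q i, fun i => ?_,
    fun s q => h q s s.2.1 s.2.2, ?_, ?_⟩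
  · rw [continuous_iff_continuousAt]
    intro a
    have := ContAlongAt.sum_smul (f := fun a : unitInterval × M => a.2) (z₀ := a)
      (v := ![fun a => F₀ a.2 i, fun a => F₁ a.2 i])
      (c := ![fun a => 1 - (a.1 : ℝ), fun a => (a.1 : ℝ)]) continuousAt_snd (fun j => ?_)
      (fun j => ?_)
    · simp only [Fin.sum_univ_two] at this
      exact this
    · fin_cases j
      · exact ((h₀.cont i).comp continuous_snd).continuousAt
      · exact ((h₁.cont i).comp continuous_snd).continuousAt
    · fin_cases j
      · exact Continuous.continuousAt (by dsimp; fun_prop)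
      · exact Continuous.continuousAt (by dsimp; fun_prop)
  · funext q i
    simp
  · funext q i
    simp

theorem SmoothVecAt.continuousAt {V : (q : M) → TangentSpace (𝓡 4) q} {q : M}
    (h : SmoothVecAt V q) : ContinuousAt (fun y => (⟨y, V y⟩ : TangentBundle (𝓡 4) M)) q :=
  ContMDiffAt.continuousAt h

theorem IsEngelPair.isFraming {D : TangentDist 4 M} {W X : (q : M) → TangentSpace (𝓡 4) q}
    (h : IsEngelPair D W X) (hD : IsEngel D) : IsFraming (engelFraming W X) := by
  refine ⟨fun i => continuous_iff_continuousAt.2 fun q => ?_, h.linearIndependent_engelFraming hD⟩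
  have h1 : ∀ q, SmoothVecAt (VectorField.mlieBracket (𝓡 4) W X) q := fun q =>
    (h.smooth_W q).mlieBracket (h.smooth_X q)
  fin_cases i
  · exact (h.smooth_W q).continuousAt
  · exact (h.smooth_X q).continuousAt
  · exact (h1 q).continuousAt
  · exact ((h.smooth_X q).mlieBracket (h1 q)).continuousAt

/-- The Engel framing depends, up to homotopy, only on the orientations: a change of the oriented
frame changes it by a triangular matrix with positive diagonal. -/
theorem IsEngelPair.framingHomotopic {D : TangentDist 4 M}
    {W X W' X' : (q : M) → TangentSpace (𝓡 4) q} (h : IsEngelPair D W X)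
    (h' : IsEngelPair D W' X') (hD : IsEngel D) (ho : SameOrientationOn univ W X W' X') :
    FramingHomotopic (engelFraming W X) (engelFraming W' X') := by
  refine framingHomotopic_of_segment (h.isFraming hD) (h'.isFraming hD) fun q s hs0 hs1 => ?_
  obtain ⟨P, hP, hpos, hg⟩ := engelFraming_eq_sum_of_sameOrientation (q := q) hD h h'
    (fun y _ => ho y (mem_univ y))
  exact (h.linearIndependent_engelFraming hD q).segment_of_blockTriangular hP hpos hg hs0 hs1

end Along

/-! ### The tube as an open subset with a moving frame -/

section TubeDomain

variable {N : Type*} [TopologicalSpace N] [ChartedSpace (EuclideanSpace ℝ (Fin 3)) N]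
  [IsManifold (𝓡 3) ∞ N]
variable {M : Type*} [TopologicalSpace M] [ChartedSpace (EuclideanSpace ℝ (Fin 4)) M]
  [IsManifold (𝓡 4) ∞ M]

/-- The space `N × (-ε, ε)`. -/
abbrev Tube.Dom (𝒯 : Tube N M) : Type _ := N × Ioo (-𝒯.ε) 𝒯.ε

/-- The tube, as a map defined on `N × (-ε, ε)`. -/
def Tube.φ (𝒯 : Tube N M) (z : 𝒯.Dom) : M := 𝒯.Φ (z.1, (z.2 : ℝ))

/-- The frame `∂_t, X, Y, Z` of the tube. -/
noncomputable def Tube.vec (𝒯 : Tube N M) (j : Fin 4) (z : 𝒯.Dom) :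
    TangentSpace (𝓡 4) (𝒯.φ z) :=
  ![tubeT 𝒯.Φ z.1 z.2, tubeDeriv 𝒯.Φ z.1 z.2 (𝒯.e 0 z.1) 0, tubeDeriv 𝒯.Φ z.1 z.2 (𝒯.e 1 z.1) 0,
    tubeDeriv 𝒯.Φ z.1 z.2 (𝒯.e 2 z.1) 0] j

variable {𝒯 : Tube N M} {γ : N → ℝ → E3} {D : TangentDist 4 M}

/-- The point of `N × (-ε, ε)` with given coordinates in a chart. -/
noncomputable def Tube.toDom (p₀ : N) (y : E3 × ℝ) (hy : y ∈ 𝒯.box p₀) : 𝒯.Dom :=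
  (chartInv p₀ y.1, ⟨y.2, hy.2⟩)

theorem Tube.exists_eq_toDom {p₀ : N} {z : 𝒯.Dom} (hz : z.1 ∈ (extChartAt (𝓡 3) p₀).source) :
    ∃ hy : (extChartAt (𝓡 3) p₀ z.1, (z.2 : ℝ)) ∈ 𝒯.box p₀, z = Tube.toDom p₀ _ hy :=
  ⟨⟨(extChartAt (𝓡 3) p₀).map_source hz, z.2.2⟩,
    Prod.ext ((extChartAt (𝓡 3) p₀).left_inv hz).symm rfl⟩

theorem Tube.continuous_φ : Continuous 𝒯.φ := by
  have h1 : Continuous fun z : 𝒯.Dom => ((z.1, (z.2 : ℝ)) : N × ℝ) := by fun_prop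
  exact 𝒯.Φ_smooth.continuousOn.comp_continuous h1 fun z => ⟨mem_univ _, z.2.2⟩

theorem Tube.injective_φ : Function.Injective 𝒯.φ := by
  intro z z' h
  have hm : ∀ z : 𝒯.Dom, ((z.1, (z.2 : ℝ)) : N × ℝ) ∈ univ ×ˢ Ioo (-𝒯.ε) 𝒯.ε :=
    fun z => ⟨mem_univ _, z.2.2⟩
  have h1 := 𝒯.Φ_inj (hm z) (hm z') h
  exact Prod.ext (Prod.ext_iff.1 h1).1 (Subtype.ext (Prod.ext_iff.1 h1).2)

theorem Tube.isOpenEmbedding_φ : IsOpenEmbedding 𝒯.φ := by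
  refine .of_continuous_injective_isOpenMap Tube.continuous_φ Tube.injective_φ ?_
  rw [isOpenMap_iff_nhds_le]
  intro z
  obtain ⟨p, t, ht⟩ := z
  have hy := mem_box_self (𝒯 := 𝒯) p ht
  have hΨ : 𝒯.Ψ p (extChartAt (𝓡 3) p p, t) = 𝒯.Φ (p, t) := by rw [Tube.Ψ, chartInv_self]
  have h1 : IsLocalParam 4 (𝒯.Ψ p) (extChartAt (𝓡 3) p p, t) := by
    filter_upwards [(Tube.isOpen_box p).mem_nhds hy] with w hw
    exact ⟨Tube.contMDiffAt_Ψ hw, Tube.bijective_dparam_Ψ hw⟩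
  have h2 : map (fun y : E3 × ℝ => (chartInv p y.1, y.2)) (𝓝 (extChartAt (𝓡 3) p p, t)) ≤
      𝓝 (p, t) := by
    have := (contMDiffAt_chartInv_prod hy).continuousAt
    rw [ContinuousAt, chartInv_self] at this
    exact this
  have h3 : IsOpenEmbedding (Prod.map id Subtype.val : 𝒯.Dom → N × ℝ) :=
    IsOpenEmbedding.id.prodMap isOpen_Ioo.isOpenEmbedding_subtypeVal
  have h4 : map (Prod.map id Subtype.val : 𝒯.Dom → N × ℝ) (𝓝 (p, ⟨t, ht⟩)) = 𝓝 (p, t) :=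
    h3.map_nhds_eq _
  have h5 : 𝒯.φ = 𝒯.Φ ∘ (Prod.map id Subtype.val : 𝒯.Dom → N × ℝ) := rfl
  have h6 : 𝒯.φ (p, ⟨t, ht⟩) = 𝒯.Φ (p, t) := rfl
  rw [h6, ← hΨ, ← h1.map_nhds, h5, ← Filter.map_map, h4]
  exact Filter.map_mono (m := 𝒯.Φ) h2

theorem Tube.vec_toDom {p₀ : N} {y : E3 × ℝ} (hy : y ∈ 𝒯.box p₀) (j : Fin 4) :
    𝒯.vec j (Tube.toDom p₀ y hy) = dparam 4 (𝒯.Ψ p₀) y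
      (![((0 : E3), (1 : ℝ)), (𝒯.frame p₀ 0 y.1, 0), (𝒯.frame p₀ 1 y.1, 0),
        (𝒯.frame p₀ 2 y.1, 0)] j) := by
  have key : ∀ i, tubeDeriv 𝒯.Φ (chartInv p₀ y.1) y.2 (𝒯.e i (chartInv p₀ y.1)) 0 =
      dparam 4 (𝒯.Ψ p₀) y (𝒯.frame p₀ i y.1, (0 : ℝ)) := by
    intro i
    rw [Tube.dparam_Ψ hy, Tube.dparam_frame hy.1]
  fin_cases j
  · exact Tube.tubeT_eq hy
  · exact key 0
  · exact key 1
  · exact key 2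

theorem Tube.contAlongAt_vec (j : Fin 4) (z : 𝒯.Dom) : ContAlongAt 𝒯.φ (𝒯.vec j) z := by
  have hsrc : z.1 ∈ (extChartAt (𝓡 3) z.1).source := mem_extChartAt_source z.1
  have hy := (Tube.exists_eq_toDom hsrc).1
  set p₀ := z.1 with hp₀
  have hloc : IsLocalParam 4 (𝒯.Ψ p₀) (extChartAt (𝓡 3) p₀ p₀, (z.2 : ℝ)) := by
    filter_upwards [(Tube.isOpen_box p₀).mem_nhds hy] with w hw
    exact ⟨Tube.contMDiffAt_Ψ hw, Tube.bijective_dparam_Ψ hw⟩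
  obtain ⟨V, hV, hVs⟩ := hloc.exists_isRep (ξ := fun y => ![((0 : E3), (1 : ℝ)),
    (𝒯.frame p₀ 0 y.1, 0), (𝒯.frame p₀ 1 y.1, 0), (𝒯.frame p₀ 2 y.1, 0)] j) (by
      filter_upwards [(Tube.isOpen_box p₀).mem_nhds hy] with w hw
      have key : ∀ i, ContDiffAt ℝ ∞ (fun y : E3 × ℝ => (𝒯.frame p₀ i y.1, (0 : ℝ))) w :=
        fun i => (ContDiffAt.comp w (Tube.contDiffAt_frame hw.1 i) contDiffAt_fst).prodMk
          contDiffAt_const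
      fin_cases j
      · exact contDiffAt_const
      · exact key 0
      · exact key 1
      · exact key 2)
  have hcont : ContinuousAt (fun z' : 𝒯.Dom => (extChartAt (𝓡 3) p₀ z'.1, (z'.2 : ℝ))) z :=
    ContinuousAt.prodMk ((continuousAt_extChartAt p₀).comp (f := Prod.fst) (x := z)
      continuousAt_fst) (by fun_prop)
  have hev : ∀ᶠ z' in 𝓝 z, 𝒯.vec j z' = V (𝒯.φ z') := by
    have h1 : ∀ᶠ z' : 𝒯.Dom in 𝓝 z, z'.1 ∈ (extChartAt (𝓡 3) p₀).source :=
      continuous_fst.continuousAt.eventually (extChartAt_source_mem_nhds p₀)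
    have h2 := hcont.eventually hV
    filter_upwards [h1, h2] with z' h3 h4
    have hex : ∃ y, ∃ hy : y ∈ 𝒯.box p₀, z' = Tube.toDom p₀ y hy ∧
        V (𝒯.Ψ p₀ y) = dparam 4 (𝒯.Ψ p₀) y (![((0 : E3), (1 : ℝ)),
          (𝒯.frame p₀ 0 y.1, 0), (𝒯.frame p₀ 1 y.1, 0), (𝒯.frame p₀ 2 y.1, 0)] j) := by
      obtain ⟨hy', hz'⟩ := Tube.exists_eq_toDom h3
      exact ⟨_, hy', hz', h4⟩
    obtain ⟨y, hy', rfl, h5⟩ := hex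
    exact (Tube.vec_toDom hy' j).trans h5.symm
  have hVc : ContinuousAt (fun q => (⟨q, V q⟩ : TangentBundle (𝓡 4) M)) (𝒯.φ z) := by
    have : 𝒯.Ψ p₀ (extChartAt (𝓡 3) p₀ p₀, (z.2 : ℝ)) = 𝒯.φ z := by
      rw [Tube.Ψ, chartInv_self]; rfl
    rw [← this]
    exact hVs.self_of_nhds.continuousAt
  have hc := ContinuousAt.comp (f := 𝒯.φ) (x := z) hVc Tube.continuous_φ.continuousAt
  refine hc.congr ?_
  filter_upwards [hev] with z' h
  exact congrArg (Bundle.TotalSpace.mk (𝒯.φ z')) h.symm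

theorem ContinuousLinearMap.apply_sum_smul_prod {F : Type*} [NormedAddCommGroup F]
    [NormedSpace ℝ F] (f : E3 × ℝ →L[ℝ] F) (e : Fin 3 → E3) (u : Fin 3 → ℝ) (r : ℝ) :
    f (∑ i, u i • e i, r) =
      r • f (0, 1) + u 0 • f (e 0, 0) + u 1 • f (e 1, 0) + u 2 • f (e 2, 0) := by
  simp only [← map_smul, ← map_add, Fin.sum_univ_three]
  congr 1
  refine Prod.ext ?_ ?_ <;> simp

theorem Tube.linearIndependent_vec (z : 𝒯.Dom) : LinearIndependent ℝ fun j => 𝒯.vec j z := by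
  rw [Fintype.linearIndependent_iff]
  intro g hg
  have hb := 𝒯.Φ_bij z.1 z.2 z.2.2
  have h1 : tubeDeriv 𝒯.Φ z.1 z.2 (∑ i : Fin 3, g i.succ • 𝒯.e i z.1) (g 0) = 0 := by
    rw [Fin.sum_univ_four] at hg
    let f : E3 × ℝ →L[ℝ] EuclideanSpace ℝ (Fin 4) :=
      mfderiv ((𝓡 3).prod 𝓘(ℝ, ℝ)) (𝓡 4) 𝒯.Φ (z.1, (z.2 : ℝ))
    exact (f.apply_sum_smul_prod (fun i => 𝒯.e i z.1) (fun i => g i.succ) (g 0)).trans hg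
  have h2 : ((∑ i : Fin 3, g i.succ • 𝒯.e i z.1, g 0) :
      TangentSpace (𝓡 3) z.1 × ℝ) = 0 := by
    refine hb.1 (h1.trans ?_)
    exact (map_zero (mfderiv ((𝓡 3).prod 𝓘(ℝ, ℝ)) (𝓡 4) 𝒯.Φ (z.1, (z.2 : ℝ)))).symm
  have h3 := Fintype.linearIndependent_iff.1 (𝒯.e_indep z.1) (fun i => g i.succ)
    (congrArg Prod.fst h2)
  intro j
  refine Fin.cases ?_ (fun i => h3 i) j
  exact congrArg Prod.snd h2

/-- The block matrix with blocks `1` and `(a, b, a × b)`. -/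
def frame4 (a b : E3) : Matrix (Fin 4) (Fin 4) ℝ :=
  !![1, 0, 0, 0;
     0, a 0, b 0, a 1 * b 2 - a 2 * b 1;
     0, a 1, b 1, a 2 * b 0 - a 0 * b 2;
     0, a 2, b 2, a 0 * b 1 - a 1 * b 0]

theorem det_frame4 (a b : E3) : (frame4 a b).det = (a 1 * b 2 - a 2 * b 1) ^ 2 +
    (a 2 * b 0 - a 0 * b 2) ^ 2 + (a 0 * b 1 - a 1 * b 0) ^ 2 := by
  rw [frame4, Matrix.det_succ_row_zero]
  simp [Fin.sum_univ_four, Matrix.det_fin_three, Fin.succAbove, Matrix.submatrix]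
  ring

theorem det_frame4_eq_inner (a b : E3) :
    (frame4 a b).det = ‖a‖ ^ 2 * ‖b‖ ^ 2 - (inner ℝ a b) ^ 2 := by
  rw [det_frame4, norm_sq_E3, norm_sq_E3, inner_E3]
  ring

theorem Continuous.frame4 {Y : Type*} [TopologicalSpace Y] {a b : Y → E3} (ha : Continuous a)
    (hb : Continuous b) : Continuous fun y => frame4 (a y) (b y) := by
  refine continuous_matrix fun i j => ?_
  fin_cases i <;> fin_cases j <;> simp [_root_.frame4] <;> fun_prop

theorem Continuous.det3 {Y : Type*} [TopologicalSpace Y] {a b c : Y → E3} (ha : Continuous a)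
    (hb : Continuous b) (hc : Continuous c) : Continuous fun y => det3 (a y) (b y) (c y) := by
  unfold _root_.det3
  fun_prop

/-- The moving frame of the tube: `∂_t`, the moving vector `γ`, its unit tangent vector and their
cross product. -/
noncomputable def Tube.mov (𝒯 : Tube N M) (γ : N → ℝ → E3) (j : Fin 4) (z : 𝒯.Dom) :
    TangentSpace (𝓡 4) (𝒯.φ z) :=
  ∑ k, frame4 (γ z.1 z.2) (unitTangent (γ z.1) z.2) k j • 𝒯.vec k z

theorem Tube.tubeVec_eq_sum (z : 𝒯.Dom) (u : E3) : tubeVec 𝒯.Φ 𝒯.e z.1 z.2 u =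
    u 0 • 𝒯.vec 1 z + u 1 • 𝒯.vec 2 z + u 2 • 𝒯.vec 3 z := by
  let f : E3 × ℝ →L[ℝ] EuclideanSpace ℝ (Fin 4) :=
    mfderiv ((𝓡 3).prod 𝓘(ℝ, ℝ)) (𝓡 4) 𝒯.Φ (z.1, (z.2 : ℝ))
  have h1 := f.apply_sum_smul_prod (fun i => 𝒯.e i z.1) u 0
  rw [zero_smul, zero_add] at h1
  exact h1

theorem Tube.mov_zero (z : 𝒯.Dom) : 𝒯.mov γ 0 z = tubeT 𝒯.Φ z.1 z.2 := by
  simp only [Tube.mov, Fin.sum_univ_four, frame4, Matrix.of_apply, Matrix.cons_val_zero,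
    Matrix.cons_val_one, Matrix.cons_val, zero_smul, add_zero, one_smul]
  rfl

theorem Tube.mov_one (z : 𝒯.Dom) : 𝒯.mov γ 1 z = tubeVec 𝒯.Φ 𝒯.e z.1 z.2 (γ z.1 z.2) := by
  refine Eq.trans ?_ (Tube.tubeVec_eq_sum z _).symm
  simp only [Tube.mov, Fin.sum_univ_four, frame4, Matrix.of_apply, Matrix.cons_val_zero,
    Matrix.cons_val_one, Matrix.cons_val, zero_smul, zero_add]

theorem Tube.mov_two (z : 𝒯.Dom) :
    𝒯.mov γ 2 z = tubeVec 𝒯.Φ 𝒯.e z.1 z.2 (unitTangent (γ z.1) z.2) := by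
  refine Eq.trans ?_ (Tube.tubeVec_eq_sum z _).symm
  simp only [Tube.mov, Fin.sum_univ_four, frame4, Matrix.of_apply, Matrix.cons_val_zero,
    Matrix.cons_val_one, Matrix.cons_val, zero_smul, zero_add]

theorem Tube.Describes.norm_unitTangent (hi : 𝒯.Immersed γ) (z : 𝒯.Dom) :
    ‖unitTangent (γ z.1) z.2‖ = 1 := by
  have h1 : ‖deriv (γ z.1) z.2‖ ≠ 0 := norm_ne_zero_iff.2 (hi z.1 z.2 z.2.2)
  rw [unitTangent, norm_smul, norm_inv, norm_norm, inv_mul_cancel₀ h1]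

theorem Tube.Describes.inner_unitTangent (h : 𝒯.Describes γ D) (z : 𝒯.Dom) :
    inner ℝ (γ z.1 z.2) (unitTangent (γ z.1) z.2) = 0 := by
  rw [unitTangent, inner_smul_right, h.inner_deriv z.2.2, mul_zero]

theorem Tube.Describes.det_frame4 (h : 𝒯.Describes γ D) (hi : 𝒯.Immersed γ) (z : 𝒯.Dom) :
    (frame4 (γ z.1 z.2) (unitTangent (γ z.1) z.2)).det = 1 := by
  rw [det_frame4_eq_inner, h.inner_unitTangent, Tube.Describes.norm_unitTangent hi,
    h.norm_eq _ _ z.2.2]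
  norm_num

theorem Tube.Describes.linearIndependent_mov (h : 𝒯.Describes γ D) (hi : 𝒯.Immersed γ)
    (z : 𝒯.Dom) : LinearIndependent ℝ fun j => 𝒯.mov γ j z :=
  (Tube.linearIndependent_vec z).sum_smul_of_det_ne_zero
    (A := frame4 (γ z.1 z.2) (unitTangent (γ z.1) z.2))
    (by rw [h.det_frame4 hi]; exact one_ne_zero)

theorem Tube.Describes.continuous (h : 𝒯.Describes γ D) :
    Continuous fun z : 𝒯.Dom => γ z.1 z.2 := by
  have h1 : Continuous fun z : 𝒯.Dom => ((z.1, (z.2 : ℝ)) : N × ℝ) := by fun_prop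
  exact h.smooth.continuousOn.comp_continuous h1 fun z => ⟨mem_univ _, z.2.2⟩

theorem Tube.continuous_of_chart {F : Type*} [TopologicalSpace F] {g : N → ℝ → F}
    (h : ∀ p₀ : N, ∀ y ∈ 𝒯.box p₀, ContinuousAt (fun y : E3 × ℝ => g (chartInv p₀ y.1) y.2) y) :
    Continuous fun z : 𝒯.Dom => g z.1 z.2 := by
  rw [continuous_iff_continuousAt]
  intro z
  have hsrc : z.1 ∈ (extChartAt (𝓡 3) z.1).source := mem_extChartAt_source z.1
  have hcont : ContinuousAt (fun z' : 𝒯.Dom => (extChartAt (𝓡 3) z.1 z'.1, (z'.2 : ℝ))) z :=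
    ContinuousAt.prodMk ((continuousAt_extChartAt z.1).comp (f := Prod.fst) (x := z)
      continuousAt_fst) (by fun_prop)
  have h2 := ContinuousAt.comp (f := fun z' : 𝒯.Dom => (extChartAt (𝓡 3) z.1 z'.1, (z'.2 : ℝ)))
    (x := z) (h z.1 _ (Tube.exists_eq_toDom hsrc).1) hcont
  refine h2.congr ?_
  have h1 : ∀ᶠ z' : 𝒯.Dom in 𝓝 z, z'.1 ∈ (extChartAt (𝓡 3) z.1).source :=
    continuous_fst.continuousAt.eventually (extChartAt_source_mem_nhds z.1)
  filter_upwards [h1] with z' hz'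
  have e1 : chartInv z.1 (extChartAt (𝓡 3) z.1 z'.1) = z'.1 :=
    (extChartAt (𝓡 3) z.1).left_inv hz'
  simp only [Function.comp_apply, e1]

theorem Tube.Describes.continuous_deriv (h : 𝒯.Describes γ D) :
    Continuous fun z : 𝒯.Dom => deriv (γ z.1) z.2 := by
  refine Tube.continuous_of_chart (g := fun p t => deriv (γ p) t) fun p₀ y hy => ?_
  refine (contDiffAt_dt (h.contDiffAt hy)).continuousAt.congr ?_
  filter_upwards [(Tube.isOpen_box p₀).mem_nhds hy] with w hw
  exact (h.deriv_eq hw).symm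

theorem Tube.Describes.continuous_deriv_deriv (h : 𝒯.Describes γ D) :
    Continuous fun z : 𝒯.Dom => deriv (deriv (γ z.1)) z.2 := by
  refine Tube.continuous_of_chart (g := fun p t => deriv (deriv (γ p)) t) fun p₀ y hy => ?_
  refine (contDiffAt_dt (contDiffAt_dt (h.contDiffAt hy))).continuousAt.congr ?_
  filter_upwards [(Tube.isOpen_box p₀).mem_nhds hy] with w hw
  exact (h.deriv_deriv_eq hw).symm

theorem Tube.Describes.continuous_unitTangent (h : 𝒯.Describes γ D) (hi : 𝒯.Immersed γ) :
    Continuous fun z : 𝒯.Dom => unitTangent (γ z.1) z.2 :=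
  (h.continuous_deriv.norm.inv₀ fun z => norm_ne_zero_iff.2 (hi z.1 z.2 z.2.2)).smul
    h.continuous_deriv

theorem Tube.Describes.continuous_geodCurv (h : 𝒯.Describes γ D) (hi : 𝒯.Immersed γ) :
    Continuous fun z : 𝒯.Dom => geodCurv (γ z.1) z.2 := by
  simp only [geodCurv_eq]
  refine Continuous.div ?_ (h.continuous_deriv.norm.pow 3)
    fun z => pow_ne_zero 3 (norm_ne_zero_iff.2 (hi z.1 z.2 z.2.2))
  exact h.continuous.det3 h.continuous_deriv h.continuous_deriv_deriv

theorem Tube.Describes.continuous_frame4 (h : 𝒯.Describes γ D) (hi : 𝒯.Immersed γ) :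
    Continuous fun z : 𝒯.Dom => frame4 (γ z.1 z.2) (unitTangent (γ z.1) z.2) :=
  h.continuous.frame4 (h.continuous_unitTangent hi)

theorem Tube.Describes.contAlongAt_mov (h : 𝒯.Describes γ D) (hi : 𝒯.Immersed γ) (j : Fin 4)
    (z : 𝒯.Dom) : ContAlongAt 𝒯.φ (𝒯.mov γ j) z := by
  have hc : ∀ k, ContinuousAt
      (fun z : 𝒯.Dom => frame4 (γ z.1 z.2) (unitTangent (γ z.1) z.2) k j) z :=
    fun k => ((h.continuous_frame4 hi).matrix_elem k j).continuousAt
  have h1 := ContAlongAt.sum_smul (m := 4) (f := 𝒯.φ) (v := 𝒯.vec) (z₀ := z)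
    (c := fun k z => frame4 (γ z.1 z.2) (unitTangent (γ z.1) z.2) k j)
    Tube.continuous_φ.continuousAt (fun k => Tube.contAlongAt_vec k z) hc
  exact h1

theorem LinearIndependent.exists_coeff {v : Fin 4 → EuclideanSpace ℝ (Fin 4)}
    (hv : LinearIndependent ℝ v) (w : EuclideanSpace ℝ (Fin 4)) : ∃ c : Fin 4 → ℝ,
      w = ∑ j, c j • v j := by
  have hf : Module.finrank ℝ (EuclideanSpace ℝ (Fin 4)) = 4 :=
    finrank_euclideanSpace_fin (𝕜 := ℝ) (n := 4)
  have h1 : Submodule.span ℝ (range v) = ⊤ :=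
    hv.span_eq_top_of_card_eq_finrank' (by rw [Fintype.card_fin]; exact hf.symm)
  have h2 : w ∈ Submodule.span ℝ (range v) := h1 ▸ Submodule.mem_top
  obtain ⟨c, hc⟩ := (Submodule.mem_span_range_iff_exists_fun ℝ).1 h2
  exact ⟨c, hc.symm⟩

/-- The components of a framing with respect to the moving frame are continuous. -/
theorem Tube.Describes.exists_matrix (h : 𝒯.Describes γ D) (hi : 𝒯.Immersed γ)
    {F : (q : M) → Fin 4 → TangentSpace (𝓡 4) q} (hF : IsFraming F) :
    ∃ Q : 𝒯.Dom → Matrix (Fin 4) (Fin 4) ℝ, Continuous Q ∧ (∀ z, (Q z).det ≠ 0) ∧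
      ∀ z i, F (𝒯.φ z) i = ∑ j, Q z j i • 𝒯.mov γ j z := by
  have hex : ∀ z i, ∃ c : Fin 4 → ℝ, F (𝒯.φ z) i = ∑ j, c j • 𝒯.mov γ j z := fun z i =>
    LinearIndependent.exists_coeff (h.linearIndependent_mov hi z) (F (𝒯.φ z) i)
  choose c hc using hex
  refine ⟨fun z => Matrix.of fun j i => c z i j, ?_, fun z h0 => ?_, hc⟩
  · refine continuous_matrix fun j i => ?_
    rw [continuous_iff_continuousAt]
    intro z
    refine continuousAt_pi.1 (ContAlongAt.coeff (c := fun z => c z i)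
      (fun j => h.contAlongAt_mov hi j z) (w := fun z => F (𝒯.φ z) i) ?_
      (h.linearIndependent_mov hi z) (Eventually.of_forall fun z => hc z i)) j
    exact ContinuousAt.comp (f := 𝒯.φ) (g := fun q => (⟨q, F q i⟩ : TangentBundle (𝓡 4) M))
      (hF.cont i).continuousAt Tube.continuous_φ.continuousAt
  · obtain ⟨g, hg, hg0⟩ := Matrix.exists_mulVec_eq_zero_iff.2 h0
    apply hg
    funext i
    refine Fintype.linearIndependent_iff.1 (hF.indep (𝒯.φ z)) g ?_ i
    simp only [hc, Finset.smul_sum, smul_smul]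
    rw [Finset.sum_comm]
    refine Finset.sum_eq_zero fun j _ => ?_
    rw [← Finset.sum_smul]
    have h2 := congrFun hg0 j
    simp only [Matrix.mulVec, dotProduct, Matrix.of_apply, Pi.zero_apply] at h2
    have h3 : ∑ i, g i * c z i j = 0 := by
      rw [← h2]
      exact Finset.sum_congr rfl fun i _ => mul_comm _ _
    rw [h3, zero_smul]

end TubeDomain

/-! ### Orientations of the modified Engel structure -/

theorem pos_of_isPreconnected {Y : Type*} [TopologicalSpace Y] {S : Set Y} (hS : IsPreconnected S)
    {f : Y → ℝ} (hf : ContinuousOn f S) (h0 : ∀ y ∈ S, f y ≠ 0) {y₀ y : Y} (hy₀ : y₀ ∈ S)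
    (hpos : 0 < f y₀) (hy : y ∈ S) : 0 < f y := by
  by_contra hcon
  have hlt : f y < 0 := lt_of_le_of_ne (not_lt.1 hcon) (h0 y hy)
  obtain ⟨w, hw, hw0⟩ := hS.intermediate_value hy hy₀ hf ⟨hlt.le, hpos.le⟩
  exact h0 w hw hw0

section Orientation

variable {N : Type*} [TopologicalSpace N] [ChartedSpace (EuclideanSpace ℝ (Fin 3)) N]
  [IsManifold (𝓡 3) ∞ N]
variable {M : Type*} [TopologicalSpace M] [ChartedSpace (EuclideanSpace ℝ (Fin 4)) M]
  [IsManifold (𝓡 4) ∞ M]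
variable {𝒯 : Tube N M} {γ : N → ℝ → E3} {D : TangentDist 4 M}
variable {ι : N → M} {D' : TangentDist 4 M} {δ : ℝ} {A : AdaptedTube ι D}
variable {W X : (q : M) → TangentSpace (𝓡 4) q}

/-- Local smooth vector fields subject to pointwise convex conditions can be glued by a partition of
unity. -/
theorem exists_smoothVec_mem_convex [SigmaCompactSpace M] [T2Space M]
    (t : (q : M) → Set (TangentSpace (𝓡 4) q)) (ht : ∀ q, Convex ℝ (t q))
    (hloc : ∀ q, ∃ V : (q : M) → TangentSpace (𝓡 4) q, ∀ᶠ y in 𝓝 q, SmoothVecAt V y ∧ V y ∈ t y) :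
    ∃ V : (q : M) → TangentSpace (𝓡 4) q, ∀ q, SmoothVecAt V q ∧ V q ∈ t q := by
  obtain ⟨s, hs⟩ := exists_contMDiffSection_forall_mem_convex_of_local (n := ⊤) (𝓡 4)
    (F_fiber := EuclideanSpace ℝ (Fin 4)) (TangentSpace (𝓡 4) : M → Type _) t ht (fun q => by
      obtain ⟨V, hV⟩ := hloc q
      exact ⟨_, hV, V, fun y hy => ContMDiffAt.contMDiffWithinAt hy.1, fun y hy => hy.2⟩)
  exact ⟨s, fun q => ⟨s.contMDiff q, hs q⟩⟩

/-- The coordinates of a point of the tube in a chart of `N`. -/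
noncomputable def Tube.coordsAt (p₀ : N) (z : 𝒯.Dom) : E3 × ℝ := (extChartAt (𝓡 3) p₀ z.1, (z.2 : ℝ))

theorem Tube.continuousAt_coordsAt (z : 𝒯.Dom) : ContinuousAt (Tube.coordsAt z.1) z :=
  ContinuousAt.prodMk ((continuousAt_extChartAt z.1).comp (f := Prod.fst) (x := z)
      continuousAt_fst) (by fun_prop)

theorem Tube.coordsAt_mem {p₀ : N} {z : 𝒯.Dom} (hz : z.1 ∈ (extChartAt (𝓡 3) p₀).source) :
    Tube.coordsAt p₀ z ∈ 𝒯.box p₀ := (Tube.exists_eq_toDom hz).1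

theorem Tube.exists_eq_toDom' {p₀ : N} {z : 𝒯.Dom} (hz : z.1 ∈ (extChartAt (𝓡 3) p₀).source) :
    ∃ y, y = Tube.coordsAt p₀ z ∧ ∃ hy : y ∈ 𝒯.box p₀, z = Tube.toDom p₀ y hy := by
  obtain ⟨hy, hz'⟩ := Tube.exists_eq_toDom hz
  exact ⟨_, rfl, hy, hz'⟩

theorem Tube.eventually_mem_source (z : 𝒯.Dom) :
    ∀ᶠ z' : 𝒯.Dom in 𝓝 z, z'.1 ∈ (extChartAt (𝓡 3) z.1).source :=
  continuous_fst.continuousAt.eventually (extChartAt_source_mem_nhds z.1)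

theorem Tube.smul_mov_add_smul_mov {p₀ : N} {y : E3 × ℝ} (hy : y ∈ 𝒯.box p₀) (a b : ℝ) :
    a • 𝒯.mov γ 0 (Tube.toDom p₀ y hy) + b • 𝒯.mov γ 1 (Tube.toDom p₀ y hy) =
      dparam 4 (𝒯.Ψ p₀) y (b • 𝒯.field γ p₀ y, a) := by
  have e0 : 𝒯.mov γ 0 (Tube.toDom p₀ y hy) = dparam 4 (𝒯.Ψ p₀) y ((0 : E3), (1 : ℝ)) :=
    (Tube.mov_zero _).trans (Tube.tubeT_eq hy)
  have e1 : 𝒯.mov γ 1 (Tube.toDom p₀ y hy) = dparam 4 (𝒯.Ψ p₀) y (𝒯.field γ p₀ y, (0 : ℝ)) :=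
    (Tube.mov_one _).trans (Tube.tubeVec_eq hy _)
  have e2 : ((b • 𝒯.field γ p₀ y, a) : E3 × ℝ) =
      a • ((0 : E3), (1 : ℝ)) + b • (𝒯.field γ p₀ y, (0 : ℝ)) := by simp
  rw [e2, map_add, map_smul, map_smul]
  exact congrArg₂ (· + ·) (congrArg (a • ·) e0) (congrArg (b • ·) e1)

theorem Tube.Describes.inKernel_mov_iff (h : 𝒯.Describes γ D) (hi : 𝒯.Immersed γ) {p₀ : N}
    {z : 𝒯.Dom} (hz : z.1 ∈ (extChartAt (𝓡 3) p₀).source) (a b : ℝ) :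
    InKernel (derivedDist D) (𝒯.φ z) (a • 𝒯.mov γ 0 z + b • 𝒯.mov γ 1 z) ↔
      b * 𝒯.kerA γ p₀ (Tube.coordsAt p₀ z) + a * 𝒯.kerB γ p₀ (Tube.coordsAt p₀ z) = 0 := by
  obtain ⟨y, hyz, hy, hzy⟩ := Tube.exists_eq_toDom' hz
  rw [← hyz]
  clear hyz
  subst hzy
  rw [Tube.smul_mov_add_smul_mov hy]
  exact (h.isImmersedFieldModel hi p₀).inKernel_iff hy a b

theorem Tube.Describes.mem_iff_mov (h : 𝒯.Describes γ D) {z : 𝒯.Dom}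
    {v : TangentSpace (𝓡 4) (𝒯.φ z)} :
    v ∈ D (𝒯.φ z) ↔ ∃ a b : ℝ, v = a • 𝒯.mov γ 0 z + b • 𝒯.mov γ 1 z := by
  have h1 := h.dist_eq z.1 z.2 z.2.2
  have key : ∀ v : TangentSpace (𝓡 4) (𝒯.Φ (z.1, (z.2 : ℝ))),
      v ∈ D (𝒯.Φ (z.1, (z.2 : ℝ))) ↔ ∃ a b : ℝ, v = a • tubeT 𝒯.Φ z.1 z.2 +
        b • tubeVec 𝒯.Φ 𝒯.e z.1 z.2 (γ z.1 z.2) := fun v => by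
    rw [h1]
    refine Submodule.mem_span_pair.trans ?_
    simp only [eq_comm]
  have e0 : 𝒯.mov γ 0 z = tubeT 𝒯.Φ z.1 z.2 := Tube.mov_zero z
  have e1 : 𝒯.mov γ 1 z = tubeVec 𝒯.Φ 𝒯.e z.1 z.2 (γ z.1 z.2) := Tube.mov_one z
  refine (key v).trans (exists_congr fun a => exists_congr fun b => ?_)
  exact Eq.congr_right (congrArg₂ (· + ·) (congrArg (a • ·) e0.symm) (congrArg (b • ·) e1.symm))

theorem Tube.Describes.mov_unique (h : 𝒯.Describes γ D) (hi : 𝒯.Immersed γ) {z : 𝒯.Dom}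
    {a b a' b' : ℝ} (he : a • 𝒯.mov γ 0 z + b • 𝒯.mov γ 1 z =
      a' • 𝒯.mov γ 0 z + b' • 𝒯.mov γ 1 z) : a = a' ∧ b = b' := by
  have h1 := Fintype.linearIndependent_iff.1 (h.linearIndependent_mov hi z)
    ![a - a', b - b', 0, 0] (by
      simp only [Fin.sum_univ_four, Matrix.cons_val_zero, Matrix.cons_val_one, Matrix.cons_val,
        zero_smul, add_zero, sub_smul]
      rw [sub_add_sub_comm, he, sub_self])
  exact ⟨sub_eq_zero.1 (h1 0), sub_eq_zero.1 (h1 1)⟩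

/-- A continuous section of the plane field has continuous coefficients. -/
theorem Tube.Describes.exists_coeff (h : 𝒯.Describes γ D) (hi : 𝒯.Immersed γ)
    {V : (q : M) → TangentSpace (𝓡 4) q}
    (hV : ∀ q, ContinuousAt (fun q => (⟨q, V q⟩ : TangentBundle (𝓡 4) M)) q)
    (hVD : ∀ z, V (𝒯.φ z) ∈ D (𝒯.φ z)) :
    ∃ a b : 𝒯.Dom → ℝ, Continuous a ∧ Continuous b ∧
      ∀ z, V (𝒯.φ z) = a z • 𝒯.mov γ 0 z + b z • 𝒯.mov γ 1 z := by
  choose a b hab using fun z => h.mem_iff_mov.1 (hVD z)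
  have hc : ∀ z, ContinuousAt (fun z => (![a z, b z, 0, 0] : Fin 4 → ℝ)) z := fun z =>
    ContAlongAt.coeff (fun j => h.contAlongAt_mov hi j z) (w := fun z => V (𝒯.φ z))
      (ContinuousAt.comp (f := 𝒯.φ) (g := fun q => (⟨q, V q⟩ : TangentBundle (𝓡 4) M))
        (hV _) Tube.continuous_φ.continuousAt)
      (h.linearIndependent_mov hi z) (Eventually.of_forall fun z => by
        rw [hab z]
        simp only [Fin.sum_univ_four, Matrix.cons_val_zero, Matrix.cons_val_one, Matrix.cons_val,
          zero_smul, add_zero])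
  exact ⟨a, b, continuous_iff_continuousAt.2 fun z => continuousAt_pi.1 (hc z) 0,
    continuous_iff_continuousAt.2 fun z => continuousAt_pi.1 (hc z) 1, hab⟩

theorem Tube.Describes.exists_local_section (h : 𝒯.Describes γ D) (z₀ : 𝒯.Dom)
    {r c : E3 × ℝ → ℝ} (hr : ∀ y ∈ 𝒯.box z₀.1, ContDiffAt ℝ ∞ r y)
    (hc : ∀ y ∈ 𝒯.box z₀.1, ContDiffAt ℝ ∞ c y) :
    ∃ V : (q : M) → TangentSpace (𝓡 4) q, ∀ᶠ z in 𝓝 z₀, SmoothVecAt V (𝒯.φ z) ∧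
      V (𝒯.φ z) = r (Tube.coordsAt z₀.1 z) • 𝒯.mov γ 0 z +
        c (Tube.coordsAt z₀.1 z) • 𝒯.mov γ 1 z := by
  have hm := h.isFieldModel z₀.1
  have hy₀ := Tube.coordsAt_mem (𝒯 := 𝒯) (mem_extChartAt_source (I := 𝓡 3) z₀.1)
  obtain ⟨V, hV, hVs⟩ := hm.exists_field hy₀
    (u := fun y => c y • 𝒯.field γ z₀.1 y) (r := r) (fun y hy => (hc y hy).smul (hm.smooth y hy)) hr
  have hΨ : 𝒯.Ψ z₀.1 (Tube.coordsAt z₀.1 z₀) = 𝒯.φ z₀ := by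
    simp only [Tube.Ψ, Tube.coordsAt, chartInv_self]
    rfl
  rw [hΨ] at hVs
  refine ⟨V, ?_⟩
  filter_upwards [Tube.eventually_mem_source z₀, Tube.continuous_φ.continuousAt.eventually hVs,
    (Tube.continuousAt_coordsAt z₀).eventually hV] with z h1 h2 h3
  refine ⟨h2, ?_⟩
  obtain ⟨y, hyz, hy, hzy⟩ := Tube.exists_eq_toDom' h1
  rw [← hyz] at h3 ⊢
  clear hyz
  subst hzy
  exact h3.trans (Tube.smul_mov_add_smul_mov hy _ _).symm

/-- Two vectors with components `(a', b')` and `(a, b)` in a plane are compatible if they point to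
the same side of the first axis, or if both lie on this axis and have the same direction. -/
def SameSide (a' b' a b : ℝ) : Prop := 0 < b' * b ∨ (b = 0 ∧ b' = 0 ∧ 0 < a' * a)

theorem SameSide.ne_zero {a' b' a b : ℝ} (h : SameSide a' b' a b) : a' ≠ 0 ∨ b' ≠ 0 := by
  rcases h with h | ⟨-, -, h⟩
  · exact Or.inr (left_ne_zero_of_mul h.ne')
  · exact Or.inl (left_ne_zero_of_mul h.ne')

/-- `SameSide` is a convex condition on its first two arguments, as the gluing of local fields by a
partition of unity requires. -/
theorem SameSide.convexComb {a' b' a'' b'' a b s t : ℝ} (h : SameSide a' b' a b)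
    (h' : SameSide a'' b'' a b) (hs : 0 ≤ s) (ht : 0 ≤ t) (hst : s + t = 1) :
    SameSide (s * a' + t * a'') (s * b' + t * b'') a b := by
  have key : ∀ x y : ℝ, 0 < x → 0 < y → 0 < s * x + t * y := by
    intro x y hx hy
    rcases hs.eq_or_lt with rfl | hs'
    · have : t = 1 := by linarith
      subst this; linarith
    · have := mul_pos hs' hx
      have := mul_nonneg ht hy.le
      linarith
  rcases h with h | ⟨h1, h2, h3⟩
  · rcases h' with h' | ⟨h1', -, -⟩
    · left
      have := key _ _ h h'
      linarith
    · rw [h1', mul_zero] at h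
      exact absurd h (lt_irrefl 0)
  · rcases h' with h' | ⟨-, h2', h3'⟩
    · rw [h1, mul_zero] at h'
      exact absurd h' (lt_irrefl 0)
    · right
      refine ⟨h1, by rw [h2, h2']; ring, ?_⟩
      have := key _ _ h3 h3'
      linarith

theorem SameSide.self {a b : ℝ} (h : a ≠ 0 ∨ b ≠ 0) : SameSide a b a b := by
  by_cases hb : b = 0
  · exact Or.inr ⟨hb, hb, mul_self_pos.2 (h.resolve_right (by simp [hb]))⟩
  · exact Or.inl (mul_self_pos.2 hb)

theorem SameSide.pos_of_smul {a b μ : ℝ} (h : SameSide (μ * a) (μ * b) a b) : 0 < μ := by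
  rcases h with h | ⟨-, -, h⟩
  · nlinarith [mul_self_nonneg b]
  · nlinarith [mul_self_nonneg a]

/-! ### Construction of the oriented frame -/

theorem EngelTorsion.mov_eq (L : EngelTorsion δ A D') {z : A.tube.Dom} (hz : L.a ≤ |(z.2 : ℝ)|) :
    A.tube.mov L.lam 0 z = A.tube.mov A.H 0 z ∧ A.tube.mov L.lam 1 z = A.tube.mov A.H 1 z := by
  rw [Tube.mov_zero, Tube.mov_zero, Tube.mov_one, Tube.mov_one, L.lam_eq z.1 z.2 z.2.2 hz]
  exact ⟨rfl, rfl⟩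

theorem EngelTorsion.φ_mem_outside_iff (L : EngelTorsion δ A D') {z : A.tube.Dom} :
    A.tube.φ z ∈ L.outside ↔ L.a < |(z.2 : ℝ)| := by
  rw [← not_le, EngelTorsion.outside, mem_compl_iff, not_iff_not]
  constructor
  · rintro ⟨⟨p, t⟩, ht, h⟩
    have h1 : t ∈ Ioo (-A.ε) A.ε := ⟨by linarith [ht.2.1, L.a_lt], by linarith [ht.2.2, L.a_lt]⟩
    have h2 : (⟨p, ⟨t, h1⟩⟩ : A.tube.Dom) = z := Tube.injective_φ (𝒯 := A.tube) h
    rw [← h2]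
    exact abs_le.2 ht.2
  · intro h
    exact ⟨(z.1, (z.2 : ℝ)), ⟨mem_univ _, abs_le.1 h⟩, rfl⟩

theorem EngelTorsion.mem_outside_or' (L : EngelTorsion δ A D') (q : M) :
    q ∈ L.outside ∨ ∃ z : A.tube.Dom, |(z.2 : ℝ)| ≤ L.a ∧ q = A.tube.φ z := by
  rcases L.mem_outside_or q with h | ⟨p, t, ht, ht', rfl⟩
  · exact Or.inl h
  · exact Or.inr ⟨(p, ⟨t, ht'⟩), abs_le.2 ht, rfl⟩

/-- A number between the size of the modification and the size of the tube. -/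
noncomputable def EngelTorsion.b (L : EngelTorsion δ A D') : ℝ := (L.a + A.ε) / 2

theorem EngelTorsion.a_lt_b (L : EngelTorsion δ A D') : L.a < L.b := by
  have := L.a_lt; unfold EngelTorsion.b; linarith

theorem EngelTorsion.b_lt (L : EngelTorsion δ A D') : L.b < A.ε := by
  have := L.a_lt; unfold EngelTorsion.b; linarith

theorem EngelTorsion.inKernel_iff [T2Space M] [CompactSpace N] (L : EngelTorsion δ A D') {q : M}
    (hq : q ∈ L.outside) {v : TangentSpace (𝓡 4) q} :
    InKernel (derivedDist D') q v ↔ InKernel (derivedDist D) q v := by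
  have h1 := eventually_derivedDist_congr (L.eventually_eq hq)
  exact ⟨fun h => h.congr (h1.mono fun _ e => e.symm), fun h => h.congr h1⟩

theorem IsEngelPair.ne_zero (h : IsEngelPair D W X) (q : M) : W q ≠ 0 := fun h0 => by
  have := LinearIndependent.ne_zero 0 (h.indep q)
  exact this h0

variable [SigmaCompactSpace M] [T2Space M] [CompactSpace N]

/-- The kernel line field of the modified structure is spanned by a vector field that agrees with
the given one away from the modification. -/
theorem EngelTorsion.exists_W (L : EngelTorsion δ A D') (hD : IsEngel D)
    (hWX : IsEngelPair D W X) {a b : A.tube.Dom → ℝ} (ha : Continuous a) (hb : Continuous b)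
    (hW : ∀ z, W (A.tube.φ z) = a z • A.tube.mov A.H 0 z + b z • A.tube.mov A.H 1 z) :
    ∃ W₁ : (q : M) → TangentSpace (𝓡 4) q, (∀ q, SmoothVecAt W₁ q) ∧
      (∀ q, q ∉ A.tube.φ '' {z | |(z.2 : ℝ)| < L.b} → W₁ q = W q) ∧
      ∀ z, ∃ a' b' : ℝ, W₁ (A.tube.φ z) =
          a' • A.tube.mov L.lam 0 z + b' • A.tube.mov L.lam 1 z ∧
        InKernel (derivedDist D') (A.tube.φ z) (W₁ (A.tube.φ z)) ∧ SameSide a' b' (a z) (b z) := by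
  let P : (z : A.tube.Dom) → TangentSpace (𝓡 4) (A.tube.φ z) → Prop := fun z v =>
    ∃ a' b' : ℝ, v = a' • A.tube.mov L.lam 0 z + b' • A.tube.mov L.lam 1 z ∧
      InKernel (derivedDist D') (A.tube.φ z) v ∧ SameSide a' b' (a z) (b z)
  let C : Set M := A.tube.φ '' {z | |(z.2 : ℝ)| < L.b}
  let t : (q : M) → Set (TangentSpace (𝓡 4) q) := fun q =>
    {v | (q ∉ C → v = W q) ∧ ∀ z, A.tube.φ z = q → P z v}
  have hdesc := A.describes
  have himm := A.immersed hD
  have hdesc' := L.describes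
  have himm' := L.immersed
  have ht : ∀ q, Convex ℝ (t q) := by
    rintro q v ⟨hv1, hv2⟩ w ⟨hw1, hw2⟩ r s hr hs hrs
    refine ⟨fun hq => ?_, ?_⟩
    · rw [hv1 hq, hw1 hq, ← add_smul, hrs, one_smul]
    · rintro z rfl
      obtain ⟨a₁, b₁, e1, k1, s1⟩ := hv2 z rfl
      obtain ⟨a₂, b₂, e2, k2, s2⟩ := hw2 z rfl
      have e3 : r • v + s • w = (r * a₁ + s * a₂) • A.tube.mov L.lam 0 z +
          (r * b₁ + s * b₂) • A.tube.mov L.lam 1 z := by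
        rw [e1, e2]; module
      refine ⟨_, _, e3, ?_, s1.convexComb s2 hr hs hrs⟩
      have hsrc := mem_extChartAt_source (I := 𝓡 3) z.1
      rw [e1, hdesc'.inKernel_mov_iff himm' hsrc] at k1
      rw [e2, hdesc'.inKernel_mov_iff himm' hsrc] at k2
      rw [e3, hdesc'.inKernel_mov_iff himm' hsrc]
      linear_combination r * k1 + s * k2
  have hab : ∀ z, a z ≠ 0 ∨ b z ≠ 0 := by
    intro z
    by_contra! hcon
    apply hWX.ne_zero (A.tube.φ z)
    rw [hW z, hcon.1, hcon.2, zero_smul, zero_smul, add_zero]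
  have hloc : ∀ q, ∃ V : (q : M) → TangentSpace (𝓡 4) q,
      ∀ᶠ y in 𝓝 q, SmoothVecAt V y ∧ V y ∈ t y := by
    intro q
    rcases L.mem_outside_or' q with hq | ⟨z₀, hz₀, rfl⟩
    · refine ⟨W, ?_⟩
      filter_upwards [L.isOpen_outside.mem_nhds hq] with y hy
      refine ⟨hWX.smooth_W y, fun _ => rfl, ?_⟩
      rintro z rfl
      have h1 := L.φ_mem_outside_iff.1 hy
      obtain ⟨e0, e1⟩ := L.mov_eq h1.le
      exact ⟨a z, b z, by rw [e0, e1]; exact hW z,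
        (L.inKernel_iff hy).2 (hWX.kernel_W _), SameSide.self (hab z)⟩
    · -- the kernel field `± (A ∂_t - B γ)`, with the sign that makes it compatible with `W`
      set p₀ := z₀.1 with hp₀
      have hm := hdesc'.isFieldModel p₀
      have hm₀ := hdesc.isFieldModel p₀
      let g : A.tube.Dom → ℝ := fun z => a z * A.tube.kerA A.H p₀ (Tube.coordsAt p₀ z) -
        b z * A.tube.kerB A.H p₀ (Tube.coordsAt p₀ z)
      have smA : ∀ (γ : N → ℝ → E3) (D : TangentDist 4 M), A.tube.Describes γ D →
          ∀ y ∈ A.tube.box p₀, ContDiffAt ℝ ∞ (A.tube.kerA γ p₀) y := fun γ D h y hy =>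
        contDiffAt_det3 ((h.isFieldModel p₀).smooth y hy)
          (contDiffAt_dt ((h.isFieldModel p₀).smooth y hy))
          (contDiffAt_spaceBracket ((h.isFieldModel p₀).smooth y hy))
      have smB : ∀ (γ : N → ℝ → E3) (D : TangentDist 4 M), A.tube.Describes γ D →
          ∀ y ∈ A.tube.box p₀, ContDiffAt ℝ ∞ (A.tube.kerB γ p₀) y := fun γ D h y hy =>
        contDiffAt_det3 ((h.isFieldModel p₀).smooth y hy)
          (contDiffAt_dt ((h.isFieldModel p₀).smooth y hy))
          (contDiffAt_dt (contDiffAt_dt ((h.isFieldModel p₀).smooth y hy)))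
      have hsrc₀ := mem_extChartAt_source (I := 𝓡 3) z₀.1
      have hy₀ : Tube.coordsAt p₀ z₀ ∈ A.tube.box p₀ := Tube.coordsAt_mem hsrc₀
      have hcA : ContinuousAt (fun z : A.tube.Dom => A.tube.kerA A.H p₀ (Tube.coordsAt p₀ z)) z₀ :=
        ContinuousAt.comp (f := Tube.coordsAt p₀) (smA _ _ hdesc _ hy₀).continuousAt
          (Tube.continuousAt_coordsAt z₀)
      have hcB : ContinuousAt (fun z : A.tube.Dom => A.tube.kerB A.H p₀ (Tube.coordsAt p₀ z)) z₀ :=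
        ContinuousAt.comp (f := Tube.coordsAt p₀) (smB _ _ hdesc _ hy₀).continuousAt
          (Tube.continuousAt_coordsAt z₀)
      have hgc : ContinuousAt g z₀ :=
        (ha.continuousAt.mul hcA).sub (hb.continuousAt.mul hcB)
      -- `W` is a nonzero multiple of the kernel field of the original structure
      have hker : ∀ z : A.tube.Dom, z.1 ∈ (extChartAt (𝓡 3) p₀).source → ∃ μ : ℝ,
          a z = μ * A.tube.kerA A.H p₀ (Tube.coordsAt p₀ z) ∧
          b z = -(μ * A.tube.kerB A.H p₀ (Tube.coordsAt p₀ z)) ∧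
          g z = μ * (A.tube.kerA A.H p₀ (Tube.coordsAt p₀ z) ^ 2 +
            A.tube.kerB A.H p₀ (Tube.coordsAt p₀ z) ^ 2) := by
        intro z hz
        have h1 := hWX.kernel_W (A.tube.φ z)
        rw [hW z, hdesc.inKernel_mov_iff himm hz] at h1
        have h2 : A.tube.kerA A.H p₀ (Tube.coordsAt p₀ z) ^ 2 +
            A.tube.kerB A.H p₀ (Tube.coordsAt p₀ z) ^ 2 ≠ 0 := by
          intro h0
          rcases L.kernel_compat hD hWX (Tube.coordsAt_mem hz) with h3 | h3
          · have := right_ne_zero_of_mul h3.2.2.ne'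
            have : 0 < A.tube.kerA A.H p₀ (Tube.coordsAt p₀ z) ^ 2 := by positivity
            nlinarith [sq_nonneg (A.tube.kerB A.H p₀ (Tube.coordsAt p₀ z))]
          · have := right_ne_zero_of_mul h3.ne'
            have : 0 < A.tube.kerB A.H p₀ (Tube.coordsAt p₀ z) ^ 2 := by positivity
            nlinarith [sq_nonneg (A.tube.kerA A.H p₀ (Tube.coordsAt p₀ z))]
        refine ⟨g z / (A.tube.kerA A.H p₀ (Tube.coordsAt p₀ z) ^ 2 +
            A.tube.kerB A.H p₀ (Tube.coordsAt p₀ z) ^ 2), ?_, ?_, ?_⟩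
        · field_simp
          simp only [g]
          linear_combination A.tube.kerB A.H p₀ (Tube.coordsAt p₀ z) * h1
        · field_simp
          simp only [g]
          linear_combination A.tube.kerA A.H p₀ (Tube.coordsAt p₀ z) * h1
        · field_simp
      have hg0 : g z₀ ≠ 0 := by
        obtain ⟨μ, h1, h2, h3⟩ := hker z₀ hsrc₀
        intro h0
        rw [h0] at h3
        have hμ : μ ≠ 0 := by
          rintro rfl
          rcases hab z₀ with h4 | h4
          · exact h4 (by rw [h1, zero_mul])
          · exact h4 (by rw [h2, zero_mul, neg_zero])
        have h4 := (mul_eq_zero.1 h3.symm).resolve_left hμ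
        have h5 : A.tube.kerA A.H p₀ (Tube.coordsAt p₀ z₀) = 0 := by
          nlinarith [sq_nonneg (A.tube.kerA A.H p₀ (Tube.coordsAt p₀ z₀)),
            sq_nonneg (A.tube.kerB A.H p₀ (Tube.coordsAt p₀ z₀))]
        have h6 : A.tube.kerB A.H p₀ (Tube.coordsAt p₀ z₀) = 0 := by
          nlinarith [sq_nonneg (A.tube.kerA A.H p₀ (Tube.coordsAt p₀ z₀)),
            sq_nonneg (A.tube.kerB A.H p₀ (Tube.coordsAt p₀ z₀))]
        rcases hab z₀ with h4 | h4
        · exact h4 (by rw [h1, h5, mul_zero])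
        · exact h4 (by rw [h2, h6, mul_zero, neg_zero])
      obtain ⟨V, hV⟩ := hdesc'.exists_local_section z₀
        (r := fun y => g z₀ * A.tube.kerA L.lam p₀ y)
        (c := fun y => -(g z₀ * A.tube.kerB L.lam p₀ y))
        (fun y hy => contDiffAt_const.mul (smA _ _ hdesc' y hy))
        (fun y hy => (contDiffAt_const.mul (smB _ _ hdesc' y hy)).neg)
      refine ⟨V, ?_⟩
      rw [← (Tube.isOpenEmbedding_φ (𝒯 := A.tube)).map_nhds_eq, eventually_map]
      have hgpos : ∀ᶠ z in 𝓝 z₀, 0 < g z₀ * g z :=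
        (continuousAt_const.mul hgc).eventually (lt_mem_nhds (mul_self_pos.2 hg0))
      have hlt : ∀ᶠ z : A.tube.Dom in 𝓝 z₀, |(z.2 : ℝ)| < L.b := by
        have : Continuous fun z : A.tube.Dom => |(z.2 : ℝ)| := by fun_prop
        exact this.continuousAt.eventually (gt_mem_nhds (hz₀.trans_lt L.a_lt_b))
      filter_upwards [hV, hgpos, hlt, Tube.eventually_mem_source z₀] with z h1 h2 h3 h4
      refine ⟨h1.1, fun h5 => absurd ⟨z, h3, rfl⟩ h5, ?_⟩
      intro z' hz'
      obtain rfl := Tube.injective_φ (𝒯 := A.tube) hz'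
      refine ⟨_, _, h1.2, ?_, ?_⟩
      · rw [h1.2, hdesc'.inKernel_mov_iff himm' h4]
        ring
      · obtain ⟨μ, k1, k2, k3⟩ := hker z' h4
        have hμ : 0 < g z₀ * μ := by
          rw [k3, ← mul_assoc] at h2
          exact (pos_iff_pos_of_mul_pos h2).2 (lt_of_le_of_ne (by positivity) (fun h => by
            rw [← h, mul_zero] at h2; exact lt_irrefl _ h2))
        rcases L.kernel_compat hD hWX (Tube.coordsAt_mem h4) with ⟨m1, m2, m3⟩ | m
        · right
          refine ⟨by rw [k2, m1, mul_zero, neg_zero], by rw [m2, mul_zero, neg_zero], ?_⟩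
          rw [k1]
          have := mul_pos hμ m3
          linarith
        · left
          rw [k2]
          have := mul_pos hμ m
          linarith
  obtain ⟨W₁, h1⟩ := exists_smoothVec_mem_convex t ht hloc
  exact ⟨W₁, fun q => (h1 q).1, fun q hq => (h1 q).2.1 hq, fun z => (h1 _).2.2 z rfl⟩

/-- A second vector field, completing the kernel field `w₁ ∂_t + w₂ lam` to an oriented frame of the
modified plane field and equal to `X` away from the modification; `d` prescribes the orientation. -/
theorem EngelTorsion.exists_X (L : EngelTorsion δ A D') (hWX : IsEngelPair D W X)
    {d w₁ w₂ : A.tube.Dom → ℝ} (hd : Continuous d) (hw₁ : Continuous w₁) (hw₂ : Continuous w₂)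
    (hd0 : ∀ z, d z ≠ 0) (hw0 : ∀ z, w₁ z ≠ 0 ∨ w₂ z ≠ 0)
    (hX : ∀ z : A.tube.Dom, L.a < |(z.2 : ℝ)| → ∃ c' d' : ℝ, X (A.tube.φ z) =
      c' • A.tube.mov L.lam 0 z + d' • A.tube.mov L.lam 1 z ∧
        0 < (w₁ z * d' - w₂ z * c') * d z) :
    ∃ X₁ : (q : M) → TangentSpace (𝓡 4) q, (∀ q, SmoothVecAt X₁ q) ∧
      (∀ q, q ∉ A.tube.φ '' {z | |(z.2 : ℝ)| < L.b} → X₁ q = X q) ∧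
      ∀ z, ∃ c' d' : ℝ, X₁ (A.tube.φ z) =
        c' • A.tube.mov L.lam 0 z + d' • A.tube.mov L.lam 1 z ∧
          0 < (w₁ z * d' - w₂ z * c') * d z := by
  let P : (z : A.tube.Dom) → TangentSpace (𝓡 4) (A.tube.φ z) → Prop := fun z v =>
    ∃ c' d' : ℝ, v = c' • A.tube.mov L.lam 0 z + d' • A.tube.mov L.lam 1 z ∧
      0 < (w₁ z * d' - w₂ z * c') * d z
  let C : Set M := A.tube.φ '' {z | |(z.2 : ℝ)| < L.b}
  let t : (q : M) → Set (TangentSpace (𝓡 4) q) := fun q =>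
    {v | (q ∉ C → v = X q) ∧ ∀ z, A.tube.φ z = q → P z v}
  have ht : ∀ q, Convex ℝ (t q) := by
    rintro q v ⟨hv1, hv2⟩ w ⟨hw1, hw2⟩ r s hr hs hrs
    refine ⟨fun hq => ?_, ?_⟩
    · rw [hv1 hq, hw1 hq, ← add_smul, hrs, one_smul]
    · rintro z rfl
      obtain ⟨a₁, b₁, e1, k1⟩ := hv2 z rfl
      obtain ⟨a₂, b₂, e2, k2⟩ := hw2 z rfl
      have e3 : r • v + s • w = (r * a₁ + s * a₂) • A.tube.mov L.lam 0 z +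
          (r * b₁ + s * b₂) • A.tube.mov L.lam 1 z := by
        rw [e1, e2]; module
      refine ⟨_, _, e3, ?_⟩
      have h3 := (convex_Ioi (0 : ℝ)) k1 k2 hr hs hrs
      simp only [smul_eq_mul, mem_Ioi] at h3
      linarith
  have hloc : ∀ q, ∃ V : (q : M) → TangentSpace (𝓡 4) q,
      ∀ᶠ y in 𝓝 q, SmoothVecAt V y ∧ V y ∈ t y := by
    intro q
    rcases L.mem_outside_or' q with hq | ⟨z₀, hz₀, rfl⟩
    · refine ⟨X, ?_⟩
      filter_upwards [L.isOpen_outside.mem_nhds hq] with y hy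
      refine ⟨hWX.smooth_X y, fun _ => rfl, ?_⟩
      rintro z rfl
      exact hX z (L.φ_mem_outside_iff.1 hy)
    · -- a combination with constant coefficients
      obtain ⟨V, hV⟩ := L.describes.exists_local_section z₀
        (r := fun _ => -(w₂ z₀ * d z₀)) (c := fun _ => w₁ z₀ * d z₀)
        (fun y hy => contDiffAt_const) (fun y hy => contDiffAt_const)
      refine ⟨V, ?_⟩
      rw [← (Tube.isOpenEmbedding_φ (𝒯 := A.tube)).map_nhds_eq, eventually_map]
      have hpos : ∀ᶠ z in 𝓝 z₀, 0 <
          (w₁ z * (w₁ z₀ * d z₀) - w₂ z * (-(w₂ z₀ * d z₀))) * d z := by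
        have hc : Continuous fun z =>
          (w₁ z * (w₁ z₀ * d z₀) - w₂ z * (-(w₂ z₀ * d z₀))) * d z := by fun_prop
        refine hc.continuousAt.eventually (lt_mem_nhds ?_)
        have h1 : 0 < d z₀ ^ 2 := by have := hd0 z₀; positivity
        have h2 : 0 < w₁ z₀ ^ 2 + w₂ z₀ ^ 2 := by
          rcases hw0 z₀ with h | h
          · have : 0 < w₁ z₀ ^ 2 := by positivity
            nlinarith [sq_nonneg (w₂ z₀)]
          · have : 0 < w₂ z₀ ^ 2 := by positivity
            nlinarith [sq_nonneg (w₁ z₀)]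
        have := mul_pos h1 h2
        linarith
      have hlt : ∀ᶠ z : A.tube.Dom in 𝓝 z₀, |(z.2 : ℝ)| < L.b := by
        have : Continuous fun z : A.tube.Dom => |(z.2 : ℝ)| := by fun_prop
        exact this.continuousAt.eventually (gt_mem_nhds (hz₀.trans_lt L.a_lt_b))
      filter_upwards [hV, hpos, hlt] with z h1 h2 h3
      refine ⟨h1.1, fun h5 => absurd ⟨z, h3, rfl⟩ h5, ?_⟩
      intro z' hz'
      obtain rfl := Tube.injective_φ (𝒯 := A.tube) hz'
      exact ⟨_, _, h1.2, h2⟩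
  obtain ⟨X₁, h1⟩ := exists_smoothVec_mem_convex t ht hloc
  exact ⟨X₁, fun q => (h1 q).1, fun q hq => (h1 q).2.1 hq, fun z => (h1 _).2.2 z rfl⟩

end Orientation

/-! ### Existence and uniqueness of the orientations -/

section OrientedPair

variable {N : Type*} [TopologicalSpace N] [ChartedSpace (EuclideanSpace ℝ (Fin 3)) N]
  [IsManifold (𝓡 3) ∞ N]
variable {M : Type*} [TopologicalSpace M] [ChartedSpace (EuclideanSpace ℝ (Fin 4)) M]
  [IsManifold (𝓡 4) ∞ M]
variable {𝒯 : Tube N M} {γ : N → ℝ → E3} {D : TangentDist 4 M}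
variable {ι : N → M} {D' : TangentDist 4 M} {δ : ℝ} {A : AdaptedTube ι D}
variable {W X W₁ X₁ W' X' : (q : M) → TangentSpace (𝓡 4) q}

/-- At every point of the tube, the frame `(W₁, X₁)` of the modified plane field induces the same
orientation of the plane, identified with the original one by means of the moving frames, as
`(W, X)`, and its first vector points to the same side. -/
def EngelTorsion.Compatible (L : EngelTorsion δ A D') (W X W₁ X₁ : (q : M) → TangentSpace (𝓡 4) q) :
    Prop :=
  ∀ (z : A.tube.Dom) (a b c d a' b' c' d' : ℝ),
    W (A.tube.φ z) = a • A.tube.mov A.H 0 z + b • A.tube.mov A.H 1 z →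
    X (A.tube.φ z) = c • A.tube.mov A.H 0 z + d • A.tube.mov A.H 1 z →
    W₁ (A.tube.φ z) = a' • A.tube.mov L.lam 0 z + b' • A.tube.mov L.lam 1 z →
    X₁ (A.tube.φ z) = c' • A.tube.mov L.lam 0 z + d' • A.tube.mov L.lam 1 z →
    SameSide a' b' a b ∧ 0 < (a' * d' - b' * c') * (a * d - b * c)

theorem Tube.Describes.linearIndependent_pair_iff (h : 𝒯.Describes γ D) (hi : 𝒯.Immersed γ)
    {z : 𝒯.Dom} {v w : TangentSpace (𝓡 4) (𝒯.φ z)} {a b c d : ℝ}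
    (hv : v = a • 𝒯.mov γ 0 z + b • 𝒯.mov γ 1 z) (hw : w = c • 𝒯.mov γ 0 z + d • 𝒯.mov γ 1 z) :
    LinearIndependent ℝ ![v, w] ↔ a * d - b * c ≠ 0 := by
  have hlin : ∀ s t : ℝ, s • v + t • w = (s * a + t * c) • 𝒯.mov γ 0 z +
      (s * b + t * d) • 𝒯.mov γ 1 z := by
    intro s t
    rw [hv, hw]; module
  have hz : ∀ s t : ℝ, s • v + t • w = 0 ↔ s * a + t * c = 0 ∧ s * b + t * d = 0 := by
    intro s t
    rw [hlin]
    constructor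
    · intro h0
      exact h.mov_unique hi (h0.trans (by rw [zero_smul, zero_smul, add_zero]))
    · rintro ⟨h1, h2⟩
      rw [h1, h2, zero_smul, zero_smul, add_zero]
  rw [LinearIndependent.pair_iff]
  constructor
  · intro h1 h2
    have e1 := h1 d (-b) ((hz _ _).2 ⟨by linear_combination h2, by ring⟩)
    have e2 := h1 (-c) a ((hz _ _).2 ⟨by ring, by linear_combination h2⟩)
    have ha : a = 0 := e2.2
    have hb : b = 0 := neg_eq_zero.1 e1.2
    have e3 := h1 1 0 ((hz _ _).2 ⟨by rw [ha]; ring_nf, by rw [hb]; ring_nf⟩)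
    exact one_ne_zero e3.1
  · intro h1 s t hst
    obtain ⟨e1, e2⟩ := (hz s t).1 hst
    constructor
    · refine (mul_eq_zero.1 (?_ : s * (a * d - b * c) = 0)).resolve_right h1
      linear_combination d * e1 - c * e2
    · refine (mul_eq_zero.1 (?_ : t * (a * d - b * c) = 0)).resolve_right h1
      linear_combination a * e2 - b * e1

variable [SigmaCompactSpace M] [T2Space M] [CompactSpace N]

/-- On the outside, fields spanning the two kernel lines that point to the same side are positive
multiples of each other. -/
theorem EngelTorsion.exists_pos_smul (L : EngelTorsion δ A D') (hD : IsEngel D)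
    (hWX : IsEngelPair D W X) {z : A.tube.Dom} (hz : L.a < |(z.2 : ℝ)|)
    {w : TangentSpace (𝓡 4) (A.tube.φ z)} (hw : InKernel (derivedDist D') (A.tube.φ z) w)
    {a b a' b' : ℝ}
    (hW : W (A.tube.φ z) = a • A.tube.mov A.H 0 z + b • A.tube.mov A.H 1 z)
    (hw' : w = a' • A.tube.mov L.lam 0 z + b' • A.tube.mov L.lam 1 z) (hs : SameSide a' b' a b) :
    ∃ μ : ℝ, 0 < μ ∧ w = μ • W (A.tube.φ z) ∧ a' = μ * a ∧ b' = μ * b := by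
  have hout := L.φ_mem_outside_iff.2 hz
  obtain ⟨μ, hμ⟩ := hWX.exists_eq_smul_of_inKernel hD ((L.inKernel_iff hout).1 hw)
  obtain ⟨e0, e1⟩ := L.mov_eq hz.le
  have h1 : a' • A.tube.mov A.H 0 z + b' • A.tube.mov A.H 1 z =
      (μ * a) • A.tube.mov A.H 0 z + (μ * b) • A.tube.mov A.H 1 z := by
    rw [← e0, ← e1, ← hw', hμ, hW, e0, e1]; module
  obtain ⟨h2, h3⟩ := A.describes.mov_unique (A.immersed hD) h1
  rw [h2, h3] at hs
  exact ⟨μ, hs.pos_of_smul, hμ, h2, h3⟩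

/-- The modified structure carries an oriented frame that extends the given one from the outside and
is compatible with it inside the tube. -/
theorem EngelTorsion.exists_pair (L : EngelTorsion δ A D') (hD : IsEngel D)
    (hWX : IsEngelPair D W X) :
    ∃ W₁ X₁ : (q : M) → TangentSpace (𝓡 4) q, IsEngelPair D' W₁ X₁ ∧
      SameOrientationOn L.outside W X W₁ X₁ ∧
      (∀ q, q ∉ A.tube.φ '' {z | |(z.2 : ℝ)| < L.b} → W₁ q = W q ∧ X₁ q = X q) ∧
      L.Compatible W X W₁ X₁ := by
  have hD' := L.isEngel hD hWX
  have hdesc := A.describes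
  have himm := A.immersed hD
  have hdesc' := L.describes
  have himm' := L.immersed
  obtain ⟨a, b, ha, hb, hab⟩ := hdesc.exists_coeff himm
    (fun q => (hWX.smooth_W q).continuousAt) (fun z => hWX.mem_W _)
  obtain ⟨c, d, hc, hd, hcd⟩ := hdesc.exists_coeff himm
    (fun q => (hWX.smooth_X q).continuousAt) (fun z => hWX.mem_X _)
  have hΔ : ∀ z, a z * d z - b z * c z ≠ 0 := fun z =>
    (hdesc.linearIndependent_pair_iff himm (hab z) (hcd z)).1 (hWX.indep _)
  obtain ⟨W₁, hW₁s, hW₁off, hW₁⟩ := L.exists_W hD hWX ha hb hab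
  obtain ⟨a', b', ha', hb', hab'⟩ := hdesc'.exists_coeff himm'
    (fun q => (hW₁s q).continuousAt) (fun z => by
      obtain ⟨a', b', h1, -⟩ := hW₁ z
      exact hdesc'.mem_iff_mov.2 ⟨a', b', h1⟩)
  have hside : ∀ z, SameSide (a' z) (b' z) (a z) (b z) := by
    intro z
    obtain ⟨a₁, b₁, h1, -, h2⟩ := hW₁ z
    obtain ⟨e1, e2⟩ := hdesc'.mov_unique himm' (h1.symm.trans (hab' z))
    rwa [← e1, ← e2]
  have hker : ∀ z, InKernel (derivedDist D') (A.tube.φ z) (W₁ (A.tube.φ z)) := fun z =>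
    (hW₁ z).choose_spec.choose_spec.2.1
  obtain ⟨X₁, hX₁s, hX₁off, hX₁⟩ := L.exists_X hWX (d := fun z => a z * d z - b z * c z)
    ((ha.mul hd).sub (hb.mul hc)) ha' hb' hΔ (fun z => (hside z).ne_zero) (fun z hz => by
      obtain ⟨e0, e1⟩ := L.mov_eq hz.le
      obtain ⟨μ, hμ, -, h2, h3⟩ := L.exists_pos_smul hD hWX hz (hker z) (hab z) (hab' z) (hside z)
      refine ⟨c z, d z, by rw [e0, e1]; exact hcd z, ?_⟩
      rw [h2, h3]
      have h4 := hΔ z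
      have : 0 < μ * (a z * d z - b z * c z) ^ 2 := by positivity
      linarith)
  have hin : ∀ z : A.tube.Dom, LinearIndependent ℝ ![W₁ (A.tube.φ z), X₁ (A.tube.φ z)] := by
    intro z
    obtain ⟨c', d', h1, h2⟩ := hX₁ z
    exact (hdesc'.linearIndependent_pair_iff himm' (hab' z) h1).2 (left_ne_zero_of_mul h2.ne')
  have hoff : ∀ q, q ∉ range A.tube.φ → q ∈ L.outside ∧ W₁ q = W q ∧ X₁ q = X q := by
    intro q hq
    refine ⟨?_, hW₁off q fun ⟨z, _, hz⟩ => hq ⟨z, hz⟩, hX₁off q fun ⟨z, _, hz⟩ => hq ⟨z, hz⟩⟩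
    rcases L.mem_outside_or' q with h | ⟨z, -, hz⟩
    · exact h
    · exact absurd ⟨z, hz.symm⟩ hq
  have hmem : ∀ q, W₁ q ∈ D' q ∧ X₁ q ∈ D' q := by
    intro q
    by_cases hq : q ∈ range A.tube.φ
    · obtain ⟨z, rfl⟩ := hq
      obtain ⟨c', d', h1, -⟩ := hX₁ z
      exact ⟨hdesc'.mem_iff_mov.2 ⟨_, _, hab' z⟩, hdesc'.mem_iff_mov.2 ⟨_, _, h1⟩⟩
    · obtain ⟨h1, h2, h3⟩ := hoff q hq
      rw [h2, h3, L.D'_off q h1]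
      exact ⟨hWX.mem_W q, hWX.mem_X q⟩
  have hindep : ∀ q, LinearIndependent ℝ ![W₁ q, X₁ q] := by
    intro q
    by_cases hq : q ∈ range A.tube.φ
    · obtain ⟨z, rfl⟩ := hq
      exact hin z
    · obtain ⟨h1, h2, h3⟩ := hoff q hq
      rw [h2, h3]
      exact hWX.indep q
  refine ⟨W₁, X₁, ⟨hW₁s, hX₁s, ?_, hindep, ?_⟩, ?_, fun q hq => ⟨hW₁off q hq, hX₁off q hq⟩, ?_⟩
  · intro q
    by_cases hq : q ∈ range A.tube.φ
    · obtain ⟨z, rfl⟩ := hq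
      exact hker z
    · obtain ⟨h1, h2, h3⟩ := hoff q hq
      rw [h2]
      exact (L.inKernel_iff h1).2 (hWX.kernel_W q)
  · intro q
    have : FiniteDimensional ℝ (TangentSpace (𝓡 4) q) :=
      inferInstanceAs (FiniteDimensional ℝ (EuclideanSpace ℝ (Fin 4)))
    have h1 : Submodule.span ℝ {W₁ q, X₁ q} = Submodule.span ℝ (range ![W₁ q, X₁ q]) := by
      congr 1
      ext v
      simp [or_comm]
    refine Submodule.eq_of_le_of_finrank_eq ?_ ?_
    · rw [Submodule.span_le]
      rintro v (rfl | hv)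
      · exact (hmem q).1
      · rw [mem_singleton_iff.1 hv]
        exact (hmem q).2
    · rw [hD'.1.finrank_eq q, h1, finrank_span_eq_card (hindep q), Fintype.card_fin]
  · intro q hq
    by_cases hqr : q ∈ range A.tube.φ
    · obtain ⟨z, rfl⟩ := hqr
      have hz := L.φ_mem_outside_iff.1 hq
      obtain ⟨e0, e1⟩ := L.mov_eq hz.le
      obtain ⟨μ, hμ, h1, h2, h3⟩ :=
        L.exists_pos_smul hD hWX hz (hker z) (hab z) (hab' z) (hside z)
      have h4 : X₁ (A.tube.φ z) ∈ D (A.tube.φ z) := by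
        rw [← L.D'_off _ hq]; exact (hmem _).2
      obtain ⟨s, r, hsr⟩ := hWX.mem_iff.1 h4
      refine ⟨μ, s, r, hμ, ?_, h1, hsr⟩
      obtain ⟨c', d', h5, h6⟩ := hX₁ z
      have h7 : c' • A.tube.mov A.H 0 z + d' • A.tube.mov A.H 1 z =
          (s * a z + r * c z) • A.tube.mov A.H 0 z + (s * b z + r * d z) • A.tube.mov A.H 1 z := by
        rw [← e0, ← e1, ← h5, hsr, hab z, hcd z, e0, e1]; module
      obtain ⟨h8, h9⟩ := hdesc.mov_unique himm h7
      rw [h2, h3, h8, h9] at h6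
      have h10 : 0 < r * (μ * (a z * d z - b z * c z) ^ 2) := by linarith
      have h11 := hΔ z
      exact (pos_iff_pos_of_mul_pos h10).2 (by positivity)
    · obtain ⟨-, h2, h3⟩ := hoff q hqr
      exact ⟨1, 0, 1, one_pos, one_pos, by rw [h2, one_smul], by rw [h3, zero_smul, one_smul, zero_add]⟩
  · intro z a₀ b₀ c₀ d₀ a₁ b₁ c₁ d₁ h1 h2 h3 h4
    obtain ⟨rfl, rfl⟩ := hdesc.mov_unique himm (h1.symm.trans (hab z))
    obtain ⟨rfl, rfl⟩ := hdesc.mov_unique himm (h2.symm.trans (hcd z))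
    obtain ⟨rfl, rfl⟩ := hdesc'.mov_unique himm' (h3.symm.trans (hab' z))
    obtain ⟨c', d', h5, h6⟩ := hX₁ z
    obtain ⟨rfl, rfl⟩ := hdesc'.mov_unique himm' (h4.symm.trans h5)
    exact ⟨hside z, h6⟩

/-- The orientations of the modified structure are determined by those on the outside, because each
fibre of the tube is connected and leaves the modified region. -/
theorem EngelTorsion.sameOrientation (L : EngelTorsion δ A D') (hD' : IsEngel D')
    (h₁ : IsEngelPair D' W₁ X₁) (h' : IsEngelPair D' W' X')
    (ho₁ : SameOrientationOn L.outside W X W₁ X₁) (ho' : SameOrientationOn L.outside W X W' X') :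
    SameOrientationOn univ W₁ X₁ W' X' := by
  choose α hα using fun q => h₁.exists_eq_smul_of_inKernel hD' (h'.kernel_W q)
  choose β κ hκ using fun q => h₁.mem_iff.1 (h'.mem_X q)
  have hF := h₁.isFraming hD'
  have hα0 : ∀ q, α q ≠ 0 := fun q h0 => h'.ne_zero q (by rw [hα, h0, zero_smul])
  have hκ0 : ∀ q, κ q ≠ 0 := by
    intro q h0
    have h1 := LinearIndependent.pair_iff.1 (h'.indep q) (β q) (-α q) (by
      rw [hα q, hκ q, h0]; module)
    exact hα0 q (neg_eq_zero.1 h1.2)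
  have hαc : Continuous α := continuous_iff_continuousAt.2 fun q =>
    continuousAt_pi.1 (ContAlongAt.coeff (f := fun q : M => q) (w := W')
      (v := fun j q => engelFraming W₁ X₁ q j) (c := fun q => ![α q, 0, 0, 0])
      (fun j => (hF.cont j).continuousAt) (h'.smooth_W q).continuousAt (hF.indep q)
      (Eventually.of_forall fun q => by
        simp only [Fin.sum_univ_four, Matrix.cons_val_zero, Matrix.cons_val_one, Matrix.cons_val,
          zero_smul, add_zero]
        exact hα q)) 0
  have hκc : Continuous κ := continuous_iff_continuousAt.2 fun q =>
    continuousAt_pi.1 (ContAlongAt.coeff (f := fun q : M => q) (w := X')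
      (v := fun j q => engelFraming W₁ X₁ q j) (c := fun q => ![β q, κ q, 0, 0])
      (fun j => (hF.cont j).continuousAt) (h'.smooth_X q).continuousAt (hF.indep q)
      (Eventually.of_forall fun q => by
        simp only [Fin.sum_univ_four, Matrix.cons_val_zero, Matrix.cons_val_one, Matrix.cons_val,
          zero_smul, add_zero]
        exact hκ q)) 1
  have hout : ∀ q ∈ L.outside, 0 < α q ∧ 0 < κ q := by
    intro q hq
    obtain ⟨a, b, c, ha, hc, e1, e2⟩ := ho₁ q hq
    obtain ⟨a', b', c', ha', hc', e3, e4⟩ := ho' q hq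
    have hi := LinearIndependent.pair_iff.1 (h₁.indep q)
    have hi' : ∀ s t : ℝ, s • W q + t • X q = 0 → s = 0 ∧ t = 0 := by
      intro s t hst
      have h1 := hi (c * s - b * t) (a * t) (by
        rw [e1, e2]
        have : (c * s - b * t) • a • W q + (a * t) • (b • W q + c • X q) =
          (a * c) • (s • W q + t • X q) := by module
        rw [this, hst, smul_zero])
      have ht : t = 0 := (mul_eq_zero.1 h1.2).resolve_left ha.ne'
      have h2 := h1.1
      rw [ht, mul_zero, sub_zero] at h2
      exact ⟨(mul_eq_zero.1 h2).resolve_left hc.ne', ht⟩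
    have h1 := hα q
    rw [e1, e3] at h1
    have h2 := (hi' (a' - α q * a) 0 (by rw [sub_smul, h1]; module)).1
    have h3 := hκ q
    rw [e1, e2, e4] at h3
    have h4 := (hi' (b' - (β q * a + κ q * b)) (c' - κ q * c) (by
      have : (b' - (β q * a + κ q * b)) • W q + (c' - κ q * c) • X q = (b' • W q + c' • X q) -
        (β q • a • W q + κ q • (b • W q + c • X q)) := by module
      rw [this, h3, sub_self])).2
    exact ⟨pos_of_mul_pos_left (by linarith : 0 < α q * a) ha.le,
      pos_of_mul_pos_left (by linarith : 0 < κ q * c) hc.le⟩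
  have hpos : ∀ q, 0 < α q ∧ 0 < κ q := by
    intro q
    rcases L.mem_outside_or' q with hq | ⟨z, hz, rfl⟩
    · exact hout q hq
    · obtain ⟨t₁, ht, ht'⟩ := exists_between L.a_lt
      have ht₁ : t₁ ∈ Ioo (-A.tube.ε) A.tube.ε :=
        ⟨by change -A.ε < t₁; linarith [L.a_pos, A.ε_pos], ht'⟩
      have hS : IsPreconnected (A.tube.φ '' {z' | z'.1 = z.1}) := by
        refine IsPreconnected.image ?_ _ (Tube.continuous_φ (𝒯 := A.tube)).continuousOn
        have h1 : {z' : A.tube.Dom | z'.1 = z.1} = {z.1} ×ˢ univ := by ext; simp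
        rw [h1]
        have : PreconnectedSpace (Ioo (-A.tube.ε) A.tube.ε) :=
          isPreconnected_iff_preconnectedSpace.1 isPreconnected_Ioo
        exact isPreconnected_singleton.prod isPreconnected_univ
      have h1 := hout (A.tube.φ (z.1, ⟨t₁, ht₁⟩))
        (L.φ_mem_outside_iff.2 (ht.trans_le (le_abs_self t₁)))
      have h2 : A.tube.φ (z.1, ⟨t₁, ht₁⟩) ∈ A.tube.φ '' {z' | z'.1 = z.1} :=
        mem_image_of_mem _ rfl
      have h3 : A.tube.φ z ∈ A.tube.φ '' {z' | z'.1 = z.1} := mem_image_of_mem _ rfl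
      exact ⟨pos_of_isPreconnected hS hαc.continuousOn (fun y _ => hα0 y) h2 h1.1 h3,
        pos_of_isPreconnected hS hκc.continuousOn (fun y _ => hκ0 y) h2 h1.2 h3⟩
  exact fun q _ => ⟨α q, β q, κ q, (hpos q).1, (hpos q).2, hα q, hκ q⟩

end OrientedPair

/-! ### Homotopies of matrix-valued maps -/

section MatrixHomotopy

variable {Z : Type*} [TopologicalSpace Z] {S : Set Z}
variable {B B₀ B₁ B₂ Q Q₀ Q₁ : Z → Matrix (Fin 4) (Fin 4) ℝ}

/-- `B₀` and `B₁` are homotopic through invertible matrices, relative to the set `S`. -/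
def MatHomotopic (S : Set Z) (B₀ B₁ : Z → Matrix (Fin 4) (Fin 4) ℝ) : Prop :=
  ∃ B : unitInterval × Z → Matrix (Fin 4) (Fin 4) ℝ, Continuous B ∧ (∀ a, (B a).det ≠ 0) ∧
    (∀ z, B (0, z) = B₀ z) ∧ (∀ z, B (1, z) = B₁ z) ∧ ∀ z ∈ S, ∀ s, B (s, z) = B (0, z)

theorem matHomotopic_iff : MatHomotopic S B₀ B₁ ↔
    ∃ f₀ f₁ : C(Z, {A : Matrix (Fin 4) (Fin 4) ℝ // A.det ≠ 0}),
      (∀ z, (f₀ z).1 = B₀ z) ∧ (∀ z, (f₁ z).1 = B₁ z) ∧ f₀.HomotopicRel f₁ S := by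
  constructor
  · rintro ⟨B, hB, hdet, h0, h1, hS⟩
    refine ⟨⟨fun z => ⟨B (0, z), hdet _⟩, by fun_prop⟩, ⟨fun z => ⟨B (1, z), hdet _⟩, by fun_prop⟩,
      h0, h1, ⟨⟨⟨⟨fun a => ⟨B a, hdet a⟩, by fun_prop⟩, fun z => rfl, fun z => rfl⟩, ?_⟩⟩⟩
    intro s z hz
    exact Subtype.ext (hS z hz s)
  · rintro ⟨f₀, f₁, h0, h1, ⟨H⟩⟩
    refine ⟨fun a => (H a).1, by fun_prop, fun a => (H a).2, fun z => ?_, fun z => ?_, ?_⟩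
    · rw [← h0]; exact congrArg Subtype.val (H.apply_zero z)
    · rw [← h1]; exact congrArg Subtype.val (H.apply_one z)
    · intro z hz s
      exact congrArg Subtype.val ((H.eq_fst s hz).trans (H.eq_fst 0 hz).symm)

theorem MatHomotopic.trans (h : MatHomotopic S B₀ B₁) (h' : MatHomotopic S B₁ B₂) :
    MatHomotopic S B₀ B₂ := by
  obtain ⟨f₀, f₁, h0, h1, H⟩ := matHomotopic_iff.1 h
  obtain ⟨g₀, g₁, k0, k1, H'⟩ := matHomotopic_iff.1 h'
  have : f₁ = g₀ := ContinuousMap.ext fun z => Subtype.ext ((h1 z).trans (k0 z).symm)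
  subst this
  exact matHomotopic_iff.2 ⟨f₀, g₁, h0, k1, H.trans H'⟩

theorem MatHomotopic.mul_left (h : MatHomotopic S B₀ B₁) (hB : Continuous B)
    (hdet : ∀ z, (B z).det ≠ 0) : MatHomotopic S (fun z => B z * B₀ z) (fun z => B z * B₁ z) := by
  obtain ⟨C, hC, hCdet, h0, h1, hS⟩ := h
  refine ⟨fun a => B a.2 * C a, (hB.comp continuous_snd).matrix_mul hC, fun a => ?_,
    fun z => by simp only [h0], fun z => by simp only [h1], fun z hz s => ?_⟩
  · rw [Matrix.det_mul]
    exact mul_ne_zero (hdet _) (hCdet _)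
  · change B z * C (s, z) = B z * C (0, z)
    rw [hS z hz s]

theorem MatHomotopic.mul_right (h : MatHomotopic S B₀ B₁) (hB : Continuous B)
    (hdet : ∀ z, (B z).det ≠ 0) : MatHomotopic S (fun z => B₀ z * B z) (fun z => B₁ z * B z) := by
  obtain ⟨C, hC, hCdet, h0, h1, hS⟩ := h
  refine ⟨fun a => C a * B a.2, hC.matrix_mul (hB.comp continuous_snd), fun a => ?_,
    fun z => by simp only [h0], fun z => by simp only [h1], fun z hz s => ?_⟩
  · rw [Matrix.det_mul]
    exact mul_ne_zero (hCdet _) (hdet _)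
  · change C (s, z) * B z = C (0, z) * B z
    rw [hS z hz s]

/-- The rotation with cosine `c` and sine `s` of the plane of the first two coordinates. -/
def rot01 (c s : ℝ) : Matrix (Fin 4) (Fin 4) ℝ :=
  !![c, -s, 0, 0; s, c, 0, 0; 0, 0, 1, 0; 0, 0, 0, 1]

/-- The rotation with cosine `c` and sine `s` of the plane of the two middle coordinates. -/
def rot12 (c s : ℝ) : Matrix (Fin 4) (Fin 4) ℝ :=
  !![1, 0, 0, 0; 0, c, -s, 0; 0, s, c, 0; 0, 0, 0, 1]

/-- The rotation with cosine `c` and sine `s` of the plane of the first and third coordinates. -/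
def rot02 (c s : ℝ) : Matrix (Fin 4) (Fin 4) ℝ :=
  !![c, 0, -s, 0; 0, 1, 0, 0; s, 0, c, 0; 0, 0, 0, 1]

theorem det_of_lowerLeft_zero {Q : Matrix (Fin 4) (Fin 4) ℝ} (h : Q 2 0 = 0 ∧ Q 2 1 = 0 ∧
    Q 3 0 = 0 ∧ Q 3 1 = 0) : Q.det = (Q 0 0 * Q 1 1 - Q 0 1 * Q 1 0) *
      (Q 2 2 * Q 3 3 - Q 2 3 * Q 3 2) := by
  obtain ⟨h1, h2, h3, h4⟩ := h
  rw [Matrix.det_succ_row_zero]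
  simp [Fin.sum_univ_four, Matrix.det_fin_three, Fin.succAbove, Matrix.submatrix, h1, h2, h3, h4]
  ring

theorem det_rot01 {c s : ℝ} (h : c ^ 2 + s ^ 2 = 1) : (rot01 c s).det = 1 := by
  rw [det_of_lowerLeft_zero ⟨rfl, rfl, rfl, rfl⟩]
  simp [rot01]
  linear_combination h

theorem det_rot12 {c s : ℝ} (h : c ^ 2 + s ^ 2 = 1) : (rot12 c s).det = 1 := by
  rw [rot12, Matrix.det_succ_row_zero]
  simp [Fin.sum_univ_four, Matrix.det_fin_three, Fin.succAbove, Matrix.submatrix]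
  linear_combination h

theorem det_rot02 {c s : ℝ} (h : c ^ 2 + s ^ 2 = 1) : (rot02 c s).det = 1 := by
  rw [rot02, Matrix.det_succ_row_zero]
  simp [Fin.sum_univ_four, Matrix.det_fin_three, Fin.succAbove, Matrix.submatrix]
  linear_combination h

theorem continuous_rot01 : Continuous fun a : ℝ × ℝ => rot01 a.1 a.2 := by
  refine continuous_matrix fun i j => ?_
  fin_cases i <;> fin_cases j <;> simp [rot01] <;> fun_prop

theorem continuous_rot12 : Continuous fun a : ℝ × ℝ => rot12 a.1 a.2 := by
  refine continuous_matrix fun i j => ?_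
  fin_cases i <;> fin_cases j <;> simp [rot12] <;> fun_prop

theorem continuous_rot02 : Continuous fun a : ℝ × ℝ => rot02 a.1 a.2 := by
  refine continuous_matrix fun i j => ?_
  fin_cases i <;> fin_cases j <;> simp [rot02] <;> fun_prop

theorem rot12_one : rot12 1 0 = 1 := by
  ext i j
  fin_cases i <;> fin_cases j <;> simp [rot12]

theorem rot02_mul_neg {c s : ℝ} (h : c ^ 2 + s ^ 2 = 1) : rot02 c s * rot02 c (-s) = 1 := by
  ext i j
  fin_cases i <;> fin_cases j <;> simp [rot02, Matrix.mul_apply, Fin.sum_univ_four] <;>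
    first | ring1 | linear_combination h

theorem rot02_conj {c s χ : ℝ} (h : χ ^ 2 = 1) :
    rot02 0 χ * rot12 c s * rot02 0 (-χ) = rot01 c (χ * s) := by
  ext i j
  fin_cases i <;> fin_cases j <;>
    simp [rot01, rot02, rot12, Matrix.mul_apply, Fin.sum_univ_four] <;>
    first | ring1 | linear_combination h | linear_combination c * h

/-- Turning the axis of the rotation deforms a rotation in one coordinate plane into a rotation in
another one, in either of its two senses. -/
theorem matHomotopic_rot12_rot01 {c s χ : Z → ℝ} (hc : Continuous c) (hs : Continuous s)
    (hχ : Continuous χ) (hcs : ∀ z, c z ^ 2 + s z ^ 2 = 1) (hχ1 : ∀ z, χ z ^ 2 = 1)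
    (hS : ∀ z ∈ S, c z = 1 ∧ s z = 0) :
    MatHomotopic S (fun z => rot12 (c z) (s z)) (fun z => rot01 (c z) (χ z * s z)) := by
  let x : unitInterval × Z → ℝ := fun a => Real.cos (Real.pi / 2 * a.1)
  let y : unitInterval × Z → ℝ := fun a => χ a.2 * Real.sin (Real.pi / 2 * a.1)
  have hx : Continuous x := by fun_prop
  have hy : Continuous y := by fun_prop
  have hxy : ∀ a, x a ^ 2 + y a ^ 2 = 1 := fun a => by
    simp only [x, y]
    rw [mul_pow, hχ1, one_mul]
    exact Real.cos_sq_add_sin_sq _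
  have hxy' : ∀ a, x a ^ 2 + (-y a) ^ 2 = 1 := fun a => by rw [neg_sq, hxy]
  refine ⟨fun a => rot02 (x a) (y a) * rot12 (c a.2) (s a.2) * rot02 (x a) (-y a), ?_, ?_, ?_, ?_,
    ?_⟩
  · exact ((continuous_rot02.comp (hx.prodMk hy)).matrix_mul
      (continuous_rot12.comp ((hc.comp continuous_snd).prodMk (hs.comp continuous_snd)))).matrix_mul
        (continuous_rot02.comp (hx.prodMk hy.neg))
  · intro a
    rw [Matrix.det_mul, Matrix.det_mul, det_rot02 (hxy a), det_rot02 (hxy' a), det_rot12 (hcs _)]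
    norm_num
  · intro z
    have h1 : rot02 1 0 = 1 := by
      ext i j
      fin_cases i <;> fin_cases j <;> simp [rot02]
    simp [x, y, h1]
  · intro z
    simp only [x, y]
    simp [rot02_conj (hχ1 z)]
  · intro z hz t
    simp only
    rw [(hS z hz).1, (hS z hz).2, rot12_one, mul_one, mul_one, rot02_mul_neg (hxy _),
      rot02_mul_neg (hxy _)]

/-- A matrix-valued map that preserves the plane of the first two coordinates intertwines a
rotation of this plane, up to homotopy, with the rotation in the sense given by its sign. -/
theorem matHomotopic_rot01_mul {c s χ σ : Z → ℝ} (hc : Continuous c) (hs : Continuous s)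
    (hχ : Continuous χ) (hcs : ∀ z, c z ^ 2 + s z ^ 2 = 1) (hχ1 : ∀ z, χ z ^ 2 = 1)
    (hQ : Continuous Q) (hdet : ∀ z, (Q z).det ≠ 0)
    (hblock : ∀ z, Q z 2 0 = 0 ∧ Q z 2 1 = 0 ∧ Q z 3 0 = 0 ∧ Q z 3 1 = 0)
    (hσc : Continuous σ) (hσ1 : ∀ z, σ z ^ 2 = 1)
    (hσ : ∀ z, 0 < σ z * (Q z 0 0 * Q z 1 1 - Q z 0 1 * Q z 1 0))
    (hS : ∀ z ∈ S, c z = 1 ∧ s z = 0) :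
    MatHomotopic S (fun z => rot01 (c z) (χ z * s z) * Q z)
      (fun z => Q z * rot01 (c z) (χ z * σ z * s z)) := by
  have hR₀ : Continuous fun a : unitInterval × Z => rot01 (c a.2) (χ a.2 * s a.2) :=
    continuous_rot01.comp ((hc.comp continuous_snd).prodMk ((hχ.mul hs).comp continuous_snd))
  have hR₁ : Continuous fun a : unitInterval × Z => rot01 (c a.2) (χ a.2 * σ a.2 * s a.2) :=
    continuous_rot01.comp ((hc.comp continuous_snd).prodMk
      (((hχ.mul hσc).mul hs).comp continuous_snd))
  have hQ' : Continuous fun a : unitInterval × Z => Q a.2 := hQ.comp continuous_snd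
  have ht : Continuous fun a : unitInterval × Z => (a.1 : ℝ) := by fun_prop
  have ht' : Continuous fun a : unitInterval × Z => 1 - (a.1 : ℝ) := by fun_prop
  refine ⟨fun a => (1 - (a.1 : ℝ)) • (rot01 (c a.2) (χ a.2 * s a.2) * Q a.2) +
    (a.1 : ℝ) • (Q a.2 * rot01 (c a.2) (χ a.2 * σ a.2 * s a.2)), ?_, ?_, ?_, ?_, ?_⟩
  · exact (ht'.smul (hR₀.matrix_mul hQ')).add (ht.smul (hQ'.matrix_mul hR₁))
  · rintro ⟨⟨t, ht0, ht1⟩, z⟩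
    obtain ⟨q1, q2, q3, q4⟩ := hblock z
    have h1 := hcs z
    have h2 := hχ1 z
    have h3 := hσ1 z
    have h4 := hσ z
    have h5 := right_ne_zero_of_mul ((det_of_lowerLeft_zero (hblock z)) ▸ hdet z)
    change ((1 - t) • (rot01 (c z) (χ z * s z) * Q z) +
      t • (Q z * rot01 (c z) (χ z * σ z * s z))).det ≠ 0
    generalize hA : (1 - t) • (rot01 (c z) (χ z * s z) * Q z) +
      t • (Q z * rot01 (c z) (χ z * σ z * s z)) = A
    have hA' : ∀ i j, A i j = (1 - t) * (rot01 (c z) (χ z * s z) * Q z) i j +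
        t * (Q z * rot01 (c z) (χ z * σ z * s z)) i j := fun i j => by rw [← hA]; rfl
    have hA2 : A 2 0 = 0 ∧ A 2 1 = 0 ∧ A 3 0 = 0 ∧ A 3 1 = 0 := by
      refine ⟨?_, ?_, ?_, ?_⟩ <;>
        simp [hA', rot01, Matrix.mul_apply, Fin.sum_univ_four, q1, q2, q3, q4]
    rw [det_of_lowerLeft_zero hA2]
    refine mul_ne_zero ?_ ?_
    · simp only [hA', rot01, Matrix.mul_apply, Fin.sum_univ_four]
      simp [q1, q2, q3, q4]
      generalize Q z 0 0 = a at *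
      generalize Q z 0 1 = b at *
      generalize Q z 1 0 = d at *
      generalize Q z 1 1 = e at *
      generalize c z = c at *
      generalize s z = s at *
      generalize χ z = χ at *
      generalize σ z = σ at *
      -- `det (c Q + s χ ((1 - t) J Q + t σ Q J))`, where the mixed term vanishes
      intro h0
      have h6 : 0 < (c ^ 2 + s ^ 2 * ((1 - t) ^ 2 + t ^ 2)) * (σ * (a * e - b * d)) +
          s ^ 2 * ((1 - t) * t * (a ^ 2 + b ^ 2 + d ^ 2 + e ^ 2)) := by
        have h7 : 0 < c ^ 2 + s ^ 2 * ((1 - t) ^ 2 + t ^ 2) := by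
          have : 0 < (1 - t) ^ 2 + t ^ 2 := by nlinarith [sq_nonneg (1 - 2 * t)]
          rcases eq_or_ne c 0 with hc | hc
          · have : s ^ 2 = 1 := by rw [hc] at h1; linarith
            rw [this]
            positivity
          · positivity
        have h8 := mul_pos h7 h4
        have h9 : 0 ≤ (1 - t) * t := mul_nonneg (by linarith) ht0
        positivity
      refine h6.ne' ?_
      have h10 := congrArg (σ * ·) h0
      simp only [mul_zero] at h10
      rw [← h10]
      linear_combination (-σ * s ^ 2 * (1 - t) ^ 2 * (a * e - b * d) -
          σ * s ^ 2 * t ^ 2 * σ ^ 2 * (a * e - b * d) -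
          s ^ 2 * σ ^ 2 * (1 - t) * t * (a ^ 2 + b ^ 2 + d ^ 2 + e ^ 2)) * h2 -
        (σ * s ^ 2 * t ^ 2 * (a * e - b * d) +
          s ^ 2 * (1 - t) * t * (a ^ 2 + b ^ 2 + d ^ 2 + e ^ 2)) * h3
    · have e1 : ∀ i j, (i = 2 ∨ i = 3) → (j = 2 ∨ j = 3) → A i j = Q z i j := by
        rintro i j (rfl | rfl) (rfl | rfl) <;>
          simp [hA', rot01, Matrix.mul_apply, Fin.sum_univ_four] <;> ring
      rw [e1 2 2 (by simp) (by simp), e1 3 3 (by simp) (by simp), e1 2 3 (by simp) (by simp),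
        e1 3 2 (by simp) (by simp)]
      exact h5
  · intro z
    simp
  · intro z
    simp
  · intro z hz t
    have h1 : rot01 1 0 = 1 := by
      ext i j
      fin_cases i <;> fin_cases j <;> simp [rot01]
    simp only
    rw [(hS z hz).1, (hS z hz).2, mul_zero, mul_zero, h1, one_mul, mul_one, ← add_smul,
      ← add_smul]
    congr 1
    ring

/-- Two maps to upper block triangular matrices are homotopic if the diagonal blocks have the same
orientation and the first columns of the upper blocks are never opposite. -/
theorem matHomotopic_of_block (hQ₀ : Continuous Q₀) (hQ₁ : Continuous Q₁)
    (hblock₀ : ∀ z, Q₀ z 2 0 = 0 ∧ Q₀ z 2 1 = 0 ∧ Q₀ z 3 0 = 0 ∧ Q₀ z 3 1 = 0 ∧ Q₀ z 3 2 = 0)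
    (hblock₁ : ∀ z, Q₁ z 2 0 = 0 ∧ Q₁ z 2 1 = 0 ∧ Q₁ z 3 0 = 0 ∧ Q₁ z 3 1 = 0 ∧ Q₁ z 3 2 = 0)
    (hside : ∀ z, SameSide (Q₁ z 0 0) (Q₁ z 1 0) (Q₀ z 0 0) (Q₀ z 1 0))
    (hdet : ∀ z, 0 < (Q₁ z 0 0 * Q₁ z 1 1 - Q₁ z 1 0 * Q₁ z 0 1) *
      (Q₀ z 0 0 * Q₀ z 1 1 - Q₀ z 1 0 * Q₀ z 0 1))
    (h22 : ∀ z, 0 < Q₁ z 2 2 * Q₀ z 2 2) (h33 : ∀ z, 0 < Q₁ z 3 3 * Q₀ z 3 3)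
    (hS : ∀ z ∈ S, Q₁ z = Q₀ z) : MatHomotopic S Q₁ Q₀ := by
  have he₀ : ∀ i j, Continuous fun z => Q₀ z i j := fun i j => hQ₀.matrix_elem i j
  have he₁ : ∀ i j, Continuous fun z => Q₁ z i j := fun i j => hQ₁.matrix_elem i j
  -- with `u` the first and `x` the second column of the upper block, `x = (r + i J) u`
  let n : (Z → Matrix (Fin 4) (Fin 4) ℝ) → Z → ℝ := fun Q z => Q z 0 0 ^ 2 + Q z 1 0 ^ 2
  let r : (Z → Matrix (Fin 4) (Fin 4) ℝ) → Z → ℝ := fun Q z =>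
    (Q z 0 0 * Q z 0 1 + Q z 1 0 * Q z 1 1) / n Q z
  let i : (Z → Matrix (Fin 4) (Fin 4) ℝ) → Z → ℝ := fun Q z =>
    (Q z 0 0 * Q z 1 1 - Q z 1 0 * Q z 0 1) / n Q z
  have hpos : ∀ a b : ℝ, a ≠ 0 ∨ b ≠ 0 → 0 < a ^ 2 + b ^ 2 := by
    rintro a b (h | h)
    · have : 0 < a ^ 2 := by positivity
      nlinarith [sq_nonneg b]
    · have : 0 < b ^ 2 := by positivity
      nlinarith [sq_nonneg a]
  have hn₁ : ∀ z, 0 < n Q₁ z := fun z => hpos _ _ (hside z).ne_zero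
  have hn₀ : ∀ z, 0 < n Q₀ z := fun z => hpos _ _ (by
    by_contra! h
    have := hdet z
    rw [h.1, h.2] at this
    simp at this)
  have hxy : ∀ Q : Z → Matrix (Fin 4) (Fin 4) ℝ, ∀ z, 0 < n Q z →
      Q z 0 1 = r Q z * Q z 0 0 - i Q z * Q z 1 0 ∧
      Q z 1 1 = r Q z * Q z 1 0 + i Q z * Q z 0 0 := by
    intro Q z hn
    have hn' := hn.ne'
    constructor
    · simp only [r, i]
      field_simp
      simp only [n]
      ring
    · simp only [r, i]
      field_simp
      simp only [n]
      ring
  have hcont : ∀ Q : Z → Matrix (Fin 4) (Fin 4) ℝ, (∀ i j, Continuous fun z => Q z i j) →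
      (∀ z, 0 < n Q z) → Continuous (r Q) ∧ Continuous (i Q) := by
    intro Q hQ hn
    have h00 := hQ 0 0
    have h01 := hQ 0 1
    have h10 := hQ 1 0
    have h11 := hQ 1 1
    exact ⟨((h00.mul h01).add (h10.mul h11)).div ((h00.pow 2).add (h10.pow 2))
      fun z => (hn z).ne', ((h00.mul h11).sub (h10.mul h01)).div ((h00.pow 2).add (h10.pow 2))
      fun z => (hn z).ne'⟩
  obtain ⟨hr₀, hi₀⟩ := hcont Q₀ he₀ hn₀
  obtain ⟨hr₁, hi₁⟩ := hcont Q₁ he₁ hn₁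
  have hii : ∀ z, 0 < i Q₁ z * i Q₀ z := by
    intro z
    simp only [i]
    rw [div_mul_div_comm]
    exact div_pos (hdet z) (mul_pos (hn₁ z) (hn₀ z))
  let L : (Z → ℝ) → (Z → ℝ) → unitInterval × Z → ℝ := fun f g a =>
    (1 - (a.1 : ℝ)) * f a.2 + a.1 * g a.2
  have hL : ∀ f g, Continuous f → Continuous g → Continuous (L f g) := fun f g hf hg => by
    simp only [L]; fun_prop
  have hLpos : ∀ f g a, 0 < f a.2 * g a.2 → L f g a ≠ 0 := by
    rintro f g ⟨⟨t, ht0, ht1⟩, z⟩ h h0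
    simp only [L] at h0 h
    have h1 : f z ≠ 0 := left_ne_zero_of_mul h.ne'
    have h2 : (1 - t) * f z ^ 2 + t * (f z * g z) = 0 := by linear_combination f z * h0
    have h3 : 0 < f z ^ 2 := by positivity
    rcases eq_or_lt_of_le ht0 with h4 | h4
    · rw [← h4] at h2; nlinarith
    · nlinarith [mul_pos h4 h, mul_nonneg (sub_nonneg.2 ht1) h3.le]
  have hL0 : ∀ f g z, L f g (0, z) = f z := fun f g z => by simp [L]
  have hL1 : ∀ f g z, L f g (1, z) = g z := fun f g z => by simp [L]
  have hLS : ∀ f g s z, f z = g z → L f g (s, z) = f z := fun f g s z h => by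
    simp only [L]; rw [← h]; ring
  let a := L (fun z => Q₁ z 0 0) (fun z => Q₀ z 0 0)
  let b := L (fun z => Q₁ z 1 0) (fun z => Q₀ z 1 0)
  let ρ := L (r Q₁) (r Q₀)
  let ν := L (i Q₁) (i Q₀)
  have ha : Continuous a := hL _ _ (he₁ 0 0) (he₀ 0 0)
  have hb : Continuous b := hL _ _ (he₁ 1 0) (he₀ 1 0)
  have hρ : Continuous ρ := hL _ _ hr₁ hr₀
  have hν : Continuous ν := hL _ _ hi₁ hi₀
  let E : Fin 4 → Fin 4 → unitInterval × Z → ℝ := fun i j =>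
    L (fun z => Q₁ z i j) (fun z => Q₀ z i j)
  have hE : ∀ i j, Continuous (E i j) := fun i j => hL _ _ (he₁ i j) (he₀ i j)
  have hab : ∀ x, 0 < a x ^ 2 + b x ^ 2 := by
    intro x
    refine hpos _ _ ?_
    rcases hside x.2 with h | ⟨h1, h2, h3⟩
    · exact Or.inr (hLpos (fun z => Q₁ z 1 0) (fun z => Q₀ z 1 0) x h)
    · exact Or.inl (hLpos (fun z => Q₁ z 0 0) (fun z => Q₀ z 0 0) x h3)
  refine ⟨fun x => !![a x, ρ x * a x - ν x * b x, E 0 2 x, E 0 3 x;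
    b x, ρ x * b x + ν x * a x, E 1 2 x, E 1 3 x; 0, 0, E 2 2 x, E 2 3 x; 0, 0, 0, E 3 3 x],
    ?_, ?_, ?_, ?_, ?_⟩
  · refine continuous_matrix fun i j => ?_
    have := hE 0 2
    have := hE 0 3
    have := hE 1 2
    have := hE 1 3
    have := hE 2 2
    have := hE 2 3
    have := hE 3 3
    clear_value a b ρ ν E
    fin_cases i <;> fin_cases j <;> simp <;> fun_prop
  · intro x
    rw [det_of_lowerLeft_zero ⟨rfl, rfl, rfl, rfl⟩]
    simp only [Matrix.of_apply, Matrix.cons_val', Matrix.cons_val_zero, Matrix.cons_val_one,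
      Matrix.cons_val, Matrix.cons_val_fin_one, mul_zero, sub_zero]
    have e1 : a x * (ρ x * b x + ν x * a x) - (ρ x * a x - ν x * b x) * b x =
        ν x * (a x ^ 2 + b x ^ 2) := by ring
    rw [e1]
    exact mul_ne_zero (mul_ne_zero (hLpos _ _ x (hii _)) (hab x).ne')
      (mul_ne_zero (hLpos (fun z => Q₁ z 2 2) (fun z => Q₀ z 2 2) x (h22 _))
        (hLpos (fun z => Q₁ z 3 3) (fun z => Q₀ z 3 3) x (h33 _)))
  · intro z
    obtain ⟨h1, h2⟩ := hxy Q₁ z (hn₁ z)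
    obtain ⟨k1, k2, k3, k4, k5⟩ := hblock₁ z
    simp only [a, b, ρ, ν, E, hL0]
    ext i j
    fin_cases i <;> fin_cases j <;> simp [k1, k2, k3, k4, k5, ← h1, ← h2]
  · intro z
    obtain ⟨h1, h2⟩ := hxy Q₀ z (hn₀ z)
    obtain ⟨k1, k2, k3, k4, k5⟩ := hblock₀ z
    simp only [a, b, ρ, ν, E, hL1]
    ext i j
    fin_cases i <;> fin_cases j <;> simp [k1, k2, k3, k4, k5, ← h1, ← h2]
  · intro z hz s
    have h1 := hS z hz
    have h2 : ∀ i j s, E i j (s, z) = Q₁ z i j := fun i j s =>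
      hLS (fun z => Q₁ z i j) (fun z => Q₀ z i j) s z (by simp only [h1])
    have h3 : ∀ s, a (s, z) = Q₁ z 0 0 := fun s => h2 0 0 s
    have h4 : ∀ s, b (s, z) = Q₁ z 1 0 := fun s => h2 1 0 s
    have h5 : ∀ s, ρ (s, z) = r Q₁ z := fun s => hLS _ _ s z (by simp only [r, n]; rw [h1])
    have h6 : ∀ s, ν (s, z) = i Q₁ z := fun s => hLS _ _ s z (by simp only [i, n]; rw [h1])
    simp only [h2, h3, h4, h5, h6]

end MatrixHomotopy

/-! ### The osculating circles -/

section Circle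

/-- The unit tangent vector of the circle of geodesic curvature `κ`. -/
noncomputable def circTangent (κ θ : ℝ) : E3 :=
  (Real.sqrt (1 + κ ^ 2))⁻¹ •
    !₂[-Real.sin θ, Real.sqrt (1 + κ ^ 2) * Real.cos θ, κ * Real.sin θ]

theorem hasDerivAt_circ (κ θ : ℝ) :
    HasDerivAt (circ κ) ((Real.sqrt (1 + κ ^ 2))⁻¹ • circTangent κ θ) θ := by
  have hn : Real.sqrt (1 + κ ^ 2) * Real.sqrt (1 + κ ^ 2) = 1 + κ ^ 2 :=
    Real.mul_self_sqrt (by positivity)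
  have h0 : HasDerivAt (fun θ => κ ^ 2 + Real.cos θ) (-Real.sin θ) θ :=
    (Real.hasDerivAt_cos θ).const_add _
  have h1 : HasDerivAt (fun θ => Real.sqrt (1 + κ ^ 2) * Real.sin θ)
      (Real.sqrt (1 + κ ^ 2) * Real.cos θ) θ := (Real.hasDerivAt_sin θ).const_mul _
  have h2 : HasDerivAt (fun θ => κ * (1 - Real.cos θ)) (κ * Real.sin θ) θ :=
    (((Real.hasDerivAt_cos θ).const_sub 1).const_mul κ).congr_deriv (by ring)
  have h3 : HasDerivAt (fun θ => !₂[κ ^ 2 + Real.cos θ, Real.sqrt (1 + κ ^ 2) * Real.sin θ,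
      κ * (1 - Real.cos θ)])
      (!₂[-Real.sin θ, Real.sqrt (1 + κ ^ 2) * Real.cos θ, κ * Real.sin θ] : E3) θ := by
    refine (EuclideanSpace.equiv (Fin 3) ℝ).symm.toContinuousLinearMap.hasFDerivAt.comp_hasDerivAt
      θ (hasDerivAt_pi.2 fun i => ?_)
    fin_cases i
    exacts [h0, h1, h2]
  refine (h3.const_smul (1 + κ ^ 2)⁻¹).congr_deriv ?_
  rw [circTangent, smul_smul, ← mul_inv, hn]

theorem norm_sq_circTangent (κ θ : ℝ) : ‖circTangent κ θ‖ ^ 2 = 1 := by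
  have hn : Real.sqrt (1 + κ ^ 2) ^ 2 = 1 + κ ^ 2 := Real.sq_sqrt (by positivity)
  have h0 : 0 < Real.sqrt (1 + κ ^ 2) := Real.sqrt_pos.2 (by positivity)
  have h1 := Real.sin_sq_add_cos_sq θ
  rw [norm_sq_E3]
  simp [circTangent]
  field_simp
  linear_combination (1 + κ ^ 2) * h1 + (Real.cos θ ^ 2 - 1) * hn

theorem norm_sq_circ (κ θ : ℝ) : ‖circ κ θ‖ ^ 2 = 1 := by
  have hn : Real.sqrt (1 + κ ^ 2) ^ 2 = 1 + κ ^ 2 := Real.sq_sqrt (by positivity)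
  have h1 := Real.sin_sq_add_cos_sq θ
  have h2 : 1 + κ ^ 2 ≠ 0 := by positivity
  rw [norm_sq_E3]
  simp [circ]
  field_simp
  linear_combination (1 + κ ^ 2) * h1 + (Real.sin θ ^ 2) * hn

theorem inner_circ_circTangent (κ θ : ℝ) : inner ℝ (circ κ θ) (circTangent κ θ) = 0 := by
  have hn : Real.sqrt (1 + κ ^ 2) ^ 2 = 1 + κ ^ 2 := Real.sq_sqrt (by positivity)
  have h0 : 0 < Real.sqrt (1 + κ ^ 2) := Real.sqrt_pos.2 (by positivity)
  have h2 : 1 + κ ^ 2 ≠ 0 := by positivity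
  rw [inner_E3]
  simp [circ, circTangent]
  field_simp
  linear_combination (Real.sin θ * Real.cos θ) * hn

theorem unitTangent_circ (κ θ : ℝ) : unitTangent (circ κ) θ = circTangent κ θ := by
  have h0 : 0 < Real.sqrt (1 + κ ^ 2) := Real.sqrt_pos.2 (by positivity)
  have h1 : ‖circTangent κ θ‖ = 1 := by
    have := norm_sq_circTangent κ θ
    nlinarith [norm_nonneg (circTangent κ θ)]
  rw [unitTangent, (hasDerivAt_circ κ θ).deriv, norm_smul, h1, mul_one, norm_inv,
    Real.norm_of_nonneg h0.le, inv_inv, smul_smul, mul_inv_cancel₀ h0.ne', one_smul]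

theorem det_frame4_circ (κ θ : ℝ) : (frame4 (circ κ θ) (circTangent κ θ)).det = 1 := by
  rw [det_frame4_eq_inner, norm_sq_circ, norm_sq_circTangent, inner_circ_circTangent]
  norm_num

theorem continuous_frame4_circ :
    Continuous fun a : ℝ × ℝ => frame4 (circ a.1 a.2) (circTangent a.1 a.2) := by
  have h0 : ∀ a : ℝ × ℝ, (1 + a.1 ^ 2) ≠ 0 := fun a => by positivity
  have h1 : ∀ a : ℝ × ℝ, Real.sqrt (1 + a.1 ^ 2) ≠ 0 := fun a =>
    (Real.sqrt_pos.2 (by positivity)).ne'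
  have h2 : Continuous fun a : ℝ × ℝ => (1 + a.1 ^ 2)⁻¹ :=
    Continuous.inv₀ (by fun_prop) h0
  have h3 : Continuous fun a : ℝ × ℝ => (Real.sqrt (1 + a.1 ^ 2))⁻¹ :=
    Continuous.inv₀ (by fun_prop) h1
  refine Continuous.frame4 (h2.smul ?_) (h3.smul ?_)
  · refine (PiLp.continuous_toLp 2 _).comp (continuous_pi fun i => ?_)
    fin_cases i <;> simp <;> fun_prop
  · refine (PiLp.continuous_toLp 2 _).comp (continuous_pi fun i => ?_)
    fin_cases i <;> simp <;> fun_prop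

theorem circ_of_cos_eq_one {κ θ : ℝ} (hc : Real.cos θ = 1) (hs : Real.sin θ = 0) :
    circ κ θ = !₂[1, 0, 0] := by
  have h2 : 1 + κ ^ 2 ≠ 0 := by positivity
  rw [circ, hc, hs]
  ext i
  fin_cases i <;> simp
  rw [add_comm, inv_mul_cancel₀ (by positivity)]

theorem circTangent_of_cos_eq_one {κ θ : ℝ} (hc : Real.cos θ = 1) (hs : Real.sin θ = 0) :
    circTangent κ θ = !₂[0, 1, 0] := by
  have h1 : Real.sqrt (1 + κ ^ 2) ≠ 0 := (Real.sqrt_pos.2 (by positivity)).ne'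
  rw [circTangent, hc, hs]
  ext i
  fin_cases i <;> simp [h1]

theorem frame4_std : frame4 !₂[1, 0, 0] !₂[0, 1, 0] = 1 := by
  ext i j
  fin_cases i <;> fin_cases j <;> simp [frame4]

theorem frame4_circ_of_cos_eq_one {κ θ : ℝ} (hc : Real.cos θ = 1) (hs : Real.sin θ = 0) :
    frame4 (circ κ θ) (circTangent κ θ) = 1 := by
  rw [circ_of_cos_eq_one hc hs, circTangent_of_cos_eq_one hc hs, frame4_std]

theorem frame4_circ_zero (θ : ℝ) :
    frame4 (circ 0 θ) (circTangent 0 θ) = rot12 (Real.cos θ) (Real.sin θ) := by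
  have h1 := Real.sin_sq_add_cos_sq θ
  ext i j
  fin_cases i <;> fin_cases j <;> simp [frame4, circ, circTangent, rot12]
  linear_combination h1

end Circle

/-! ### Removing the torsion -/

theorem norm_smul_lt_of_mem {E : Type*} [NormedAddCommGroup E] [NormedSpace ℝ E] {s r : ℝ}
    (hs0 : 0 ≤ s) (hs1 : s ≤ 1) {v : E} (hv : ‖v‖ < r) : ‖s • v‖ < r := by
  rw [norm_smul, Real.norm_of_nonneg hs0]
  nlinarith [norm_nonneg v]

/-- Vectors that are close to an orthonormal pair are linearly independent. -/
theorem det_frame4_ne_zero_of_close {a b v w : E3} (ha : ‖a‖ = 1) (hb : ‖b‖ = 1)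
    (hab : inner ℝ a b = 0) (hv : ‖v‖ < 1 / 10) (hw : ‖w‖ < 1 / 10) :
    (frame4 (a + v) (b + w)).det ≠ 0 := by
  have h1 : 9 / 10 ≤ ‖a + v‖ := by
    have := norm_sub_le (a + v) v
    rw [add_sub_cancel_right] at this
    linarith
  have h2 : 9 / 10 ≤ ‖b + w‖ := by
    have := norm_sub_le (b + w) w
    rw [add_sub_cancel_right] at this
    linarith
  have h3 : |inner ℝ (a + v) (b + w)| ≤ 21 / 100 := by
    rw [inner_add_left, inner_add_right, inner_add_right, hab, zero_add]
    have e1 := abs_real_inner_le_norm a w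
    have e2 := abs_real_inner_le_norm v b
    have e3 := abs_real_inner_le_norm v w
    have e4 : ‖v‖ * ‖w‖ ≤ 1 / 10 * (1 / 10) :=
      mul_le_mul hv.le hw.le (norm_nonneg _) (by norm_num)
    rw [ha, one_mul] at e1
    rw [hb, mul_one] at e2
    calc _ ≤ |inner ℝ a w| + |inner ℝ v b + inner ℝ v w| := abs_add_le _ _
      _ ≤ |inner ℝ a w| + (|inner ℝ v b| + |inner ℝ v w|) := by gcongr; exact abs_add_le _ _
      _ ≤ _ := by linarith
  rw [det_frame4_eq_inner]
  have h4 : (9 / 10 : ℝ) ^ 2 ≤ ‖a + v‖ ^ 2 := by gcongr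
  have h5 : (9 / 10 : ℝ) ^ 2 ≤ ‖b + w‖ ^ 2 := by gcongr
  have h6 : (inner ℝ (a + v) (b + w)) ^ 2 ≤ (21 / 100 : ℝ) ^ 2 := by
    rw [← sq_abs]; gcongr
  have h7 := mul_le_mul h4 h5 (by positivity) (by positivity)
  intro h8
  norm_num at h6 h7
  linarith

section Removing

variable {N : Type*} [TopologicalSpace N] [ChartedSpace (EuclideanSpace ℝ (Fin 3)) N]
  [IsManifold (𝓡 3) ∞ N]
variable {M : Type*} [TopologicalSpace M] [ChartedSpace (EuclideanSpace ℝ (Fin 4)) M]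
  [IsManifold (𝓡 4) ∞ M]
variable {𝒯 : Tube N M} {γ : N → ℝ → E3} {D : TangentDist 4 M}
variable {ι : N → M} {D' : TangentDist 4 M} {δ : ℝ} {A : AdaptedTube ι D}
variable {W X W₁ X₁ : (q : M) → TangentSpace (𝓡 4) q}

theorem AdaptedTube.unitTangent_zero (A : AdaptedTube ι D) (p : N) :
    unitTangent (A.H p) 0 = !₂[0, 1, 0] := by
  obtain ⟨c, hc, h⟩ := A.H_deriv_zero p
  have h1 : ‖(!₂[0, 1, 0] : E3)‖ = 1 := by
    rw [EuclideanSpace.norm_eq]; simp [Fin.sum_univ_three]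
  rw [unitTangent, h, norm_smul, h1, mul_one, Real.norm_of_nonneg hc.le, smul_smul,
    inv_mul_cancel₀ hc.ne', one_smul]

theorem AdaptedTube.frame4_zero (A : AdaptedTube ι D) (p : N) :
    frame4 (A.H p 0) (unitTangent (A.H p) 0) = 1 := by
  rw [A.H_zero, A.unitTangent_zero, frame4_std]

/-- The parameter on the curve `H_p` of the point of the concatenation with parameter `s`, constant
along the circle. -/
noncomputable def offCircle (s : ℝ) : ℝ := min s 0 + max (s - 2 * Real.pi) 0

/-- The parameter on the circle of the point of the concatenation with parameter `s`. -/
noncomputable def onCircle (s : ℝ) : ℝ := max 0 (min s (2 * Real.pi))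

theorem offOn_of_nonpos {s : ℝ} (hs : s ≤ 0) : offCircle s = s ∧ onCircle s = 0 := by
  have := Real.pi_pos
  rw [offCircle, onCircle, min_eq_left hs, max_eq_right (by linarith), min_eq_left (by linarith),
    max_eq_left hs, add_zero]
  exact ⟨rfl, rfl⟩

theorem offOn_of_mem {s : ℝ} (hs : 0 ≤ s) (hs' : s ≤ 2 * Real.pi) :
    offCircle s = 0 ∧ onCircle s = s := by
  rw [offCircle, onCircle, min_eq_right hs, max_eq_right (by linarith), min_eq_left hs',
    max_eq_right hs, add_zero]
  exact ⟨rfl, rfl⟩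

theorem offOn_of_ge {s : ℝ} (hs : 2 * Real.pi ≤ s) :
    offCircle s = s - 2 * Real.pi ∧ onCircle s = 2 * Real.pi := by
  have := Real.pi_pos
  rw [offCircle, onCircle, min_eq_right (by linarith), max_eq_left (by linarith), min_eq_right hs,
    max_eq_right (by linarith), zero_add]
  exact ⟨rfl, rfl⟩

theorem continuous_offCircle : Continuous offCircle := by unfold offCircle; fun_prop

theorem continuous_onCircle : Continuous onCircle := by unfold onCircle; fun_prop

/-- The moving frame of the concatenation of `H_p` and its osculating circle is the product of the
moving frames of the two curves. -/
theorem AdaptedTube.frame4_withCircle (A : AdaptedTube ι D) (p : N) (s : ℝ) :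
    frame4 (withCircle (fun γ s => γ s) (A.H p) s) (withCircle unitTangent (A.H p) s) =
      frame4 (A.H p (offCircle s)) (unitTangent (A.H p) (offCircle s)) *
        frame4 (circ (geodCurv (A.H p) 0) (onCircle s))
          (circTangent (geodCurv (A.H p) 0) (onCircle s)) := by
  by_cases h1 : s ≤ 0
  · obtain ⟨e1, e2⟩ := offOn_of_nonpos h1
    rw [e1, e2, frame4_circ_of_cos_eq_one Real.cos_zero Real.sin_zero, mul_one]
    simp only [withCircle, if_pos h1]
  by_cases h2 : s ≤ 2 * Real.pi
  · obtain ⟨e1, e2⟩ := offOn_of_mem (not_le.1 h1).le h2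
    rw [e1, e2, A.frame4_zero, one_mul, ← unitTangent_circ]
    simp only [withCircle, if_neg h1, if_pos h2]
  · obtain ⟨e1, e2⟩ := offOn_of_ge (not_le.1 h2).le
    rw [e1, e2, frame4_circ_of_cos_eq_one Real.cos_two_pi Real.sin_two_pi, mul_one]
    simp only [withCircle, if_neg h1, if_neg h2]

theorem EngelTorsion.offCircle_mem (L : EngelTorsion δ A D') (p : N) {t : ℝ}
    (ht : t ∈ Ioo (-A.ε) A.ε) : offCircle (L.τ p t) ∈ Ioo (-A.ε) A.ε := by
  have hp := Real.pi_pos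
  have ha := L.a_pos
  have ha' := L.a_lt
  rcases le_or_gt t (-L.a) with h | h
  · rw [L.τ_left p t ⟨ht.1, h⟩, (offOn_of_nonpos (by linarith)).1]
    exact ht
  rcases le_or_gt L.a t with h' | h'
  · rw [L.τ_right p t ⟨h', ht.2⟩, (offOn_of_ge (by linarith)).1]
    exact ⟨by linarith [ht.1], by linarith [ht.2]⟩
  have m1 : -L.a ∈ Ioo (-A.ε) A.ε := ⟨by linarith, by linarith⟩
  have m2 : L.a ∈ Ioo (-A.ε) A.ε := ⟨by linarith, by linarith⟩
  have h1 := L.τ_mono p m1 ht h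
  have h2 := L.τ_mono p ht m2 h'
  rw [L.τ_left p _ ⟨m1.1, le_rfl⟩] at h1
  rw [L.τ_right p _ ⟨le_rfl, m2.2⟩] at h2
  rcases le_or_gt (L.τ p t) 0 with h3 | h3
  · rw [(offOn_of_nonpos h3).1]
    exact ⟨by linarith, by linarith⟩
  rcases le_or_gt (2 * Real.pi) (L.τ p t) with h4 | h4
  · rw [(offOn_of_ge h4).1]
    exact ⟨by linarith, by linarith⟩
  · rw [(offOn_of_mem h3.le h4.le).1]
    exact ⟨by linarith, by linarith⟩

theorem EngelTorsion.b_pos (L : EngelTorsion δ A D') : 0 < L.b := L.a_pos.trans L.a_lt_b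

/-- The angle by which the Engel framing is rotated at height `t` in the tube. -/
noncomputable def EngelTorsion.angle (L : EngelTorsion δ A D') (t : ℝ) : ℝ :=
  Real.pi * (1 + max (-1) (min 1 (t / L.b)))

theorem EngelTorsion.continuous_angle (L : EngelTorsion δ A D') : Continuous L.angle := by
  unfold EngelTorsion.angle; fun_prop

theorem EngelTorsion.angle_of_le (L : EngelTorsion δ A D') {t : ℝ} (ht : t ≤ -L.b) :
    L.angle t = 0 := by
  have h1 : t / L.b ≤ -1 := by rw [div_le_iff₀ L.b_pos]; linarith
  rw [EngelTorsion.angle, min_eq_right (by linarith), max_eq_left h1]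
  ring

theorem EngelTorsion.angle_of_ge (L : EngelTorsion δ A D') {t : ℝ} (ht : L.b ≤ t) :
    L.angle t = 2 * Real.pi := by
  have h1 : 1 ≤ t / L.b := by rw [le_div_iff₀ L.b_pos]; linarith
  rw [EngelTorsion.angle, min_eq_left h1, max_eq_right (by norm_num)]
  ring

theorem EngelTorsion.cos_sin_angle (L : EngelTorsion δ A D') {t : ℝ} (ht : L.b ≤ |t|) :
    Real.cos (L.angle t) = 1 ∧ Real.sin (L.angle t) = 0 := by
  rcases le_abs.1 ht with h | h
  · rw [L.angle_of_ge h]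
    exact ⟨Real.cos_two_pi, Real.sin_two_pi⟩
  · rw [L.angle_of_le (by linarith)]
    exact ⟨Real.cos_zero, Real.sin_zero⟩

theorem AdaptedTube.continuous_frame4_mul_circ (A : AdaptedTube ι D) (hD : IsEngel D)
    {Y : Type*} [TopologicalSpace Y] {p : Y → N} {m k θ : Y → ℝ} (hp : Continuous p)
    (hm : Continuous m) (hmm : ∀ y, m y ∈ Ioo (-A.tube.ε) A.tube.ε) (hk : Continuous k)
    (hθ : Continuous θ) : Continuous fun y =>
      frame4 (A.H (p y) (m y)) (unitTangent (A.H (p y)) (m y)) *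
        frame4 (circ (k y) (θ y)) (circTangent (k y) (θ y)) := by
  have h1 : Continuous fun y => frame4 (circ (k y) (θ y)) (circTangent (k y) (θ y)) :=
    Continuous.comp (g := fun a : ℝ × ℝ => frame4 (circ a.1 a.2) (circTangent a.1 a.2))
      (f := fun y => (k y, θ y)) continuous_frame4_circ (hk.prodMk hθ)
  have h2 : Continuous fun y => frame4 (A.H (p y) (m y)) (unitTangent (A.H (p y)) (m y)) :=
    (A.describes.continuous_frame4 (A.immersed hD)).comp
      (f := fun y => ((p y, ⟨m y, hmm y⟩) : A.tube.Dom)) (hp.prodMk (hm.subtype_mk hmm))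
  exact h2.matrix_mul h1

theorem EngelTorsion.continuous_τ (L : EngelTorsion δ A D') :
    Continuous fun z : A.tube.Dom => L.τ z.1 z.2 :=
  L.τ_continuous.comp_continuous (f := fun z : A.tube.Dom => (z.1, (z.2 : ℝ))) (by fun_prop)
    fun z => ⟨mem_univ _, z.2.2⟩

theorem AdaptedTube.continuous_geodCurv_zero (A : AdaptedTube ι D) (hD : IsEngel D) :
    Continuous fun p => geodCurv (A.H p) 0 :=
  (A.describes.continuous_geodCurv (A.immersed hD)).comp
    (f := fun p => ((p, ⟨0, A.zero_mem⟩) : A.tube.Dom)) (by fun_prop)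

/-- The moving frame of the concatenations is homotopic, relative to the outside, to the moving
frame of the curves `H_p`, rotated once in the plane of the first two vectors. -/
theorem EngelTorsion.matHomotopic_withCircle (L : EngelTorsion δ A D') (hD : IsEngel D) :
    MatHomotopic {z : A.tube.Dom | L.b < |(z.2 : ℝ)|}
      (fun z => frame4 (withCircle (fun γ s => γ s) (A.H z.1) (L.τ z.1 z.2))
        (withCircle unitTangent (A.H z.1) (L.τ z.1 z.2)))
      (fun z => frame4 (A.H z.1 z.2) (unitTangent (A.H z.1) z.2) *
        rot12 (Real.cos (L.angle z.2)) (Real.sin (L.angle z.2))) := by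
  have hdesc := A.describes
  have himm := A.immersed hD
  have hτ := L.continuous_τ
  have hκ : Continuous fun z : A.tube.Dom => geodCurv (A.H z.1) 0 :=
    (A.continuous_geodCurv_zero hD).comp continuous_fst
  -- shrink the circle to a great circle, and let the parameter on `H_p` tend to `t`
  let m : unitInterval × A.tube.Dom → ℝ := fun x =>
    (1 - (x.1 : ℝ)) * offCircle (L.τ x.2.1 x.2.2) + x.1 * x.2.2
  have hm : Continuous m := by
    have := (continuous_offCircle.comp hτ).comp (continuous_snd (X := unitInterval))
    simp only [Function.comp_def] at this
    simp only [m]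
    fun_prop
  have hmm : ∀ x, m x ∈ Ioo (-A.tube.ε) A.tube.ε := by
    rintro ⟨⟨s, hs0, hs1⟩, z⟩
    exact (convex_Ioo (-A.ε) A.ε) (L.offCircle_mem z.1 z.2.2) z.2.2 (sub_nonneg.2 hs1) hs0
      (by ring)
  let k : unitInterval × A.tube.Dom → ℝ := fun x => (1 - (x.1 : ℝ)) * geodCurv (A.H x.2.1) 0
  have hk : Continuous k := by
    have := hκ.comp (continuous_snd (X := unitInterval))
    simp only [Function.comp_def] at this
    simp only [k]
    fun_prop
  let θ : unitInterval × A.tube.Dom → ℝ := fun x =>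
    (1 - (x.1 : ℝ)) * onCircle (L.τ x.2.1 x.2.2) + x.1 * L.angle x.2.2
  have hθ : Continuous θ := by
    have h1 := (continuous_onCircle.comp hτ).comp (continuous_snd (X := unitInterval))
    have h2 := L.continuous_angle
    simp only [Function.comp_def] at h1
    simp only [θ]
    fun_prop
  let G : unitInterval × A.tube.Dom → Matrix (Fin 4) (Fin 4) ℝ := fun x =>
    frame4 (A.H x.2.1 (m x)) (unitTangent (A.H x.2.1) (m x)) *
      frame4 (circ (k x) (θ x)) (circTangent (k x) (θ x))
  have hG : Continuous G :=
    A.continuous_frame4_mul_circ hD (continuous_fst.comp continuous_snd) hm hmm hk hθ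
  have hGdet : ∀ x, (G x).det ≠ 0 := by
    intro x
    have h1 := hdesc.det_frame4 himm (x.2.1, ⟨m x, hmm x⟩)
    simp only [G]
    rw [Matrix.det_mul, det_frame4_circ, mul_one]
    exact h1.trans_ne one_ne_zero
  have hout : ∀ z : A.tube.Dom, L.b < |(z.2 : ℝ)| → offCircle (L.τ z.1 z.2) = z.2 ∧
      onCircle (L.τ z.1 z.2) = L.angle z.2 := by
    intro z hz
    have hb := L.a_lt_b
    have hb' := L.b_pos
    rcases lt_abs.1 hz with h | h
    · rw [L.τ_right z.1 z.2 ⟨by linarith, z.2.2.2⟩, L.angle_of_ge h.le]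
      obtain ⟨e1, e2⟩ := offOn_of_ge (s := (z.2 : ℝ) + 2 * Real.pi) (by linarith)
      exact ⟨e1.trans (by ring), e2⟩
    · rw [L.τ_left z.1 z.2 ⟨z.2.2.1, by linarith⟩, L.angle_of_le (by linarith)]
      exact offOn_of_nonpos (by linarith)
  refine ⟨G, hG, hGdet, fun z => ?_, fun z => ?_, fun z hz s => ?_⟩
  · simp only [G, m, k, θ]
    rw [A.frame4_withCircle]
    simp
  · simp only [G, m, k, θ]
    simp [frame4_circ_zero]
  · obtain ⟨e1, e2⟩ := hout z hz
    obtain ⟨e3, e4⟩ := L.cos_sin_angle (le_of_lt hz)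
    have h1 : ∀ s, m (s, z) = z.2 := fun s => by simp only [m]; rw [e1]; ring
    have h2 : ∀ s, θ (s, z) = L.angle z.2 := fun s => by simp only [θ]; rw [e2]; ring
    simp only [G]
    rw [h1, h1, h2, h2, frame4_circ_of_cos_eq_one e3 e4, frame4_circ_of_cos_eq_one e3 e4]

/-- The moving frame of the curves `lam_p` is homotopic, relative to the outside, to the moving
frame of the concatenations, because the two are close to each other. -/
theorem EngelTorsion.matHomotopic_lam (L : EngelTorsion (1 / 10) A D') (hD : IsEngel D) :
    MatHomotopic {z : A.tube.Dom | L.b < |(z.2 : ℝ)|}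
      (fun z => frame4 (L.lam z.1 z.2) (unitTangent (L.lam z.1) z.2))
      (fun z => frame4 (withCircle (fun γ s => γ s) (A.H z.1) (L.τ z.1 z.2))
        (withCircle unitTangent (A.H z.1) (L.τ z.1 z.2))) := by
  have hdesc' := L.describes
  have himm' := L.immersed
  let η : A.tube.Dom → E3 := fun z => withCircle (fun γ s => γ s) (A.H z.1) (L.τ z.1 z.2)
  let ζ : A.tube.Dom → E3 := fun z => withCircle unitTangent (A.H z.1) (L.τ z.1 z.2)
  have hG0c : Continuous fun z => frame4 (η z) (ζ z) := by
    obtain ⟨G, hG, -, h0, -⟩ := L.matHomotopic_withCircle hD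
    have : Continuous fun z : A.tube.Dom => G (0, z) := hG.comp (by fun_prop)
    simpa only [h0] using this
  have hηc : Continuous η := by
    refine (PiLp.continuous_toLp 2 _).comp (g := WithLp.toLp 2) (f := fun z i => η z i)
      (continuous_pi fun i => ?_)
    fin_cases i
    exacts [hG0c.matrix_elem 1 1, hG0c.matrix_elem 2 1, hG0c.matrix_elem 3 1]
  have hζc : Continuous ζ := by
    refine (PiLp.continuous_toLp 2 _).comp (g := WithLp.toLp 2) (f := fun z i => ζ z i)
      (continuous_pi fun i => ?_)
    fin_cases i
    exacts [hG0c.matrix_elem 1 2, hG0c.matrix_elem 2 2, hG0c.matrix_elem 3 2]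
  have hlc := hdesc'.continuous
  have huc := hdesc'.continuous_unitTangent himm'
  refine ⟨fun x => frame4 (L.lam x.2.1 x.2.2 + (x.1 : ℝ) • (η x.2 - L.lam x.2.1 x.2.2))
    (unitTangent (L.lam x.2.1) x.2.2 + (x.1 : ℝ) • (ζ x.2 - unitTangent (L.lam x.2.1) x.2.2)),
    ?_, ?_, ?_, ?_, ?_⟩
  · have h1 := hlc.comp (continuous_snd (X := unitInterval))
    have h2 := huc.comp (continuous_snd (X := unitInterval))
    have h3 := hηc.comp (continuous_snd (X := unitInterval))
    have h4 := hζc.comp (continuous_snd (X := unitInterval))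
    have h5 : Continuous fun x : unitInterval × A.tube.Dom => (x.1 : ℝ) := by fun_prop
    exact Continuous.frame4 (h1.add (h5.smul (h3.sub h1))) (h2.add (h5.smul (h4.sub h2)))
  · rintro ⟨⟨s, hs0, hs1⟩, z⟩
    have h1 := hdesc'.norm_eq z.1 z.2 z.2.2
    have h2 := Tube.Describes.norm_unitTangent himm' z
    have h3 := hdesc'.inner_unitTangent z
    have h4 : ‖η z - L.lam z.1 z.2‖ < 1 / 10 := by
      rw [norm_sub_rev]; exact L.close_position z.1 z.2 z.2.2
    have h5 : ‖ζ z - unitTangent (L.lam z.1) z.2‖ < 1 / 10 := by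
      rw [norm_sub_rev]; exact L.close_tangent z.1 z.2 z.2.2
    exact det_frame4_ne_zero_of_close h1 h2 h3 (norm_smul_lt_of_mem hs0 hs1 h4)
      (norm_smul_lt_of_mem hs0 hs1 h5)
  · intro z
    simp
  · intro z
    simp [η, ζ]
  · intro z hz s
    have hb := L.a_lt_b
    have hz' : L.a < |(z.2 : ℝ)| := hb.trans hz
    have e0 : L.lam z.1 =ᶠ[𝓝 (z.2 : ℝ)] A.H z.1 := by
      have hc : Continuous fun t : ℝ => |t| := continuous_abs
      filter_upwards [isOpen_Ioo.mem_nhds z.2.2,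
        hc.continuousAt.eventually (lt_mem_nhds hz')] with t ht ht'
      exact L.lam_eq z.1 t ht ht'.le
    have e1 : unitTangent (L.lam z.1) z.2 = unitTangent (A.H z.1) z.2 := by
      rw [unitTangent, unitTangent, e0.deriv_eq]
    have e2 : η z = L.lam z.1 z.2 ∧ ζ z = unitTangent (L.lam z.1) z.2 := by
      rw [e0.eq_of_nhds, e1]
      have hp := Real.pi_pos
      have hb' := L.b_pos
      rcases lt_abs.1 hz' with h | h
      · have h1 : L.τ z.1 z.2 = z.2 + 2 * Real.pi := L.τ_right z.1 z.2 ⟨h.le, z.2.2.2⟩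
        have ha := L.a_pos
        have h2 : ¬ ((z.2 : ℝ) + 2 * Real.pi ≤ 0) := by linarith
        have h3 : ¬ ((z.2 : ℝ) + 2 * Real.pi ≤ 2 * Real.pi) := by linarith
        simp only [η, ζ, withCircle, h1, if_neg h2, if_neg h3, add_sub_cancel_right]
        exact ⟨trivial, trivial⟩
      · have h1 : L.τ z.1 z.2 = z.2 := L.τ_left z.1 z.2 ⟨z.2.2.1, by linarith⟩
        have ha := L.a_pos
        have h2 : (z.2 : ℝ) ≤ 0 := by linarith
        simp only [η, ζ, withCircle, h1, if_pos h2]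
        exact ⟨trivial, trivial⟩
    simp only
    rw [e2.1, e2.2, sub_self, sub_self, smul_zero, smul_zero]

end Removing

/-! ### The Engel framing of the modified structure -/

section RotatedFraming

variable {N : Type*} [TopologicalSpace N] [ChartedSpace (EuclideanSpace ℝ (Fin 3)) N]
  [IsManifold (𝓡 3) ∞ N]
variable {M : Type*} [TopologicalSpace M] [ChartedSpace (EuclideanSpace ℝ (Fin 4)) M]
  [IsManifold (𝓡 4) ∞ M]
variable {𝒯 : Tube N M} {γ : N → ℝ → E3} {D : TangentDist 4 M}
variable {ι : N → M} {D' : TangentDist 4 M} {δ : ℝ} {A : AdaptedTube ι D}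
variable {W X W₁ X₁ : (q : M) → TangentSpace (𝓡 4) q}

theorem engelFraming_congr {q : M} (hW : W =ᶠ[𝓝 q] W₁) (hX : X =ᶠ[𝓝 q] X₁) :
    engelFraming W X q = engelFraming W₁ X₁ q := by
  have h1 : VectorField.mlieBracket (𝓡 4) W X =ᶠ[𝓝 q] VectorField.mlieBracket (𝓡 4) W₁ X₁ :=
    hW.mlieBracket_vectorField hX
  simp only [engelFraming]
  rw [hW.self_of_nhds, hX.self_of_nhds, h1.self_of_nhds, hX.mlieBracket_vectorField_eq h1]

/-- The framing obtained from `F` by rotating its first two vectors; the functions `c` and `s` are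
the cosine and the sine of the angle. -/
noncomputable def rotFraming (c s : M → ℝ) (F : (q : M) → Fin 4 → TangentSpace (𝓡 4) q) (q : M)
    (i : Fin 4) : TangentSpace (𝓡 4) q := ∑ j, rot01 (c q) (s q) j i • F q j

theorem sum_smul_sum_smul {V : Type*} [AddCommGroup V] [Module ℝ V]
    {P R : Matrix (Fin 4) (Fin 4) ℝ} {f g : Fin 4 → V} (h : ∀ j, f j = ∑ l, P l j • g l)
    (i : Fin 4) : ∑ j, R j i • f j = ∑ l, (P * R) l i • g l := by
  simp only [h, Finset.smul_sum, smul_smul, Matrix.mul_apply, Finset.sum_smul]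
  rw [Finset.sum_comm]
  exact Finset.sum_congr rfl fun l _ => Finset.sum_congr rfl fun j _ => by rw [mul_comm]

theorem rot01_one : rot01 1 0 = 1 := by
  ext i j
  fin_cases i <;> fin_cases j <;> simp [rot01]

theorem rotFraming_of_eq_one {c s : M → ℝ} {F : (q : M) → Fin 4 → TangentSpace (𝓡 4) q} {q : M}
    (hc : c q = 1) (hs : s q = 0) : rotFraming c s F q = F q := by
  funext i
  rw [rotFraming, hc, hs, rot01_one]
  simp [Matrix.one_apply]

theorem Tube.Describes.mov_coeff_unique (h : 𝒯.Describes γ D) (hi : 𝒯.Immersed γ) {z : 𝒯.Dom}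
    {c c' : Fin 4 → ℝ} (he : ∑ j, c j • 𝒯.mov γ j z = ∑ j, c' j • 𝒯.mov γ j z) (j : Fin 4) :
    c j = c' j :=
  sub_eq_zero.1 (Fintype.linearIndependent_iff.1 (h.linearIndependent_mov hi z)
    (fun j => c j - c' j) (by simp only [sub_smul, Finset.sum_sub_distrib, he, sub_self]) j)

/-- The derived distribution is spanned by the first three vectors of the moving frame. -/
theorem Tube.Describes.exists_of_mem_derivedDist (h : 𝒯.Describes γ D) (hi : 𝒯.Immersed γ)
    {z : 𝒯.Dom} {v : TangentSpace (𝓡 4) (𝒯.φ z)} (hv : v ∈ derivedDist D (𝒯.φ z)) :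
    ∃ a b c : ℝ, v = a • 𝒯.mov γ 0 z + b • 𝒯.mov γ 1 z + c • 𝒯.mov γ 2 z := by
  obtain ⟨hy, hz⟩ := Tube.exists_eq_toDom (mem_extChartAt_source (I := 𝓡 3) z.1)
  generalize (extChartAt (𝓡 3) z.1 z.1, (z.2 : ℝ)) = y at hy hz
  generalize z.1 = p₀ at hy hz
  subst hz
  have e0 : 𝒯.mov γ 0 (Tube.toDom p₀ y hy) = dparam 4 (𝒯.Ψ p₀) y ((0 : E3), (1 : ℝ)) :=
    (Tube.mov_zero _).trans (Tube.tubeT_eq hy)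
  have e1 : 𝒯.mov γ 1 (Tube.toDom p₀ y hy) = dparam 4 (𝒯.Ψ p₀) y (𝒯.field γ p₀ y, (0 : ℝ)) :=
    (Tube.mov_one _).trans (Tube.tubeVec_eq hy _)
  have e2 : 𝒯.mov γ 2 (Tube.toDom p₀ y hy) = dparam 4 (𝒯.Ψ p₀) y
      (∑ i, unitTangent (γ (chartInv p₀ y.1)) y.2 i • 𝒯.frame p₀ i y.1, (0 : ℝ)) :=
    (Tube.mov_two _).trans (Tube.tubeVec_eq hy _)
  have hn : ‖deriv (γ (chartInv p₀ y.1)) y.2‖ ≠ 0 := norm_ne_zero_iff.2 (hi _ _ hy.2)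
  have e3 : dparam 4 (𝒯.Ψ p₀) y (dt (𝒯.field γ p₀) y, (0 : ℝ)) =
      ‖deriv (γ (chartInv p₀ y.1)) y.2‖ • dparam 4 (𝒯.Ψ p₀) y
        (∑ i, unitTangent (γ (chartInv p₀ y.1)) y.2 i • 𝒯.frame p₀ i y.1, (0 : ℝ)) := by
    rw [← map_smul, h.dt_field hy]
    congr 1
    simp only [Prod.smul_mk, Finset.smul_sum, smul_smul, unitTangent, PiLp.smul_apply, smul_eq_mul,
      mul_inv_cancel_left₀ hn, mul_zero]
  have key : ∀ v : TangentSpace (𝓡 4) (𝒯.Ψ p₀ y), v ∈ derivedDist D (𝒯.Ψ p₀ y) →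
      ∃ a b c : ℝ, v = a • dparam 4 (𝒯.Ψ p₀) y ((0 : E3), (1 : ℝ)) +
        b • dparam 4 (𝒯.Ψ p₀) y (𝒯.field γ p₀ y, (0 : ℝ)) +
        c • dparam 4 (𝒯.Ψ p₀) y (dt (𝒯.field γ p₀) y, (0 : ℝ)) := by
    intro v hv
    rw [(h.isFieldModel p₀).derivedDist_eq hy] at hv
    exact mem_span_range_three.1 hv
  obtain ⟨a, b, c, habc⟩ := key v hv
  refine ⟨a, b, c * ‖deriv (γ (chartInv p₀ y.1)) y.2‖, habc.trans ?_⟩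
  refine congrArg₂ (· + ·) (congrArg₂ (· + ·) (congrArg (a • ·) e0.symm)
    (congrArg (b • ·) e1.symm)) ?_
  exact (congrArg (c • ·) e3).trans ((smul_smul _ _ _).trans (congrArg (_ • ·) e2.symm))

/-- With respect to the moving frame, the Engel framing is block triangular. -/
theorem Tube.Describes.engelFraming_block (h : 𝒯.Describes γ D) (hi : 𝒯.Immersed γ)
    (hWX : IsEngelPair D W X) {z : 𝒯.Dom} {Q : Matrix (Fin 4) (Fin 4) ℝ}
    (hQ : ∀ i, engelFraming W X (𝒯.φ z) i = ∑ j, Q j i • 𝒯.mov γ j z) :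
    Q 2 0 = 0 ∧ Q 2 1 = 0 ∧ Q 3 0 = 0 ∧ Q 3 1 = 0 ∧ Q 3 2 = 0 := by
  have key : ∀ i, engelFraming W X (𝒯.φ z) i ∈ D (𝒯.φ z) → Q 2 i = 0 ∧ Q 3 i = 0 := by
    intro i hi'
    obtain ⟨a, b, hab⟩ := h.mem_iff_mov.1 hi'
    have h1 := h.mov_coeff_unique hi (c := fun j => Q j i) (c' := ![a, b, 0, 0]) (z := z)
      ((hQ i).symm.trans (hab.trans (by
        simp only [Fin.sum_univ_four, Matrix.cons_val_zero, Matrix.cons_val_one, Matrix.cons_val,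
          zero_smul, add_zero])))
    exact ⟨h1 2, h1 3⟩
  have k0 := key 0 (hWX.mem_W _)
  have k1 := key 1 (hWX.mem_X _)
  refine ⟨k0.1, k1.1, k0.2, k1.2, ?_⟩
  have h2 : engelFraming W X (𝒯.φ z) 2 ∈ derivedDist D (𝒯.φ z) :=
    hWX.mem_derivedDist_iff.2 ⟨0, 0, 1, by rw [zero_smul, zero_smul, one_smul, zero_add, zero_add]; rfl⟩
  obtain ⟨a, b, c, habc⟩ := h.exists_of_mem_derivedDist hi h2
  exact h.mov_coeff_unique hi (c := fun j => Q j 2) (c' := ![a, b, c, 0]) (z := z)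
    ((hQ 2).symm.trans (habc.trans (by
      simp only [Fin.sum_univ_four, Matrix.cons_val_zero, Matrix.cons_val_one, Matrix.cons_val,
        zero_smul, add_zero]))) 3

theorem EngelTorsion.frame4_eq (L : EngelTorsion δ A D') {z : A.tube.Dom}
    (hz : L.a < |(z.2 : ℝ)|) : frame4 (L.lam z.1 z.2) (unitTangent (L.lam z.1) z.2) =
      frame4 (A.H z.1 z.2) (unitTangent (A.H z.1) z.2) := by
  have e0 : L.lam z.1 =ᶠ[𝓝 (z.2 : ℝ)] A.H z.1 := by
    have hc : Continuous fun t : ℝ => |t| := continuous_abs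
    filter_upwards [isOpen_Ioo.mem_nhds z.2.2,
      hc.continuousAt.eventually (lt_mem_nhds hz)] with t ht ht'
    exact L.lam_eq z.1 t ht ht'.le
  rw [unitTangent, unitTangent, e0.deriv_eq, e0.eq_of_nhds]

theorem Tube.isPreconnected_fibre (p : N) : IsPreconnected {z : 𝒯.Dom | z.1 = p} := by
  have h1 : {z : 𝒯.Dom | z.1 = p} = {p} ×ˢ univ := by ext; simp
  rw [h1]
  have : PreconnectedSpace (Ioo (-𝒯.ε) 𝒯.ε) :=
    isPreconnected_iff_preconnectedSpace.1 isPreconnected_Ioo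
  exact isPreconnected_singleton.prod isPreconnected_univ

theorem EngelTorsion.exists_fibre_outside (L : EngelTorsion δ A D') (p : N) :
    ∃ z : A.tube.Dom, z.1 = p ∧ L.b < |(z.2 : ℝ)| := by
  obtain ⟨t, ht, ht'⟩ := exists_between L.b_lt
  exact ⟨(p, ⟨t, by change -A.ε < t; linarith [L.b_pos, A.ε_pos], ht'⟩), rfl,
    ht.trans_le (le_abs_self t)⟩

/-- The cosine of the angle of rotation, extended to `M`. -/
noncomputable def EngelTorsion.cosMap (L : EngelTorsion δ A D') : M → ℝ :=
  Function.extend A.tube.φ (fun z => Real.cos (L.angle z.2)) 1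

/-- The sine of the angle of rotation, with the sense of rotation given by `ρ`, extended to `M`. -/
noncomputable def EngelTorsion.sinMap (L : EngelTorsion δ A D') (ρ : N → ℝ) : M → ℝ :=
  Function.extend A.tube.φ (fun z => ρ z.1 * Real.sin (L.angle z.2)) 0

theorem EngelTorsion.cosMap_φ (L : EngelTorsion δ A D') (z : A.tube.Dom) :
    L.cosMap (A.tube.φ z) = Real.cos (L.angle z.2) := Tube.injective_φ.extend_apply _ _ _

theorem EngelTorsion.sinMap_φ (L : EngelTorsion δ A D') (ρ : N → ℝ) (z : A.tube.Dom) :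
    L.sinMap ρ (A.tube.φ z) = ρ z.1 * Real.sin (L.angle z.2) :=
  Tube.injective_φ.extend_apply _ _ _

theorem EngelTorsion.cosMap_of_notMem (L : EngelTorsion δ A D') {q : M}
    (hq : q ∉ range A.tube.φ) : L.cosMap q = 1 :=
  Function.extend_apply' _ _ _ hq

theorem EngelTorsion.sinMap_of_notMem (L : EngelTorsion δ A D') (ρ : N → ℝ) {q : M}
    (hq : q ∉ range A.tube.φ) : L.sinMap ρ q = 0 :=
  Function.extend_apply' _ _ _ hq

theorem EngelTorsion.isClosed_image [T2Space M] [CompactSpace N] (L : EngelTorsion δ A D') :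
    IsClosed (A.tube.φ '' {z | |(z.2 : ℝ)| ≤ L.b}) := by
  have h1 : A.tube.φ '' {z | |(z.2 : ℝ)| ≤ L.b} = A.Φ '' (univ ×ˢ Icc (-L.b) L.b) := by
    ext q
    constructor
    · rintro ⟨z, hz, rfl⟩
      exact ⟨(z.1, (z.2 : ℝ)), ⟨mem_univ _, abs_le.1 hz⟩, rfl⟩
    · rintro ⟨⟨p, t⟩, ht, rfl⟩
      exact ⟨(p, ⟨t, by change -A.ε < t; linarith [ht.2.1, L.b_lt],
        by change t < A.ε; linarith [ht.2.2, L.b_lt]⟩), abs_le.2 ht.2, rfl⟩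
  rw [h1]
  refine IsCompact.isClosed ((isCompact_univ.prod isCompact_Icc).image_of_continuousOn
    (A.Φ_smooth.continuousOn.mono ?_))
  exact prod_mono subset_rfl fun t ht => ⟨by linarith [ht.1, L.b_lt], by linarith [ht.2, L.b_lt]⟩

theorem EngelTorsion.engelFraming_eq [T2Space M] [CompactSpace N] (L : EngelTorsion δ A D')
    (hoff : ∀ q, q ∉ A.tube.φ '' {z | |(z.2 : ℝ)| < L.b} → W₁ q = W q ∧ X₁ q = X q) {q : M}
    (hq : q ∉ A.tube.φ '' {z | |(z.2 : ℝ)| ≤ L.b}) : engelFraming W₁ X₁ q = engelFraming W X q := by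
  have h1 : ∀ᶠ y in 𝓝 q, W₁ y = W y ∧ X₁ y = X y := by
    filter_upwards [L.isClosed_image.isOpen_compl.mem_nhds hq] with y hy
    exact hoff y fun ⟨z, hz, hzy⟩ => hy ⟨z, (show |(z.2 : ℝ)| < L.b from hz).le, hzy⟩
  exact engelFraming_congr (h1.mono fun _ h => h.1) (h1.mono fun _ h => h.2)

theorem continuous_sign_of_ne_zero {Y : Type*} [TopologicalSpace Y] {f : Y → ℝ} (hf : Continuous f)
    (h0 : ∀ y, f y ≠ 0) : ∃ σ : Y → ℝ, Continuous σ ∧ (∀ y, σ y ^ 2 = 1) ∧ ∀ y, 0 < σ y * f y := by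
  refine ⟨fun y => f y / |f y|, hf.div hf.abs fun y => abs_ne_zero.2 (h0 y), fun y => ?_,
    fun y => ?_⟩
  · rw [div_pow, sq_abs, div_self (pow_ne_zero 2 (h0 y))]
  · rw [div_mul_eq_mul_div]
    exact div_pos (mul_self_pos.2 (h0 y)) (abs_pos.2 (h0 y))

variable [T2Space M] [CompactSpace N]

/-- The Engel framing of the modified structure arises from the original one by rotating the first
two vectors once along the fibres of the tube, in a sense that may be chosen. -/
theorem EngelTorsion.framingHomotopic_rotFraming_of_compatible (L : EngelTorsion (1 / 10) A D')
    (hD : IsEngel D) (hWX : IsEngelPair D W X) (hWX₁ : IsEngelPair D' W₁ X₁)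
    (hoff : ∀ q, q ∉ A.tube.φ '' {z | |(z.2 : ℝ)| < L.b} → W₁ q = W q ∧ X₁ q = X q)
    (hcomp : L.Compatible W X W₁ X₁) {ρ : N → ℝ} (hρ : Continuous ρ) (hρ1 : ∀ p, ρ p ^ 2 = 1) :
    FramingHomotopic (engelFraming W₁ X₁) (rotFraming L.cosMap (L.sinMap ρ) (engelFraming W X)) := by
  have hD' := L.isEngel hD hWX
  have hdesc := A.describes
  have himm := A.immersed hD
  have hdesc' := L.describes
  have himm' := L.immersed
  obtain ⟨Q, hQ, hQdet, hQF⟩ := hdesc.exists_matrix himm (hWX.isFraming hD)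
  obtain ⟨Q₁, hQ₁, hQ₁det, hQ₁F⟩ := hdesc'.exists_matrix himm' (hWX₁.isFraming hD')
  have hbl : ∀ z, Q z 2 0 = 0 ∧ Q z 2 1 = 0 ∧ Q z 3 0 = 0 ∧ Q z 3 1 = 0 ∧ Q z 3 2 = 0 :=
    fun z => hdesc.engelFraming_block himm hWX (hQF z)
  have hbl₁ : ∀ z, Q₁ z 2 0 = 0 ∧ Q₁ z 2 1 = 0 ∧ Q₁ z 3 0 = 0 ∧ Q₁ z 3 1 = 0 ∧ Q₁ z 3 2 = 0 :=
    fun z => hdesc'.engelFraming_block himm' hWX₁ (hQ₁F z)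
  have hbl' : ∀ z, Q z 2 0 = 0 ∧ Q z 2 1 = 0 ∧ Q z 3 0 = 0 ∧ Q z 3 1 = 0 :=
    fun z => ⟨(hbl z).1, (hbl z).2.1, (hbl z).2.2.1, (hbl z).2.2.2.1⟩
  have hbl₁' : ∀ z, Q₁ z 2 0 = 0 ∧ Q₁ z 2 1 = 0 ∧ Q₁ z 3 0 = 0 ∧ Q₁ z 3 1 = 0 :=
    fun z => ⟨(hbl₁ z).1, (hbl₁ z).2.1, (hbl₁ z).2.2.1, (hbl₁ z).2.2.2.1⟩
  have hne : ∀ z, Q z 0 0 * Q z 1 1 - Q z 0 1 * Q z 1 0 ≠ 0 ∧ Q z 2 2 ≠ 0 ∧ Q z 3 3 ≠ 0 := by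
    intro z
    have h1 := hQdet z
    rw [det_of_lowerLeft_zero (hbl' z), (hbl z).2.2.2.2, mul_zero, sub_zero] at h1
    exact ⟨left_ne_zero_of_mul h1, left_ne_zero_of_mul (right_ne_zero_of_mul h1),
      right_ne_zero_of_mul (right_ne_zero_of_mul h1)⟩
  have hne₁ : ∀ z, Q₁ z 2 2 ≠ 0 ∧ Q₁ z 3 3 ≠ 0 := by
    intro z
    have h1 := hQ₁det z
    rw [det_of_lowerLeft_zero (hbl₁' z), (hbl₁ z).2.2.2.2, mul_zero, sub_zero] at h1
    exact ⟨left_ne_zero_of_mul (right_ne_zero_of_mul h1),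
      right_ne_zero_of_mul (right_ne_zero_of_mul h1)⟩
  -- outside of the modification the two matrices agree
  have hmem : ∀ z : A.tube.Dom, L.b < |(z.2 : ℝ)| →
      A.tube.φ z ∉ A.tube.φ '' {z | |(z.2 : ℝ)| ≤ L.b} := by
    rintro z hz ⟨z', hz', he⟩
    rw [Tube.injective_φ he] at hz'
    exact absurd hz (not_lt.2 hz')
  have heq : ∀ z : A.tube.Dom, L.b < |(z.2 : ℝ)| → Q₁ z = Q z := by
    intro z hz
    have h1 := L.engelFraming_eq hoff (hmem z hz)
    have h2 := L.frame4_eq (L.a_lt_b.trans hz)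
    have h3 : ∀ j, A.tube.mov L.lam j z = A.tube.mov A.H j z := fun j => by
      simp only [Tube.mov, h2]
    ext j i
    refine hdesc.mov_coeff_unique himm (z := z) (c := fun j => Q₁ z j i) (c' := fun j => Q z j i)
      ?_ j
    have h4 := hQ₁F z i
    simp only [h3] at h4
    rw [← h4, ← hQF z i, h1]
  have hsign : ∀ j, (∀ z, Q z j j ≠ 0) → (∀ z, Q₁ z j j ≠ 0) → ∀ z, 0 < Q₁ z j j * Q z j j := by
    intro j h h₁ z
    obtain ⟨z₁, hz₁, hz₁'⟩ := L.exists_fibre_outside z.1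
    have hc : Continuous fun z => Q₁ z j j * Q z j j :=
      (hQ₁.matrix_elem j j).mul (hQ.matrix_elem j j)
    refine pos_of_isPreconnected (Tube.isPreconnected_fibre (𝒯 := A.tube) z.1) hc.continuousOn
      (fun z _ => mul_ne_zero (h₁ z) (h z)) (y₀ := z₁) hz₁ ?_ rfl
    simp only [heq z₁ hz₁']
    exact mul_self_pos.2 (h z₁)
  have hW : ∀ z, W (A.tube.φ z) =
      Q z 0 0 • A.tube.mov A.H 0 z + Q z 1 0 • A.tube.mov A.H 1 z := fun z =>
    (hQF z 0).trans (by
      rw [Fin.sum_univ_four, (hbl z).1, (hbl z).2.2.1, zero_smul, zero_smul, add_zero, add_zero])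
  have hX : ∀ z, X (A.tube.φ z) =
      Q z 0 1 • A.tube.mov A.H 0 z + Q z 1 1 • A.tube.mov A.H 1 z := fun z =>
    (hQF z 1).trans (by
      rw [Fin.sum_univ_four, (hbl z).2.1, (hbl z).2.2.2.1, zero_smul, zero_smul, add_zero,
        add_zero])
  have hW₁ : ∀ z, W₁ (A.tube.φ z) =
      Q₁ z 0 0 • A.tube.mov L.lam 0 z + Q₁ z 1 0 • A.tube.mov L.lam 1 z := fun z =>
    (hQ₁F z 0).trans (by
      rw [Fin.sum_univ_four, (hbl₁ z).1, (hbl₁ z).2.2.1, zero_smul, zero_smul, add_zero, add_zero])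
  have hX₁ : ∀ z, X₁ (A.tube.φ z) =
      Q₁ z 0 1 • A.tube.mov L.lam 0 z + Q₁ z 1 1 • A.tube.mov L.lam 1 z := fun z =>
    (hQ₁F z 1).trans (by
      rw [Fin.sum_univ_four, (hbl₁ z).2.1, (hbl₁ z).2.2.2.1, zero_smul, zero_smul, add_zero,
        add_zero])
  have hc2 : ∀ z, _ := fun z => hcomp z _ _ _ _ _ _ _ _ (hW z) (hX z) (hW₁ z) (hX₁ z)
  obtain ⟨σ, hσ, hσ1, hσpos⟩ := continuous_sign_of_ne_zero
    (((hQ.matrix_elem 0 0).mul (hQ.matrix_elem 1 1)).sub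
      ((hQ.matrix_elem 0 1).mul (hQ.matrix_elem 1 0))) (fun z => (hne z).1)
  set S : Set A.tube.Dom := {z | L.b < |(z.2 : ℝ)|} with hSdef
  have hfr' := hdesc'.continuous_frame4 himm'
  have hfr := hdesc.continuous_frame4 himm
  have hc : Continuous fun z : A.tube.Dom => Real.cos (L.angle z.2) :=
    Real.continuous_cos.comp (L.continuous_angle.comp (by fun_prop))
  have hs : Continuous fun z : A.tube.Dom => Real.sin (L.angle z.2) :=
    Real.continuous_sin.comp (L.continuous_angle.comp (by fun_prop))
  have hcs : ∀ z : A.tube.Dom, Real.cos (L.angle z.2) ^ 2 + Real.sin (L.angle z.2) ^ 2 = 1 :=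
    fun z => Real.cos_sq_add_sin_sq _
  have hS : ∀ z ∈ S, Real.cos (L.angle z.2) = 1 ∧ Real.sin (L.angle z.2) = 0 := fun z hz =>
    L.cos_sin_angle (le_of_lt hz)
  have hχ : Continuous fun z : A.tube.Dom => ρ z.1 * σ z := (hρ.comp continuous_fst).mul hσ
  have hχ1 : ∀ z : A.tube.Dom, (ρ z.1 * σ z) ^ 2 = 1 := fun z => by
    rw [mul_pow, hρ1, hσ1, one_mul]
  have hdet1 : ∀ z : A.tube.Dom, (frame4 (A.H z.1 z.2) (unitTangent (A.H z.1) z.2)).det ≠ 0 :=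
    fun z => by rw [hdesc.det_frame4 himm]; exact one_ne_zero
  have s1 : MatHomotopic S (fun z => frame4 (L.lam z.1 z.2) (unitTangent (L.lam z.1) z.2) * Q₁ z)
      (fun z => frame4 (L.lam z.1 z.2) (unitTangent (L.lam z.1) z.2) * Q z) :=
    (matHomotopic_of_block hQ hQ₁ hbl hbl₁ (fun z => (hc2 z).1)
      (fun z => by have := (hc2 z).2; linarith)
      (hsign 2 (fun z => (hne z).2.1) (fun z => (hne₁ z).1))
      (hsign 3 (fun z => (hne z).2.2) (fun z => (hne₁ z).2)) heq).mul_left hfr'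
      (fun z => by rw [hdesc'.det_frame4 himm']; exact one_ne_zero)
  have s2 := ((L.matHomotopic_lam hD).trans (L.matHomotopic_withCircle hD)).mul_right hQ hQdet
  have s3 := ((matHomotopic_rot12_rot01 hc hs hχ hcs hχ1 hS).mul_left hfr hdet1).mul_right hQ hQdet
  have s4 := (matHomotopic_rot01_mul hc hs hχ hcs hχ1 hQ hQdet hbl' hσ hσ1 hσpos hS).mul_left
    hfr hdet1
  simp only [Matrix.mul_assoc] at s2 s3
  obtain ⟨B, hB, hBdet, hB0, hB1, hBS⟩ := ((s1.trans s2).trans s3).trans s4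
  refine framingHomotopic_of_matrix (Tube.isOpenEmbedding_φ (𝒯 := A.tube))
    (v := fun j z => A.tube.vec j z) Tube.contAlongAt_vec Tube.linearIndependent_vec
    (K := {z | |(z.2 : ℝ)| ≤ L.b}) L.isClosed_image hB hBdet (hWX₁.isFraming hD') ?_ ?_ ?_ ?_
  · intro z i
    rw [hB0, hQ₁F]
    exact sum_smul_sum_smul (fun j => rfl) i
  · intro z i
    have h1 : ρ z.1 * σ z * σ z * Real.sin (L.angle z.2) = ρ z.1 * Real.sin (L.angle z.2) := by
      linear_combination (ρ z.1 * Real.sin (L.angle z.2)) * hσ1 z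
    have h2 : B (1, z) = frame4 (A.H z.1 z.2) (unitTangent (A.H z.1) z.2) *
        (Q z * rot01 (Real.cos (L.angle z.2)) (ρ z.1 * Real.sin (L.angle z.2))) :=
      (hB1 z).trans (by simp only [h1])
    rw [h2, rotFraming, L.cosMap_φ, L.sinMap_φ]
    exact (sum_smul_sum_smul (hQF z) i).trans
      (sum_smul_sum_smul (g := fun j => A.tube.vec j z) (fun j => rfl) i)
  · intro z hz s
    exact hBS z (show L.b < |(z.2 : ℝ)| from not_le.1 hz) s
  · intro q hq
    rw [rotFraming_of_eq_one (L.cosMap_of_notMem hq) (L.sinMap_of_notMem ρ hq)]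
    exact (L.engelFraming_eq hoff fun ⟨z, _, hz⟩ => hq ⟨z, hz⟩).symm

/-- The Engel framing of the modified structure arises from the original one by rotating the first
two vectors once along the fibres of the tube, in a sense that may be chosen. -/
theorem EngelTorsion.framingHomotopic_rotFraming [SigmaCompactSpace M]
    (L : EngelTorsion (1 / 10) A D')
    (hD : IsEngel D) (hWX : IsEngelPair D W X) (hWX₁ : IsEngelPair D' W₁ X₁)
    (ho : SameOrientationOn L.outside W X W₁ X₁) {ρ : N → ℝ} (hρ : Continuous ρ)
    (hρ1 : ∀ p, ρ p ^ 2 = 1) :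
    FramingHomotopic (engelFraming W₁ X₁) (rotFraming L.cosMap (L.sinMap ρ) (engelFraming W X)) := by
  have hD' := L.isEngel hD hWX
  obtain ⟨W₂, X₂, hWX₂, ho₂, hoff, hcomp⟩ := L.exists_pair hD hWX
  exact (hWX₁.framingHomotopic hWX₂ hD' (L.sameOrientation hD' hWX₁ hWX₂ ho ho₂)).trans
    (L.framingHomotopic_rotFraming_of_compatible hD hWX hWX₂ hoff hcomp hρ hρ1)

end RotatedFraming

/-! ### The two sides of the hypersurface -/

section Sides

variable {N : Type*} [TopologicalSpace N] [ChartedSpace (EuclideanSpace ℝ (Fin 3)) N]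
  [IsManifold (𝓡 3) ∞ N]
variable {M : Type*} [TopologicalSpace M] [ChartedSpace (EuclideanSpace ℝ (Fin 4)) M]
  [IsManifold (𝓡 4) ∞ M]
variable {𝒯 𝒯₁ 𝒯₂ : Tube N M} {ι : N → M}

theorem continuousAt_extend {Z Y B : Type*} [TopologicalSpace Z] [TopologicalSpace Y]
    [TopologicalSpace B] {φ : Z → Y} (hφ : IsOpenEmbedding φ) {f : Z → B} {g : Y → B} {z : Z}
    (hf : ContinuousAt f z) : ContinuousAt (Function.extend φ f g) (φ z) := by
  rw [← hφ.continuousAt_iff, Function.extend_comp hφ.injective]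
  exact hf

/-- The height over the zero section of a point in the tube. -/
noncomputable def Tube.height (𝒯 : Tube N M) : M → ℝ :=
  Function.extend 𝒯.φ (fun z => (z.2 : ℝ)) 0

theorem Tube.height_φ (z : 𝒯.Dom) : 𝒯.height (𝒯.φ z) = z.2 := Tube.injective_φ.extend_apply _ _ _

theorem Tube.continuousAt_height (z : 𝒯.Dom) : ContinuousAt 𝒯.height (𝒯.φ z) :=
  continuousAt_extend Tube.isOpenEmbedding_φ (by fun_prop)

/-- The point of the zero section over `p`. -/
def Tube.zeroAt (𝒯 : Tube N M) (p : N) : 𝒯.Dom := (p, ⟨0, Tube.zero_mem 𝒯⟩)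

theorem Tube.isOpen_range : IsOpen (range 𝒯.φ) := Tube.isOpenEmbedding_φ.isOpen_range

theorem Tube.continuousAt_Φ {x : N × ℝ} (hx : x.2 ∈ Ioo (-𝒯.ε) 𝒯.ε) : ContinuousAt 𝒯.Φ x :=
  𝒯.Φ_smooth.continuousOn.continuousAt ((isOpen_univ.prod isOpen_Ioo).mem_nhds ⟨mem_univ _, hx⟩)

/-- Two tubes with the same zero section have the same height zero locus. -/
theorem Tube.eq_zero_iff (h₁ : ∀ p, 𝒯₁.φ (𝒯₁.zeroAt p) = ι p)
    (h₂ : ∀ p, 𝒯₂.φ (𝒯₂.zeroAt p) = ι p) {z₁ : 𝒯₁.Dom} {z₂ : 𝒯₂.Dom}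
    (h : 𝒯₁.φ z₁ = 𝒯₂.φ z₂) (h0 : (z₂.2 : ℝ) = 0) : (z₁.2 : ℝ) = 0 := by
  have e : z₂ = 𝒯₂.zeroAt z₂.1 := Prod.ext rfl (Subtype.ext h0)
  have h3 : 𝒯₁.φ z₁ = 𝒯₁.φ (𝒯₁.zeroAt z₂.1) := by rw [h, e, h₂, h₁]; rfl
  rw [Tube.injective_φ h3]
  rfl

/-- `r` is the sign, near `q`, for which the fibres of the two tubes cross the zero section in
opposite (`r = 1`) or equal (`r = -1`) directions. -/
def Tube.OppositeAt (𝒯₁ 𝒯₂ : Tube N M) (r : ℝ) (q : M) : Prop :=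
  ∀ᶠ q' in 𝓝 q, ∀ (z₁ : 𝒯₁.Dom) (z₂ : 𝒯₂.Dom), 𝒯₁.φ z₁ = q' → 𝒯₂.φ z₂ = q' →
    Real.sign z₁.2 + r * Real.sign z₂.2 = 0

/-- The sign is read off from the height in the second tube along short fibres of the first one; as
the heights vanish simultaneously, it is constant on each side of the zero section. -/
theorem Tube.exists_oppositeAt (h₁ : ∀ p, 𝒯₁.φ (𝒯₁.zeroAt p) = ι p)
    (h₂ : ∀ p, 𝒯₂.φ (𝒯₂.zeroAt p) = ι p) (p₀ : N) :
    ∃ r : ℝ, r ^ 2 = 1 ∧ Tube.OppositeAt 𝒯₁ 𝒯₂ r (ι p₀) := by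
  have hlc : LocallyConnectedSpace N := ChartedSpace.locallyConnectedSpace (EuclideanSpace ℝ (Fin 3)) N
  -- a product neighbourhood with connected base that is contained in the second tube
  have hι : 𝒯₁.Φ (p₀, 0) = 𝒯₂.φ (𝒯₂.zeroAt p₀) := (h₁ p₀).trans (h₂ p₀).symm
  have hU : {x : N × ℝ | 𝒯₁.Φ x ∈ range 𝒯₂.φ} ∈ 𝓝 (p₀, (0 : ℝ)) :=
    (Tube.continuousAt_Φ (𝒯 := 𝒯₁) (x := (p₀, 0)) (Tube.zero_mem 𝒯₁)).eventually
      (Tube.isOpen_range.mem_nhds (by rw [hι]; exact mem_range_self _))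
  obtain ⟨V, hV, T, hT, hVT⟩ := mem_nhds_prod_iff.1 hU
  obtain ⟨V', ⟨hV'o, hpV', hV'c⟩, hV'V⟩ :=
    (LocallyConnectedSpace.open_connected_basis p₀).mem_iff.1 hV
  obtain ⟨c', hc', hcT⟩ := Metric.mem_nhds_iff.1 hT
  set c := min c' 𝒯₁.ε with hc
  have hc0 : 0 < c := lt_min hc' 𝒯₁.ε_pos
  have hcε : ∀ t ∈ Ioo (-c) c, t ∈ Ioo (-𝒯₁.ε) 𝒯₁.ε := fun t ht =>
    ⟨by linarith [ht.1, min_le_right c' 𝒯₁.ε], ht.2.trans_le (min_le_right _ _)⟩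
  have hbox : ∀ x ∈ V' ×ˢ Ioo (-c) c, x.2 ∈ Ioo (-𝒯₁.ε) 𝒯₁.ε ∧ 𝒯₁.Φ x ∈ range 𝒯₂.φ := by
    rintro ⟨p, t⟩ ⟨hp, ht⟩
    refine ⟨hcε t ht, hVT ⟨hV'V hp, hcT ?_⟩⟩
    rw [Metric.mem_ball, Real.dist_eq, sub_zero]
    exact (abs_lt.2 ht).trans_le (min_le_left _ _)
  -- the height in the second tube
  let f : N × ℝ → ℝ := fun x => 𝒯₂.height (𝒯₁.Φ x)
  have hf : ContinuousOn f (V' ×ˢ Ioo (-c) c) := by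
    intro x hx
    obtain ⟨hx1, z, hz⟩ := hbox x hx
    exact (ContinuousAt.comp (f := 𝒯₁.Φ) (g := 𝒯₂.height) (by
      rw [← hz]; exact Tube.continuousAt_height z) (Tube.continuousAt_Φ hx1)).continuousWithinAt
  have hf0 : ∀ x ∈ V' ×ˢ Ioo (-c) c, x.2 ≠ 0 → f x ≠ 0 := by
    intro x hx hx0 h0
    obtain ⟨hx1, z, hz⟩ := hbox x hx
    refine hx0 (Tube.eq_zero_iff h₁ h₂ (z₁ := (x.1, ⟨x.2, hx1⟩)) (z₂ := z) hz.symm ?_)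
    simp only [f] at h0
    rwa [← hz, Tube.height_φ] at h0
  have hpos : V' ×ˢ Ioo 0 c ⊆ V' ×ˢ Ioo (-c) c :=
    prod_mono subset_rfl (Ioo_subset_Ioo_left (by linarith))
  have hneg : V' ×ˢ Ioo (-c) 0 ⊆ V' ×ˢ Ioo (-c) c :=
    prod_mono subset_rfl (Ioo_subset_Ioo_right hc0.le)
  have hP : IsPreconnected (V' ×ˢ Ioo 0 c) := hV'c.isPreconnected.prod isPreconnected_Ioo
  have hN : IsPreconnected (V' ×ˢ Ioo (-c) 0) := hV'c.isPreconnected.prod isPreconnected_Ioo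
  have hx₀ : (p₀, c / 2) ∈ V' ×ˢ Ioo 0 c := ⟨hpV', by constructor <;> simp only <;> linarith⟩
  obtain ⟨e, he, hex⟩ : ∃ e : ℝ, (e = 1 ∨ e = -1) ∧ 0 < e * f (p₀, c / 2) := by
    rcases (hf0 _ (hpos hx₀) (by simp only; linarith)).lt_or_gt with h | h
    · exact ⟨-1, Or.inr rfl, by linarith⟩
    · exact ⟨1, Or.inl rfl, by linarith⟩
  have he0 : e ≠ 0 := by rcases he with rfl | rfl <;> norm_num
  have hef : ContinuousOn (fun x => e * f x) (V' ×ˢ Ioo (-c) c) := continuousOn_const.mul hf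
  have hfpos : ∀ x ∈ V' ×ˢ Ioo 0 c, 0 < e * f x := fun x hx =>
    pos_of_isPreconnected hP (hef.mono hpos)
      (fun y hy => mul_ne_zero he0 (hf0 y (hpos hy) hy.2.1.ne')) hx₀ hex hx
  have hWn : ∀ᶠ q in 𝓝 (ι p₀), ∃ x ∈ V' ×ˢ Ioo (-c) c, 𝒯₁.Φ x = q := by
    have h3 : ∀ᶠ z : 𝒯₁.Dom in 𝓝 (𝒯₁.zeroAt p₀), (z.1, (z.2 : ℝ)) ∈ V' ×ˢ Ioo (-c) c := by
      have hcont : Continuous fun z : 𝒯₁.Dom => (z.1, (z.2 : ℝ)) := by fun_prop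
      exact hcont.continuousAt.eventually ((hV'o.prod isOpen_Ioo).mem_nhds
        ⟨hpV', neg_lt_zero.2 hc0, hc0⟩)
    rw [← h₁ p₀, ← Tube.isOpenEmbedding_φ.map_nhds_eq, eventually_map]
    filter_upwards [h3] with z hz
    exact ⟨_, hz, rfl⟩
  have hfneg : ∀ x ∈ V' ×ˢ Ioo (-c) 0, e * f x < 0 := by
    -- otherwise the height in the second tube would have one sign near the zero section
    intro x hx
    by_contra hcon
    have hx' := lt_of_le_of_ne (not_lt.1 hcon)
      (mul_ne_zero he0 (hf0 x (hneg hx) hx.2.2.ne)).symm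
    have hall : ∀ y ∈ V' ×ˢ Ioo (-c) c, 0 ≤ e * f y := by
      rintro ⟨p, t⟩ ⟨hp, ht⟩
      rcases lt_trichotomy t 0 with h | h | h
      · exact (pos_of_isPreconnected hN (hef.mono hneg)
          (fun y hy => mul_ne_zero he0 (hf0 y (hneg hy) hy.2.2.ne)) hx hx' ⟨hp, ht.1, h⟩).le
      · have h3 : f (p, t) = 0 := by
          have h4 : 𝒯₁.Φ (p, t) = 𝒯₂.φ (𝒯₂.zeroAt p) := by
            rw [h]; exact (h₁ p).trans (h₂ p).symm
          simp only [f]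
          rw [h4, Tube.height_φ]
          rfl
        rw [h3, mul_zero]
      · exact (hfpos _ ⟨hp, h, ht.2⟩).le
    have h5 : ∀ᶠ z : 𝒯₂.Dom in 𝓝 (𝒯₂.zeroAt p₀), 0 ≤ e * (z.2 : ℝ) := by
      rw [← h₂ p₀, ← Tube.isOpenEmbedding_φ.map_nhds_eq, eventually_map] at hWn
      filter_upwards [hWn] with z ⟨y, hy, hyz⟩
      have := hall y hy
      simp only [f] at this
      rwa [hyz, Tube.height_φ] at this
    have h6 : ∀ᶠ t : Ioo (-𝒯₂.ε) 𝒯₂.ε in 𝓝 ⟨0, Tube.zero_mem 𝒯₂⟩, 0 ≤ e * (t : ℝ) :=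
      (Continuous.tendsto' (f := fun t : Ioo (-𝒯₂.ε) 𝒯₂.ε => ((p₀, t) : 𝒯₂.Dom)) (by fun_prop) _ _
        rfl).eventually h5
    rw [nhds_subtype_eq_comap, eventually_comap] at h6
    have h7 : ∀ᶠ t : ℝ in 𝓝 0, 0 ≤ e * t := by
      filter_upwards [h6, isOpen_Ioo.mem_nhds (Tube.zero_mem 𝒯₂)] with t ht ht'
      exact ht ⟨t, ht'⟩ rfl
    obtain ⟨d, hd, hd'⟩ := Metric.eventually_nhds_iff.1 h7
    have h8 := @hd' (-e * (d / 2)) (by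
      rw [Real.dist_eq, sub_zero]
      rcases he with rfl | rfl
      · rw [abs_of_neg] <;> linarith
      · rw [abs_of_pos] <;> linarith)
    rcases he with rfl | rfl <;> linarith
  refine ⟨-e, by rcases he with rfl | rfl <;> norm_num, ?_⟩
  filter_upwards [hWn] with q ⟨x, hx, hxq⟩ z₁ z₂ hz₁ hz₂
  have hx1 := (hbox x hx).1
  have e1 : z₁ = (x.1, ⟨x.2, hx1⟩) := Tube.injective_φ (hz₁.trans hxq.symm)
  have e2 : (z₁.2 : ℝ) = x.2 := by rw [e1]
  have e3 : f x = z₂.2 := by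
    simp only [f]
    rw [hxq, ← hz₂, Tube.height_φ]
  rw [e2, ← e3]
  rcases lt_trichotomy x.2 0 with h | h | h
  · have h9 := hfneg x ⟨hx.1, hx.2.1, h⟩
    rw [Real.sign_of_neg h]
    rcases he with rfl | rfl
    · rw [Real.sign_of_neg (by linarith)]; norm_num
    · rw [Real.sign_of_pos (by linarith)]; norm_num
  · have h9 := Tube.eq_zero_iff h₂ h₁ (hz₂.trans hz₁.symm) (e2.trans h)
    rw [e3, h9, h, Real.sign_zero, mul_zero, add_zero]
  · have h9 := hfpos x ⟨hx.1, h, hx.2.2⟩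
    rw [Real.sign_of_pos h]
    rcases he with rfl | rfl
    · rw [Real.sign_of_pos (by linarith)]; norm_num
    · rw [Real.sign_of_neg (by linarith)]; norm_num

theorem Tube.OppositeAt.unique (h₁ : ∀ p, 𝒯₁.φ (𝒯₁.zeroAt p) = ι p)
    (h₂ : ∀ p, 𝒯₂.φ (𝒯₂.zeroAt p) = ι p) {p : N} {r r' : ℝ}
    (h : Tube.OppositeAt 𝒯₁ 𝒯₂ r (ι p)) (h' : Tube.OppositeAt 𝒯₁ 𝒯₂ r' (ι p)) : r = r' := by
  have h3 : ∀ᶠ q in 𝓝 (ι p), q ∈ range 𝒯₁.φ :=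
    Tube.isOpen_range.mem_nhds (by rw [← h₁ p]; exact mem_range_self _)
  have h4 := (h.and h').and h3
  rw [← h₂ p, ← Tube.isOpenEmbedding_φ.map_nhds_eq, eventually_map] at h4
  have h6 : ∀ᶠ t : Ioo (-𝒯₂.ε) 𝒯₂.ε in 𝓝 ⟨0, Tube.zero_mem 𝒯₂⟩, 0 < (t : ℝ) → r = r' := by
    have h5 := (Continuous.tendsto' (f := fun t : Ioo (-𝒯₂.ε) 𝒯₂.ε => ((p, t) : 𝒯₂.Dom))
      (by fun_prop) _ _ rfl).eventually h4
    filter_upwards [h5] with t ⟨⟨k1, k2⟩, z₁, hz₁⟩ ht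
    have e1 := k1 z₁ _ hz₁ rfl
    have e2 := k2 z₁ _ hz₁ rfl
    simp only [Real.sign_of_pos ht] at e1 e2
    linarith
  rw [nhds_subtype_eq_comap, eventually_comap] at h6
  have h7 : ∀ᶠ t : ℝ in 𝓝 0, 0 < t → r = r' := by
    filter_upwards [h6, isOpen_Ioo.mem_nhds (Tube.zero_mem 𝒯₂)] with t ht ht'
    exact ht ⟨t, ht'⟩ rfl
  obtain ⟨d, hd, hd'⟩ := Metric.eventually_nhds_iff.1 h7
  exact @hd' (d / 2) (by rw [Real.dist_eq, sub_zero, abs_of_pos] <;> linarith) (by linarith)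

/-- The signs of `Tube.OppositeAt` are locally constant, which allows senses of rotation that vary
over `N` when the two tubes induce different coorientations on some of its components. -/
theorem Tube.exists_oppositeSign (h₁ : ∀ p, 𝒯₁.φ (𝒯₁.zeroAt p) = ι p)
    (h₂ : ∀ p, 𝒯₂.φ (𝒯₂.zeroAt p) = ι p) :
    ∃ r : N → ℝ, Continuous r ∧ (∀ p, r p ^ 2 = 1) ∧ ∀ p, ∀ᶠ q in 𝓝 (ι p),
      ∀ (z₁ : 𝒯₁.Dom) (z₂ : 𝒯₂.Dom), 𝒯₁.φ z₁ = q → 𝒯₂.φ z₂ = q →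
        Real.sign z₁.2 + r z₂.1 * Real.sign z₂.2 = 0 := by
  choose r hr1 hr using Tube.exists_oppositeAt h₁ h₂
  have hι : Continuous ι := by
    have h3 : Continuous fun p => 𝒯₁.φ (𝒯₁.zeroAt p) :=
      Tube.continuous_φ.comp (continuous_id.prodMk continuous_const)
    simpa only [h₁] using h3
  have hloc : ∀ p, ∀ᶠ p' in 𝓝 p, r p' = r p := by
    intro p
    filter_upwards [hι.continuousAt.eventually (eventually_eventually_nhds.2 (hr p))] with p' hp'
    exact Tube.OppositeAt.unique h₁ h₂ (hr p') hp'
  refine ⟨r, continuous_iff_continuousAt.2 fun p =>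
    continuousAt_const.congr ((hloc p).mono fun _ h => h.symm), hr1, fun p => ?_⟩
  have h3 : ∀ᶠ q in 𝓝 (ι p), ∀ z₂ : 𝒯₂.Dom, 𝒯₂.φ z₂ = q → r z₂.1 = r p := by
    rw [← h₂ p, ← Tube.isOpenEmbedding_φ.map_nhds_eq, eventually_map]
    have h4 : ∀ᶠ z : 𝒯₂.Dom in 𝓝 (𝒯₂.zeroAt p), r z.1 = r p :=
      (Continuous.tendsto' (f := fun z : 𝒯₂.Dom => z.1) continuous_fst (𝒯₂.zeroAt p) p rfl).eventually
        (hloc p)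
    filter_upwards [h4] with z hz z₂ hz₂
    rwa [Tube.injective_φ hz₂]
  filter_upwards [hr p, h3] with q h4 h5 z₁ z₂ hz₁ hz₂
  rw [h5 z₂ hz₂]
  exact h4 z₁ z₂ hz₁ hz₂

end Sides

/-! ### Cancelling the two rotations -/

section Phase

variable {N : Type*} [TopologicalSpace N] [ChartedSpace (EuclideanSpace ℝ (Fin 3)) N]
  [IsManifold (𝓡 3) ∞ N]
variable {M : Type*} [TopologicalSpace M] [ChartedSpace (EuclideanSpace ℝ (Fin 4)) M]
  [IsManifold (𝓡 4) ∞ M]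
variable {ι : N → M} {D D' : TangentDist 4 M} {δ : ℝ} {A : AdaptedTube ι D}

/-- The extension of a function along an open embedding is continuous at a point if the function
agrees, off a set `K` with closed image, with the continuous function `g` by which it is
extended. -/
theorem continuous_extend_of_eq_off {Z Y B : Type*} [TopologicalSpace Z] [TopologicalSpace Y]
    [TopologicalSpace B] {φ : Z → Y} (hφ : IsOpenEmbedding φ) {f : Z → B} {g : Y → B} {K : Set Z}
    (hK : IsClosed (φ '' K)) (hg : Continuous g) (hfg : ∀ z ∉ K, f z = g (φ z)) {y : Y}
    (hf : ∀ z, φ z = y → ContinuousAt f z) : ContinuousAt (Function.extend φ f g) y := by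
  by_cases hy : y ∈ range φ
  · obtain ⟨z, rfl⟩ := hy
    exact continuousAt_extend hφ (hf z rfl)
  · refine hg.continuousAt.congr ?_
    have hy' : y ∉ φ '' K := fun ⟨z, _, hz⟩ => hy ⟨z, hz⟩
    filter_upwards [hK.isOpen_compl.mem_nhds hy'] with y' hy'
    by_cases h : ∃ z, φ z = y'
    · obtain ⟨z, rfl⟩ := h
      rw [hφ.injective.extend_apply, hfg z fun hz => hy' ⟨z, hz, rfl⟩]
    · rw [Function.extend_apply' _ _ _ h]

/-- The truncated height, as a multiple of `π`. -/
noncomputable def EngelTorsion.ramp (L : EngelTorsion δ A D') (t : ℝ) : ℝ :=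
  Real.pi * max (-1) (min 1 (t / L.b))

/-- The angle of rotation modulo `2π`, chosen to tend to zero away from the hypersurface; it jumps
by `2π` at height zero, where its value is the mean of the one-sided limits. -/
noncomputable def EngelTorsion.phase (L : EngelTorsion δ A D') (t : ℝ) : ℝ :=
  L.ramp t - Real.pi * Real.sign t

/-- The angle of rotation with the sense of rotation given by `ρ`, extended to `M`. -/
noncomputable def EngelTorsion.phaseMap (L : EngelTorsion δ A D') (ρ : N → ℝ) : M → ℝ :=
  Function.extend A.tube.φ (fun z => ρ z.1 * L.phase z.2) 0

theorem EngelTorsion.phaseMap_φ (L : EngelTorsion δ A D') (ρ : N → ℝ) (z : A.tube.Dom) :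
    L.phaseMap ρ (A.tube.φ z) = ρ z.1 * L.phase z.2 := Tube.injective_φ.extend_apply _ _ _

theorem EngelTorsion.continuous_ramp (L : EngelTorsion δ A D') : Continuous L.ramp := by
  unfold EngelTorsion.ramp; fun_prop

theorem EngelTorsion.phase_zero (L : EngelTorsion δ A D') : L.phase 0 = 0 := by
  simp [EngelTorsion.phase, EngelTorsion.ramp]

theorem EngelTorsion.phase_of_neg (L : EngelTorsion δ A D') {t : ℝ} (ht : t < 0) :
    L.phase t = L.angle t := by
  rw [EngelTorsion.phase, EngelTorsion.ramp, EngelTorsion.angle, Real.sign_of_neg ht]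
  ring

theorem EngelTorsion.phase_of_pos (L : EngelTorsion δ A D') {t : ℝ} (ht : 0 < t) :
    L.phase t = L.angle t - 2 * Real.pi := by
  rw [EngelTorsion.phase, EngelTorsion.ramp, EngelTorsion.angle, Real.sign_of_pos ht]
  ring

theorem EngelTorsion.phase_eq_zero (L : EngelTorsion δ A D') {t : ℝ} (ht : L.b ≤ |t|) :
    L.phase t = 0 := by
  have hb := L.b_pos
  rcases le_abs.1 ht with h | h
  · rw [L.phase_of_pos (by linarith), L.angle_of_ge h, sub_self]
  · rw [L.phase_of_neg (by linarith), L.angle_of_le (by linarith)]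

theorem EngelTorsion.cos_sin_phase (L : EngelTorsion δ A D') {t : ℝ} (ht : t ≠ 0) :
    Real.cos (L.phase t) = Real.cos (L.angle t) ∧ Real.sin (L.phase t) = Real.sin (L.angle t) := by
  rcases ht.lt_or_gt with h | h
  · rw [L.phase_of_neg h]
    exact ⟨rfl, rfl⟩
  · rw [L.phase_of_pos h, Real.cos_sub_two_pi, Real.sin_sub_two_pi]
    exact ⟨rfl, rfl⟩

theorem cos_sin_mul_of_sq_eq_one {r : ℝ} (hr : r ^ 2 = 1) (x : ℝ) :
    Real.cos (r * x) = Real.cos x ∧ Real.sin (r * x) = r * Real.sin x := by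
  rcases sq_eq_sq_iff_eq_or_eq_neg.1 (hr.trans (one_pow 2).symm) with rfl | rfl
  · simp
  · simp

theorem AdaptedTube.φ_zeroAt (A : AdaptedTube ι D) (p : N) : A.tube.φ (A.tube.zeroAt p) = ι p :=
  A.Φ_zero p

theorem AdaptedTube.mem_range_iff (A : AdaptedTube ι D) {z : A.tube.Dom} :
    A.tube.φ z ∈ range ι ↔ (z.2 : ℝ) = 0 := by
  constructor
  · rintro ⟨p, hp⟩
    rw [← A.φ_zeroAt] at hp
    rw [← Tube.injective_φ hp]
    rfl
  · intro h
    exact ⟨z.1, (A.φ_zeroAt z.1).symm.trans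
      (congrArg A.tube.φ (Prod.ext rfl (Subtype.ext h.symm)))⟩

theorem EngelTorsion.cos_sin_phaseMap (L : EngelTorsion δ A D') {ρ : N → ℝ}
    (hρ : ∀ p, ρ p ^ 2 = 1) {q : M} (hq : q ∉ range ι) :
    Real.cos (L.phaseMap ρ q) = L.cosMap q ∧ Real.sin (L.phaseMap ρ q) = L.sinMap ρ q := by
  by_cases h : q ∈ range A.tube.φ
  · obtain ⟨z, rfl⟩ := h
    have h0 : (z.2 : ℝ) ≠ 0 := fun h0 => hq (A.mem_range_iff.2 h0)
    obtain ⟨e1, e2⟩ := cos_sin_mul_of_sq_eq_one (hρ z.1) (L.phase z.2)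
    obtain ⟨e3, e4⟩ := L.cos_sin_phase h0
    rw [L.phaseMap_φ, L.cosMap_φ, L.sinMap_φ, e1, e2, e3, e4]
    exact ⟨rfl, rfl⟩
  · have e : L.phaseMap ρ q = 0 := Function.extend_apply' _ _ _ h
    rw [e, L.cosMap_of_notMem h, L.sinMap_of_notMem ρ h, Real.cos_zero, Real.sin_zero]
    exact ⟨rfl, rfl⟩

theorem EngelTorsion.maps_zero (L : EngelTorsion δ A D') (ρ : N → ℝ) (p : N) :
    L.phaseMap ρ (ι p) = 0 ∧ L.cosMap (ι p) = -1 ∧ L.sinMap ρ (ι p) = 0 := by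
  have h : L.angle 0 = Real.pi := by simp [EngelTorsion.angle]
  have h0 : ((A.tube.zeroAt p).2 : ℝ) = 0 := rfl
  rw [← A.φ_zeroAt p, L.phaseMap_φ, L.cosMap_φ, L.sinMap_φ, h0, L.phase_zero, h, Real.cos_pi,
    Real.sin_pi, mul_zero]
  exact ⟨rfl, rfl, rfl⟩

variable [T2Space M] [CompactSpace N]

theorem EngelTorsion.continuous_cosMap (L : EngelTorsion δ A D') : Continuous L.cosMap := by
  refine continuous_iff_continuousAt.2 fun q => continuous_extend_of_eq_off
    Tube.isOpenEmbedding_φ L.isClosed_image continuous_const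
    (fun z hz => (L.cos_sin_angle (not_le.1 (mt mem_ofPred_eq.mpr hz)).le).1) fun z _ => ?_
  exact (Real.continuous_cos.comp (L.continuous_angle.comp (by fun_prop))).continuousAt

theorem EngelTorsion.continuous_sinMap (L : EngelTorsion δ A D') {ρ : N → ℝ} (hρ : Continuous ρ) :
    Continuous (L.sinMap ρ) := by
  refine continuous_iff_continuousAt.2 fun q => continuous_extend_of_eq_off
    Tube.isOpenEmbedding_φ L.isClosed_image continuous_const
    (fun z hz => ?_) fun z _ => ?_
  · rw [(L.cos_sin_angle (not_le.1 (mt mem_ofPred_eq.mpr hz)).le).2, mul_zero]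
    rfl
  · exact ((hρ.comp continuous_fst).mul (Real.continuous_sin.comp
      (L.continuous_angle.comp (by fun_prop)))).continuousAt

theorem EngelTorsion.continuousAt_phaseMap (L : EngelTorsion δ A D') {ρ : N → ℝ}
    (hρ : Continuous ρ) {q : M} (hq : q ∉ range ι) : ContinuousAt (L.phaseMap ρ) q := by
  refine continuous_extend_of_eq_off Tube.isOpenEmbedding_φ L.isClosed_image continuous_const
    (fun z hz => ?_) fun z hz => ?_
  · rw [L.phase_eq_zero (not_le.1 (mt mem_ofPred_eq.mpr hz)).le, mul_zero]
    rfl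
  · have h0 : (z.2 : ℝ) ≠ 0 := fun h0 => hq (hz ▸ A.mem_range_iff.2 h0)
    have h1 : ContinuousAt L.phase (z.2 : ℝ) := by
      refine L.continuous_ramp.continuousAt.sub (continuousAt_const.mul ?_)
      rcases h0.lt_or_gt with h | h
      · exact continuousAt_const.congr
          ((gt_mem_nhds h).mono fun t ht => (Real.sign_of_neg ht).symm)
      · exact continuousAt_const.congr
          ((lt_mem_nhds h).mono fun t ht => (Real.sign_of_pos ht).symm)
    exact (hρ.comp continuous_fst).continuousAt.mul
      (ContinuousAt.comp (f := fun z : A.tube.Dom => (z.2 : ℝ)) (g := L.phase) h1 (by fun_prop))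

variable {D₂ : TangentDist 4 M} {A₂ : AdaptedTube ι D'} {δ₂ : ℝ}

/-- The jumps of the two angles along the hypersurface cancel if the rotations have opposite
senses. -/
theorem EngelTorsion.continuous_phaseMap_add (L : EngelTorsion δ A D') (L₂ : EngelTorsion δ₂ A₂ D₂)
    {r : N → ℝ} (hr : Continuous r)
    (hs : ∀ p, ∀ᶠ q in 𝓝 (ι p), ∀ (z₁ : A.tube.Dom) (z₂ : A₂.tube.Dom), A.tube.φ z₁ = q →
      A₂.tube.φ z₂ = q → Real.sign z₁.2 + r z₂.1 * Real.sign z₂.2 = 0) :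
    Continuous fun q => L.phaseMap (fun _ => 1) q + L₂.phaseMap r q := by
  refine continuous_iff_continuousAt.2 fun q => ?_
  by_cases hq : q ∈ range ι
  · obtain ⟨p, rfl⟩ := hq
    have h1 : ContinuousAt (Function.extend A.tube.φ (fun z => L.ramp z.2) 0) (ι p) := by
      rw [← A.φ_zeroAt p]
      exact continuousAt_extend Tube.isOpenEmbedding_φ
        (L.continuous_ramp.comp (by fun_prop)).continuousAt
    have h2 : ContinuousAt (Function.extend A₂.tube.φ (fun z => r z.1 * L₂.ramp z.2) 0) (ι p) := by
      rw [← A₂.φ_zeroAt p]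
      exact continuousAt_extend Tube.isOpenEmbedding_φ
        ((hr.comp continuous_fst).mul (L₂.continuous_ramp.comp (by fun_prop))).continuousAt
    refine (h1.add h2).congr ?_
    have hr1 : ∀ᶠ q in 𝓝 (ι p), q ∈ range A.tube.φ :=
      Tube.isOpen_range.mem_nhds (by rw [← A.φ_zeroAt p]; exact mem_range_self _)
    have hr2 : ∀ᶠ q in 𝓝 (ι p), q ∈ range A₂.tube.φ :=
      Tube.isOpen_range.mem_nhds (by rw [← A₂.φ_zeroAt p]; exact mem_range_self _)
    filter_upwards [hs p, hr1, hr2] with q h3 ⟨z₁, hz₁⟩ ⟨z₂, hz₂⟩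
    have h4 := h3 z₁ z₂ hz₁ hz₂
    have e1 : Function.extend A.tube.φ (fun z => L.ramp z.2) 0 q = L.ramp z₁.2 := by
      rw [← hz₁, Tube.injective_φ.extend_apply]
    have e2 : Function.extend A₂.tube.φ (fun z => r z.1 * L₂.ramp z.2) 0 q =
        r z₂.1 * L₂.ramp z₂.2 := by
      rw [← hz₂, Tube.injective_φ.extend_apply]
    have e3 : L.phaseMap (fun _ => 1) q = 1 * L.phase z₁.2 := by rw [← hz₁, L.phaseMap_φ]
    have e4 : L₂.phaseMap r q = r z₂.1 * L₂.phase z₂.2 := by rw [← hz₂, L₂.phaseMap_φ]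
    rw [Pi.add_apply, e1, e2, e3, e4, EngelTorsion.phase, EngelTorsion.phase]
    linear_combination Real.pi * h4
  · exact (L.continuousAt_phaseMap continuous_const hq).add (L₂.continuousAt_phaseMap hr hq)

end Phase

section Framings

variable {M : Type*} [TopologicalSpace M] [ChartedSpace (EuclideanSpace ℝ (Fin 4)) M]
  [IsManifold (𝓡 4) ∞ M]
variable {F F₀ F₁ : (q : M) → Fin 4 → TangentSpace (𝓡 4) q} {c s : M → ℝ}

theorem FramingHomotopic.rotFraming (h : FramingHomotopic F₀ F₁) (hc : Continuous c)
    (hs : Continuous s) (hcs : ∀ q, c q ^ 2 + s q ^ 2 = 1) :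
    FramingHomotopic (rotFraming c s F₀) (rotFraming c s F₁) := by
  obtain ⟨F, hF, hi, rfl, rfl⟩ := h
  refine ⟨fun t => _root_.rotFraming c s (F t), fun i => ?_, fun t q => ?_, rfl, rfl⟩
  · have hR : Continuous fun a : unitInterval × M => rot01 (c a.2) (s a.2) :=
      continuous_rot01.comp ((hc.comp continuous_snd).prodMk (hs.comp continuous_snd))
    exact continuous_iff_continuousAt.2 fun a =>
      ContAlongAt.sum_smul (f := fun a : unitInterval × M => a.2)
        (v := fun j a => F a.1 a.2 j) (c := fun j a => rot01 (c a.2) (s a.2) j i)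
        continuous_snd.continuousAt (fun j => (hF j).continuousAt)
        (fun j => (hR.matrix_elem j i).continuousAt)
  · exact (hi t q).sum_smul_of_det_ne_zero (A := rot01 (c q) (s q)) (by rw [det_rot01 (hcs q)]; exact one_ne_zero)

/-- Rotating by a continuous real-valued angle does not change the homotopy class. -/
theorem framingHomotopic_rotFraming_cos_sin (hF : IsFraming F) {ψ : M → ℝ} (hψ : Continuous ψ) :
    FramingHomotopic F (rotFraming (fun q => Real.cos (ψ q)) (fun q => Real.sin (ψ q)) F) := by
  have hθ : Continuous fun a : unitInterval × M => (a.1 : ℝ) * ψ a.2 := by fun_prop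
  have h := framingHomotopic_mul hF (B := fun a : unitInterval × M =>
      rot01 (Real.cos (a.1 * ψ a.2)) (Real.sin (a.1 * ψ a.2)))
    (continuous_rot01.comp ((Real.continuous_cos.comp hθ).prodMk (Real.continuous_sin.comp hθ)))
    (fun a => by rw [det_rot01 (Real.cos_sq_add_sin_sq _)]; exact one_ne_zero)
  have e0 : (fun q i => ∑ j, rot01 (Real.cos (((0 : unitInterval) : ℝ) * ψ q))
      (Real.sin (((0 : unitInterval) : ℝ) * ψ q)) j i • F q j) = F :=
    funext fun q => rotFraming_of_eq_one (c := fun q => Real.cos (((0 : unitInterval) : ℝ) * ψ q))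
      (s := fun q => Real.sin (((0 : unitInterval) : ℝ) * ψ q)) (by simp) (by simp)
  have e1 : (fun q i => ∑ j, rot01 (Real.cos (((1 : unitInterval) : ℝ) * ψ q))
      (Real.sin (((1 : unitInterval) : ℝ) * ψ q)) j i • F q j) =
      rotFraming (fun q => Real.cos (ψ q)) (fun q => Real.sin (ψ q)) F := by
    simp only [Set.Icc.coe_one, one_mul]
    rfl
  simp only [e0, e1] at h
  exact h

theorem rot01_mul (c s c' s' : ℝ) :
    rot01 c s * rot01 c' s' = rot01 (c * c' - s * s') (s * c' + c * s') := by
  ext i j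
  fin_cases i <;> fin_cases j <;> simp [rot01, Matrix.mul_apply, Fin.sum_univ_four] <;> ring

theorem rotFraming_rotFraming (c s c' s' : M → ℝ) : rotFraming c' s' (rotFraming c s F) =
    rotFraming (fun q => c q * c' q - s q * s' q) (fun q => s q * c' q + c q * s' q) F := by
  funext q i
  exact (sum_smul_sum_smul (fun j => rfl) i).trans (by rw [rot01_mul]; rfl)

end Framings

theorem mainTheorem7
    {M : Type*} [TopologicalSpace M] [T2Space M] [SecondCountableTopology M]
    [ChartedSpace (EuclideanSpace ℝ (Fin 4)) M] [IsManifold (𝓡 4) ∞ M]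
    {N : Type*} [TopologicalSpace N] [CompactSpace N]
    [ChartedSpace (EuclideanSpace ℝ (Fin 3)) N] [IsManifold (𝓡 3) ∞ N]
    (D : TangentDist 4 M) (hD : IsEngel D)
    (W X : (q : M) → TangentSpace (𝓡 4) q) (hWX : IsEngelPair D W X)
    (ι : N → M) (hι : Manifold.IsSmoothEmbedding (𝓡 3) (𝓡 4) ∞ ι) (hN : IsTransverse ι D) :
    ∃ δ : ℝ, 0 < δ ∧
      ∀ (A₁ : AdaptedTube ι D) (D₁ : TangentDist 4 M) (L₁ : EngelTorsion δ A₁ D₁)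
        (A₂ : AdaptedTube ι D₁) (D₂ : TangentDist 4 M) (L₂ : EngelTorsion δ A₂ D₂),
        IsEngel D₁ ∧ IsTransverse ι D₁ ∧ IsEngel D₂ ∧
        (∃ W₁ X₁ W₂ X₂ : (q : M) → TangentSpace (𝓡 4) q,
          IsEngelPair D₁ W₁ X₁ ∧ SameOrientationOn L₁.outside W X W₁ X₁ ∧
          IsEngelPair D₂ W₂ X₂ ∧ SameOrientationOn L₂.outside W₁ X₁ W₂ X₂) ∧
        ∀ W₁ X₁ W₂ X₂ : (q : M) → TangentSpace (𝓡 4) q,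
          IsEngelPair D₁ W₁ X₁ → SameOrientationOn L₁.outside W X W₁ X₁ →
          IsEngelPair D₂ W₂ X₂ → SameOrientationOn L₂.outside W₁ X₁ W₂ X₂ →
          FramingHomotopic (engelFraming W X) (engelFraming W₂ X₂) := by
  refine ⟨1 / 10, by norm_num, fun A₁ D₁ L₁ A₂ D₂ L₂ => ?_⟩
  have : LocallyCompactSpace M := ChartedSpace.locallyCompactSpace (EuclideanSpace ℝ (Fin 4)) M
  have hD₁ := L₁.isEngel hD hWX
  obtain ⟨W₁, X₁, hWX₁, ho₁, -, -⟩ := L₁.exists_pair hD hWX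
  obtain ⟨W₂, X₂, hWX₂, ho₂, -, -⟩ := L₂.exists_pair hD₁ hWX₁
  refine ⟨hD₁, L₁.isTransverse, L₂.isEngel hD₁ hWX₁,
    ⟨W₁, X₁, W₂, X₂, hWX₁, ho₁, hWX₂, ho₂⟩, ?_⟩
  clear! W₁ X₁ W₂ X₂
  intro W₁ X₁ W₂ X₂ hWX₁ ho₁ hWX₂ ho₂
  obtain ⟨r, hr, hr1, hs⟩ := Tube.exists_oppositeSign A₁.φ_zeroAt A₂.φ_zeroAt
  have h1 := L₁.framingHomotopic_rotFraming hD hWX hWX₁ ho₁ (ρ := fun _ => 1) continuous_const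
    (fun _ => one_pow 2)
  have h2 := L₂.framingHomotopic_rotFraming hD₁ hWX₁ hWX₂ ho₂ hr hr1
  -- the two rotations combine to a rotation by a continuous angle
  set ψ : M → ℝ := fun q => L₁.phaseMap (fun _ => 1) q + L₂.phaseMap r q with hψ
  have hcs : ∀ q, Real.cos (ψ q) = L₁.cosMap q * L₂.cosMap q -
      L₁.sinMap (fun _ => 1) q * L₂.sinMap r q ∧
      Real.sin (ψ q) = L₁.sinMap (fun _ => 1) q * L₂.cosMap q + L₁.cosMap q * L₂.sinMap r q := by
    intro q
    by_cases hq : q ∈ range ι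
    · obtain ⟨p, rfl⟩ := hq
      obtain ⟨a1, a2, a3⟩ := L₁.maps_zero (fun _ => 1) p
      obtain ⟨b1, b2, b3⟩ := L₂.maps_zero r p
      simp only [hψ, a1, a2, a3, b1, b2, b3]
      simp
    · obtain ⟨a1, a2⟩ := L₁.cos_sin_phaseMap (ρ := fun _ => 1) (fun _ => one_pow 2) hq
      obtain ⟨b1, b2⟩ := L₂.cos_sin_phaseMap hr1 hq
      simp only [hψ]
      rw [Real.cos_add, Real.sin_add, a1, a2, b1, b2]
      exact ⟨rfl, rfl⟩
  have hcs₂ : ∀ q, L₂.cosMap q ^ 2 + L₂.sinMap r q ^ 2 = 1 := by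
    intro q
    by_cases hq : q ∈ range ι
    · obtain ⟨p, rfl⟩ := hq
      obtain ⟨-, b2, b3⟩ := L₂.maps_zero r p
      rw [b2, b3]
      norm_num
    · obtain ⟨b1, b2⟩ := L₂.cos_sin_phaseMap hr1 hq
      rw [← b1, ← b2]
      exact Real.cos_sq_add_sin_sq _
  have h3 := h2.trans (h1.rotFraming L₂.continuous_cosMap (L₂.continuous_sinMap hr) hcs₂)
  rw [rotFraming_rotFraming] at h3
  simp only [← (hcs _).1, ← (hcs _).2] at h3
  exact (framingHomotopic_rotFraming_cos_sin (hWX.isFraming hD)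
    (L₁.continuous_phaseMap_add L₂ hr hs)).trans h3.symm
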